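/- Let $N\in\{2,3\}$, $R>0$, $\Omega=B_R=\{x\in\mathbb R^N:|x|<R\}$, $a>0$, $\gamma>1$, and let $\mu,\lambda$ be constants with $\mu>0$ and $\mu+\frac N2\lambda\ge 0$. Consider the isentropic compressible Navier–Stokes problem $$\rho_t+\operatorname{div}(\rho U)=0,\qquad (\rho U)_t+\operatorname{div}(\rho U\otimes U)+\nabla(a\rho^\gamma)=\mu\Delta U+(\mu+\lambda)\nabla\operatorname{div}U\quad\text{in }(0,T)\times\Omega,$$ with $U=0$ on $\partial\Omega$ and $(\rho,U)(0,\cdot)=(\rho_0,U_0)$, where the initial data are spherically symmetric, $\rho_0(x)=\rho_0(|x|)$, $U_0(x)=u_0(|x|)\frac{x}{|x|}$, and satisfy $\rho_0\ge\underline\rho$ a.e. for some constant $\underline\rho>0$, $\rho_0\in L^\infty(\Omega)$, $U_0\in H^1(\Omega)^N$. A weak solution on $(0,T)\times\Omega$ is a pair $(\rho,U)$ with $\rho\ge0$ a.e., $\rho\in L^\infty(0,T;L^\gamma(\Omega))$, $\rho|U|^2\in L^\infty(0,T;L^1(\Omega))$, $U\in L^2(0,T;H^1_0(\Omega)^N)$,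 such that $$\int_0^T\!\!\int_\Omega \rho(\varphi_t+U\cdot\nabla\varphi)\,dx\,dt+\int_\Omega\rho_0\,\varphi(0,\cdot)\,dx=0,$$ $$\int_0^T\!\!\int_\Omega\big(\rho U\cdot\psi_t+\rho\,(U\otimes U):\nabla\psi+a\rho^\gamma\operatorname{div}\psi\big)\,dx\,dt+\int_\Omega\rho_0U_0\cdot\psi(0,\cdot)\,dx=\int_0^T\!\!\int_\Omega\big(\mu\nabla U:\nabla\psi+(\mu+\lambda)\operatorname{div}U\operatorname{div}\psi\big)\,dx\,dt$$ for all scalar $\varphi$ and vector-valued $\psi$ that are smooth with compact support in $[0,T)\times\Omega$. Let $T>0$ and let $(\rho^1,U^1)$, $(\rho^2,U^2)$ be two weak solutions on $(0,T)\times\Omega$ with the same initial data $(\rho_0,U_0)$ as above, both spherically symmetric, that is, of the form $\rho(t,x)=\rho(t,|x|)$, $U(t,x)=u(t,|x|)\frac{x}{|x|}$, and both in the regularity class $$\rho\in L^\infty((0,T)\times\Omega),\quad \rho\dot U\in L^2((0,T)\times\Omega),\quad \nabla\dot U\in L^2((0,T)\times\Omega),\quad \operatorname{div}U\in L^2(0,T;L^\infty(\Omega)),\quad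 \nabla U\in L^\infty(0,T;L^2(\Omega))\cap L^2(0,T;L^\infty(\Omega)),$$ where $\dot U=U_t+U\cdot\nabla U$ is the material derivative (derivatives being weak derivatives, with $U_t$ and $\dot U$ locally integrable). Then $$\rho^1=\rho^2,\qquad U^1=U^2\qquad\text{a.e. on }(0,T)\times\Omega.$$ -/

import Mathlib

open MeasureTheory Set
open scoped ENNReal ContDiff

noncomputable section

/-! ### Weak derivatives and function spaces -/

/-- On the open set `Q`, the locally integrable function `g` is the weak (distributional) derivative
of the locally integrable function `f` in the direction `v`. -/
def HasWeakDirDeriv {X F : Type*} [NormedAddCommGroup X] [NormedSpace ℝ X] [MeasureSpace X]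
    [NormedAddCommGroup F] [NormedSpace ℝ F] (Q : Set X) (v : X) (f g : X → F) : Prop :=
  LocallyIntegrableOn f Q ∧ LocallyIntegrableOn g Q ∧
    ∀ φ : X → ℝ, ContDiff ℝ ∞ φ → HasCompactSupport φ → tsupport φ ⊆ Q →
      ∫ z in Q, (fderiv ℝ φ z v) • f z = -∫ z in Q, φ z • g z

/-- The ball `Ω = B_R` of `ℝ^N`. -/
def ballDomain (N : ℕ) (R : ℝ) : Set (EuclideanSpace ℝ (Fin N)) := Metric.ball 0 R

/-- The space-time spaceTimeCyl `(0,T) × Ω`. -/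
def spaceTimeCyl (N : ℕ) (R T : ℝ) : Set (ℝ × EuclideanSpace ℝ (Fin N)) :=
  Ioo 0 T ×ˢ ballDomain N R

/-- `f ∈ L^p(0,T; L^q(Ω))`, for a function of `(t,x)` measurable on `(0,T) × Ω`:
the function `t ↦ ‖f(t,·)‖_{L^q(Ω)}` has finite `L^p(0,T)` norm. -/
def MemMixedLp {N : ℕ} {F : Type*} [NormedAddCommGroup F] (p q : ℝ≥0∞) (R T : ℝ)
    (f : ℝ × EuclideanSpace ℝ (Fin N) → F) : Prop :=
  AEStronglyMeasurable f (volume.restrict (spaceTimeCyl N R T)) ∧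
    eLpNorm (fun t : ℝ => eLpNorm (fun x => f (t, x)) q (volume.restrict (ballDomain N R))) p
      (volume.restrict (Ioo 0 T)) < ⊤

/-- The weak spatial gradient on `(0,T) × Ω`: `DU (t,x) e` is the weak derivative of `U` in the
spatial direction `e`. -/
def HasWeakSpaceGradient {N : ℕ} (R T : ℝ)
    (U : ℝ × EuclideanSpace ℝ (Fin N) → EuclideanSpace ℝ (Fin N))
    (DU : ℝ × EuclideanSpace ℝ (Fin N) →
      EuclideanSpace ℝ (Fin N) →L[ℝ] EuclideanSpace ℝ (Fin N)) : Prop :=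
  ∀ e : EuclideanSpace ℝ (Fin N),
    HasWeakDirDeriv (spaceTimeCyl N R T) (0, e) U (fun z => DU z e)

/-- `V ∈ H¹(Ω)^N`. -/
def MemH1 {N : ℕ} (R : ℝ) (V : EuclideanSpace ℝ (Fin N) → EuclideanSpace ℝ (Fin N)) : Prop :=
  MemLp V 2 (volume.restrict (ballDomain N R)) ∧
    ∃ DV : EuclideanSpace ℝ (Fin N) → EuclideanSpace ℝ (Fin N) →L[ℝ] EuclideanSpace ℝ (Fin N),
      MemLp DV 2 (volume.restrict (ballDomain N R)) ∧
      ∀ e : EuclideanSpace ℝ (Fin N), HasWeakDirDeriv (ballDomain N R) e V (fun x => DV x e)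

/-- `V ∈ H¹₀(Ω)^N` with gradient `DV`: the pair `(V, DV)` is the limit in `L²(Ω)` of pairs
`(φ, ∇φ)` with `φ` smooth and compactly supported in `Ω`. -/
def IsH10WithGradient {N : ℕ} (R : ℝ)
    (V : EuclideanSpace ℝ (Fin N) → EuclideanSpace ℝ (Fin N))
    (DV : EuclideanSpace ℝ (Fin N) →
      EuclideanSpace ℝ (Fin N) →L[ℝ] EuclideanSpace ℝ (Fin N)) : Prop :=
  MemLp V 2 (volume.restrict (ballDomain N R)) ∧
  MemLp DV 2 (volume.restrict (ballDomain N R)) ∧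
  ∀ ε : ℝ≥0∞, 0 < ε → ∃ φ : EuclideanSpace ℝ (Fin N) → EuclideanSpace ℝ (Fin N),
    ContDiff ℝ ∞ φ ∧ HasCompactSupport φ ∧ tsupport φ ⊆ ballDomain N R ∧
    eLpNorm (fun x => V x - φ x) 2 (volume.restrict (ballDomain N R)) < ε ∧
    eLpNorm (fun x => DV x - fderiv ℝ φ x) 2 (volume.restrict (ballDomain N R)) < ε

/-! ### Matrix operations and spherical symmetry -/

/-- The trace of a gradient, that is, the divergence. -/
def divOf {N : ℕ} (A : EuclideanSpace ℝ (Fin N) →L[ℝ] EuclideanSpace ℝ (Fin N)) : ℝ :=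
  ∑ i, (A (EuclideanSpace.single i 1)) i

/-- The Frobenius product `A : B = ∑_{i,j} A_{ij} B_{ij}`. -/
def frobProd {N : ℕ} (A B : EuclideanSpace ℝ (Fin N) →L[ℝ] EuclideanSpace ℝ (Fin N)) : ℝ :=
  ∑ i, ∑ j, (A (EuclideanSpace.single j 1)) i * (B (EuclideanSpace.single j 1)) i

/-- `ρ₀(x) = ρ₀(|x|)` and `U₀(x) = u₀(|x|) x/|x|` for almost every `x ∈ Ω`. -/
def IsRadialData {N : ℕ} (R : ℝ) (ρ₀ : EuclideanSpace ℝ (Fin N) → ℝ)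
    (U₀ : EuclideanSpace ℝ (Fin N) → EuclideanSpace ℝ (Fin N)) : Prop :=
  ∃ r₀ u₀ : ℝ → ℝ, Measurable r₀ ∧ Measurable u₀ ∧
    ∀ᵐ x ∂(volume.restrict (ballDomain N R)),
      ρ₀ x = r₀ ‖x‖ ∧ U₀ x = u₀ ‖x‖ • (‖x‖⁻¹ • x)

/-- `ρ(t,x) = ρ(t,|x|)` and `U(t,x) = u(t,|x|) x/|x|` for almost every `(t,x) ∈ (0,T) × Ω`. -/
def IsRadialFlow {N : ℕ} (R T : ℝ) (ρ : ℝ × EuclideanSpace ℝ (Fin N) → ℝ)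
    (U : ℝ × EuclideanSpace ℝ (Fin N) → EuclideanSpace ℝ (Fin N)) : Prop :=
  ∃ r u : ℝ × ℝ → ℝ, Measurable r ∧ Measurable u ∧
    ∀ᵐ z ∂(volume.restrict (spaceTimeCyl N R T)),
      ρ z = r (z.1, ‖z.2‖) ∧ U z = u (z.1, ‖z.2‖) • (‖z.2‖⁻¹ • z.2)

/-- The assumptions on the initial data: spherical symmetry, `ρ₀ ≥ c > 0` for a constant `c`,
`ρ₀ ∈ L^∞(Ω)` and `U₀ ∈ H¹(Ω)^N`. -/
structure IsAdmissibleData {N : ℕ} (R : ℝ) (ρ₀ : EuclideanSpace ℝ (Fin N) → ℝ)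
    (U₀ : EuclideanSpace ℝ (Fin N) → EuclideanSpace ℝ (Fin N)) : Prop where
  radial : IsRadialData R ρ₀ U₀
  lower_bound : ∃ c : ℝ, 0 < c ∧ ∀ᵐ x ∂(volume.restrict (ballDomain N R)), c ≤ ρ₀ x
  density_bounded : MemLp ρ₀ ⊤ (volume.restrict (ballDomain N R))
  velocity_H1 : MemH1 R U₀

/-! ### Weak solutions -/

/-- `(ρ, U)`, with weak spatial gradient `DU = ∇U`, is a weak solution on `(0,T) × Ω` of
`ρ_t + div(ρU) = 0`,
`(ρU)_t + div(ρ U ⊗ U) + ∇(a ρ^γ) = μ ΔU + (μ+lam) ∇ div U`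
with `(ρ,U)(0,·) = (ρ₀,U₀)` and `U = 0` on `∂Ω`: finite energy class, boundary condition in the
sense of `H¹₀`, equations and initial conditions tested against smooth functions compactly
supported in `[0,T) × Ω` (restrictions of functions with compact support in `(-∞,T) × Ω`). -/
structure IsWeakSolution {N : ℕ} (R T a γ μ lam : ℝ) (ρ₀ : EuclideanSpace ℝ (Fin N) → ℝ)
    (U₀ : EuclideanSpace ℝ (Fin N) → EuclideanSpace ℝ (Fin N))
    (ρ : ℝ × EuclideanSpace ℝ (Fin N) → ℝ)
    (U : ℝ × EuclideanSpace ℝ (Fin N) → EuclideanSpace ℝ (Fin N))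
    (DU : ℝ × EuclideanSpace ℝ (Fin N) →
      EuclideanSpace ℝ (Fin N) →L[ℝ] EuclideanSpace ℝ (Fin N)) : Prop where
  density_nonneg : ∀ᵐ z ∂(volume.restrict (spaceTimeCyl N R T)), 0 ≤ ρ z
  density_energy : MemMixedLp ⊤ (ENNReal.ofReal γ) R T ρ
  kinetic_energy : MemMixedLp ⊤ 1 R T (fun z => ρ z * ‖U z‖ ^ 2)
  velocity_L2 : MemLp U 2 (volume.restrict (spaceTimeCyl N R T))
  gradient_L2 : MemLp DU 2 (volume.restrict (spaceTimeCyl N R T))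
  gradient : HasWeakSpaceGradient R T U DU
  boundary : ∀ᵐ t ∂(volume.restrict (Ioo (0 : ℝ) T)),
    IsH10WithGradient R (fun x => U (t, x)) (fun x => DU (t, x))
  continuity_eq : ∀ φ : ℝ × EuclideanSpace ℝ (Fin N) → ℝ,
    ContDiff ℝ ∞ φ → HasCompactSupport φ → tsupport φ ⊆ Iio T ×ˢ ballDomain N R →
    (∫ z in spaceTimeCyl N R T, ρ z * (fderiv ℝ φ z (1, 0) + fderiv ℝ φ z (0, U z)))
      + ∫ x in ballDomain N R, ρ₀ x * φ (0, x) = 0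
  momentum_eq : ∀ φ : ℝ × EuclideanSpace ℝ (Fin N) → EuclideanSpace ℝ (Fin N),
    ContDiff ℝ ∞ φ → HasCompactSupport φ → tsupport φ ⊆ Iio T ×ˢ ballDomain N R →
    (∫ z in spaceTimeCyl N R T,
        (ρ z * inner ℝ (U z) (fderiv ℝ φ z (1, 0))
          + ρ z * inner ℝ (U z) (fderiv ℝ φ z (0, U z))
          + a * ρ z ^ γ * divOf ((fderiv ℝ φ z).comp (ContinuousLinearMap.inr ℝ ℝ _))))
      + ∫ x in ballDomain N R, ρ₀ x * inner ℝ (U₀ x) (φ (0, x))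
    = ∫ z in spaceTimeCyl N R T,
        (μ * frobProd (DU z) ((fderiv ℝ φ z).comp (ContinuousLinearMap.inr ℝ ℝ _))
          + (μ + lam) * (divOf (DU z)
              * divOf ((fderiv ℝ φ z).comp (ContinuousLinearMap.inr ℝ ℝ _))))

/-- The regularity class on `(0,T) × Ω`:
`ρ ∈ L^∞`, `ρ U̇ ∈ L²`, `∇U̇ ∈ L²`, `div U ∈ L²(0,T;L^∞)`,
`∇U ∈ L^∞(0,T;L²) ∩ L²(0,T;L^∞)`,
where `DU = ∇U`, `Ut` is the weak time derivative of `U`, `U̇ = Ut + U·∇U` is the material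
derivative and `DUdot` is its weak spatial gradient. -/
structure IsInRegularityClass {N : ℕ} (R T : ℝ)
    (ρ : ℝ × EuclideanSpace ℝ (Fin N) → ℝ)
    (U : ℝ × EuclideanSpace ℝ (Fin N) → EuclideanSpace ℝ (Fin N))
    (DU : ℝ × EuclideanSpace ℝ (Fin N) →
      EuclideanSpace ℝ (Fin N) →L[ℝ] EuclideanSpace ℝ (Fin N)) : Prop where
  density_bounded : MemLp ρ ⊤ (volume.restrict (spaceTimeCyl N R T))
  material : ∃ (Ut : ℝ × EuclideanSpace ℝ (Fin N) → EuclideanSpace ℝ (Fin N))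
      (DUdot : ℝ × EuclideanSpace ℝ (Fin N) →
        EuclideanSpace ℝ (Fin N) →L[ℝ] EuclideanSpace ℝ (Fin N)),
    HasWeakDirDeriv (spaceTimeCyl N R T) (1, 0) U Ut ∧
    MemLp (fun z => ρ z • (Ut z + DU z (U z))) 2 (volume.restrict (spaceTimeCyl N R T)) ∧
    HasWeakSpaceGradient R T (fun z => Ut z + DU z (U z)) DUdot ∧
    MemLp DUdot 2 (volume.restrict (spaceTimeCyl N R T))
  div_L2Linfty : MemMixedLp 2 ⊤ R T (fun z => divOf (DU z))
  gradient_LinftyL2 : MemMixedLp ⊤ 2 R T DU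
  gradient_L2Linfty : MemMixedLp 2 ⊤ R T DU

/-- A spherically symmetric weak solution on `(0,T) × Ω` lying in the regularity class. -/
def IsRegularRadialWeakSolution {N : ℕ} (R T a γ μ lam : ℝ)
    (ρ₀ : EuclideanSpace ℝ (Fin N) → ℝ)
    (U₀ : EuclideanSpace ℝ (Fin N) → EuclideanSpace ℝ (Fin N))
    (ρ : ℝ × EuclideanSpace ℝ (Fin N) → ℝ)
    (U : ℝ × EuclideanSpace ℝ (Fin N) → EuclideanSpace ℝ (Fin N)) : Prop :=
  IsRadialFlow R T ρ U ∧
    ∃ DU : ℝ × EuclideanSpace ℝ (Fin N) →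
        EuclideanSpace ℝ (Fin N) →L[ℝ] EuclideanSpace ℝ (Fin N),
      IsWeakSolution R T a γ μ lam ρ₀ U₀ ρ U DU ∧ IsInRegularityClass R T ρ U DU

end

/-! In the volume coordinate q = |x|^N/N, with the volume flux g = |x|^(N-1) u, a radial flow
becomes one-dimensional: Lebesgue measure on the ball becomes a multiple of dq on (0,V) with V =
R^N/N, div U becomes g_q, |U|² becomes c₁ q^(-θ) g² with θ = 2 - 2/N, and for radial test fields the
two viscous terms merge into one with coefficient ν = 2μ + λ. Since U(t) lies in H¹₀ and its
divergence is bounded by D(t), the flux g(t,·) is Lipschitz with constant D(t) and vanishes at 0 and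
V (`exists_isTransportField`); D is integrable and square integrable in time. Hence g has a flow
q(t,η), bi-Lipschitz in the label η, with Jacobian J = exp ∫ g_q. Mass conservation becomes ρJ = ρ₀
(`density_flow`), so the density is determined by the flow and the data.

For two solutions, write each momentum balance in its own Lagrangian coordinates, with common labels
and common data, and test both with the same function Z(s) - Z(t), where Z = q₁ - q₂. This function
vanishes at the final time s, and its time derivative is -(g₁ - g₂) along the trajectories, so
neither an acceleration nor a trace of the momentum at time s enters. Subtraction removes the
initial data and leaves `energy_identity`. Its kinetic part contains minus a weighted square of g₁ -
g₂, which absorbs the other terms linear in g₁ - g₂. With L = log(J₁/J₂), its viscous part is an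
exact time derivative up to a quadratic remainder (`integral_viscous`) and controls ∫ J₁ L(s)²,
hence Y(s) = ∫ (J₁ - J₂)² at time s. The pressure part is quadratic in the differences of the
Jacobians. Finally Z vanishes at the center, so (q₁ - q₂)² ≤ ηY by Cauchy–Schwarz, which turns the
singular weight η^(-θ) into the integrable η^(1-θ).

The outcome is that Y(s) is at most a constant times ∫(1 + D + D²) times the supremum of Y over the
interval where the flows have not yet been shown to agree (`exists_jacDist_le`). A Grönwall argument
in finitely many steps gives q₁ = q₂ (`flow_unique`); the flux is recovered as the time derivative
of the trajectories and the density as ρ₀/J.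

The analytic burden lies in the admissibility of this test function. It has only a square integrable
time derivative and a bounded space derivative, so the weak identities are first extended by
mollification (`IsWeakIdentity.sobolevTest`) and the chain rule for the flow is verified in weak
form (`IsLagrangianTest.isSobolevTest`). Cutoffs at the center and at the wall are harmless because
Z vanishes linearly at both ends. -/

/-! ### Absolutely continuous functions with a prescribed derivative -/

/-- `f` is locally absolutely continuous on `ℝ` and has derivative `f'` almost everywhere. -/
structure IsACWithDeriv (f f' : ℝ → ℝ) : Prop where
  ac : ∀ a b, AbsolutelyContinuousOnInterval f a b
  ae_deriv : ∀ᵐ x, HasDerivAt f (f' x) x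

theorem AbsolutelyContinuousOnInterval.lipschitz_comp {X Y : Type*} [PseudoMetricSpace X]
    [PseudoMetricSpace Y] {f : ℝ → X} {h : X → Y} {a b : ℝ} {K : NNReal}
    (hf : AbsolutelyContinuousOnInterval f a b) (hh : LipschitzOnWith K h (f '' uIcc a b)) :
    AbsolutelyContinuousOnInterval (fun x => h (f x)) a b := by
  rw [absolutelyContinuousOnInterval_iff] at hf ⊢
  intro ε hε
  obtain ⟨δ, hδ, H⟩ := hf (ε / (K + 1)) (by positivity)
  refine ⟨δ, hδ, fun E hE hs => ?_⟩
  have h1 := H E hE hs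
  calc ∑ i ∈ Finset.range E.1, dist (h (f (E.2 i).1)) (h (f (E.2 i).2))
      ≤ ∑ i ∈ Finset.range E.1, K * dist (f (E.2 i).1) (f (E.2 i).2) := by
        refine Finset.sum_le_sum fun i hi => ?_
        have h3 := hE.1 i hi
        exact hh.dist_le_mul _ (mem_image_of_mem _ h3.1) _ (mem_image_of_mem _ h3.2)
    _ = K * ∑ i ∈ Finset.range E.1, dist (f (E.2 i).1) (f (E.2 i).2) := by
        rw [Finset.mul_sum]
    _ ≤ K * (ε / (K + 1)) := by gcongr
    _ < (K + 1) * (ε / (K + 1)) := by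
        have : 0 < ε / ((K : ℝ) + 1) := by positivity
        nlinarith
    _ = ε := by field_simp

theorem AbsolutelyContinuousOnInterval.prodMk {X Y : Type*} [PseudoMetricSpace X]
    [PseudoMetricSpace Y] {f : ℝ → X} {g : ℝ → Y} {a b : ℝ}
    (hf : AbsolutelyContinuousOnInterval f a b) (hg : AbsolutelyContinuousOnInterval g a b) :
    AbsolutelyContinuousOnInterval (fun x => (f x, g x)) a b := by
  rw [absolutelyContinuousOnInterval_iff] at hf hg ⊢
  intro ε hε
  obtain ⟨δ, hδ, H⟩ := hf (ε / 2) (by positivity)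
  obtain ⟨δ', hδ', H'⟩ := hg (ε / 2) (by positivity)
  refine ⟨min δ δ', lt_min hδ hδ', fun E hE hs => ?_⟩
  have h1 := H E hE (hs.trans_le (min_le_left _ _))
  have h2 := H' E hE (hs.trans_le (min_le_right _ _))
  calc _ ≤ ∑ i ∈ Finset.range E.1, (dist (f (E.2 i).1) (f (E.2 i).2)
          + dist (g (E.2 i).1) (g (E.2 i).2)) := by
        refine Finset.sum_le_sum fun i _ => ?_
        rw [Prod.dist_eq]
        exact max_le_add_of_nonneg dist_nonneg dist_nonneg
    _ < ε := by rw [Finset.sum_add_distrib]; linarith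

namespace IsACWithDeriv

variable {f f' g g' : ℝ → ℝ}

theorem continuous (hf : IsACWithDeriv f f') : Continuous f := by
  refine continuous_iff_continuousAt.2 fun x => ?_
  refine (hf.ac (x - 1) (x + 1)).continuousOn.continuousAt ?_
  rw [uIcc_of_le (by linarith)]
  exact Icc_mem_nhds (by linarith) (by linarith)

theorem intervalIntegrable (hf : IsACWithDeriv f f') (a b : ℝ) :
    IntervalIntegrable f' volume a b := by
  refine (hf.ac a b).intervalIntegrable_deriv.congr_ae ?_
  refine ae_restrict_of_ae ?_
  filter_upwards [hf.ae_deriv] with x hx using hx.deriv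

theorem locallyIntegrable (hf : IsACWithDeriv f f') : LocallyIntegrable f' := by
  intro x
  refine ⟨Icc (x - 1) (x + 1), Icc_mem_nhds (by linarith) (by linarith), ?_⟩
  have := hf.intervalIntegrable (x - 1) (x + 1)
  rwa [intervalIntegrable_iff_integrableOn_Icc_of_le (by linarith)] at this

theorem integral_eq (hf : IsACWithDeriv f f') (a b : ℝ) : ∫ x in a..b, f' x = f b - f a := by
  rw [← (hf.ac a b).integral_deriv_eq_sub]
  refine intervalIntegral.integral_congr_ae ?_
  filter_upwards [hf.ae_deriv] with x hx _ using hx.deriv.symm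

/-- The derivative comes from Lebesgue differentiation, the absolute continuity from that of the
integral. Solutions of integral equations enter the calculus of `IsACWithDeriv` through this lemma.
-/
theorem of_integral {c a : ℝ} (h' : LocallyIntegrable f')
    (h : ∀ x, f x = c + ∫ s in a..x, f' s) : IsACWithDeriv f f' := by
  have hi : ∀ a b, IntervalIntegrable f' volume a b := fun a b =>
    (h'.integrableOn_isCompact isCompact_uIcc).intervalIntegrable
  constructor
  · intro p r
    have h0 : AbsolutelyContinuousOnInterval (fun x => ∫ s in p..x, f' s) p r :=
      (hi p r).absolutelyContinuousOnInterval_intervalIntegral (by simp)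
    have h1 : AbsolutelyContinuousOnInterval (fun _ : ℝ => f p) p r :=
      (LipschitzWith.const (f p)).lipschitzOnWith.absolutelyContinuousOnInterval
    have h2 := h0.add h1
    have h3 : f = (fun x => ∫ s in p..x, f' s) + fun _ => f p := by
      funext x
      simp only [Pi.add_apply]
      rw [h x, h p, ← intervalIntegral.integral_add_adjacent_intervals (hi a p) (hi p x)]
      ring
    rw [h3]
    exact h2
  · filter_upwards [LocallyIntegrable.ae_hasDerivAt_integral h'] with x hx
    have := (hx a).const_add c
    rwa [← funext h] at this

theorem congr_deriv {h' : ℝ → ℝ} (hf : IsACWithDeriv f f') (h : ∀ᵐ x, f' x = h' x) :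
    IsACWithDeriv f h' :=
  ⟨hf.ac, by filter_upwards [hf.ae_deriv, h] with x hx h; rwa [← h]⟩

theorem mul (hf : IsACWithDeriv f f') (hg : IsACWithDeriv g g') :
    IsACWithDeriv (fun x => f x * g x) (fun x => f' x * g x + f x * g' x) :=
  ⟨fun a b => (hf.ac a b).mul (hg.ac a b), by
    filter_upwards [hf.ae_deriv, hg.ae_deriv] with x h1 h2 using h1.mul h2⟩

theorem add (hf : IsACWithDeriv f f') (hg : IsACWithDeriv g g') :
    IsACWithDeriv (fun x => f x + g x) (fun x => f' x + g' x) :=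
  ⟨fun a b => (hf.ac a b).add (hg.ac a b), by
    filter_upwards [hf.ae_deriv, hg.ae_deriv] with x h1 h2 using h1.add h2⟩

theorem sub (hf : IsACWithDeriv f f') (hg : IsACWithDeriv g g') :
    IsACWithDeriv (fun x => f x - g x) (fun x => f' x - g' x) :=
  ⟨fun a b => (hf.ac a b).sub (hg.ac a b), by
    filter_upwards [hf.ae_deriv, hg.ae_deriv] with x h1 h2 using h1.sub h2⟩

theorem neg (hf : IsACWithDeriv f f') : IsACWithDeriv (fun x => -f x) (fun x => -f' x) :=
  ⟨fun a b => (hf.ac a b).neg, by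
    filter_upwards [hf.ae_deriv] with x h1 using h1.neg⟩

theorem const (c : ℝ) : IsACWithDeriv (fun _ => c) (fun _ => 0) :=
  ⟨fun _ _ => (LipschitzWith.const c).lipschitzOnWith.absolutelyContinuousOnInterval,
    Filter.Eventually.of_forall fun x => hasDerivAt_const x c⟩

theorem id : IsACWithDeriv (fun x => x) (fun _ => 1) :=
  ⟨fun _ _ => LipschitzWith.id.lipschitzOnWith.absolutelyContinuousOnInterval,
    Filter.Eventually.of_forall fun x => hasDerivAt_id x⟩

theorem of_lipschitz {K : NNReal} (hf : LipschitzWith K f) : IsACWithDeriv f (deriv f) :=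
  ⟨fun _ _ => hf.lipschitzOnWith.absolutelyContinuousOnInterval, by
    filter_upwards [hf.ae_differentiableAt_real] with x hx using hx.hasDerivAt⟩

/-- A C¹ function is Lipschitz on bounded sets only, but the image of a compact interval under f is
bounded, and this suffices. -/
theorem comp_contDiff {h : ℝ → ℝ} (hf : IsACWithDeriv f f') (hh : ContDiff ℝ 1 h) :
    IsACWithDeriv (fun x => h (f x)) (fun x => deriv h (f x) * f' x) := by
  constructor
  · intro a b
    have hc : IsCompact (f '' uIcc a b) := isCompact_uIcc.image hf.continuous
    obtain ⟨r, hr⟩ := hc.isBounded.subset_closedBall 0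
    obtain ⟨K, hK⟩ := (hh.locallyLipschitz.locallyLipschitzOn
      (s := Metric.closedBall (0 : ℝ) r)).exists_lipschitzOnWith_of_compact
        (isCompact_closedBall _ _)
    exact (hf.ac a b).lipschitz_comp (hK.mono hr)
  · filter_upwards [hf.ae_deriv] with x hx
    exact ((hh.differentiable one_ne_zero _).hasDerivAt).comp x hx

/-- This is the chain rule for a test function along a trajectory; compact support provides a global
Lipschitz constant. -/
theorem comp_prod {h : ℝ × ℝ → ℝ} (hf : IsACWithDeriv f f') (hh : ContDiff ℝ 1 h)
    (hc : HasCompactSupport h) :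
    IsACWithDeriv (fun x => h (x, f x)) (fun x => fderiv ℝ h (x, f x) (1, f' x)) := by
  obtain ⟨K, hK⟩ := hh.lipschitzWith_of_hasCompactSupport hc one_ne_zero
  constructor
  · intro a b
    exact ((LipschitzWith.id.lipschitzOnWith.absolutelyContinuousOnInterval).prodMk
      (hf.ac a b)).lipschitz_comp hK.lipschitzOnWith
  · filter_upwards [hf.ae_deriv] with x hx
    have h1 : HasDerivAt (fun x => (x, f x)) (1, f' x) x := (hasDerivAt_id x).prodMk hx
    exact ((hh.differentiable one_ne_zero (x, f x)).hasFDerivAt).comp_hasDerivAt x h1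

/-- Integration of an absolutely continuous function with compact support. -/
theorem integral_eq_zero (hf : IsACWithDeriv f f') (hc : HasCompactSupport f) :
    ∫ x, f' x = 0 := by
  by_cases hi : Integrable f'
  swap
  -- The Bochner integral of a nonintegrable function is zero by convention, so integrability need
  -- not be established.
  · exact integral_undef hi
  obtain ⟨r, hr⟩ := hc.isCompact.isBounded.subset_closedBall 0
  have h0 : ∀ x, r < |x| → f x = 0 := fun x hx => by
    by_contra h
    have := hr (subset_tsupport f h)
    rw [Metric.mem_closedBall, dist_zero_right, Real.norm_eq_abs] at this
    linarith
  have h1 := intervalIntegral_tendsto_integral hi Filter.tendsto_neg_atTop_atBot Filter.tendsto_id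
  refine tendsto_nhds_unique h1 (tendsto_const_nhds.congr' ?_)
  filter_upwards [Filter.eventually_gt_atTop (max r 0)] with R hR
  have hR0 : 0 < R := (le_max_right _ _).trans_lt hR
  have hRr : r < R := (le_max_left _ _).trans_lt hR
  rw [hf.integral_eq, h0 _ (by rwa [_root_.id, abs_of_pos hR0]),
    h0 _ (by rwa [abs_neg, abs_of_pos hR0]), sub_zero]

end IsACWithDeriv

/-- The integrating factor exp(-∫ e) makes the product absolutely continuous with zero derivative;
the coefficient only has to be locally integrable. -/
theorem linear_ode_eq_exp {d e : ℝ → ℝ} (he : LocallyIntegrable e)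
    (hd : IsACWithDeriv d (fun t => e t * d t)) (t : ℝ) :
    d t = d 0 * Real.exp (∫ s in (0 : ℝ)..t, e s) := by
  have hE : IsACWithDeriv (fun t => ∫ s in (0 : ℝ)..t, e s) e :=
    IsACWithDeriv.of_integral (c := 0) (a := 0) he fun x => (zero_add _).symm
  have hX := (hE.neg.comp_contDiff (Real.contDiff_exp)).mul hd
  simp only [Real.deriv_exp] at hX
  have h0 := hX.integral_eq 0 t
  have h1 : ∀ s, Real.exp (-∫ s in (0 : ℝ)..s, e s) * -e s * d s
      + Real.exp (-∫ s in (0 : ℝ)..s, e s) * (e s * d s) = 0 := fun s => by ring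
  simp only [h1, intervalIntegral.integral_zero, intervalIntegral.integral_same, neg_zero,
    Real.exp_zero, one_mul] at h0
  have h2 : d 0 = Real.exp (-∫ s in (0 : ℝ)..t, e s) * d t := by linarith
  rw [h2, mul_right_comm, ← Real.exp_add, neg_add_cancel, Real.exp_zero, one_mul]

/-! ### One-dimensional transport fields and their flows -/

/-- A velocity field on the interval `(0,V)`, vanishing outside of `(0,T) × (0,V)`, measurable in
time and Lipschitz in space with an integrable and square integrable Lipschitz constant. -/
structure IsTransportField (V T : ℝ) (D : ℝ → ℝ) (g : ℝ → ℝ → ℝ) : Prop where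
  pos : 0 < V
  measurable : Measurable (Function.uncurry g)
  measurable_lip : Measurable D
  nonneg : ∀ t, 0 ≤ D t
  integrable : Integrable D
  integrable_sq : Integrable (fun t => D t ^ 2)
  lip_zero : ∀ t, t ∉ Ioo 0 T → D t = 0
  lip : ∀ t x y, |g t x - g t y| ≤ D t * |x - y|
  zero_left : ∀ t x, x ≤ 0 → g t x = 0
  zero_right : ∀ t x, V ≤ x → g t x = 0

/-- The spatial derivative of a transport field, as an upper limit of difference quotients. -/
noncomputable def fieldDiv (g : ℝ → ℝ → ℝ) (t x : ℝ) : ℝ :=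
  Filter.limsup (fun n : ℕ => ((n : ℝ) + 1) * (g t (x + 1 / ((n : ℝ) + 1)) - g t x)) Filter.atTop

/-- `q` is the flow of `g`. -/
structure IsFlowOf (g q : ℝ → ℝ → ℝ) : Prop where
  cont : ∀ η, Continuous fun t => q t η
  eq : ∀ t η, q t η = η + ∫ s in (0 : ℝ)..t, g s (q s η)

/-- The Jacobian of the flow `q` of `g`. -/
noncomputable def flowJac (g q : ℝ → ℝ → ℝ) (t η : ℝ) : ℝ :=
  Real.exp (∫ s in (0 : ℝ)..t, fieldDiv g s (q s η))

/-! ### Existence, uniqueness and bi-Lipschitz bounds of the flow. -/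

namespace IsTransportField

variable {V T : ℝ} {D : ℝ → ℝ} {g q : ℝ → ℝ → ℝ}

theorem continuous_field (hg : IsTransportField V T D g) (t : ℝ) : Continuous (g t) := by
  have : LipschitzWith (D t).toNNReal (g t) := LipschitzWith.of_dist_le_mul fun x y => by
    rw [Real.coe_toNNReal _ (hg.nonneg t)]
    exact hg.lip t x y
  exact this.continuous

theorem lipschitzWith (hg : IsTransportField V T D g) (t : ℝ) :
    LipschitzWith (D t).toNNReal (g t) := LipschitzWith.of_dist_le_mul fun x y => by
  rw [Real.coe_toNNReal _ (hg.nonneg t)]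
  exact hg.lip t x y

theorem abs_le_mul (hg : IsTransportField V T D g) (t x : ℝ) : |g t x| ≤ D t * |x| := by
  have := hg.lip t x 0
  rwa [hg.zero_left t 0 le_rfl, sub_zero, sub_zero] at this

theorem abs_le (hg : IsTransportField V T D g) (t x : ℝ) : |g t x| ≤ D t * V := by
  have hp := mul_nonneg (hg.nonneg t) hg.pos.le
  rcases le_or_gt x 0 with h | h
  · rw [hg.zero_left t x h, abs_zero]; exact hp
  rcases le_or_gt V x with h' | h'
  · rw [hg.zero_right t x h', abs_zero]; exact hp
  · refine (hg.abs_le_mul t x).trans ?_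
    rw [abs_of_pos h]
    exact mul_le_mul_of_nonneg_left h'.le (hg.nonneg t)

theorem measurable_comp (hg : IsTransportField V T D g) {c : ℝ → ℝ} (hc : Measurable c) :
    Measurable fun s => g s (c s) :=
  hg.measurable.comp (measurable_id.prodMk hc)

theorem integrable_comp (hg : IsTransportField V T D g) {c : ℝ → ℝ} (hc : Measurable c) :
    Integrable fun s => g s (c s) := by
  refine (hg.integrable.mul_const V).mono' (hg.measurable_comp hc).aestronglyMeasurable ?_
  exact Filter.Eventually.of_forall fun s => hg.abs_le s _

theorem acWithDeriv_integral (hg : IsTransportField V T D g) :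
    IsACWithDeriv (fun t => ∫ s in (0 : ℝ)..t, D s) D :=
  IsACWithDeriv.of_integral (c := 0) (a := 0) hg.integrable.locallyIntegrable
    fun _ => (zero_add _).symm

theorem abs_integral_le (hg : IsTransportField V T D g) (a b : ℝ) :
    |∫ s in a..b, D s| ≤ ∫ s, D s := by
  rw [intervalIntegral.abs_integral_eq_abs_integral_uIoc, abs_of_nonneg
    (setIntegral_nonneg measurableSet_uIoc fun s _ => hg.nonneg s)]
  exact setIntegral_le_integral hg.integrable (Filter.Eventually.of_forall hg.nonneg)

theorem integral_nonneg (hg : IsTransportField V T D g) (t : ℝ) :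
    0 ≤ ∫ s in (0 : ℝ)..t, D s := by
  rcases le_total 0 t with h | h
  · exact intervalIntegral.integral_nonneg h fun s _ => hg.nonneg s
  · rw [intervalIntegral.integral_symm]
    have : ∫ s in t..0, D s = 0 := by
      rw [intervalIntegral.integral_congr (g := fun _ => 0)]
      · simp
      · intro s hs
        rw [uIcc_of_le h] at hs
        exact hg.lip_zero s fun h' => absurd h'.1 (not_lt.2 hs.2)
    rw [this, neg_zero]

open BoundedContinuousFunction in
-- Picard iteration in a weighted sup norm. The unknown is P = w (c - η) with w = exp(-2∫D); the
-- weight makes the iteration a contraction on the whole time axis at once, so no local solutions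
-- have to be continued.
theorem exists_flow_path (hg : IsTransportField V T D g) (η : ℝ) :
    ∃ c : ℝ → ℝ, Continuous c ∧ ∀ t, c t = η + ∫ s in (0 : ℝ)..t, g s (c s) := by
  set E : ℝ → ℝ := fun t => ∫ s in (0 : ℝ)..t, D s with hE
  have hEc : Continuous E := hg.acWithDeriv_integral.continuous
  have hE0 : ∀ t, 0 ≤ E t := hg.integral_nonneg
  set w : ℝ → ℝ := fun t => Real.exp (-(2 * E t)) with hw
  have hwc : Continuous w := by fun_prop
  have hw0 : ∀ t, 0 < w t := fun t => Real.exp_pos _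
  have hw1 : ∀ t, w t ≤ 1 := fun t => Real.exp_le_one_iff.2 (by linarith [hE0 t])
  -- The primitive of D/w is 1/(2w). The exponent 2 in the weight is what produces the contraction
  -- factor 1/2.
  have hexp : IsACWithDeriv (fun t => Real.exp (2 * E t) / 2) fun t => D t / w t := by
    have h1 := (hg.acWithDeriv_integral.comp_contDiff (h := fun x => Real.exp (2 * x) / 2)
      (by fun_prop))
    refine h1.congr_deriv (Filter.Eventually.of_forall fun t => ?_)
    have : HasDerivAt (fun x => Real.exp (2 * x) / 2) (Real.exp (2 * E t)) (E t) := by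
      have := (((hasDerivAt_id (E t)).const_mul 2).exp).div_const 2
      simpa using this
    rw [this.deriv, hw]
    simp only
    rw [Real.exp_neg, div_inv_eq_mul, mul_comm]
  have hint : ∀ P : ℝ →ᵇ ℝ, Integrable fun s => g s (η + P s / w s) := fun P =>
    hg.integrable_comp (by
      have : Continuous fun s => η + P s / w s :=
        continuous_const.add (P.continuous.div hwc fun t => (hw0 t).ne')
      exact this.measurable)
  have hSc : ∀ P : ℝ →ᵇ ℝ, Continuous fun t => w t * ∫ s in (0 : ℝ)..t, g s (η + P s / w s) :=
    fun P => hwc.mul (intervalIntegral.continuous_primitive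
      (fun a b => (hint P).intervalIntegrable) 0)
  have hSb : ∀ (P : ℝ →ᵇ ℝ) t, ‖w t * ∫ s in (0 : ℝ)..t, g s (η + P s / w s)‖
      ≤ (∫ s, D s) * V := fun P t => by
    rw [norm_mul, Real.norm_of_nonneg (hw0 t).le]
    have h1 : ‖∫ s in (0 : ℝ)..t, g s (η + P s / w s)‖ ≤ |∫ s in (0 : ℝ)..t, D s * V| :=
      intervalIntegral.norm_integral_le_abs_of_norm_le
        (Filter.Eventually.of_forall fun s => hg.abs_le s _)
        (hg.integrable.mul_const V).intervalIntegrable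
    rw [intervalIntegral.integral_mul_const, abs_mul, abs_of_pos hg.pos] at h1
    have h2 := mul_le_mul_of_nonneg_right (hg.abs_integral_le 0 t) hg.pos.le
    calc _ ≤ 1 * _ := mul_le_mul_of_nonneg_right (hw1 t) (norm_nonneg _)
      _ ≤ _ := by rw [one_mul]; exact h1.trans h2
  let S : (ℝ →ᵇ ℝ) → (ℝ →ᵇ ℝ) := fun P =>
    BoundedContinuousFunction.ofNormedAddCommGroup _ (hSc P) _ (hSb P)
  have hS : ∀ P t, S P t = w t * ∫ s in (0 : ℝ)..t, g s (η + P s / w s) := fun P t => rfl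
  have hcontr : ContractingWith (1 / 2) S := by
    refine ⟨by rw [← NNReal.coe_lt_coe]; norm_num, LipschitzWith.of_dist_le_mul fun P P' => ?_⟩
    refine (BoundedContinuousFunction.dist_le (mul_nonneg (NNReal.coe_nonneg _) dist_nonneg)).2
      fun t => ?_
    rw [hS, hS, Real.dist_eq, ← mul_sub, ← intervalIntegral.integral_sub
      (hint P).intervalIntegrable (hint P').intervalIntegrable, abs_mul, abs_of_pos (hw0 t)]
    have h1 : |∫ s in (0 : ℝ)..t, (g s (η + P s / w s) - g s (η + P' s / w s))|
        ≤ |∫ s in (0 : ℝ)..t, D s / w s * dist P P'| := by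
      rw [← Real.norm_eq_abs]
      refine intervalIntegral.norm_integral_le_abs_of_norm_le
        (Filter.Eventually.of_forall fun s => ?_) ((hexp.intervalIntegrable 0 t).mul_const _)
      rw [Real.norm_eq_abs]
      refine (hg.lip s _ _).trans ?_
      rw [add_sub_add_left_eq_sub, ← sub_div, abs_div, abs_of_pos (hw0 s), div_mul_eq_mul_div,
        mul_div_assoc]
      refine mul_le_mul_of_nonneg_left ?_ (hg.nonneg s)
      have : dist (P s) (P' s) ≤ dist P P' := BoundedContinuousFunction.dist_coe_le_dist s
      rw [Real.dist_eq] at this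
      exact div_le_div_of_nonneg_right this (hw0 s).le
    rw [intervalIntegral.integral_mul_const, hexp.integral_eq, abs_mul,
      abs_of_nonneg (dist_nonneg (x := P) (y := P'))] at h1
    have h2 : E 0 = 0 := by simp [hE]
    have h3 : 1 ≤ Real.exp (2 * E t) := Real.one_le_exp (by linarith [hE0 t])
    rw [h2, mul_zero, Real.exp_zero, abs_of_nonneg (a := Real.exp (2 * E t) / 2 - 1 / 2)
      (by linarith)] at h1
    have h4 : w t * Real.exp (2 * E t) = 1 := by
      rw [hw]; simp only; rw [← Real.exp_add]; simp
    have h5 := mul_le_mul_of_nonneg_left h1 (hw0 t).le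
    have hd : 0 ≤ dist P P' := dist_nonneg
    have : ((1 / 2 : NNReal) : ℝ) = 1 / 2 := by norm_num
    rw [this]
    nlinarith [mul_nonneg (hw0 t).le hd]
  obtain ⟨P, hP, -⟩ := hcontr.exists_fixedPoint (0 : ℝ →ᵇ ℝ) (edist_ne_top _ _)
  refine ⟨fun t => η + P t / w t, continuous_const.add (P.continuous.div hwc fun t => (hw0 t).ne'),
    fun t => ?_⟩
  have h1 : P t = w t * ∫ s in (0 : ℝ)..t, g s (η + P s / w s) := by
    conv_lhs => rw [← hP.eq]
    rfl
  change η + P t / w t = _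
  rw [h1, mul_div_cancel_left₀ _ (hw0 t).ne']

theorem exists_flow (hg : IsTransportField V T D g) : ∃ q, IsFlowOf g q := by
  choose c hc using hg.exists_flow_path
  exact ⟨fun t η => c η t, fun η => (hc η).1, fun t η => (hc η).2 t⟩

theorem flow_ac (hg : IsTransportField V T D g) (hq : IsFlowOf g q) (η : ℝ) :
    IsACWithDeriv (fun t => q t η) (fun t => g t (q t η)) :=
  IsACWithDeriv.of_integral (hg.integrable_comp (hq.cont η).measurable).locallyIntegrable
    fun t => hq.eq t η

theorem slope_abs_le (hg : IsTransportField V T D g) (t x y : ℝ) : |slope (g t) x y| ≤ D t := by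
  rw [slope_def_field, abs_div]
  rcases eq_or_ne y x with h | h
  · simp [h, hg.nonneg]
  · rw [div_le_iff₀ (abs_pos.2 (sub_ne_zero.2 h))]
    exact hg.lip t y x

theorem integrable_slope (hg : IsTransportField V T D g) {x y : ℝ → ℝ} (hx : Continuous x)
    (hy : Continuous y) : Integrable fun s => slope (g s) (x s) (y s) := by
  refine hg.integrable.mono' ?_ (Filter.Eventually.of_forall fun s => hg.slope_abs_le s _ _)
  simp only [slope_def_field]
  exact (((hg.measurable_comp hy.measurable).sub (hg.measurable_comp hx.measurable)).div
    (hy.measurable.sub hx.measurable)).aestronglyMeasurable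

/-- The difference of two trajectories solves a linear equation whose coefficient is the difference
quotient of the field, bounded by D. This one formula yields uniqueness, monotonicity in the label
and both Lipschitz bounds of the flow. -/
theorem solution_sub (hg : IsTransportField V T D g) {x y : ℝ → ℝ}
    (hx : IsACWithDeriv x fun t => g t (x t)) (hy : IsACWithDeriv y fun t => g t (y t)) (t : ℝ) :
    y t - x t = (y 0 - x 0) * Real.exp (∫ s in (0 : ℝ)..t, slope (g s) (x s) (y s)) := by
  refine linear_ode_eq_exp (d := fun t => y t - x t)
    (hg.integrable_slope hx.continuous hy.continuous).locallyIntegrable ?_ t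
  refine (hy.sub hx).congr_deriv (Filter.Eventually.of_forall fun s => ?_)
  simp only [slope_def_field]
  rcases eq_or_ne (y s) (x s) with h | h
  -- Where the trajectories meet, `slope` is zero by convention and both sides vanish.
  · rw [h]; simp
  · rw [div_mul_cancel₀ _ (sub_ne_zero.2 h)]

theorem flow_zero (hq : IsFlowOf g q) (η : ℝ) : q 0 η = η := by simp [hq.eq 0 η]

theorem flow_sub (hg : IsTransportField V T D g) (hq : IsFlowOf g q) (t a b : ℝ) :
    q t b - q t a = (b - a) * Real.exp (∫ s in (0 : ℝ)..t, slope (g s) (q s a) (q s b)) := by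
  have := hg.solution_sub (hg.flow_ac hq a) (hg.flow_ac hq b) t
  simpa only [flow_zero hq] using this

theorem flow_eq_of_fixed (hg : IsTransportField V T D g) (hq : IsFlowOf g q) {η : ℝ}
    (h : ∀ t, g t η = 0) (t : ℝ) : q t η = η := by
  have h1 : IsACWithDeriv (fun _ => η) (fun t => g t η) := by
    simp only [h]; exact IsACWithDeriv.const η
  have := hg.solution_sub h1 (hg.flow_ac hq η) t
  simp only [flow_zero hq, sub_self, zero_mul] at this
  linarith

theorem flow_of_nonpos (hg : IsTransportField V T D g) (hq : IsFlowOf g q) {η : ℝ} (h : η ≤ 0)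
    (t : ℝ) : q t η = η := hg.flow_eq_of_fixed hq (fun t => hg.zero_left t η h) t

theorem flow_of_ge (hg : IsTransportField V T D g) (hq : IsFlowOf g q) {η : ℝ} (h : V ≤ η)
    (t : ℝ) : q t η = η := hg.flow_eq_of_fixed hq (fun t => hg.zero_right t η h) t

theorem abs_integral_slope_le (hg : IsTransportField V T D g) (a b : ℝ) (x y : ℝ → ℝ) :
    |∫ s in a..b, slope (g s) (x s) (y s)| ≤ ∫ s, D s := by
  refine le_trans ?_ (hg.abs_integral_le a b)
  exact intervalIntegral.norm_integral_le_abs_of_norm_le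
    (Filter.Eventually.of_forall fun s => by
      rw [Real.norm_eq_abs]; exact hg.slope_abs_le s (x s) (y s)) hg.integrable.intervalIntegrable

theorem abs_flow_sub_le (hg : IsTransportField V T D g) (hq : IsFlowOf g q) (t a b : ℝ) :
    |q t b - q t a| ≤ Real.exp (∫ s, D s) * |b - a| := by
  rw [hg.flow_sub hq, abs_mul, abs_of_pos (Real.exp_pos _), mul_comm]
  refine mul_le_mul_of_nonneg_right (Real.exp_le_exp.2 ?_) (abs_nonneg _)
  exact (_root_.abs_le.1 (hg.abs_integral_slope_le 0 t _ _)).2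

theorem le_abs_flow_sub (hg : IsTransportField V T D g) (hq : IsFlowOf g q) (t a b : ℝ) :
    Real.exp (-∫ s, D s) * |b - a| ≤ |q t b - q t a| := by
  rw [hg.flow_sub hq, abs_mul, abs_of_pos (Real.exp_pos _), mul_comm |b - a|]
  refine mul_le_mul_of_nonneg_right (Real.exp_le_exp.2 ?_) (abs_nonneg _)
  exact (_root_.abs_le.1 (hg.abs_integral_slope_le 0 t _ _)).1

theorem flow_strictMono (hg : IsTransportField V T D g) (hq : IsFlowOf g q) (t : ℝ) :
    StrictMono (q t) := fun a b hab => by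
  have := hg.flow_sub hq t a b
  have h2 : 0 < (b - a) * Real.exp (∫ s in (0 : ℝ)..t, slope (g s) (q s a) (q s b)) :=
    mul_pos (sub_pos.2 hab) (Real.exp_pos _)
  linarith

theorem flow_pos (hg : IsTransportField V T D g) (hq : IsFlowOf g q) {η : ℝ} (h : 0 < η) (t : ℝ) :
    0 < q t η := by
  have := hg.flow_strictMono hq t h
  rwa [hg.flow_of_nonpos hq le_rfl] at this

theorem flow_lt (hg : IsTransportField V T D g) (hq : IsFlowOf g q) {η : ℝ} (h : η < V) (t : ℝ) :
    q t η < V := by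
  have := hg.flow_strictMono hq t h
  rwa [hg.flow_of_ge hq le_rfl] at this

theorem flow_continuous_space (hg : IsTransportField V T D g) (hq : IsFlowOf g q) (t : ℝ) :
    Continuous (q t) := by
  have : LipschitzWith (Real.exp (∫ s, D s)).toNNReal (q t) :=
    LipschitzWith.of_dist_le_mul fun x y => by
      rw [Real.coe_toNNReal _ (Real.exp_pos _).le]
      exact hg.abs_flow_sub_le hq t y x
  exact this.continuous

theorem flow_continuous (hg : IsTransportField V T D g) (hq : IsFlowOf g q) :
    Continuous fun p : ℝ × ℝ => q p.1 p.2 := by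
  have hl : ∀ t, LipschitzWith (Real.exp (∫ s, D s)).toNNReal (q t) := fun t =>
    LipschitzWith.of_dist_le_mul fun x y => by
      rw [Real.coe_toNNReal _ (Real.exp_pos _).le]
      exact hg.abs_flow_sub_le hq t y x
  exact continuous_prod_of_continuous_lipschitzWith' (fun p : ℝ × ℝ => q p.1 p.2) _ hl hq.cont

/-- The flow is the identity outside (0,V), hence tends to ±∞ at ±∞, and continuity does the rest.
-/
theorem flow_surjective (hg : IsTransportField V T D g) (hq : IsFlowOf g q) (t : ℝ) :
    Function.Surjective (q t) := by
  refine (hg.flow_continuous_space hq t).surjective ?_ ?_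
  · refine Filter.tendsto_id.congr' ?_
    filter_upwards [Filter.eventually_ge_atTop V] with x hx
    exact (hg.flow_of_ge hq hx t).symm
  · refine Filter.tendsto_id.congr' ?_
    filter_upwards [Filter.eventually_le_atBot 0] with x hx
    exact (hg.flow_of_nonpos hq hx t).symm

end IsTransportField

/-- By continuity the remainder estimate extends from rational increments to all increments.
Differentiability thereby becomes a countable combination of inequalities, hence a measurable
condition on parameters. -/
theorem hasDerivAt_iff_forall_rat {f : ℝ → ℝ} (hf : Continuous f) (f' x : ℝ) :
    HasDerivAt f f' x ↔ ∀ n : ℕ, ∃ m : ℕ, ∀ h : ℚ, |(h : ℝ)| < 1 / ((m : ℝ) + 1) →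
      |f (x + h) - f x - h * f'| ≤ 1 / ((n : ℝ) + 1) * |(h : ℝ)| := by
  rw [hasDerivAt_iff_isLittleO_nhds_zero, Asymptotics.isLittleO_iff]
  constructor
  · intro H n
    obtain ⟨ε, hε, h⟩ := Metric.eventually_nhds_iff.1
      (H (show (0 : ℝ) < 1 / ((n : ℝ) + 1) by positivity))
    obtain ⟨m, hm⟩ := exists_nat_one_div_lt hε
    exact ⟨m, fun r hr => h (by rw [dist_zero_right]; exact hr.trans hm)⟩
  · intro H c hc
    obtain ⟨n, hn⟩ := exists_nat_one_div_lt hc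
    obtain ⟨m, hm⟩ := H n
    refine Metric.eventually_nhds_iff.2 ⟨1 / ((m : ℝ) + 1), by positivity, fun y hy => ?_⟩
    rw [dist_zero_right, Real.norm_eq_abs] at hy
    have h1 : ‖f (x + y) - f x - y • f'‖ ≤ 1 / ((n : ℝ) + 1) * ‖y‖ := by
      have hcl : IsClosed {y : ℝ | |f (x + y) - f x - y * f'| ≤ 1 / ((n : ℝ) + 1) * |y|} :=
        isClosed_le (by fun_prop) (by fun_prop)
      have hop : IsOpen {y : ℝ | |y| < 1 / ((m : ℝ) + 1)} :=
        isOpen_lt continuous_abs continuous_const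
      have hd : Dense (range ((↑) : ℚ → ℝ)) := Rat.denseRange_cast
      have h2 := hd.open_subset_closure_inter hop
      have h3 : {y : ℝ | |y| < 1 / ((m : ℝ) + 1)} ∩ range ((↑) : ℚ → ℝ)
          ⊆ {y : ℝ | |f (x + y) - f x - y * f'| ≤ 1 / ((n : ℝ) + 1) * |y|} := by
        rintro _ ⟨h4, ⟨r, rfl⟩⟩
        exact hm r h4
      exact closure_minimal h3 hcl (h2 hy)
    exact h1.trans (mul_le_mul_of_nonneg_right hn.le (norm_nonneg _))

/-! ### The Jacobian of the flow and the change of variables. -/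

namespace IsTransportField

variable {V T : ℝ} {D : ℝ → ℝ} {g q : ℝ → ℝ → ℝ}

theorem abs_diffQuot_le (hg : IsTransportField V T D g) (t x : ℝ) (n : ℕ) :
    |((n : ℝ) + 1) * (g t (x + 1 / ((n : ℝ) + 1)) - g t x)| ≤ D t := by
  have hn : (0 : ℝ) < (n : ℝ) + 1 := by positivity
  rw [abs_mul, abs_of_pos hn]
  have := mul_le_mul_of_nonneg_left (hg.lip t (x + 1 / ((n : ℝ) + 1)) x) hn.le
  rw [add_sub_cancel_left, abs_of_pos (one_div_pos.2 hn)] at this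
  refine this.trans (le_of_eq ?_)
  field_simp

theorem abs_fieldDiv_le (hg : IsTransportField V T D g) (t x : ℝ) : |fieldDiv g t x| ≤ D t := by
  have h := fun n => _root_.abs_le.1 (hg.abs_diffQuot_le t x n)
  have hb : Filter.IsBoundedUnder (· ≤ ·) Filter.atTop
      (fun n : ℕ => ((n : ℝ) + 1) * (g t (x + 1 / ((n : ℝ) + 1)) - g t x)) :=
    Filter.isBoundedUnder_of ⟨D t, fun n => (h n).2⟩
  have hb' : Filter.IsBoundedUnder (· ≥ ·) Filter.atTop
      (fun n : ℕ => ((n : ℝ) + 1) * (g t (x + 1 / ((n : ℝ) + 1)) - g t x)) :=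
    Filter.isBoundedUnder_of ⟨-D t, fun n => (h n).1⟩
  refine _root_.abs_le.2 ⟨?_, ?_⟩
  · exact Filter.le_limsup_of_frequently_le
      (Filter.Frequently.of_forall fun n => (h n).1) hb
  · exact Filter.limsup_le_of_le hb'.isCoboundedUnder_le
      (Filter.Eventually.of_forall fun n => (h n).2)

theorem fieldDiv_zero_time (hg : IsTransportField V T D g) {t : ℝ} (ht : t ∉ Ioo 0 T) (x : ℝ) :
    fieldDiv g t x = 0 := by
  have := hg.abs_fieldDiv_le t x
  rw [hg.lip_zero t ht] at this
  exact abs_nonpos_iff.1 this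

/-- A limit superior of countably many measurable difference quotients is jointly measurable in time
and space, although g is merely measurable in time. -/
theorem measurable_fieldDiv (hg : IsTransportField V T D g) :
    Measurable fun p : ℝ × ℝ => fieldDiv g p.1 p.2 := by
  refine Measurable.limsup fun n => ?_
  have h1 : Measurable fun p : ℝ × ℝ => g p.1 (p.2 + 1 / ((n : ℝ) + 1)) :=
    hg.measurable.comp (measurable_fst.prodMk (measurable_snd.add_const _))
  exact (h1.sub hg.measurable).const_mul _

theorem fieldDiv_eq (t : ℝ) {x d : ℝ} (h : HasDerivAt (g t) d x) :
    fieldDiv g t x = d := by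
  refine Filter.Tendsto.limsup_eq ?_
  have h1 := h.tendsto_slope
  have h2 : Filter.Tendsto (fun n : ℕ => x + 1 / ((n : ℝ) + 1)) Filter.atTop (nhdsWithin x {x}ᶜ) := by
    refine tendsto_nhdsWithin_iff.2 ⟨?_, Filter.Eventually.of_forall fun n => ?_⟩
    · simpa using tendsto_one_div_add_atTop_nhds_zero_nat.const_add x
    · have : (0 : ℝ) < 1 / ((n : ℝ) + 1) := by positivity
      simp only [mem_compl_iff, mem_singleton_iff]
      linarith
  refine (h1.comp h2).congr fun n => ?_
  simp only [Function.comp, slope_def_field, add_sub_cancel_left]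
  rw [div_div_eq_mul_div, div_one, mul_comm]

theorem ae_hasDerivAt_field (hg : IsTransportField V T D g) (t : ℝ) :
    ∀ᵐ x, HasDerivAt (g t) (fieldDiv g t x) x := by
  filter_upwards [(hg.lipschitzWith t).ae_differentiableAt_real] with x hx
  rw [fieldDiv_eq t hx.hasDerivAt]
  exact hx.hasDerivAt

theorem field_ac (hg : IsTransportField V T D g) (t : ℝ) :
    IsACWithDeriv (g t) (fieldDiv g t) :=
  ⟨(IsACWithDeriv.of_lipschitz (hg.lipschitzWith t)).ac, hg.ae_hasDerivAt_field t⟩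

theorem measurableSet_hasDerivAt (hg : IsTransportField V T D g) :
    MeasurableSet {p : ℝ × ℝ | HasDerivAt (g p.1) (fieldDiv g p.1 p.2) p.2} := by
  simp only [hasDerivAt_iff_forall_rat (hg.continuous_field _), ofPred_forall, ofPred_exists]
  refine MeasurableSet.iInter fun n => MeasurableSet.iUnion fun m => MeasurableSet.iInter fun h =>
    MeasurableSet.iInter fun _ => measurableSet_le ?_ measurable_const
  have h1 : Measurable fun p : ℝ × ℝ => g p.1 (p.2 + h) :=
    hg.measurable.comp (measurable_fst.prodMk (measurable_snd.add_const _))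
  exact ((h1.sub hg.measurable).sub (hg.measurable_fieldDiv.const_mul _)).abs

theorem flow_antilipschitz (hg : IsTransportField V T D g) (hq : IsFlowOf g q) (t : ℝ) :
    AntilipschitzWith (Real.exp (∫ s, D s)).toNNReal (q t) := by
  refine AntilipschitzWith.of_le_mul_dist fun x y => ?_
  rw [Real.coe_toNNReal _ (Real.exp_pos _).le, dist_comm, dist_comm (q t x)]
  have := mul_le_mul_of_nonneg_left (hg.le_abs_flow_sub hq t x y) (Real.exp_pos (∫ s, D s)).le
  rwa [← mul_assoc, ← Real.exp_add, add_neg_cancel, Real.exp_zero, one_mul] at this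

theorem flow_lipschitz (hg : IsTransportField V T D g) (hq : IsFlowOf g q) (t : ℝ) :
    LipschitzWith (Real.exp (∫ s, D s)).toNNReal (q t) :=
  LipschitzWith.of_dist_le_mul fun x y => by
    rw [Real.coe_toNNReal _ (Real.exp_pos _).le]
    exact hg.abs_flow_sub_le hq t y x

/-- An antilipschitz map pulls null sets back to null sets; on the line, Lebesgue measure is the
one-dimensional Hausdorff measure. -/
theorem ae_flow (hg : IsTransportField V T D g) (hq : IsFlowOf g q) (t : ℝ) {P : ℝ → Prop}
    (h : ∀ᵐ x, P x) : ∀ᵐ η, P (q t η) := by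
  rw [ae_iff] at h ⊢
  have h1 := (hg.flow_antilipschitz hq t).hausdorffMeasure_preimage_le zero_le_one {x | ¬ P x}
  rw [hausdorffMeasure_real, h, mul_zero] at h1
  exact le_antisymm h1 (zero_le)

theorem flow_image_null (hg : IsTransportField V T D g) (hq : IsFlowOf g q) (t : ℝ) {s : Set ℝ}
    (h : volume s = 0) : volume (q t '' s) = 0 := by
  have h1 := (hg.flow_lipschitz hq t).hausdorffMeasure_image_le zero_le_one s
  rw [hausdorffMeasure_real, h, mul_zero] at h1
  exact le_antisymm h1 (zero_le)

theorem measurable_flow (hg : IsTransportField V T D g) (hq : IsFlowOf g q) :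
    Measurable fun p : ℝ × ℝ => (p.1, q p.1 p.2) :=
  measurable_fst.prodMk (hg.flow_continuous hq).measurable

/-- Rademacher's theorem on each time slice leaves an exceptional set that depends on the time.
Pulling it back by the flow and applying Fubini exchanges the quantifiers: almost every trajectory
avoids the bad points at almost every time. -/
theorem ae_hasDerivAt_field_flow (hg : IsTransportField V T D g) (hq : IsFlowOf g q) :
    ∀ᵐ η, ∀ᵐ t, HasDerivAt (g t) (fieldDiv g t (q t η)) (q t η) := by
  have hm : MeasurableSet {p : ℝ × ℝ | HasDerivAt (g p.1) (fieldDiv g p.1 (q p.1 p.2)) (q p.1 p.2)} :=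
    hg.measurableSet_hasDerivAt.preimage (hg.measurable_flow hq)
  have h1 : ∀ᵐ p : ℝ × ℝ, HasDerivAt (g p.1) (fieldDiv g p.1 (q p.1 p.2)) (q p.1 p.2) := by
    rw [Measure.volume_eq_prod, Measure.ae_prod_iff_ae_ae hm]
    exact Filter.Eventually.of_forall fun t => hg.ae_flow hq t (hg.ae_hasDerivAt_field t)
  have h2 := (Measure.measurePreserving_swap (μ := (volume : Measure ℝ))
    (ν := (volume : Measure ℝ))).quasiMeasurePreserving.ae h1
  exact Measure.ae_ae_of_ae_prod h2

theorem measurable_fieldDiv_comp (hg : IsTransportField V T D g) {c : ℝ → ℝ} (hc : Measurable c) :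
    Measurable fun s => fieldDiv g s (c s) :=
  Measurable.comp (g := fun p : ℝ × ℝ => fieldDiv g p.1 p.2) (f := fun s => (s, c s))
    hg.measurable_fieldDiv (measurable_id.prodMk hc)

theorem integrable_fieldDiv_comp (hg : IsTransportField V T D g) {c : ℝ → ℝ} (hc : Measurable c) :
    Integrable fun s => fieldDiv g s (c s) :=
  hg.integrable.mono' (hg.measurable_fieldDiv_comp hc).aestronglyMeasurable
    (Filter.Eventually.of_forall fun s => hg.abs_fieldDiv_le s _)

/-- By `flow_sub` the difference quotient of the flow is exactly the exponential of an integral of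
slopes of g, and these are dominated by D, so the limit passes inside. The exceptional labels do not
depend on the time, since they are those of `ae_hasDerivAt_field_flow`. -/
theorem ae_hasDerivAt_flow (hg : IsTransportField V T D g) (hq : IsFlowOf g q) :
    ∀ᵐ η, ∀ t, HasDerivAt (q t) (flowJac g q t η) η := by
  filter_upwards [hg.ae_hasDerivAt_field_flow hq] with η hη t
  rw [hasDerivAt_iff_tendsto_slope]
  have h1 : ∀ y ∈ ({η}ᶜ : Set ℝ), Real.exp (∫ s in (0 : ℝ)..t, slope (g s) (q s η) (q s y))
      = slope (q t) η y := fun y hy => by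
    rw [slope_def_field, hg.flow_sub hq, mul_div_cancel_left₀ _ (sub_ne_zero.2 hy)]
  refine Filter.Tendsto.congr' (Filter.eventuallyEq_of_mem self_mem_nhdsWithin h1) ?_
  refine (Real.continuous_exp.tendsto _).comp ?_
  refine intervalIntegral.tendsto_integral_filter_of_dominated_convergence D
    (Filter.Eventually.of_forall fun y =>
      (hg.integrable_slope (hq.cont η) (hq.cont y)).aestronglyMeasurable.restrict)
    (Filter.Eventually.of_forall fun y => Filter.Eventually.of_forall fun s _ =>
      hg.slope_abs_le s _ _) hg.integrable.intervalIntegrable ?_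
  filter_upwards [hη] with s hs _
  refine hs.tendsto_slope.comp (tendsto_nhdsWithin_iff.2 ⟨?_, ?_⟩)
  · exact ((hg.flow_continuous_space hq s).tendsto η).mono_left nhdsWithin_le_nhds
  · filter_upwards [self_mem_nhdsWithin] with y hy
    exact fun h => hy ((hg.flow_strictMono hq s).injective h)

theorem flowJac_pos (g q : ℝ → ℝ → ℝ) (t η : ℝ) : 0 < flowJac g q t η := Real.exp_pos _

theorem flowJac_zero (g q : ℝ → ℝ → ℝ) (η : ℝ) : flowJac g q 0 η = 1 := by simp [flowJac]

theorem log_flowJac_ac (hg : IsTransportField V T D g) (hq : IsFlowOf g q) (η : ℝ) :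
    IsACWithDeriv (fun t => ∫ s in (0 : ℝ)..t, fieldDiv g s (q s η))
      (fun t => fieldDiv g t (q t η)) :=
  IsACWithDeriv.of_integral (c := 0) (a := 0)
    (hg.integrable_fieldDiv_comp (hq.cont η).measurable).locallyIntegrable
    fun _ => (zero_add _).symm

theorem flowJac_ac (hg : IsTransportField V T D g) (hq : IsFlowOf g q) (η : ℝ) :
    IsACWithDeriv (fun t => flowJac g q t η)
      (fun t => flowJac g q t η * fieldDiv g t (q t η)) := by
  have := (hg.log_flowJac_ac hq η).comp_contDiff Real.contDiff_exp
  simp only [Real.deriv_exp] at this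
  exact this

theorem abs_log_flowJac_le (hg : IsTransportField V T D g) (t η : ℝ) :
    |∫ s in (0 : ℝ)..t, fieldDiv g s (q s η)| ≤ ∫ s, D s := by
  refine le_trans ?_ (hg.abs_integral_le 0 t)
  exact intervalIntegral.norm_integral_le_abs_of_norm_le
    (Filter.Eventually.of_forall fun s => by
      rw [Real.norm_eq_abs]; exact hg.abs_fieldDiv_le s (q s η)) hg.integrable.intervalIntegrable

theorem flowJac_le (hg : IsTransportField V T D g) (t η : ℝ) :
    flowJac g q t η ≤ Real.exp (∫ s, D s) :=
  Real.exp_le_exp.2 (_root_.abs_le.1 (hg.abs_log_flowJac_le t η)).2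

theorem le_flowJac (hg : IsTransportField V T D g) (t η : ℝ) :
    Real.exp (-∫ s, D s) ≤ flowJac g q t η :=
  Real.exp_le_exp.2 (_root_.abs_le.1 (hg.abs_log_flowJac_le t η)).1

theorem measurable_flowJac (hg : IsTransportField V T D g) (hq : IsFlowOf g q) :
    Measurable fun p : ℝ × ℝ => flowJac g q p.1 p.2 := by
  have h1 : Measurable fun p : ℝ × ℝ => fieldDiv g p.2 (q p.2 p.1) :=
    Measurable.comp (g := fun p : ℝ × ℝ => fieldDiv g p.1 p.2)
      (f := fun p : ℝ × ℝ => (p.2, q p.2 p.1)) hg.measurable_fieldDiv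
      ((hg.measurable_flow hq).comp measurable_swap)
  refine measurable_uncurry_of_continuous_of_measurable (u := fun t η => flowJac g q t η)
    (fun η => (hg.flowJac_ac hq η).continuous) fun t => ?_
  refine Real.measurable_exp.comp ?_
  simp only [intervalIntegral]
  exact (h1.stronglyMeasurable.integral_prod_right'.measurable).sub
    (h1.stronglyMeasurable.integral_prod_right'.measurable)

theorem flow_ac_space (hg : IsTransportField V T D g) (hq : IsFlowOf g q) (t : ℝ) :
    IsACWithDeriv (q t) (flowJac g q t) :=
  ⟨(IsACWithDeriv.of_lipschitz (hg.flow_lipschitz hq t)).ac, by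
    filter_upwards [hg.ae_hasDerivAt_flow hq] with η h using h t⟩

/-- The space-time homeomorphism `(t, η) ↦ (t, q t η)`. -/
noncomputable def flowHomeo (hg : IsTransportField V T D g) (hq : IsFlowOf g q) :
    ℝ × ℝ ≃ₜ ℝ × ℝ where
  toFun p := (p.1, q p.1 p.2)
  invFun p := (p.1, Function.surjInv (hg.flow_surjective hq p.1) p.2)
  left_inv p := by
    refine Prod.ext rfl ((hg.flow_strictMono hq p.1).injective ?_)
    exact Function.surjInv_eq (hg.flow_surjective hq p.1) _
  right_inv p := Prod.ext rfl (Function.surjInv_eq (hg.flow_surjective hq p.1) _)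
  continuous_toFun := continuous_fst.prodMk (hg.flow_continuous hq)
  continuous_invFun := by
    refine continuous_fst.prodMk ?_
    have hY : ∀ t x, q t (Function.surjInv (hg.flow_surjective hq t) x) = x := fun t x =>
      Function.surjInv_eq (hg.flow_surjective hq t) x
    refine continuous_prod_of_continuous_lipschitzWith' (fun p : ℝ × ℝ =>
      Function.surjInv (hg.flow_surjective hq p.1) p.2) (Real.exp (∫ s, D s)).toNNReal
      (fun t => ?_) fun x => ?_
    · exact (hg.flow_antilipschitz hq t).to_rightInverse (hY t)
    -- Continuity in time of the inverse at a fixed x: the antilipschitz bound of q(s,·) compares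
    -- the preimages of x at the times s and t by the distance of x to the time-s position of the
    -- time-t preimage, and this tends to zero.
    · refine continuous_iff_continuousAt.2 fun t => ?_
      have h1 : Filter.Tendsto (fun s => Real.exp (∫ s, D s) *
          dist x (q s (Function.surjInv (hg.flow_surjective hq t) x))) (nhds t) (nhds 0) := by
        have h2 := ((hq.cont (Function.surjInv (hg.flow_surjective hq t) x)).tendsto t)
        have h3 := (tendsto_const_nhds (x := x)).dist h2
        rw [hY, dist_self] at h3
        simpa using h3.const_mul (Real.exp (∫ s, D s))
      refine tendsto_iff_dist_tendsto_zero.2 (squeeze_zero (fun _ => dist_nonneg) (fun s => ?_) h1)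
      have := (hg.flow_antilipschitz hq s).le_mul_dist
        (Function.surjInv (hg.flow_surjective hq s) x)
        (Function.surjInv (hg.flow_surjective hq t) x)
      rwa [Real.coe_toNNReal _ (Real.exp_pos _).le, hY] at this

/-- Change of variables holds off the null set of labels where the flow is not differentiable; its
image under the Lipschitz map q(t,·) is null as well. -/
theorem lintegral_flow (hg : IsTransportField V T D g) (hq : IsFlowOf g q) (t : ℝ)
    (f : ℝ → ℝ≥0∞) :
    ∫⁻ x, f x = ∫⁻ η, ENNReal.ofReal (flowJac g q t η) * f (q t η) := by
  obtain ⟨s, hs, hsm, hsn⟩ := exists_measurable_superset_of_null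
    (ae_iff.1 (hg.ae_hasDerivAt_flow hq))
  have hd : ∀ η ∈ sᶜ, HasDerivWithinAt (q t) (flowJac g q t η) sᶜ η := fun η hη => by
    have : ∀ t, HasDerivAt (q t) (flowJac g q t η) η := by
      by_contra h
      exact hη (hs h)
    exact (this t).hasDerivWithinAt
  have h1 := lintegral_image_eq_lintegral_abs_deriv_mul hsm.compl hd
    (hg.flow_strictMono hq t).injective.injOn f
  have hc : q t '' sᶜ = (q t '' s)ᶜ :=
    image_compl_eq ⟨(hg.flow_strictMono hq t).injective, hg.flow_surjective hq t⟩
  rw [hc, setLIntegral_congr (t := univ), setLIntegral_univ] at h1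
  · rw [h1, setLIntegral_congr (t := univ), setLIntegral_univ]
    · refine lintegral_congr fun η => ?_
      rw [abs_of_pos (flowJac_pos g q t η)]
    · exact ae_eq_univ.2 (by rw [compl_compl]; exact hsn)
  · exact ae_eq_univ.2 (by rw [compl_compl]; exact hg.flow_image_null hq t hsn)

/-- Integrating the slice formula in time. As the flow map is a homeomorphism of space-time,
integrals, integrability and null sets then transfer for arbitrary integrands. -/
theorem map_flow (hg : IsTransportField V T D g) (hq : IsFlowOf g q) :
    Measure.map (hg.flowHomeo hq)
      ((volume : Measure (ℝ × ℝ)).withDensity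
        fun p => ENNReal.ofReal (flowJac g q p.1 p.2)) = volume := by
  refine Measure.ext_of_lintegral _ fun f hf => ?_
  have hJ : Measurable fun p : ℝ × ℝ => ENNReal.ofReal (flowJac g q p.1 p.2) :=
    (hg.measurable_flowJac hq).ennreal_ofReal
  have hfm : Measurable fun p => f (hg.flowHomeo hq p) :=
    hf.comp (hg.flowHomeo hq).continuous.measurable
  rw [lintegral_map hf (hg.flowHomeo hq).continuous.measurable,
    lintegral_withDensity_eq_lintegral_mul _ hJ hfm, Measure.volume_eq_prod,
    lintegral_prod _ hf.aemeasurable, lintegral_prod _ (hJ.mul hfm).aemeasurable]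
  refine lintegral_congr fun t => ?_
  rw [hg.lintegral_flow hq t fun x => f (t, x)]
  rfl

theorem integral_flow (hg : IsTransportField V T D g) (hq : IsFlowOf g q) (F : ℝ × ℝ → ℝ) :
    ∫ p, F p = ∫ p : ℝ × ℝ, flowJac g q p.1 p.2 * F (p.1, q p.1 p.2) := by
  conv_lhs => rw [← hg.map_flow hq]
  rw [(hg.flowHomeo hq).measurableEmbedding.integral_map,
    integral_withDensity_eq_integral_toReal_smul
      (hg.measurable_flowJac hq).ennreal_ofReal (Filter.Eventually.of_forall fun _ =>
        ENNReal.ofReal_lt_top)]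
  refine integral_congr_ae (Filter.Eventually.of_forall fun p => ?_)
  simp only [ENNReal.toReal_ofReal (flowJac_pos g q p.1 p.2).le, smul_eq_mul]
  rfl

theorem integrable_flow (hg : IsTransportField V T D g) (hq : IsFlowOf g q) (F : ℝ × ℝ → ℝ) :
    Integrable F ↔ Integrable fun p : ℝ × ℝ => flowJac g q p.1 p.2 * F (p.1, q p.1 p.2) := by
  conv_lhs => rw [← hg.map_flow hq]
  rw [(hg.flowHomeo hq).measurableEmbedding.integrable_map_iff,
    integrable_withDensity_iff_integrable_smul'
      (hg.measurable_flowJac hq).ennreal_ofReal (Filter.Eventually.of_forall fun _ =>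
        ENNReal.ofReal_lt_top)]
  refine integrable_congr (Filter.Eventually.of_forall fun p => ?_)
  simp only [ENNReal.toReal_ofReal (flowJac_pos g q p.1 p.2).le, smul_eq_mul]
  rfl

theorem ae_flow_iff (hg : IsTransportField V T D g) (hq : IsFlowOf g q) (P : ℝ × ℝ → Prop) :
    (∀ᵐ p, P p) ↔ ∀ᵐ p : ℝ × ℝ, P (p.1, q p.1 p.2) := by
  conv_lhs => rw [← hg.map_flow hq]
  rw [(hg.flowHomeo hq).measurableEmbedding.ae_map_iff,
    ae_withDensity_iff (hg.measurable_flowJac hq).ennreal_ofReal]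
  refine Filter.eventually_congr (Filter.Eventually.of_forall fun p => ?_)
  have : ENNReal.ofReal (flowJac g q p.1 p.2) ≠ 0 := by
    simpa using flowJac_pos g q p.1 p.2
  simp only [ne_eq, this, not_false_eq_true, forall_const]
  rfl

end IsTransportField

/-! ### Mollification -/

/-- Dominated convergence with a convergent sequence of dominating functions. -/
theorem tendsto_integral_of_tendsto_dominating {α : Type*} [MeasurableSpace α] {m : Measure α}
    {f G : ℕ → α → ℝ} {f₀ G₀ : α → ℝ} (hf : ∀ n, AEStronglyMeasurable (f n) m)
    (hG : ∀ n, Integrable (G n) m) (hG₀ : Integrable G₀ m) (hfG : ∀ n, ∀ᵐ x ∂m, |f n x| ≤ G n x)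
    (hlf : ∀ᵐ x ∂m, Filter.Tendsto (fun n => f n x) Filter.atTop (nhds (f₀ x)))
    (hlG : ∀ᵐ x ∂m, Filter.Tendsto (fun n => G n x) Filter.atTop (nhds (G₀ x)))
    (hI : Filter.Tendsto (fun n => ∫ x, G n x ∂m) Filter.atTop (nhds (∫ x, G₀ x ∂m))) :
    Filter.Tendsto (fun n => ∫ x, f n x ∂m) Filter.atTop (nhds (∫ x, f₀ x ∂m)) := by
  have hfi : ∀ n, Integrable (f n) m := fun n => (hG n).mono' (hf n) (hfG n)
  have hf₀m : AEStronglyMeasurable f₀ m := aestronglyMeasurable_of_tendsto_ae _ hf hlf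
  have hfG₀ : ∀ᵐ x ∂m, |f₀ x| ≤ G₀ x := by
    filter_upwards [hlf, hlG, ae_all_iff.2 hfG] with x h1 h2 h3
    exact le_of_tendsto_of_tendsto' h1.abs h2 h3
  have hf₀i : Integrable f₀ m := hG₀.mono' hf₀m hfG₀
  -- Fatou's lemma for these nonnegative functions bounds the lower limit from below by 2∫G₀; the
  -- upper bound follows by dropping the absolute value. The difference with ∫(G n + G₀) shows that
  -- ∫|f n - f₀| tends to zero.
  have key : Filter.Tendsto (fun n => ∫ x, (G n x + G₀ x - |f n x - f₀ x|) ∂m) Filter.atTop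
      (nhds (∫ x, 2 * G₀ x ∂m)) := by
    have hnn : ∀ n, 0 ≤ᵐ[m] fun x => G n x + G₀ x - |f n x - f₀ x| := fun n => by
      filter_upwards [hfG n, hfG₀] with x h1 h2
      have := abs_sub (f n x) (f₀ x)
      simp only [Pi.zero_apply]
      linarith
    have hi : ∀ n, Integrable (fun x => G n x + G₀ x - |f n x - f₀ x|) m := fun n =>
      ((hG n).add hG₀).sub ((hfi n).sub hf₀i).abs
    have h2nn : 0 ≤ᵐ[m] fun x => 2 * G₀ x := by
      filter_upwards [hfG₀] with x h2
      have := (abs_nonneg _).trans h2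
      simp only [Pi.zero_apply]
      linarith
    have hF := lintegral_liminf_le' (μ := m) (u := Filter.atTop)
      (f := fun n x => ENNReal.ofReal (G n x + G₀ x - |f n x - f₀ x|))
      fun n => (hi n).aestronglyMeasurable.aemeasurable.ennreal_ofReal
    have hlim : ∫⁻ x, Filter.liminf (fun n => ENNReal.ofReal (G n x + G₀ x - |f n x - f₀ x|))
        Filter.atTop ∂m = ENNReal.ofReal (∫ x, 2 * G₀ x ∂m) := by
      rw [ofReal_integral_eq_lintegral_ofReal (hG₀.const_mul 2) h2nn]
      refine lintegral_congr_ae ?_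
      filter_upwards [hlf, hlG] with x h1 h2
      refine Filter.Tendsto.liminf_eq ?_
      refine (ENNReal.continuous_ofReal.tendsto _).comp ?_
      have := (h2.add_const (G₀ x)).sub (h1.sub_const (f₀ x)).abs
      rwa [sub_self, abs_zero, sub_zero, ← two_mul] at this
    rw [hlim] at hF
    have hub : ∀ n, ∫ x, (G n x + G₀ x - |f n x - f₀ x|) ∂m
        ≤ ∫ x, G n x ∂m + ∫ x, G₀ x ∂m := fun n => by
      rw [← integral_add (hG n) hG₀]
      refine integral_mono (hi n) ((hG n).add hG₀) fun x => ?_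
      have := abs_nonneg (f n x - f₀ x)
      simp only
      linarith
    have hlimub := hI.add_const (∫ x, G₀ x ∂m)
    have h2 : ∫ x, G₀ x ∂m + ∫ x, G₀ x ∂m = ∫ x, 2 * G₀ x ∂m := by
      rw [integral_const_mul]; ring
    rw [h2] at hlimub
    refine tendsto_order.2 ⟨fun c hc => ?_, fun c hc => ?_⟩
    · rcases lt_or_ge c 0 with h0 | h0
      · exact Filter.Eventually.of_forall fun n => h0.trans_le (integral_nonneg_of_ae (hnn n))
      · have h3 : ENNReal.ofReal c < ENNReal.ofReal (∫ x, 2 * G₀ x ∂m) :=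
          (ENNReal.ofReal_lt_ofReal_iff (h0.trans_lt hc)).2 hc
        filter_upwards [Filter.eventually_lt_of_lt_liminf (h3.trans_le hF)] with n hn
        rw [← ofReal_integral_eq_lintegral_ofReal (hi n) (hnn n)] at hn
        exact (ENNReal.ofReal_lt_ofReal_iff_of_nonneg h0).1 hn
    · filter_upwards [(tendsto_order.1 hlimub).2 c hc] with n hn
      exact (hub n).trans_lt hn
  have h3 : Filter.Tendsto (fun n => ∫ x, |f n x - f₀ x| ∂m) Filter.atTop (nhds 0) := by
    have h4 := (hI.add_const (∫ x, G₀ x ∂m)).sub key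
    have h5 : ∫ x, G₀ x ∂m + ∫ x, G₀ x ∂m - ∫ x, 2 * G₀ x ∂m = 0 := by
      rw [integral_const_mul]; ring
    rw [h5] at h4
    refine h4.congr fun n => ?_
    have hA := integral_sub ((hG n).add hG₀) ((hfi n).sub hf₀i).abs
    have hB := integral_add (hG n) hG₀
    simp only [Pi.add_apply, Pi.sub_apply] at hA hB
    rw [hA, hB]
    ring
  refine tendsto_iff_dist_tendsto_zero.2 (squeeze_zero (fun _ => dist_nonneg) (fun n => ?_) h3)
  rw [Real.dist_eq, ← integral_sub (hfi n) hf₀i]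
  exact abs_integral_le_integral_abs

section Mollify

variable {E : Type*} [NormedAddCommGroup E] [NormedSpace ℝ E] [FiniteDimensional ℝ E]
  [MeasureSpace E] [BorelSpace E] [(volume : Measure E).IsAddHaarMeasure]

/-- A sequence of bump functions with shrinking supports. -/
noncomputable def bumpSeq (E : Type*) [NormedAddCommGroup E] [NormedSpace ℝ E] (n : ℕ) :
    ContDiffBump (0 : E) where
  rIn := 1 / (2 * ((n : ℝ) + 1))
  rOut := 1 / ((n : ℝ) + 1)
  rIn_pos := by positivity
  rIn_lt_rOut := by
    rw [div_lt_div_iff₀ (by positivity) (by positivity)]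
    have : (0 : ℝ) ≤ n := by positivity
    linarith

/-- The mollification of `f` at scale `1 / (n + 1)`. -/
noncomputable def mollify (n : ℕ) (f : E → ℝ) : E → ℝ :=
  convolution ((bumpSeq E n).normed volume) f (ContinuousLinearMap.lsmul ℝ ℝ) volume

theorem mollify_apply (n : ℕ) (f : E → ℝ) (x : E) :
    mollify n f x = ∫ y, (bumpSeq E n).normed volume (x - y) * f y :=
  convolution_lsmul_swap

theorem bumpSeq_rOut_tendsto {E : Type*} [NormedAddCommGroup E] [NormedSpace ℝ E] :
    Filter.Tendsto (fun n => (bumpSeq E n).rOut) Filter.atTop (nhds 0) :=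
  tendsto_one_div_add_atTop_nhds_zero_nat

theorem contDiff_mollify (n : ℕ) {f : E → ℝ} (hf : LocallyIntegrable f) :
    ContDiff ℝ ∞ (mollify n f) :=
  (bumpSeq E n).hasCompactSupport_normed.contDiff_convolution_left _
    (bumpSeq E n).contDiff_normed hf

theorem ae_tendsto_mollify {f : E → ℝ} (hf : LocallyIntegrable f) :
    ∀ᵐ x, Filter.Tendsto (fun n => mollify n f x) Filter.atTop (nhds (f x)) := by
  -- The ratio of outer to inner radius equals 2 for every n; a uniform bound on it is needed to
  -- compare the bumps with averages over balls.
  refine ContDiffBump.ae_convolution_tendsto_right_of_locallyIntegrable (K := 2)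
    bumpSeq_rOut_tendsto (Filter.Eventually.of_forall fun n => ?_) hf
  change 1 / ((n : ℝ) + 1) ≤ 2 * (1 / (2 * ((n : ℝ) + 1)))
  have : (0 : ℝ) < (n : ℝ) + 1 := by positivity
  field_simp
  exact le_refl _

theorem tendsto_mollify_of_continuous {f : E → ℝ} (hf : Continuous f) (x : E) :
    Filter.Tendsto (fun n => mollify n f x) Filter.atTop (nhds (f x)) :=
  ContDiffBump.convolution_tendsto_right_of_continuous bumpSeq_rOut_tendsto hf x

theorem integrable_bump_mul (n : ℕ) {f : E → ℝ} (hf : LocallyIntegrable f) (x : E) :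
    Integrable fun y => (bumpSeq E n).normed volume (x - y) * f y := by
  have h1 := (bumpSeq E n).hasCompactSupport_normed (μ := volume)
  have h2 : HasCompactSupport fun y => (bumpSeq E n).normed volume (x - y) :=
    h1.comp_homeomorph (Homeomorph.subLeft x)
  have h3 : Continuous fun y => (bumpSeq E n).normed volume (x - y) :=
    ((bumpSeq E n).continuous_normed).comp (by fun_prop)
  exact hf.integrable_smul_left_of_hasCompactSupport h3 h2

theorem integral_bump_sub (n : ℕ) (x : E) :
    ∫ y, (bumpSeq E n).normed volume (x - y) = 1 := by
  rw [integral_sub_left_eq_self (fun y => (bumpSeq E n).normed volume y)]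
  exact (bumpSeq E n).integral_normed

theorem abs_mollify_le (n : ℕ) {f : E → ℝ} {C : ℝ} (hC : ∀ᵐ x, |f x| ≤ C) (x : E) :
    |mollify n f x| ≤ C := by
  rw [mollify_apply]
  have h1 := norm_integral_le_of_norm_le (μ := (volume : Measure E))
    (f := fun y => (bumpSeq E n).normed volume (x - y) * f y)
    (g := fun y => (bumpSeq E n).normed volume (x - y) * C)
    ((((bumpSeq E n).integrable_normed).comp_sub_left x).mul_const C) (by
      filter_upwards [hC] with y hy
      rw [norm_mul, Real.norm_of_nonneg ((bumpSeq E n).nonneg_normed _)]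
      exact mul_le_mul_of_nonneg_left hy ((bumpSeq E n).nonneg_normed _))
  rwa [integral_mul_const, integral_bump_sub, one_mul] at h1

/-- Jensen's inequality for the probability density given by the bump, obtained by expanding a
nonnegative variance. -/
theorem mollify_sq_le (n : ℕ) {f : E → ℝ} (hf : LocallyIntegrable f)
    (hf2 : LocallyIntegrable fun x => f x ^ 2) (x : E) :
    mollify n f x ^ 2 ≤ mollify n (fun x => f x ^ 2) x := by
  set m := mollify n f x with hm
  have h1 : 0 ≤ ∫ y, (bumpSeq E n).normed volume (x - y) * (f y - m) ^ 2 :=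
    integral_nonneg fun y => mul_nonneg ((bumpSeq E n).nonneg_normed _) (sq_nonneg _)
  have h2 : ∫ y, (bumpSeq E n).normed volume (x - y) * (f y - m) ^ 2
      = mollify n (fun x => f x ^ 2) x - m ^ 2 := by
    have e : ∀ y, (bumpSeq E n).normed volume (x - y) * (f y - m) ^ 2
        = (bumpSeq E n).normed volume (x - y) * f y ^ 2
          - 2 * m * ((bumpSeq E n).normed volume (x - y) * f y)
          + m ^ 2 * (bumpSeq E n).normed volume (x - y) := fun y => by ring
    simp only [e]
    rw [integral_add, integral_sub, integral_const_mul, integral_const_mul, integral_bump_sub,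
      ← mollify_apply n (fun x => f x ^ 2), ← mollify_apply n f, ← hm]
    · ring
    · exact integrable_bump_mul n hf2 x
    · exact (integrable_bump_mul n hf x).const_mul _
    · exact (integrable_bump_mul n hf2 x).sub ((integrable_bump_mul n hf x).const_mul _)
    · exact (((bumpSeq E n).integrable_normed).comp_sub_left x).const_mul _
  linarith

theorem integral_mollify (n : ℕ) {f : E → ℝ} (hf : Integrable f) :
    ∫ x, mollify n f x = ∫ x, f x := by
  have := integral_convolution (μ := (volume : Measure E)) (ν := (volume : Measure E))
    (ContinuousLinearMap.lsmul ℝ ℝ) ((bumpSeq E n).integrable_normed (μ := volume)) hf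
  rw [(bumpSeq E n).integral_normed] at this
  simp only [ContinuousLinearMap.lsmul_apply, one_smul] at this
  exact this

theorem integrable_mollify (n : ℕ) {f : E → ℝ} (hf : Integrable f) : Integrable (mollify n f) :=
  ((bumpSeq E n).integrable_normed (μ := volume)).integrable_convolution _ hf

/-- The derivative falls on the bump, and the weak derivative is tested with the reflected bump y ↦
φ(x - y); the sign of the reflection cancels that of the integration by parts. -/
theorem fderiv_mollify (n : ℕ) {f a : E → ℝ} (hf : LocallyIntegrable f) (v : E)
    (ha : ∀ h : E → ℝ, ContDiff ℝ ∞ h → HasCompactSupport h →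
      ∫ x, f x * fderiv ℝ h x v = -∫ x, a x * h x) (x : E) :
    fderiv ℝ (mollify n f) x v = mollify n a x := by
  have hs := (bumpSeq E n).hasCompactSupport_normed (μ := volume)
  have hd : ContDiff ℝ ∞ ((bumpSeq E n).normed volume) := (bumpSeq E n).contDiff_normed
  have h1 := hs.hasFDerivAt_convolution_left (μ := volume) (ContinuousLinearMap.lsmul ℝ ℝ)
    (hd.of_le (by simp)) hf x
  have h1' : fderiv ℝ (mollify n f) x = _ := h1.fderiv
  rw [h1', convolution_eq_swap]
  have hint : Integrable fun t => ((ContinuousLinearMap.lsmul ℝ ℝ).precompL E)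
      (fderiv ℝ ((bumpSeq E n).normed volume) (x - t)) (f t) := by
    exact ((hs.fderiv ℝ).convolutionExists_left _ (hd.continuous_fderiv (by simp)) hf
      x).integrable_swap
  rw [ContinuousLinearMap.integral_apply hint]
  have h2 := ha (fun y => (bumpSeq E n).normed volume (x - y)) (hd.comp (by fun_prop))
    (hs.comp_homeomorph (Homeomorph.subLeft x))
  have h3 : ∀ y, fderiv ℝ (fun y => (bumpSeq E n).normed volume (x - y)) y v
      = -fderiv ℝ ((bumpSeq E n).normed volume) (x - y) v := fun y => by
    have h4 : HasFDerivAt (fun y => x - y) (-ContinuousLinearMap.id ℝ E) y := by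
      simpa using (hasFDerivAt_id y).const_sub x
    have h5 := ((hd.differentiable (by simp) (x - y)).hasFDerivAt).comp y h4
    have h6 : fderiv ℝ (fun y => (bumpSeq E n).normed volume (x - y)) y = _ := h5.fderiv
    rw [h6]
    simp
  simp only [h3, mul_neg, integral_neg, neg_inj] at h2
  rw [mollify_apply]
  calc _ = ∫ y, f y * fderiv ℝ ((bumpSeq E n).normed volume) (x - y) v := by
        refine integral_congr_ae (Filter.Eventually.of_forall fun y => ?_)
        simp [ContinuousLinearMap.precompL_apply, mul_comm]
    _ = _ := by
        rw [h2]
        exact integral_congr_ae (Filter.Eventually.of_forall fun y => mul_comm _ _)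

theorem mollify_eq_zero_of_notMem (n : ℕ) {f : E → ℝ} {K : Set E} (hf : ∀ x ∉ K, f x = 0) {x : E}
    (hx : x ∉ Metric.cthickening (1 / ((n : ℝ) + 1)) K) : mollify n f x = 0 := by
  rw [mollify_apply]
  refine integral_eq_zero_of_ae (Filter.Eventually.of_forall fun y => ?_)
  by_cases hy : y ∈ K
  · have h1 : x - y ∉ Function.support ((bumpSeq E n).normed volume) := by
      rw [(bumpSeq E n).support_normed_eq, Metric.mem_ball, dist_zero_right, not_lt]
      by_contra h
      rw [not_le] at h
      refine hx (Metric.mem_cthickening_of_dist_le x y _ K hy ?_)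
      rw [dist_eq_norm]
      exact h.le
    simp [Function.notMem_support.1 h1]
  · simp [hf y hy]

/-- Weak convergence in `L²` of mollifications. -/
theorem tendsto_integral_mul_mollify {F a : E → ℝ} (hF : AEStronglyMeasurable F)
    (hF2 : Integrable fun x => F x ^ 2) (ha : LocallyIntegrable a)
    (ha2 : Integrable fun x => a x ^ 2) :
    Filter.Tendsto (fun n => ∫ x, F x * mollify n a x) Filter.atTop (nhds (∫ x, F x * a x)) := by
  refine tendsto_integral_of_tendsto_dominating
    -- The dominating functions vary with n, but their integrals do not, because mollification
    -- preserves the integral of a².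
    (G := fun n x => F x ^ 2 + mollify n (fun x => a x ^ 2) x)
    (G₀ := fun x => F x ^ 2 + a x ^ 2) (fun n => ?_) (fun n => ?_) (hF2.add ha2) (fun n => ?_)
    ?_ ?_ ?_
  · exact hF.mul (contDiff_mollify n ha).continuous.aestronglyMeasurable
  · exact hF2.add (integrable_mollify n ha2)
  · refine Filter.Eventually.of_forall fun x => ?_
    have h1 := mollify_sq_le n ha ha2.locallyIntegrable x
    rw [abs_mul]
    nlinarith [sq_abs (F x), sq_abs (mollify n a x), sq_nonneg (|F x| - |mollify n a x|),
      sq_nonneg (F x), sq_nonneg (mollify n a x)]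
  · filter_upwards [ae_tendsto_mollify ha] with x hx using hx.const_mul _
  · filter_upwards [ae_tendsto_mollify ha2.locallyIntegrable] with x hx using hx.const_add _
  · have : ∀ n, ∫ x, (F x ^ 2 + mollify n (fun x => a x ^ 2) x)
        = ∫ x, F x ^ 2 + a x ^ 2 := fun n => by
      rw [integral_add hF2 (integrable_mollify n ha2), integral_mollify n ha2,
        integral_add hF2 ha2]
    simp only [this]
    exact tendsto_const_nhds

theorem tendsto_integral_mul_mollify_of_bounded {F b : E → ℝ} {C : ℝ} (hF : Integrable F)
    (hb : LocallyIntegrable b) (hC : ∀ᵐ x, |b x| ≤ C) :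
    Filter.Tendsto (fun n => ∫ x, F x * mollify n b x) Filter.atTop (nhds (∫ x, F x * b x)) := by
  refine tendsto_integral_of_dominated_convergence (fun x => |F x| * C)
    (fun n => hF.aestronglyMeasurable.mul (contDiff_mollify n hb).continuous.aestronglyMeasurable)
    (hF.abs.mul_const C) (fun n => Filter.Eventually.of_forall fun x => ?_) ?_
  · rw [norm_mul]
    exact mul_le_mul_of_nonneg_left (abs_mollify_le n hC x) (abs_nonneg _)
  · filter_upwards [ae_tendsto_mollify hb] with x hx using hx.const_mul _

end Mollify

/-! ### Weak identities in one space dimension and their nonsmooth test functions -/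

/-- The identity `∬ (A φ_t + B φ_x + C φ) + ∫ c₀ φ(0, ·) = 0` for all smooth `φ` with compact
support in `(-∞, T) × (0, V)`. -/
def IsWeakIdentity (T V : ℝ) (A B C : ℝ × ℝ → ℝ) (c₀ : ℝ → ℝ) : Prop :=
  ∀ φ : ℝ × ℝ → ℝ, ContDiff ℝ ∞ φ → HasCompactSupport φ → tsupport φ ⊆ Iio T ×ˢ Ioo 0 V →
    (∫ p, (A p * fderiv ℝ φ p (1, 0) + B p * fderiv ℝ φ p (0, 1) + C p * φ p))
      + ∫ x, c₀ x * φ (0, x) = 0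

/-- The coefficients of a weak identity are locally (square) integrable. -/
structure HasLocalCoeffs (T V : ℝ) (A B C : ℝ × ℝ → ℝ) (c₀ : ℝ → ℝ) : Prop where
  measA : AEStronglyMeasurable A
  sqA : ∀ K : Set (ℝ × ℝ), IsCompact K → K ⊆ Iio T ×ˢ Ioo 0 V →
    IntegrableOn (fun p => A p ^ 2) K
  intB : ∀ K : Set (ℝ × ℝ), IsCompact K → K ⊆ Iio T ×ˢ Ioo 0 V → IntegrableOn B K
  intC : ∀ K : Set (ℝ × ℝ), IsCompact K → K ⊆ Iio T ×ˢ Ioo 0 V → IntegrableOn C K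
  int₀ : ∀ K : Set ℝ, IsCompact K → K ⊆ Ioo 0 V → IntegrableOn c₀ K

/-- A continuous test function on space-time, supported in `K`, with weak derivatives `a` in time
and `b` in space, where `a` is square integrable and `b` is bounded. -/
structure IsSobolevTest (K : Set (ℝ × ℝ)) (z a b : ℝ × ℝ → ℝ) : Prop where
  cont : Continuous z
  zero_z : ∀ p ∉ K, z p = 0
  zero_a : ∀ p ∉ K, a p = 0
  zero_b : ∀ p ∉ K, b p = 0
  meas_a : AEStronglyMeasurable a
  sq_a : Integrable fun p => a p ^ 2
  meas_b : AEStronglyMeasurable b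
  bdd_b : ∃ M, ∀ᵐ p, |b p| ≤ M
  weak_a : ∀ h : ℝ × ℝ → ℝ, ContDiff ℝ ∞ h → HasCompactSupport h →
    ∫ p, z p * fderiv ℝ h p (1, 0) = -∫ p, a p * h p
  weak_b : ∀ h : ℝ × ℝ → ℝ, ContDiff ℝ ∞ h → HasCompactSupport h →
    ∫ p, z p * fderiv ℝ h p (0, 1) = -∫ p, b p * h p

theorem integrable_of_sq_of_compact {α : Type*} [MeasurableSpace α] {m : Measure α} {f : α → ℝ}
    {K : Set α} (hK : MeasurableSet K) (hKf : m K < ⊤) (hf : AEStronglyMeasurable f m)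
    (hf2 : Integrable (fun x => f x ^ 2) m) (h0 : ∀ x ∉ K, f x = 0) : Integrable f m := by
  have h1 : Integrable (K.indicator (fun _ => (1 : ℝ))) m :=
    (integrable_indicator_iff hK).2 (integrableOn_const hKf.ne)
  refine (hf2.add h1).mono' hf (Filter.Eventually.of_forall fun x => ?_)
  simp only [Pi.add_apply, Real.norm_eq_abs]
  by_cases hx : x ∈ K
  · rw [indicator_of_mem hx]
    nlinarith [sq_abs (f x), sq_nonneg (|f x| - 1)]
  · rw [h0 x hx, indicator_of_notMem hx]; simp

/-- Insert the mollifications of z, whose derivatives are the mollifications of a and b, and pass to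
the limit. For fine mollifications the supports stay in a compact thickening K' inside the domain,
so the coefficients may be cut off to K' and become globally integrable. The product A a pairs two
square integrable functions; the other products pair an integrable with a bounded one. -/
theorem IsWeakIdentity.sobolevTest {T V : ℝ} {A B C : ℝ × ℝ → ℝ} {c₀ : ℝ → ℝ}
    (h : IsWeakIdentity T V A B C c₀) (hc : HasLocalCoeffs T V A B C c₀) {K : Set (ℝ × ℝ)}
    (hK : IsCompact K) (hKO : K ⊆ Iio T ×ˢ Ioo 0 V) {z a b : ℝ × ℝ → ℝ}
    (hz : IsSobolevTest K z a b) :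
    (∫ p, A p * a p) + (∫ p, B p * b p) + (∫ p, C p * z p) + ∫ x, c₀ x * z (0, x) = 0 := by
  obtain ⟨ε, hε, hεO⟩ := hK.exists_cthickening_subset_open (isOpen_Iio.prod isOpen_Ioo) hKO
  set K' := Metric.cthickening ε K with hK'
  have hK'c : IsCompact K' := hK.cthickening
  have hKK' : K ⊆ K' := Metric.self_subset_cthickening K
  have hK'm : MeasurableSet K' := hK'c.isClosed.measurableSet
  set K₁ : Set ℝ := Prod.snd '' K' with hK₁
  have hK₁c : IsCompact K₁ := hK'c.image continuous_snd
  have hK₁m : MeasurableSet K₁ := hK₁c.isClosed.measurableSet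
  have hK₁O : K₁ ⊆ Ioo 0 V := by
    rintro _ ⟨p, hp, rfl⟩
    exact (hεO hp).2
  obtain ⟨Mb, hMb⟩ := hz.bdd_b
  have hzi : Integrable z := by
    refine hz.cont.integrable_of_hasCompactSupport ?_
    exact HasCompactSupport.intro hK fun p hp => hz.zero_z p hp
  have hai : Integrable a := integrable_of_sq_of_compact hK.isClosed.measurableSet
    hK.measure_lt_top hz.meas_a hz.sq_a hz.zero_a
  have hbi : Integrable b := by
    have h1 : IntegrableOn b K := IntegrableOn.of_bound hK.measure_lt_top
      hz.meas_b.restrict Mb (ae_restrict_of_ae hMb)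
    exact h1.integrable_of_forall_notMem_eq_zero fun p hp => hz.zero_b p hp
  obtain ⟨Mz, hMz⟩ : ∃ M, ∀ p, |z p| ≤ M :=
    hz.cont.bounded_above_of_compact_support
      (HasCompactSupport.intro hK fun p hp => hz.zero_z p hp)
  set F := K'.indicator A with hF
  have hFm : AEStronglyMeasurable F := hc.measA.indicator hK'm
  have hF2 : Integrable fun p => F p ^ 2 := by
    have h1 := (integrable_indicator_iff hK'm).2 (hc.sqA K' hK'c hεO)
    refine h1.congr (Filter.Eventually.of_forall fun p => ?_)
    by_cases hp : p ∈ K' <;> simp [hF, hp]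
  have hFB : Integrable (K'.indicator B) := (integrable_indicator_iff hK'm).2
    (hc.intB K' hK'c hεO)
  have hFC : Integrable (K'.indicator C) := (integrable_indicator_iff hK'm).2
    (hc.intC K' hK'c hεO)
  have hF0 : Integrable (K₁.indicator c₀) := (integrable_indicator_iff hK₁m).2
    (hc.int₀ K₁ hK₁c hK₁O)
  have hFi : Integrable F := integrable_of_sq_of_compact hK'm hK'c.measure_lt_top hFm hF2
    fun p hp => indicator_of_notMem hp _
  have T1 := tendsto_integral_mul_mollify hFm hF2 hai.locallyIntegrable hz.sq_a
  have T2 := tendsto_integral_mul_mollify_of_bounded hFB hbi.locallyIntegrable hMb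
  have T3 := tendsto_integral_mul_mollify_of_bounded hFC hzi.locallyIntegrable
    (Filter.Eventually.of_forall hMz)
  have T4 : Filter.Tendsto (fun n => ∫ x, K₁.indicator c₀ x * mollify n z (0, x)) Filter.atTop
      (nhds (∫ x, K₁.indicator c₀ x * z (0, x))) := by
    refine tendsto_integral_of_dominated_convergence (fun x => |K₁.indicator c₀ x| * Mz)
      (fun n => hF0.aestronglyMeasurable.mul
        ((contDiff_mollify n hzi.locallyIntegrable).continuous.comp
          (by fun_prop)).aestronglyMeasurable)
      (hF0.abs.mul_const Mz) (fun n => Filter.Eventually.of_forall fun x => ?_)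
      (Filter.Eventually.of_forall fun x =>
        (tendsto_mollify_of_continuous hz.cont (0, x)).const_mul _)
    rw [norm_mul]
    exact mul_le_mul_of_nonneg_left (abs_mollify_le n (Filter.Eventually.of_forall hMz) _)
      (abs_nonneg _)
  have T := ((T1.add T2).add T3).add T4
  have hlim : (∫ p, F p * a p) + (∫ p, K'.indicator B p * b p) + (∫ p, K'.indicator C p * z p)
      + ∫ x, K₁.indicator c₀ x * z (0, x) = 0 := by
    refine tendsto_nhds_unique T (tendsto_const_nhds.congr' ?_)
    obtain ⟨n₀, hn₀⟩ := exists_nat_one_div_lt hε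
    filter_upwards [Filter.eventually_ge_atTop n₀] with n hn
    have hne : 1 / ((n : ℝ) + 1) ≤ ε := by
      refine le_trans ?_ hn₀.le
      exact one_div_le_one_div_of_le (by positivity) (by gcongr)
    have hmem : ∀ p, p ∉ K' → p ∉ Metric.cthickening (1 / ((n : ℝ) + 1)) K := fun p hp hp' =>
      hp (Metric.cthickening_mono hne K hp')
    have z0 : ∀ p ∉ K', mollify n z p = 0 := fun p hp =>
      mollify_eq_zero_of_notMem n hz.zero_z (hmem p hp)
    have a0 : ∀ p ∉ K', mollify n a p = 0 := fun p hp =>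
      mollify_eq_zero_of_notMem n hz.zero_a (hmem p hp)
    have b0 : ∀ p ∉ K', mollify n b p = 0 := fun p hp =>
      mollify_eq_zero_of_notMem n hz.zero_b (hmem p hp)
    have hsupp : tsupport (mollify n z) ⊆ K' :=
      closure_minimal (fun p hp => by_contra fun hp' => hp (z0 p hp')) hK'c.isClosed
    have hcs : HasCompactSupport (mollify n z) := HasCompactSupport.intro hK'c z0
    have H := h (mollify n z) (contDiff_mollify n hzi.locallyIntegrable) hcs
      (hsupp.trans hεO)
    have e1 : ∀ p, A p * mollify n a p = F p * mollify n a p := fun p => by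
      by_cases hp : p ∈ K'
      · simp [hF, hp]
      · simp [a0 p hp]
    have e2 : ∀ p, B p * mollify n b p = K'.indicator B p * mollify n b p := fun p => by
      by_cases hp : p ∈ K'
      · simp [hp]
      · simp [b0 p hp]
    have e3 : ∀ p, C p * mollify n z p = K'.indicator C p * mollify n z p := fun p => by
      by_cases hp : p ∈ K'
      · simp [hp]
      · simp [z0 p hp]
    have e4 : ∀ x, c₀ x * mollify n z (0, x) = K₁.indicator c₀ x * mollify n z (0, x) :=
      fun x => by
      by_cases hp : x ∈ K₁
      · simp [hp]
      · have : ((0 : ℝ), x) ∉ K' := fun h' => hp ⟨_, h', rfl⟩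
        simp [z0 _ this]
    simp only [fderiv_mollify n hzi.locallyIntegrable _ hz.weak_a,
      fderiv_mollify n hzi.locallyIntegrable _ hz.weak_b, e1, e2, e3, e4] at H
    have bddint : ∀ {f w : ℝ × ℝ → ℝ}, Integrable f → LocallyIntegrable w →
        (∀ p ∉ K', mollify n w p = 0) → Integrable fun p => f p * mollify n w p := by
      intro f w hf hw hw0
      have hcw := (contDiff_mollify n hw).continuous
      obtain ⟨M, hM⟩ := hcw.bounded_above_of_compact_support (HasCompactSupport.intro hK'c hw0)
      exact hf.mul_bdd hcw.aestronglyMeasurable (Filter.Eventually.of_forall hM)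
    have i1 := integral_add ((bddint hFi hai.locallyIntegrable a0).add
      (bddint hFB hbi.locallyIntegrable b0)) (bddint hFC hzi.locallyIntegrable z0)
    have i2 := integral_add (bddint hFi hai.locallyIntegrable a0)
      (bddint hFB hbi.locallyIntegrable b0)
    simp only [Pi.add_apply] at i1
    rw [i1, i2] at H
    exact H.symm
  have e1 : ∀ p, F p * a p = A p * a p := fun p => by
    by_cases hp : p ∈ K'
    · simp [hF, hp]
    · simp [hz.zero_a p fun h' => hp (hKK' h')]
  have e2 : ∀ p, K'.indicator B p * b p = B p * b p := fun p => by
    by_cases hp : p ∈ K'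
    · simp [hp]
    · simp [hz.zero_b p fun h' => hp (hKK' h')]
  have e3 : ∀ p, K'.indicator C p * z p = C p * z p := fun p => by
    by_cases hp : p ∈ K'
    · simp [hp]
    · simp [hz.zero_z p fun h' => hp (hKK' h')]
  have e4 : ∀ x, K₁.indicator c₀ x * z (0, x) = c₀ x * z (0, x) := fun x => by
    by_cases hp : x ∈ K₁
    · simp [hp]
    · have : ((0 : ℝ), x) ∉ K' := fun h' => hp ⟨_, h', rfl⟩
      simp [hz.zero_z _ fun h' => this (hKK' h')]
  simpa only [e1, e2, e3, e4] using hlim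

theorem HasLocalCoeffs.integrable_mul {T V : ℝ} {A B C : ℝ × ℝ → ℝ} {c₀ : ℝ → ℝ}
    (hc : HasLocalCoeffs T V A B C c₀) {K : Set (ℝ × ℝ)}
    (hK : IsCompact K) (hKO : K ⊆ Iio T ×ˢ Ioo 0 V) {z a b : ℝ × ℝ → ℝ}
    (hz : IsSobolevTest K z a b) :
    (Integrable fun p => A p * a p) ∧ (Integrable fun p => B p * b p) ∧
      Integrable fun p => C p * z p := by
  have hKm := hK.isClosed.measurableSet
  refine ⟨?_, ?_, ?_⟩
  · have h1 := ((integrable_indicator_iff hKm).2 (hc.sqA K hK hKO)).add hz.sq_a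
    refine h1.mono' (hc.measA.mul hz.meas_a) (Filter.Eventually.of_forall fun p => ?_)
    simp only [Pi.add_apply]
    by_cases hp : p ∈ K
    · rw [indicator_of_mem hp, norm_mul, Real.norm_eq_abs, Real.norm_eq_abs]
      nlinarith [sq_abs (A p), sq_abs (a p), sq_nonneg (|A p| - |a p|), sq_nonneg (A p),
        sq_nonneg (a p)]
    · rw [hz.zero_a p hp]; simp [indicator_of_notMem hp]
  · obtain ⟨M, hM⟩ := hz.bdd_b
    have h1 := ((integrable_indicator_iff hKm).2 (hc.intB K hK hKO)).mul_bdd hz.meas_b hM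
    refine h1.congr (Filter.Eventually.of_forall fun p => ?_)
    by_cases hp : p ∈ K
    · simp [hp]
    · simp [hz.zero_b p hp]
  · obtain ⟨M, hM⟩ := hz.cont.bounded_above_of_compact_support
      (HasCompactSupport.intro hK fun p hp => hz.zero_z p hp)
    have h1 := ((integrable_indicator_iff hKm).2 (hc.intC K hK hKO)).mul_bdd
      hz.cont.aestronglyMeasurable (Filter.Eventually.of_forall hM)
    refine h1.congr (Filter.Eventually.of_forall fun p => ?_)
    by_cases hp : p ∈ K
    · simp [hp]
    · simp [hz.zero_z p hp]

/-! ### Test functions in Lagrangian coordinates -/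

/-- A test function in Lagrangian coordinates: absolutely continuous in time with square integrable
derivative, Lipschitz in space, and supported in `[-1, s] × [δ, V - δ]`. -/
structure IsLagrangianTest (s δ V : ℝ) (ζ ζt ζη : ℝ → ℝ → ℝ) (k : ℝ → ℝ) (M : ℝ) : Prop where
  pos : 0 < δ
  meas_t : Measurable fun p : ℝ × ℝ => ζt p.1 p.2
  meas_η : Measurable fun p : ℝ × ℝ => ζη p.1 p.2
  ac_t : ∀ η, IsACWithDeriv (fun t => ζ t η) fun t => ζt t η
  ac_η : ∀ t, IsACWithDeriv (ζ t) (ζη t)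
  meas_k : Measurable k
  sq_k : Integrable fun t => k t ^ 2
  bdd_t : ∀ t η, |ζt t η| ≤ k t
  bdd_η : ∀ t η, |ζη t η| ≤ M
  zero : ∀ t η, (t, η) ∉ Icc (-1) s ×ˢ Icc δ (V - δ) → ζ t η = 0
  zero_t : ∀ t η, (t, η) ∉ Icc (-1) s ×ˢ Icc δ (V - δ) → ζt t η = 0
  zero_η : ∀ t η, (t, η) ∉ Icc (-1) s ×ˢ Icc δ (V - δ) → ζη t η = 0

theorem integrable_of_strip {V : ℝ} {f : ℝ × ℝ → ℝ} {κ : ℝ → ℝ} (hf : AEStronglyMeasurable f)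
    (hκ : Integrable κ) (hb : ∀ t x, |f (t, x)| ≤ κ t) (h0 : ∀ t x, x ∉ Icc 0 V → f (t, x) = 0) :
    Integrable f := by
  have h1 : Integrable ((Icc 0 V).indicator fun _ : ℝ => (1 : ℝ)) :=
    (integrable_indicator_iff measurableSet_Icc).2 (integrableOn_const measure_Icc_lt_top.ne)
  have h2 := hκ.mul_prod h1
  rw [← Measure.volume_eq_prod] at h2
  refine h2.mono' hf (Filter.Eventually.of_forall fun p => ?_)
  obtain ⟨t, x⟩ := p
  by_cases hx : x ∈ Icc 0 V
  · simpa [hx] using hb t x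
  · rw [h0 t x hx]; simp [indicator_of_notMem hx]

theorem integral_eq_zero_of_space {f : ℝ × ℝ → ℝ} (hf : Integrable f)
    (h : ∀ t, ∫ x, f (t, x) = 0) : ∫ p, f p = 0 := by
  rw [Measure.volume_eq_prod] at hf ⊢
  rw [integral_prod _ hf]
  simp [h]

theorem integral_eq_zero_of_time {f : ℝ × ℝ → ℝ} (hf : Integrable f)
    (h : ∀ x, ∫ t, f (t, x) = 0) : ∫ p, f p = 0 := by
  rw [Measure.volume_eq_prod] at hf ⊢
  rw [integral_prod_symm _ hf]
  simp [h]

/-! ### Lagrangian test functions seen in Eulerian coordinates. -/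

namespace IsLagrangianTest

variable {s δ V T M : ℝ} {ζ ζt ζη : ℝ → ℝ → ℝ} {k D : ℝ → ℝ} {g q : ℝ → ℝ → ℝ}

theorem bound_nonneg (h : IsLagrangianTest s δ V ζ ζt ζη k M) : 0 ≤ M :=
  (abs_nonneg _).trans (h.bdd_η 0 0)

theorem lipschitz (h : IsLagrangianTest s δ V ζ ζt ζη k M) (t : ℝ) :
    LipschitzWith M.toNNReal (ζ t) := by
  refine LipschitzWith.of_dist_le_mul fun x y => ?_
  rw [Real.coe_toNNReal _ h.bound_nonneg, Real.dist_eq, Real.dist_eq, ← (h.ac_η t).integral_eq y x]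
  exact intervalIntegral.norm_integral_le_of_norm_le_const (f := ζη t) fun η _ => by
    rw [Real.norm_eq_abs]; exact h.bdd_η t η

theorem continuous (h : IsLagrangianTest s δ V ζ ζt ζη k M) :
    Continuous fun p : ℝ × ℝ => ζ p.1 p.2 :=
  continuous_prod_of_continuous_lipschitzWith' (fun p : ℝ × ℝ => ζ p.1 p.2) _ h.lipschitz
    fun η => (h.ac_t η).continuous

theorem field_flow_ac (hg : IsTransportField V T D g) (hq : IsFlowOf g q) (t : ℝ) :
    IsACWithDeriv (fun η => g t (q t η)) fun η => fieldDiv g t (q t η) * flowJac g q t η := by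
  constructor
  · exact fun a b => (((hg.lipschitzWith t).comp
      (hg.flow_lipschitz hq t)).lipschitzOnWith).absolutelyContinuousOnInterval
  · filter_upwards [hg.ae_flow hq t (hg.ae_hasDerivAt_field t), hg.ae_hasDerivAt_flow hq]
      with η h1 h2
    exact h1.comp η (h2 t)

theorem comp_flow_ac {h' : ℝ × ℝ → ℝ} (hg : IsTransportField V T D g) (hq : IsFlowOf g q)
    (hs : ContDiff ℝ ∞ h') (t : ℝ) :
    IsACWithDeriv (fun η => h' (t, q t η))
      (fun η => fderiv ℝ h' (t, q t η) (0, 1) * flowJac g q t η) := by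
  have h1 : ContDiff ℝ 1 fun x => h' (t, x) :=
    (hs.comp (contDiff_prodMk_right t)).of_le (by simp)
  refine ((hg.flow_ac_space hq t).comp_contDiff h1).congr_deriv
    (Filter.Eventually.of_forall fun η => ?_)
  have h2 : HasDerivAt (fun x => (t, x)) ((0 : ℝ), (1 : ℝ)) (q t η) :=
    (hasDerivAt_const _ t).prodMk (hasDerivAt_id _)
  have h3 := ((hs.differentiable (by simp) (t, q t η)).hasFDerivAt).comp_hasDerivAt _ h2
  have h4 : deriv (fun x => h' (t, x)) (q t η) = _ := h3.deriv
  rw [h4]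

/-- The chain rule predicts z_x = ζη/J and z_t = ζt - gζη/J. It is verified in weak form by moving
the integrals to Lagrangian coordinates, where ζ, q and J are absolutely continuous in each variable
separately and every term becomes an exact derivative in time or in the label. -/
theorem isSobolevTest (h : IsLagrangianTest s δ V ζ ζt ζη k M) (hg : IsTransportField V T D g)
    (hq : IsFlowOf g q) {z a b : ℝ × ℝ → ℝ}
    (hz : ∀ t η, z (t, q t η) = ζ t η)
    (ha : ∀ t η, a (t, q t η) = ζt t η - g t (q t η) * ζη t η / flowJac g q t η)
    (hb : ∀ t η, b (t, q t η) = ζη t η / flowJac g q t η) :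
    IsSobolevTest ((hg.flowHomeo hq) '' (Icc (-1) s ×ˢ Icc δ (V - δ))) z a b := by
  set Φ := hg.flowHomeo hq with hΦ
  have hJm := hg.measurable_flowJac hq
  have hgm : Measurable fun p : ℝ × ℝ => g p.1 (q p.1 p.2) :=
    Measurable.comp (g := fun p : ℝ × ℝ => g p.1 p.2) (f := fun p : ℝ × ℝ => (p.1, q p.1 p.2))
      hg.measurable (hg.measurable_flow hq)
  have hsurj : ∀ p, ∃ t η, p = (t, q t η) := fun p =>
    ⟨p.1, (hg.flow_surjective hq p.1 p.2).choose,
      Prod.ext rfl (hg.flow_surjective hq p.1 p.2).choose_spec.symm⟩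
  have hpull : ∀ {f : ℝ × ℝ → ℝ} {F : ℝ → ℝ → ℝ}, (∀ t η, f (t, q t η) = F t η) →
      f = (fun p : ℝ × ℝ => F p.1 p.2) ∘ Φ.symm := by
    intro f F hf
    funext p
    obtain ⟨t, η, rfl⟩ := hsurj p
    have : Φ.symm (t, q t η) = (t, η) := Φ.symm_apply_apply (t, η)
    simp only [Function.comp, this, hf]
  have hmem : ∀ t η, (t, q t η) ∉ Φ '' (Icc (-1) s ×ˢ Icc δ (V - δ)) →
      (t, η) ∉ Icc (-1) s ×ˢ Icc δ (V - δ) := fun t η hp hp' => hp ⟨(t, η), hp', rfl⟩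
  have hzc : Continuous z := by
    rw [hpull hz]
    exact h.continuous.comp Φ.symm.continuous
  have ham : Measurable a := by
    rw [hpull ha]
    exact (h.meas_t.sub ((hgm.mul h.meas_η).div hJm)).comp Φ.symm.continuous.measurable
  have hbm : Measurable b := by
    rw [hpull hb]
    exact (h.meas_η.div hJm).comp Φ.symm.continuous.measurable
  set Λ := Real.exp (∫ s, D s) with hΛ
  have hΛ0 : 0 < Λ := Real.exp_pos _
  have hJinv : ∀ t η, 1 / flowJac g q t η ≤ Λ := fun t η => by
    have h1 := hg.le_flowJac (q := q) t η
    rw [Real.exp_neg] at h1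
    rw [one_div, ← inv_inv Λ]
    exact inv_anti₀ (inv_pos.2 hΛ0) h1
  have hbb : ∀ p, |b p| ≤ M * Λ := fun p => by
    obtain ⟨t, η, rfl⟩ := hsurj p
    rw [hb, abs_div, abs_of_pos (IsTransportField.flowJac_pos g q t η), div_eq_mul_one_div]
    exact mul_le_mul (h.bdd_η t η) (hJinv t η)
      (one_div_nonneg.2 (IsTransportField.flowJac_pos g q t η).le) h.bound_nonneg
  have hab : ∀ t x, |a (t, x)| ≤ k t + D t * V * (M * Λ) := fun t x => by
    obtain ⟨η, rfl⟩ := hg.flow_surjective hq t x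
    rw [ha, mul_div_assoc, ← hb]
    refine (abs_sub _ _).trans (add_le_add (h.bdd_t t η) ?_)
    rw [abs_mul]
    exact mul_le_mul (hg.abs_le t _) (hbb _) (abs_nonneg _) (mul_nonneg (hg.nonneg t) hg.pos.le)
  have hout : ∀ t η, η ∉ Icc (0 : ℝ) V → (t, η) ∉ Icc (-1) s ×ˢ Icc δ (V - δ) := by
    intro t η hη hp
    exact hη ⟨h.pos.le.trans hp.2.1, by linarith [hp.2.2, h.pos]⟩
  have hK : IsCompact (Icc (-1) s ×ˢ Icc δ (V - δ)) := isCompact_Icc.prod isCompact_Icc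
  have zK : ∀ p ∉ Φ '' (Icc (-1) s ×ˢ Icc δ (V - δ)), z p = 0 := fun p hp => by
    obtain ⟨t, η, rfl⟩ := hsurj p
    rw [hz, h.zero _ _ (hmem t η hp)]
  have aK : ∀ p ∉ Φ '' (Icc (-1) s ×ˢ Icc δ (V - δ)), a p = 0 := fun p hp => by
    obtain ⟨t, η, rfl⟩ := hsurj p
    rw [ha, h.zero_t _ _ (hmem t η hp), h.zero_η _ _ (hmem t η hp)]; simp
  have bK : ∀ p ∉ Φ '' (Icc (-1) s ×ˢ Icc δ (V - δ)), b p = 0 := fun p hp => by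
    obtain ⟨t, η, rfl⟩ := hsurj p
    rw [hb, h.zero_η _ _ (hmem t η hp), zero_div]
  have haV : ∀ t x, x ∉ Icc 0 V → a (t, x) = 0 := fun t x hx => by
    obtain ⟨η, rfl⟩ := hg.flow_surjective hq t x
    have hη : η ∉ Icc 0 V := fun hη => hx ⟨by
      have := (hg.flow_strictMono hq t).monotone hη.1
      rwa [hg.flow_of_nonpos hq le_rfl] at this, by
      have := (hg.flow_strictMono hq t).monotone hη.2
      rwa [hg.flow_of_ge hq le_rfl] at this⟩
    rw [ha, h.zero_t _ _ (hout t η hη), h.zero_η _ _ (hout t η hη)]; simp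
  have ha2 : Integrable fun p => a p ^ 2 := by
    refine integrable_of_strip (V := V)
      (κ := fun t => 2 * k t ^ 2 + 2 * (V * (M * Λ)) ^ 2 * D t ^ 2)
      (ham.pow_const 2).aestronglyMeasurable
      ((h.sq_k.const_mul 2).add (hg.integrable_sq.const_mul _)) (fun t x => ?_) fun t x hx => ?_
    · rw [abs_pow]
      have h1 := pow_le_pow_left₀ (abs_nonneg _) (hab t x) 2
      nlinarith [sq_nonneg (k t - D t * V * (M * Λ))]
    · rw [haV t x hx]; simp
  have hai : Integrable a := integrable_of_sq_of_compact (hK.image Φ.continuous).measurableSet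
    (hK.image Φ.continuous).measure_lt_top ham.aestronglyMeasurable ha2 aK
  obtain ⟨Mz, hMz⟩ : ∃ B, ∀ p : ℝ × ℝ, ‖ζ p.1 p.2‖ ≤ B :=
    h.continuous.bounded_above_of_compact_support
      (HasCompactSupport.intro hK fun p hp => h.zero p.1 p.2 hp)
  have hMz0 : 0 ≤ Mz := (norm_nonneg _).trans (hMz 0)
  refine ⟨hzc, zK, aK, bK, ham.aestronglyMeasurable, ha2, hbm.aestronglyMeasurable,
    ⟨_, Filter.Eventually.of_forall hbb⟩, fun h' hs hc => ?_, fun h' hs hc => ?_⟩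
  · obtain ⟨Mh, hMh⟩ := hs.continuous.bounded_above_of_compact_support hc
    obtain ⟨Md, hMd⟩ := (hs.continuous_fderiv (by simp)).bounded_above_of_compact_support
      (hc.fderiv ℝ)
    have hMh0 : 0 ≤ Mh := (norm_nonneg _).trans (hMh 0)
    have hMd0 : 0 ≤ Md := (norm_nonneg _).trans (hMd 0)
    have hdt : Continuous fun p => fderiv ℝ h' p (1, 0) :=
      (hs.continuous_fderiv (by simp)).clm_apply continuous_const
    have hdx : Continuous fun p => fderiv ℝ h' p (0, 1) :=
      (hs.continuous_fderiv (by simp)).clm_apply continuous_const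
    have hMdx : ∀ p, |fderiv ℝ h' p (0, 1)| ≤ Md := fun p =>
      ((fderiv ℝ h' p).le_opNorm _).trans (by
        have : ‖((0 : ℝ), (1 : ℝ))‖ = 1 := by simp [Prod.norm_def]
        rw [this, mul_one]; exact hMd p)
    have hF : Integrable fun p => z p * fderiv ℝ h' p (1, 0) + a p * h' p := by
      refine Integrable.add ?_ (hai.mul_bdd hs.continuous.aestronglyMeasurable
        (Filter.Eventually.of_forall hMh))
      exact (hzc.mul hdt).integrable_of_hasCompactSupport
        ((HasCompactSupport.intro (hK.image Φ.continuous) zK).mul_right)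
    have hFJ := (hg.integrable_flow hq _).1 hF
    -- X₂ is the label derivative of ζ g(t,q) h'(t,q), so it integrates to zero on each time slice.
    set X₂ : ℝ × ℝ → ℝ := fun p => (ζη p.1 p.2 * g p.1 (q p.1 p.2)
      + ζ p.1 p.2 * (fieldDiv g p.1 (q p.1 p.2) * flowJac g q p.1 p.2)) * h' (p.1, q p.1 p.2)
      + ζ p.1 p.2 * g p.1 (q p.1 p.2) *
        (fderiv ℝ h' (p.1, q p.1 p.2) (0, 1) * flowJac g q p.1 p.2) with hX₂
    have hX₂i : Integrable X₂ := by
      have hhm : Measurable fun p : ℝ × ℝ => h' (p.1, q p.1 p.2) :=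
        hs.continuous.measurable.comp (hg.measurable_flow hq)
      have hhxm : Measurable fun p : ℝ × ℝ => fderiv ℝ h' (p.1, q p.1 p.2) (0, 1) :=
        Measurable.comp (g := fun p => fderiv ℝ h' p (0, 1))
          (f := fun p : ℝ × ℝ => (p.1, q p.1 p.2)) hdx.measurable (hg.measurable_flow hq)
      have hGm : Measurable fun p : ℝ × ℝ => fieldDiv g p.1 (q p.1 p.2) :=
        Measurable.comp (g := fun p : ℝ × ℝ => fieldDiv g p.1 p.2)
          (f := fun p : ℝ × ℝ => (p.1, q p.1 p.2)) hg.measurable_fieldDiv (hg.measurable_flow hq)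
      have hζm : Measurable fun p : ℝ × ℝ => ζ p.1 p.2 := h.continuous.measurable
      refine integrable_of_strip (V := V)
        (κ := fun t => ((M * V + Mz * Λ) * Mh + Mz * V * (Md * Λ)) * D t)
        ((((h.meas_η.mul hgm).add (hζm.mul (hGm.mul hJm))).mul hhm).add
          ((hζm.mul hgm).mul (hhxm.mul hJm))).aestronglyMeasurable (hg.integrable.const_mul _)
        (fun t η => ?_) fun t η hη => ?_
      · have hD := hg.nonneg t
        have hV := hg.pos.le
        have b1 : |ζη t η * g t (q t η)| ≤ M * (D t * V) := by
          rw [abs_mul]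
          exact mul_le_mul (h.bdd_η t η) (hg.abs_le t _) (abs_nonneg _) h.bound_nonneg
        have hJ : |flowJac g q t η| ≤ Λ := by
          rw [abs_of_pos (IsTransportField.flowJac_pos g q t η)]
          exact hg.flowJac_le t η
        have b2 : |ζ t η * (fieldDiv g t (q t η) * flowJac g q t η)| ≤ Mz * (D t * Λ) := by
          rw [abs_mul, abs_mul]
          exact mul_le_mul (hMz (t, η)) (mul_le_mul (hg.abs_fieldDiv_le t _) hJ (abs_nonneg _) hD)
            (by positivity) hMz0
        have b3 : |ζ t η * g t (q t η) * (fderiv ℝ h' (t, q t η) (0, 1) * flowJac g q t η)|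
            ≤ Mz * (D t * V) * (Md * Λ) := by
          rw [abs_mul, abs_mul, abs_mul]
          exact mul_le_mul (mul_le_mul (hMz (t, η)) (hg.abs_le t _) (abs_nonneg _) hMz0)
            (mul_le_mul (hMdx _) hJ (abs_nonneg _) hMd0) (by positivity) (by positivity)
        have b4 := (abs_add_le (ζη t η * g t (q t η))
          (ζ t η * (fieldDiv g t (q t η) * flowJac g q t η))).trans (add_le_add b1 b2)
        have b5 : |(ζη t η * g t (q t η) + ζ t η * (fieldDiv g t (q t η) * flowJac g q t η))
            * h' (t, q t η)| ≤ (M * (D t * V) + Mz * (D t * Λ)) * Mh := by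
          rw [abs_mul]
          refine mul_le_mul b4 (hMh _) (abs_nonneg _) ?_
          have := h.bound_nonneg
          positivity
        refine (abs_add_le _ _).trans ((add_le_add b5 b3).trans (le_of_eq ?_))
        ring
      · simp only [hX₂, h.zero_η _ _ (hout t η hη), h.zero _ _ (hout t η hη)]
        ring
    have hX₂0 : ∫ p, X₂ p = 0 := by
      refine integral_eq_zero_of_space hX₂i fun t => ?_
      have hφ := comp_flow_ac hg hq hs t
      refine ((((h.ac_η t).mul (field_flow_ac hg hq t)).mul hφ)).integral_eq_zero ?_
      exact HasCompactSupport.intro (isCompact_Icc (a := δ) (b := V - δ)) fun η hη => by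
        simp only [h.zero t η fun h' => hη h'.2]; ring
    have hX₁i := hFJ.add hX₂i
    -- With X₂ added, the pulled back integrand is the time derivative of ζ J h'(t,q), so it
    -- integrates to zero for each label; the growth JG of the Jacobian, with G = g_q, is the term
    -- supplied by X₂.
    have hX₁0 : ∫ p : ℝ × ℝ, (flowJac g q p.1 p.2 * (z (p.1, q p.1 p.2)
        * fderiv ℝ h' (p.1, q p.1 p.2) (1, 0) + a (p.1, q p.1 p.2) * h' (p.1, q p.1 p.2))
          + X₂ p) = 0 := by
      refine integral_eq_zero_of_time hX₁i fun η => ?_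
      have hφ := (hg.flow_ac hq η).comp_prod (hs.of_le (by simp)) hc
      have h1 := ((h.ac_t η).mul (hg.flowJac_ac hq η)).mul hφ
      refine Eq.trans (integral_congr_ae (Filter.Eventually.of_forall fun t => ?_))
        (h1.integral_eq_zero (HasCompactSupport.intro (isCompact_Icc (a := -1) (b := s))
          fun t ht => by simp only [h.zero t η fun h' => ht h'.1]; ring))
      have hJ0 := (IsTransportField.flowJac_pos g q t η).ne'
      have hsplit : fderiv ℝ h' (t, q t η) (1, g t (q t η)) = fderiv ℝ h' (t, q t η) (1, 0)
          + g t (q t η) * fderiv ℝ h' (t, q t η) (0, 1) := by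
        rw [← smul_eq_mul (g t (q t η)), ← map_smul, ← map_add]
        simp
      simp only [hz, ha, hX₂, hsplit]
      field_simp
      ring
    have hsum := integral_add hFJ hX₂i
    rw [hX₁0, hX₂0, add_zero, ← hg.integral_flow hq
      (fun p => z p * fderiv ℝ h' p (1, 0) + a p * h' p), integral_add] at hsum
    · linarith
    · exact (hzc.mul hdt).integrable_of_hasCompactSupport
        ((HasCompactSupport.intro (hK.image Φ.continuous) zK).mul_right)
    · exact hai.mul_bdd hs.continuous.aestronglyMeasurable (Filter.Eventually.of_forall hMh)
  · have hdx : Continuous fun p => fderiv ℝ h' p (0, 1) :=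
      (hs.continuous_fderiv (by simp)).clm_apply continuous_const
    have i1 : Integrable fun p => z p * fderiv ℝ h' p (0, 1) :=
      (hzc.mul hdx).integrable_of_hasCompactSupport
        ((HasCompactSupport.intro (hK.image Φ.continuous) zK).mul_right)
    have i2 : Integrable fun p => b p * h' p :=
      (hs.continuous.integrable_of_hasCompactSupport hc).bdd_mul hbm.aestronglyMeasurable
        (Filter.Eventually.of_forall hbb)
    have hFJ := (hg.integrable_flow hq _).1 (i1.add i2)
    -- Here the Jacobian cancels the denominator of b, and the integrand is the label derivative of
    -- ζ h'(t,q).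
    have h0 := integral_eq_zero_of_space hFJ fun t => by
      have hφ := comp_flow_ac hg hq hs t
      refine Eq.trans (integral_congr_ae (Filter.Eventually.of_forall fun η => ?_))
        (((h.ac_η t).mul hφ).integral_eq_zero (HasCompactSupport.intro
          (isCompact_Icc (a := δ) (b := V - δ)) fun η hη => by
            simp only [h.zero t η fun h' => hη h'.2]; ring))
      have hJ0 := (IsTransportField.flowJac_pos g q t η).ne'
      simp only [Pi.add_apply, hz, hb]
      field_simp
      ring
    rw [← hg.integral_flow hq] at h0
    have hsum := integral_add i1 i2
    simp only [Pi.add_apply] at h0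
    rw [h0] at hsum
    linarith

end IsLagrangianTest

/-- A weak identity, tested in the Lagrangian coordinates of the flow `q`. -/
theorem IsWeakIdentity.lagrangian {s δ V T M : ℝ} {ζ ζt ζη : ℝ → ℝ → ℝ} {k D : ℝ → ℝ}
    {g q : ℝ → ℝ → ℝ} {A B C : ℝ × ℝ → ℝ} {c₀ : ℝ → ℝ} (hW : IsWeakIdentity T V A B C c₀)
    (hc : HasLocalCoeffs T V A B C c₀) (hg : IsTransportField V T D g) (hq : IsFlowOf g q)
    (h : IsLagrangianTest s δ V ζ ζt ζη k M) (hs : s < T) :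
    (Integrable fun p : ℝ × ℝ => A (p.1, q p.1 p.2) * (flowJac g q p.1 p.2 * ζt p.1 p.2)
        + (B (p.1, q p.1 p.2) - g p.1 (q p.1 p.2) * A (p.1, q p.1 p.2)) * ζη p.1 p.2
        + C (p.1, q p.1 p.2) * (flowJac g q p.1 p.2 * ζ p.1 p.2)) ∧
    (∫ p : ℝ × ℝ, (A (p.1, q p.1 p.2) * (flowJac g q p.1 p.2 * ζt p.1 p.2)
        + (B (p.1, q p.1 p.2) - g p.1 (q p.1 p.2) * A (p.1, q p.1 p.2)) * ζη p.1 p.2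
        + C (p.1, q p.1 p.2) * (flowJac g q p.1 p.2 * ζ p.1 p.2)))
      + ∫ x, c₀ x * ζ 0 x = 0 := by
  set Φ := hg.flowHomeo hq with hΦ
  have hsymm : ∀ t η, Φ.symm (t, q t η) = (t, η) := fun t η => Φ.symm_apply_apply (t, η)
  have hK : IsCompact (Φ '' (Icc (-1) s ×ˢ Icc δ (V - δ))) :=
    (isCompact_Icc.prod isCompact_Icc).image Φ.continuous
  have hKO : Φ '' (Icc (-1) s ×ˢ Icc δ (V - δ)) ⊆ Iio T ×ˢ Ioo 0 V := by
    rintro _ ⟨⟨t, η⟩, hp, rfl⟩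
    have hδ := h.pos
    exact ⟨hp.1.2.trans_lt hs, hg.flow_pos hq (hδ.trans_le hp.2.1) t,
      hg.flow_lt hq (by linarith [hp.2.2]) t⟩
  have hS := h.isSobolevTest hg hq (z := fun p => ζ (Φ.symm p).1 (Φ.symm p).2)
    (a := fun p => ζt (Φ.symm p).1 (Φ.symm p).2
      - g p.1 p.2 * ζη (Φ.symm p).1 (Φ.symm p).2 / flowJac g q (Φ.symm p).1 (Φ.symm p).2)
    (b := fun p => ζη (Φ.symm p).1 (Φ.symm p).2 / flowJac g q (Φ.symm p).1 (Φ.symm p).2)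
    (fun t η => by simp only [hsymm]) (fun t η => by simp only [hsymm])
    (fun t η => by simp only [hsymm])
  have H := hW.sobolevTest hc hK hKO hS
  obtain ⟨iA, iB, iC⟩ := hc.integrable_mul hK hKO hS
  have hsum := integral_add (iA.add iB) iC
  have hsum' := integral_add iA iB
  have hI := (iA.add iB).add iC
  simp only [Pi.add_apply] at hsum
  rw [← hsum', ← hsum, hg.integral_flow hq] at H
  have hIJ := (hg.integrable_flow hq _).1 hI
  have hζ0 : ∀ x, (Φ.symm ((0 : ℝ), x)) = (0, x) := fun x => by
    have := hsymm 0 x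
    rwa [IsTransportField.flow_zero hq] at this
  -- The flux appears only as B - gA: transport by g disappears in Lagrangian coordinates.
  have e : ∀ p : ℝ × ℝ, flowJac g q p.1 p.2 * (A (p.1, q p.1 p.2) *
      (ζt p.1 p.2 - g p.1 (q p.1 p.2) * ζη p.1 p.2 / flowJac g q p.1 p.2)
      + B (p.1, q p.1 p.2) * (ζη p.1 p.2 / flowJac g q p.1 p.2)
      + C (p.1, q p.1 p.2) * ζ p.1 p.2)
      = A (p.1, q p.1 p.2) * (flowJac g q p.1 p.2 * ζt p.1 p.2)
        + (B (p.1, q p.1 p.2) - g p.1 (q p.1 p.2) * A (p.1, q p.1 p.2)) * ζη p.1 p.2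
        + C (p.1, q p.1 p.2) * (flowJac g q p.1 p.2 * ζ p.1 p.2) := fun p => by
    have hJ0 := (IsTransportField.flowJac_pos g q p.1 p.2).ne'
    field_simp
    ring
  simp only [Pi.add_apply, hsymm, hζ0, e] at H hIJ
  exact ⟨hIJ, H⟩

/-! ### Solutions in one space dimension -/

/-- A solution `(ρ, g)` of the radial problem, written in the volume coordinate: `ρ` is the density,
`g` the volume flux and `c₁ x ^ (-θ)` is the coefficient of the kinetic energy. -/
structure IsVolumeSolution (V T a γ ν c₁ θ : ℝ) (D : ℝ → ℝ) (g ρ : ℝ → ℝ → ℝ) (ρ₀ c₀ : ℝ → ℝ) :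
    Prop where
  field : IsTransportField V T D g
  meas : Measurable fun p : ℝ × ℝ => ρ p.1 p.2
  nonneg : ∀ t x, 0 ≤ ρ t x
  bdd : ∃ B, ∀ t x, ρ t x ≤ B
  zero_time : ∀ t x, t ∉ Ioo 0 T → ρ t x = 0
  continuity : IsWeakIdentity T V (fun p => ρ p.1 p.2) (fun p => ρ p.1 p.2 * g p.1 p.2)
    (fun _ => 0) ρ₀
  momentum : IsWeakIdentity T V (fun p => ρ p.1 p.2 * (c₁ * p.2 ^ (-θ)) * g p.1 p.2)
    (fun p => ρ p.1 p.2 * (c₁ * p.2 ^ (-θ)) * g p.1 p.2 ^ 2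
      + (a * ρ p.1 p.2 ^ γ - ν * fieldDiv g p.1 p.2))
    (fun p => ρ p.1 p.2 * (-(c₁ * θ / 2) * p.2 ^ (-θ - 1)) * g p.1 p.2 ^ 2) c₀

/-- Initial data in the volume coordinate. -/
structure IsVolumeData (V : ℝ) (ρ₀ c₀ : ℝ → ℝ) : Prop where
  meas : Measurable ρ₀
  nonneg : ∀ x, 0 ≤ ρ₀ x
  bdd : ∃ B, ∀ x, ρ₀ x ≤ B
  locInt : ∀ K : Set ℝ, IsCompact K → K ⊆ Ioo 0 V → IntegrableOn c₀ K

theorem exists_subset_Icc_of_isCompact {V : ℝ} {K : Set ℝ} (hK : IsCompact K)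
    (h : K ⊆ Ioo 0 V) : ∃ δ > 0, K ⊆ Icc δ (V - δ) := by
  rcases K.eq_empty_or_nonempty with rfl | hne
  · exact ⟨1, one_pos, empty_subset _⟩
  obtain ⟨x, hx, hxm⟩ := hK.exists_isLeast hne
  obtain ⟨y, hy, hym⟩ := hK.exists_isGreatest hne
  refine ⟨min x (V - y), lt_min (h hx).1 (by linarith [(h hy).2]), fun z hz => ⟨?_, ?_⟩⟩
  · exact (min_le_left _ _).trans (hxm hz)
  · have := min_le_right x (V - y)
    linarith [hym hz]

theorem integrableOn_of_bound_time {K : Set (ℝ × ℝ)} (hK : IsCompact K) {f : ℝ × ℝ → ℝ}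
    {κ : ℝ → ℝ} {V : ℝ} (hKV : ∀ p ∈ K, p.2 ∈ Icc 0 V) (hf : Measurable f)
    (hκ : Integrable κ) (hκ0 : ∀ t, 0 ≤ κ t)
    (hb : ∀ p ∈ K, |f p| ≤ κ p.1) : IntegrableOn f K := by
  have hKm := hK.isClosed.measurableSet
  rw [← integrable_indicator_iff hKm]
  refine integrable_of_strip (V := V) (hf.indicator hKm).aestronglyMeasurable hκ
    (fun t x => ?_) fun t x hx => ?_
  · by_cases hp : (t, x) ∈ K
    · rw [indicator_of_mem hp]; exact hb _ hp
    · rw [indicator_of_notMem hp, abs_zero]; exact hκ0 t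
  · exact indicator_of_notMem (fun hp => hx (hKV _ hp)) _

theorem integrableOn_of_bound_time_const {K : Set (ℝ × ℝ)} (hK : IsCompact K) {f : ℝ × ℝ → ℝ}
    {κ : ℝ → ℝ} {V M : ℝ} (hKV : ∀ p ∈ K, p.2 ∈ Icc 0 V) (hf : Measurable f)
    (hκ : Integrable κ) (hκ0 : ∀ t, 0 ≤ κ t) (hM : 0 ≤ M)
    (hb : ∀ p ∈ K, |f p| ≤ M + κ p.1) : IntegrableOn f K := by
  obtain ⟨r, hr⟩ := (hK.image continuous_fst).isBounded.subset_closedBall 0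
  have h1 : Integrable ((Metric.closedBall (0 : ℝ) r).indicator fun _ => M) :=
    (integrable_indicator_iff measurableSet_closedBall).2
      (integrableOn_const measure_closedBall_lt_top.ne)
  refine integrableOn_of_bound_time hK hKV hf (h1.add hκ) (fun t => ?_) fun p hp => ?_
  · exact add_nonneg (indicator_nonneg (fun _ _ => hM) t) (hκ0 t)
  · simp only [Pi.add_apply]
    rw [indicator_of_mem (hr ⟨p, hp, rfl⟩)]
    exact hb p hp

namespace IsVolumeSolution

variable {V T a γ ν c₁ θ : ℝ} {D : ℝ → ℝ} {g ρ q : ℝ → ℝ → ℝ} {ρ₀ c₀ : ℝ → ℝ}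

theorem hasLocalCoeffs_continuity (h : IsVolumeSolution V T a γ ν c₁ θ D g ρ ρ₀ c₀)
    (h₀ : IsVolumeData V ρ₀ c₀) :
    HasLocalCoeffs T V (fun p => ρ p.1 p.2) (fun p => ρ p.1 p.2 * g p.1 p.2)
      (fun _ => 0) ρ₀ := by
  obtain ⟨B, hB⟩ := h.bdd
  have hB0 : 0 ≤ B := (h.nonneg 0 0).trans (hB 0 0)
  refine ⟨h.meas.aestronglyMeasurable, fun K hK hKO => ?_, fun K hK hKO => ?_,
    fun K hK hKO => integrableOn_zero, fun K hK hKO => ?_⟩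
  · refine IntegrableOn.of_bound hK.measure_lt_top (h.meas.pow_const 2).aestronglyMeasurable
      (B ^ 2) (Filter.Eventually.of_forall fun p => ?_)
    rw [norm_pow, Real.norm_of_nonneg (h.nonneg _ _)]
    exact pow_le_pow_left₀ (h.nonneg _ _) (hB _ _) 2
  · refine integrableOn_of_bound_time hK (V := V) (fun p hp => Ioo_subset_Icc_self (hKO hp).2)
      (h.meas.mul h.field.measurable) (h.field.integrable.const_mul (B * V))
      (fun t => mul_nonneg (mul_nonneg hB0 h.field.pos.le) (h.field.nonneg t)) fun p _ => ?_
    rw [abs_mul, abs_of_nonneg (h.nonneg _ _)]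
    refine (mul_le_mul (hB _ _) (h.field.abs_le p.1 p.2) (abs_nonneg _) hB0).trans (le_of_eq ?_)
    ring
  · obtain ⟨B₀, hB₀⟩ := h₀.bdd
    refine IntegrableOn.of_bound hK.measure_lt_top h₀.meas.aestronglyMeasurable B₀
      (Filter.Eventually.of_forall fun x => ?_)
    rw [Real.norm_of_nonneg (h₀.nonneg x)]
    exact hB₀ x

/-- Compact subsets stay at a distance δ from the center, where the negative powers of the volume
coordinate are bounded; the factors g and g_q are controlled by D, and the products by D². -/
theorem hasLocalCoeffs_momentum (h : IsVolumeSolution V T a γ ν c₁ θ D g ρ ρ₀ c₀)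
    (h₀ : IsVolumeData V ρ₀ c₀) (ha : 0 < a) (hγ : 0 < γ) (hc₁ : 0 < c₁) (hθ : 0 < θ) :
    HasLocalCoeffs T V (fun p => ρ p.1 p.2 * (c₁ * p.2 ^ (-θ)) * g p.1 p.2)
    (fun p => ρ p.1 p.2 * (c₁ * p.2 ^ (-θ)) * g p.1 p.2 ^ 2
      + (a * ρ p.1 p.2 ^ γ - ν * fieldDiv g p.1 p.2))
    (fun p => ρ p.1 p.2 * (-(c₁ * θ / 2) * p.2 ^ (-θ - 1)) * g p.1 p.2 ^ 2) c₀ := by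
  obtain ⟨B, hB⟩ := h.bdd
  have hB0 : 0 ≤ B := (h.nonneg 0 0).trans (hB 0 0)
  have hgm : Measurable fun p : ℝ × ℝ => g p.1 p.2 := h.field.measurable
  have hρm := h.meas
  have hGm := h.field.measurable_fieldDiv
  have hpow : ∀ r : ℝ, Measurable fun p : ℝ × ℝ => p.2 ^ r := fun r =>
    measurable_snd.pow_const r
  have hV := h.field.pos.le
  have hKδ : ∀ K : Set (ℝ × ℝ), IsCompact K → K ⊆ Iio T ×ˢ Ioo 0 V →
      ∃ δ > 0, ∀ p ∈ K, δ ≤ p.2 ∧ p.2 ≤ V := fun K hK hKO => by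
    obtain ⟨δ, hδ, hs⟩ := exists_subset_Icc_of_isCompact (hK.image continuous_snd)
      (V := V) (by rintro _ ⟨p, hp, rfl⟩; exact (hKO hp).2)
    exact ⟨δ, hδ, fun p hp => ⟨(hs ⟨p, hp, rfl⟩).1, by linarith [(hs ⟨p, hp, rfl⟩).2]⟩⟩
  have hpb : ∀ {r δ x : ℝ}, r ≤ 0 → 0 < δ → δ ≤ x → |x ^ r| ≤ δ ^ r := fun hr hδ hx => by
    rw [abs_of_nonneg (Real.rpow_nonneg (hδ.le.trans hx) _)]
    exact Real.rpow_le_rpow_of_nonpos hδ hx hr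
  have hg2 : ∀ p : ℝ × ℝ, |g p.1 p.2 ^ 2| ≤ V ^ 2 * D p.1 ^ 2 := fun p => by
    rw [abs_pow, ← mul_pow, mul_comm V]
    exact pow_le_pow_left₀ (abs_nonneg _) (h.field.abs_le p.1 p.2) 2
  have hκ : ∀ {δ : ℝ} {p : ℝ × ℝ}, 0 < δ → δ ≤ p.2 →
      |ρ p.1 p.2 * (c₁ * p.2 ^ (-θ))| ≤ B * (c₁ * δ ^ (-θ)) := fun hδ hp => by
    rw [abs_mul, abs_mul, abs_of_nonneg (h.nonneg _ _), abs_of_pos hc₁]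
    exact mul_le_mul (hB _ _) (mul_le_mul_of_nonneg_left (hpb (by linarith) hδ hp) hc₁.le)
      (by positivity) hB0
  have hκ' : ∀ {δ : ℝ} {p : ℝ × ℝ}, 0 < δ → δ ≤ p.2 →
      |ρ p.1 p.2 * (-(c₁ * θ / 2) * p.2 ^ (-θ - 1))| ≤ B * (c₁ * θ / 2 * δ ^ (-θ - 1)) :=
    fun hδ hp => by
    rw [abs_mul, abs_mul, abs_of_nonneg (h.nonneg _ _), abs_neg, abs_of_pos (a := c₁ * θ / 2)
      (by positivity)]
    exact mul_le_mul (hB _ _) (mul_le_mul_of_nonneg_left (hpb (by linarith) hδ hp)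
      (by positivity)) (by positivity) hB0
  refine ⟨((hρm.mul ((hpow _).const_mul _)).mul hgm).aestronglyMeasurable, fun K hK hKO => ?_,
    fun K hK hKO => ?_, fun K hK hKO => ?_, h₀.locInt⟩
  · obtain ⟨δ, hδ, hKδ⟩ := hKδ K hK hKO
    refine integrableOn_of_bound_time hK (V := V) (fun p hp => Ioo_subset_Icc_self (hKO hp).2)
      (((hρm.mul ((hpow _).const_mul _)).mul hgm).pow_const 2)
      (h.field.integrable_sq.const_mul ((B * (c₁ * δ ^ (-θ))) ^ 2 * V ^ 2))
      (fun t => by positivity) fun p hp => ?_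
    rw [mul_pow, abs_mul, mul_assoc]
    refine mul_le_mul ?_ (hg2 p) (abs_nonneg _) (sq_nonneg _)
    rw [abs_pow]
    exact pow_le_pow_left₀ (abs_nonneg _) (hκ hδ (hKδ p hp).1) 2
  · obtain ⟨δ, hδ, hKδ⟩ := hKδ K hK hKO
    refine integrableOn_of_bound_time_const hK (V := V) (M := a * B ^ γ)
      (fun p hp => Ioo_subset_Icc_self (hKO hp).2)
      (((hρm.mul ((hpow _).const_mul _)).mul (hgm.pow_const 2)).add
        (((hρm.pow_const γ).const_mul a).sub (hGm.const_mul ν)))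
      ((h.field.integrable_sq.const_mul (B * (c₁ * δ ^ (-θ)) * V ^ 2)).add
        (h.field.integrable.const_mul |ν|))
      (fun t => ?_) (by positivity) fun p hp => ?_
    · have := h.field.nonneg t
      simp only [Pi.add_apply]
      positivity
    · have b1 : |ρ p.1 p.2 * (c₁ * p.2 ^ (-θ)) * g p.1 p.2 ^ 2|
          ≤ B * (c₁ * δ ^ (-θ)) * V ^ 2 * D p.1 ^ 2 := by
        rw [abs_mul, mul_assoc _ (V ^ 2)]
        exact mul_le_mul (hκ hδ (hKδ p hp).1) (hg2 p) (abs_nonneg _) (by positivity)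
      have b2 : |a * ρ p.1 p.2 ^ γ| ≤ a * B ^ γ := by
        rw [abs_mul, abs_of_pos ha, abs_of_nonneg (Real.rpow_nonneg (h.nonneg _ _) _)]
        exact mul_le_mul_of_nonneg_left (Real.rpow_le_rpow (h.nonneg _ _) (hB _ _) hγ.le) ha.le
      have b3 : |ν * fieldDiv g p.1 p.2| ≤ |ν| * D p.1 := by
        rw [abs_mul]
        exact mul_le_mul_of_nonneg_left (h.field.abs_fieldDiv_le _ _) (abs_nonneg _)
      have b4 := (abs_sub (a * ρ p.1 p.2 ^ γ) (ν * fieldDiv g p.1 p.2)).trans (add_le_add b2 b3)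
      refine (abs_add_le _ _).trans ((add_le_add b1 b4).trans (le_of_eq ?_))
      simp only [Pi.add_apply]
      ring
  · obtain ⟨δ, hδ, hKδ⟩ := hKδ K hK hKO
    refine integrableOn_of_bound_time hK (V := V) (fun p hp => Ioo_subset_Icc_self (hKO hp).2)
      ((hρm.mul ((hpow _).const_mul _)).mul (hgm.pow_const 2))
      (h.field.integrable_sq.const_mul (B * (c₁ * θ / 2 * δ ^ (-θ - 1)) * V ^ 2))
      (fun t => by positivity) fun p hp => ?_
    rw [abs_mul, mul_assoc _ (V ^ 2)]
    exact mul_le_mul (hκ' hδ (hKδ p hp).1) (hg2 p) (abs_nonneg _) (by positivity)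

end IsVolumeSolution

/-! ### Lagrangian test functions vanishing at a final time -/

/-- The piecewise linear function which is `0` before `-1` and `1` after `0`. -/
noncomputable def timeRamp (t : ℝ) : ℝ := max 0 (min 1 (t + 1))

theorem timeRamp_of_nonneg {t : ℝ} (h : 0 ≤ t) : timeRamp t = 1 := by
  unfold timeRamp
  rw [min_eq_left (by linarith), max_eq_right zero_le_one]

theorem timeRamp_of_le {t : ℝ} (h : t ≤ -1) : timeRamp t = 0 := by
  unfold timeRamp
  rw [max_eq_left ((min_le_right _ _).trans (by linarith))]

theorem abs_timeRamp_le (t : ℝ) : |timeRamp t| ≤ 1 := by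
  unfold timeRamp
  rw [abs_of_nonneg (le_max_left _ _)]
  exact max_le zero_le_one (min_le_left _ _)

theorem timeRamp_ac :
    IsACWithDeriv timeRamp ((Ioo (-1 : ℝ) 0).indicator fun _ => 1) := by
  have hl : LipschitzWith 1 timeRamp :=
    ((LipschitzWith.id.add (LipschitzWith.const (1 : ℝ))).const_min 1).const_max 0 |>.weaken
      (by simp)
  refine ⟨fun a b => hl.lipschitzOnWith.absolutelyContinuousOnInterval, ?_⟩
  have h1 : ∀ᵐ t : ℝ, t ≠ -1 := Measure.ae_ne volume (-1)
  have h2 : ∀ᵐ t : ℝ, t ≠ 0 := Measure.ae_ne volume 0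
  filter_upwards [h1, h2] with t ht1 ht2
  rcases lt_or_gt_of_ne ht1 with h | h
  · rw [indicator_of_notMem (by simp; intro h'; linarith)]
    refine (hasDerivAt_const t (0 : ℝ)).congr_of_eventuallyEq ?_
    filter_upwards [Iio_mem_nhds h] with x hx
    exact timeRamp_of_le (le_of_lt hx)
  · rcases lt_or_gt_of_ne ht2 with h' | h'
    · rw [indicator_of_mem (show t ∈ Ioo (-1 : ℝ) 0 from ⟨h, h'⟩)]
      refine ((hasDerivAt_id t).add_const 1).congr_of_eventuallyEq ?_
      filter_upwards [Ioo_mem_nhds h h'] with x hx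
      unfold timeRamp
      rw [min_eq_right (by linarith [hx.2]), max_eq_right (by linarith [hx.1])]
      rfl
    · rw [indicator_of_notMem (by simp; intro _; linarith)]
      refine (hasDerivAt_const t (1 : ℝ)).congr_of_eventuallyEq ?_
      filter_upwards [Ioi_mem_nhds h'] with x hx
      exact timeRamp_of_nonneg (le_of_lt hx)

/-- A function `Z` with `Z(0, ·) = 0`, constant in time after the time `s` and supported in
`[δ, V - δ]`, with time derivative `f` and space derivative `Zη`. -/
structure IsPrimitiveTest (s δ V : ℝ) (Z f Zη : ℝ → ℝ → ℝ) (k : ℝ → ℝ) (K M : ℝ) : Prop where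
  pos : 0 < δ
  nonneg : 0 ≤ s
  meas_f : Measurable fun p : ℝ × ℝ => f p.1 p.2
  meas_η : Measurable fun p : ℝ × ℝ => Zη p.1 p.2
  ac_t : ∀ η, IsACWithDeriv (fun t => Z t η) fun t => f t η
  ac_η : ∀ t, IsACWithDeriv (Z t) (Zη t)
  meas_k : Measurable k
  sq_k : Integrable fun t => k t ^ 2
  bdd_f : ∀ t η, |f t η| ≤ k t
  bdd : ∀ η, |Z s η| ≤ K
  bdd_η : ∀ t η, |Zη t η| ≤ M
  zero_t : ∀ t η, t ≤ 0 → Z t η = 0 ∧ Zη t η = 0 ∧ f t η = 0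
  const_t : ∀ t η, s ≤ t → Z t η = Z s η ∧ Zη t η = Zη s η ∧ f t η = 0
  zero_η : ∀ t η, η ∉ Icc δ (V - δ) → Z t η = 0 ∧ Zη t η = 0 ∧ f t η = 0

/-- Subtracting Z from its final value makes the test function vanish from the time s on without
altering its time derivative up to sign. The ramp lives at negative times and only serves to make
the support compact. -/
theorem IsPrimitiveTest.isLagrangianTest {s δ V K M : ℝ} {Z f Zη : ℝ → ℝ → ℝ} {k : ℝ → ℝ}
    (h : IsPrimitiveTest s δ V Z f Zη k K M) :
    IsLagrangianTest s δ V (fun t η => timeRamp t * Z s η - Z t η)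
      (fun t η => (Ioo (-1 : ℝ) 0).indicator (fun _ => 1) t * Z s η - f t η)
      (fun t η => timeRamp t * Zη s η - Zη t η)
      (fun t => (Ioo (-1 : ℝ) 0).indicator (fun _ => K) t + k t) (2 * M) := by
  have hs := h.nonneg
  have hrm : Measurable timeRamp := timeRamp_ac.continuous.measurable
  have hZs : Measurable fun p : ℝ × ℝ => Z s p.2 := (h.ac_η s).continuous.measurable.comp
    measurable_snd
  have hi : Measurable ((Ioo (-1 : ℝ) 0).indicator fun _ => (1 : ℝ)) :=
    measurable_const.indicator measurableSet_Ioo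
  have hK : 0 ≤ K := (abs_nonneg _).trans (h.bdd 0)
  have key : ∀ t η, (t, η) ∉ Icc (-1) s ×ˢ Icc δ (V - δ) →
      (timeRamp t * Z s η - Z t η = 0) ∧
      ((Ioo (-1 : ℝ) 0).indicator (fun _ => 1) t * Z s η - f t η = 0) ∧
      (timeRamp t * Zη s η - Zη t η = 0) := by
    intro t η hp
    by_cases hη : η ∈ Icc δ (V - δ)
    · have ht : t ∉ Icc (-1) s := fun ht => hp ⟨ht, hη⟩
      rcases lt_or_ge t (-1) with h1 | h1
      · obtain ⟨e1, e2, e3⟩ := h.zero_t t η (by linarith)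
        rw [e1, e2, e3, timeRamp_of_le h1.le, indicator_of_notMem (fun hm => by
          linarith [hm.1])]
        simp
      · have h2 : s < t := lt_of_not_ge fun h2 => ht ⟨h1, h2⟩
        obtain ⟨e1, e2, e3⟩ := h.const_t t η h2.le
        rw [e1, e2, e3, timeRamp_of_nonneg (by linarith), indicator_of_notMem (fun hm => by
          linarith [hm.2])]
        simp
    · obtain ⟨e1, e2, e3⟩ := h.zero_η t η hη
      obtain ⟨d1, d2, d3⟩ := h.zero_η s η hη
      rw [e1, e2, e3, d1, d2]
      simp
  refine ⟨h.pos, ((hi.comp measurable_fst).mul hZs).sub h.meas_f, ?_, fun η => ?_, fun t => ?_,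
    (measurable_const.indicator measurableSet_Ioo).add h.meas_k, ?_, fun t η => ?_, fun t η => ?_,
    fun t η hp => (key t η hp).1, fun t η hp => (key t η hp).2.1, fun t η hp => (key t η hp).2.2⟩
  · exact ((hrm.comp measurable_fst).mul
      (h.meas_η.comp (measurable_const.prodMk measurable_snd))).sub h.meas_η
  · refine ((timeRamp_ac.mul (IsACWithDeriv.const (Z s η))).sub (h.ac_t η)).congr_deriv
      (Filter.Eventually.of_forall fun t => ?_)
    ring
  · refine (((IsACWithDeriv.const (timeRamp t)).mul (h.ac_η s)).sub (h.ac_η t)).congr_deriv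
      (Filter.Eventually.of_forall fun t => ?_)
    ring
  · have i1 : Integrable ((Ioo (-1 : ℝ) 0).indicator fun _ => K ^ 2) :=
      (integrable_indicator_iff measurableSet_Ioo).2 (integrableOn_const measure_Ioo_lt_top.ne)
    refine ((i1.const_mul 2).add (h.sq_k.const_mul 2)).mono'
      (((measurable_const.indicator measurableSet_Ioo).add h.meas_k).pow_const 2).aestronglyMeasurable
      (Filter.Eventually.of_forall fun t => ?_)
    rw [Real.norm_of_nonneg (sq_nonneg _)]
    simp only [Pi.add_apply]
    by_cases ht : t ∈ Ioo (-1 : ℝ) 0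
    · rw [indicator_of_mem ht, indicator_of_mem ht]
      nlinarith [sq_nonneg (K - k t)]
    · rw [indicator_of_notMem ht, indicator_of_notMem ht]
      nlinarith [sq_nonneg (k t)]
  · refine (abs_sub _ _).trans (add_le_add ?_ (h.bdd_f t η))
    by_cases ht : t ∈ Ioo (-1 : ℝ) 0
    · rw [indicator_of_mem ht, indicator_of_mem ht, one_mul]
      exact h.bdd η
    · rw [indicator_of_notMem ht, indicator_of_notMem ht, zero_mul, abs_zero]
  · refine (abs_sub _ _).trans ?_
    rw [two_mul]
    refine add_le_add ?_ (h.bdd_η t η)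
    rw [abs_mul]
    refine (mul_le_mul (abs_timeRamp_le t) (h.bdd_η s η) (abs_nonneg _) zero_le_one).trans ?_
    rw [one_mul]

/-- A weak identity with coefficients vanishing for negative times, tested with the difference of
the final value of `Z` and `Z` in Lagrangian coordinates. -/
theorem IsWeakIdentity.lagrangian_primitive {s δ V T K M : ℝ} {Z f Zη : ℝ → ℝ → ℝ} {k D : ℝ → ℝ}
    {g q : ℝ → ℝ → ℝ} {A B C : ℝ × ℝ → ℝ} {c₀ : ℝ → ℝ} (hW : IsWeakIdentity T V A B C c₀)
    (hc : HasLocalCoeffs T V A B C c₀) (hg : IsTransportField V T D g) (hq : IsFlowOf g q)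
    (h : IsPrimitiveTest s δ V Z f Zη k K M) (hs : s < T)
    (h0 : ∀ t x, t ≤ 0 → A (t, x) = 0 ∧ B (t, x) = 0 ∧ C (t, x) = 0) :
    (Integrable fun p : ℝ × ℝ => -(A (p.1, q p.1 p.2) * flowJac g q p.1 p.2 * f p.1 p.2)
        + (B (p.1, q p.1 p.2) - g p.1 (q p.1 p.2) * A (p.1, q p.1 p.2))
          * (Zη s p.2 - Zη p.1 p.2)
        + C (p.1, q p.1 p.2) * flowJac g q p.1 p.2 * (Z s p.2 - Z p.1 p.2)) ∧
    (∫ p : ℝ × ℝ, (-(A (p.1, q p.1 p.2) * flowJac g q p.1 p.2 * f p.1 p.2)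
        + (B (p.1, q p.1 p.2) - g p.1 (q p.1 p.2) * A (p.1, q p.1 p.2))
          * (Zη s p.2 - Zη p.1 p.2)
        + C (p.1, q p.1 p.2) * flowJac g q p.1 p.2 * (Z s p.2 - Z p.1 p.2)))
      + ∫ x, c₀ x * Z s x = 0 := by
  have H := hW.lagrangian hc hg hq h.isLagrangianTest hs
  have e : ∀ p : ℝ × ℝ, A (p.1, q p.1 p.2) * (flowJac g q p.1 p.2 *
        ((Ioo (-1 : ℝ) 0).indicator (fun _ => 1) p.1 * Z s p.2 - f p.1 p.2))
        + (B (p.1, q p.1 p.2) - g p.1 (q p.1 p.2) * A (p.1, q p.1 p.2))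
          * (timeRamp p.1 * Zη s p.2 - Zη p.1 p.2)
        + C (p.1, q p.1 p.2) * (flowJac g q p.1 p.2 * (timeRamp p.1 * Z s p.2 - Z p.1 p.2))
      = -(A (p.1, q p.1 p.2) * flowJac g q p.1 p.2 * f p.1 p.2)
        + (B (p.1, q p.1 p.2) - g p.1 (q p.1 p.2) * A (p.1, q p.1 p.2))
          * (Zη s p.2 - Zη p.1 p.2)
        + C (p.1, q p.1 p.2) * flowJac g q p.1 p.2 * (Z s p.2 - Z p.1 p.2) := fun p => by
    -- For nonpositive times the coefficients vanish; for positive times the ramp is constantly 1.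
    -- Hence the ramp leaves no trace.
    rcases le_or_gt p.1 0 with hp | hp
    · obtain ⟨a1, a2, a3⟩ := h0 p.1 (q p.1 p.2) hp
      rw [a1, a2, a3]; ring
    · rw [timeRamp_of_nonneg hp.le, indicator_of_notMem (fun hm => by linarith [hm.2])]
      ring
  have e0 : ∀ x, c₀ x * (timeRamp 0 * Z s x - Z 0 x) = c₀ x * Z s x := fun x => by
    rw [timeRamp_of_nonneg le_rfl, (h.zero_t 0 x le_rfl).1]; ring
  simp only [e, e0] at H
  exact H

/-- The primitive in time of a smooth test function. -/
theorem isPrimitiveTest_of_contDiff {T V : ℝ} (hT : 0 < T) {ξ : ℝ × ℝ → ℝ} (hξ : ContDiff ℝ ∞ ξ)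
    (hc : HasCompactSupport ξ) (hs : tsupport ξ ⊆ Ioo 0 T ×ˢ Ioo 0 V) :
    ∃ s < T, ∃ δ k K M, IsPrimitiveTest s δ V (fun t η => ∫ τ in (0 : ℝ)..t, ξ (τ, η))
      (fun t η => ξ (t, η)) (fun t η => ∫ τ in (0 : ℝ)..t, fderiv ℝ ξ (τ, η) (0, 1)) k K M := by
  obtain ⟨δ, hδ, hsδ⟩ := exists_subset_Icc_of_isCompact (V := V) (hc.image continuous_snd)
    (by rintro _ ⟨p, hp, rfl⟩; exact (hs hp).2)
  obtain ⟨ε, hε, hsε⟩ := exists_subset_Icc_of_isCompact (V := T) (hc.image continuous_fst)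
    (by rintro _ ⟨p, hp, rfl⟩; exact (hs hp).1)
  -- The support of ξ ends by the time T - ε, so this time lies after the support and before T; the
  -- maximum covers an empty support, for which ε need not be smaller than T.
  set s := max 0 (T - ε / 2) with hsdef
  have hsT : s < T := max_lt hT (by linarith)
  set ξ' : ℝ × ℝ → ℝ := fun p => fderiv ℝ ξ p (0, 1) with hξ'
  have hξ'c : Continuous ξ' := (hξ.continuous_fderiv (by simp)).clm_apply continuous_const
  have hξ's : HasCompactSupport ξ' := hc.fderiv_apply ℝ (0, 1)
  have z1 : ∀ p ∉ tsupport ξ, ξ p = 0 ∧ ξ' p = 0 := fun p hp =>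
    ⟨image_eq_zero_of_notMem_tsupport hp, by
      simp only [hξ', fderiv_of_notMem_tsupport ℝ hp]; rfl⟩
  have zη : ∀ τ η, η ∉ Icc δ (V - δ) → ξ (τ, η) = 0 ∧ ξ' (τ, η) = 0 := fun τ η hη =>
    z1 _ fun hp => hη (hsδ ⟨_, hp, rfl⟩)
  have zτ : ∀ τ η, τ ∉ Icc ε (T - ε) → ξ (τ, η) = 0 ∧ ξ' (τ, η) = 0 := fun τ η hτ =>
    z1 _ fun hp => hτ (hsε ⟨_, hp, rfl⟩)
  obtain ⟨M₁, hM₁⟩ := hξ.continuous.bounded_above_of_compact_support hc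
  obtain ⟨M₂, hM₂⟩ := hξ'c.bounded_above_of_compact_support hξ's
  have hcol : ∀ (F : ℝ × ℝ → ℝ), Continuous F → ∀ η, Continuous fun τ => F (τ, η) :=
    fun F hF η => hF.comp (continuous_id.prodMk continuous_const)
  have hprim : ∀ (F : ℝ × ℝ → ℝ) (M : ℝ), Continuous F → (∀ p, ‖F p‖ ≤ M) →
      (∀ τ η, τ ∉ Icc ε (T - ε) → F (τ, η) = 0) →
      (∀ t η, t ≤ 0 → ∫ τ in (0 : ℝ)..t, F (τ, η) = 0) ∧
      (∀ t η, s ≤ t → ∫ τ in (0 : ℝ)..t, F (τ, η) = ∫ τ in (0 : ℝ)..s, F (τ, η)) ∧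
      (∀ t η, |∫ τ in (0 : ℝ)..t, F (τ, η)| ≤ M * T) := by
    intro F M hF hM hz
    have a1 : ∀ t η, t ≤ 0 → ∫ τ in (0 : ℝ)..t, F (τ, η) = 0 := fun t η ht => by
      rw [intervalIntegral.integral_congr (g := fun _ => 0) fun τ hτ => ?_]
      · simp
      · rw [uIcc_of_ge ht] at hτ
        exact hz τ η fun h' => by linarith [h'.1, hτ.2]
    have a2 : ∀ t η, s ≤ t → ∫ τ in (0 : ℝ)..t, F (τ, η) = ∫ τ in (0 : ℝ)..s, F (τ, η) := by
      intro t η ht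
      rw [← intervalIntegral.integral_add_adjacent_intervals
        ((hcol F hF η).intervalIntegrable 0 s) ((hcol F hF η).intervalIntegrable s t),
        add_eq_left]
      refine intervalIntegral.integral_zero_ae (Filter.Eventually.of_forall fun τ hτ => ?_)
      rw [uIoc_of_le ht] at hτ
      exact hz τ η fun h' => by linarith [h'.2, hτ.1, le_max_right 0 (T - ε / 2)]
    refine ⟨a1, a2, fun t η => ?_⟩
    have hM0 : 0 ≤ M := (norm_nonneg _).trans (hM 0)
    have a3 : ∀ t, 0 ≤ t → t ≤ T → |∫ τ in (0 : ℝ)..t, F (τ, η)| ≤ M * T := fun t h1 h2 => by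
      refine (intervalIntegral.norm_integral_le_of_norm_le_const (C := M)
        fun τ _ => hM (τ, η)).trans ?_
      rw [sub_zero, abs_of_nonneg h1]
      exact mul_le_mul_of_nonneg_left h2 hM0
    rcases le_or_gt t 0 with ht | ht
    · rw [a1 t η ht, abs_zero]; exact mul_nonneg hM0 hT.le
    · rcases le_or_gt t T with ht' | ht'
      · exact a3 t ht.le ht'
      · rw [a2 t η (hsT.trans ht').le]
        exact a3 s (le_max_left _ _) hsT.le
  obtain ⟨p1, p2, p3⟩ := hprim ξ M₁ hξ.continuous hM₁ fun τ η h => (zτ τ η h).1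
  obtain ⟨r1, r2, r3⟩ := hprim ξ' M₂ hξ'c hM₂ fun τ η h => (zτ τ η h).2
  have hεT : ∀ t, t ≤ 0 → t ∉ Icc ε (T - ε) := fun t ht h' => by linarith [h'.1]
  refine ⟨s, hsT, δ, (Icc (0 : ℝ) T).indicator fun _ => M₁, M₁ * T, M₂ * T, hδ, le_max_left _ _,
    hξ.continuous.measurable, ?_, fun η => ?_, fun t => ?_,
    measurable_const.indicator measurableSet_Icc, ?_, fun t η => ?_, p3 s, r3, fun t η ht => ?_,
    fun t η ht => ?_, fun t η hη => ?_⟩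
  · have : StronglyMeasurable fun p : ℝ × ℝ => ∫ τ in (0 : ℝ)..p.1, ξ' (τ, p.2) := by
      refine Continuous.stronglyMeasurable ?_
      exact intervalIntegral.continuous_parametric_intervalIntegral_of_continuous
        (f := fun (p : ℝ × ℝ) τ => ξ' (τ, p.2))
        (hξ'c.comp (continuous_snd.prodMk (continuous_snd.comp continuous_fst)))
        continuous_fst
    exact this.measurable
  · exact IsACWithDeriv.of_integral (c := 0) (a := 0) (hcol ξ hξ.continuous η).locallyIntegrable
      fun t => by rw [zero_add]
  · have hder : ∀ τ x, HasDerivAt (fun x => ξ (τ, x)) (ξ' (τ, x)) x := fun τ x => by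
      have h2 : HasDerivAt (fun x => (τ, x)) ((0 : ℝ), (1 : ℝ)) x :=
        (hasDerivAt_const _ τ).prodMk (hasDerivAt_id _)
      exact ((hξ.differentiable (by simp) (τ, x)).hasFDerivAt).comp_hasDerivAt _ h2
    have hcont : Continuous fun x => ∫ τ in (0 : ℝ)..t, ξ' (τ, x) :=
      intervalIntegral.continuous_parametric_intervalIntegral_of_continuous'
        (f := fun x τ => ξ' (τ, x)) (hξ'c.comp continuous_swap) 0 t
    refine IsACWithDeriv.of_integral (c := 0) (a := 0) hcont.locallyIntegrable fun x => ?_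
    -- Fubini and the fundamental theorem in the label; the boundary term at label 0 vanishes since
    -- the support starts at δ > 0.
    rw [zero_add, intervalIntegral_intervalIntegral_swap]
    · refine intervalIntegral.integral_congr fun τ _ => ?_
      rw [intervalIntegral.integral_eq_sub_of_hasDerivAt (fun x _ => hder τ x)
        ((hξ'c.comp (continuous_const.prodMk continuous_id)).intervalIntegrable 0 x),
        (zη τ 0 fun h' => by linarith [h'.1]).1, sub_zero]
    · exact ((hξ'c.comp continuous_swap).continuousOn.integrableOn_compact
        (isCompact_uIcc.prod isCompact_uIcc)).mono_set
          (prod_mono uIoc_subset_uIcc uIoc_subset_uIcc)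
  · have e : (fun t => (Icc (0 : ℝ) T).indicator (fun _ => M₁) t ^ 2)
        = (Icc (0 : ℝ) T).indicator fun _ => M₁ ^ 2 := by
      funext t
      by_cases ht : t ∈ Icc (0 : ℝ) T
      · rw [indicator_of_mem ht, indicator_of_mem ht]
      · rw [indicator_of_notMem ht, indicator_of_notMem ht]; ring
    rw [e]
    exact (integrable_indicator_iff measurableSet_Icc).2 (integrableOn_const measure_Icc_lt_top.ne)
  · by_cases ht : t ∈ Icc (0 : ℝ) T
    · rw [indicator_of_mem ht]; exact hM₁ _
    · rw [indicator_of_notMem ht, (zτ t η fun h' => ht ⟨by linarith [h'.1], by linarith [h'.2]⟩).1,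
        abs_zero]
  · exact ⟨p1 t η ht, r1 t η ht, (zτ t η (hεT t ht)).1⟩
  · exact ⟨p2 t η ht, r2 t η ht,
       (zτ t η fun hm => by linarith [hm.2, le_max_right 0 (T - ε / 2)]).1⟩
  · refine ⟨?_, ?_, (zη t η hη).1⟩
    · simp only [(zη _ η hη).1, intervalIntegral.integral_zero]
    · have : ∀ τ, fderiv ℝ ξ (τ, η) (0, 1) = 0 := fun τ => (zη τ η hη).2
      simp only [this, intervalIntegral.integral_zero]

/-! ### The equations in Lagrangian coordinates -/

namespace IsVolumeSolution

variable {V T a γ ν c₁ θ : ℝ} {D : ℝ → ℝ} {g ρ q : ℝ → ℝ → ℝ} {ρ₀ c₀ : ℝ → ℝ}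

/-- Conservation of mass in Lagrangian coordinates. -/
theorem density_flow (h : IsVolumeSolution V T a γ ν c₁ θ D g ρ ρ₀ c₀) (h₀ : IsVolumeData V ρ₀ c₀)
    (hT : 0 < T) (hq : IsFlowOf g q) :
    ∀ᵐ p : ℝ × ℝ, p ∈ Ioo 0 T ×ˢ Ioo 0 V →
      ρ p.1 (q p.1 p.2) * flowJac g q p.1 p.2 - ρ₀ p.2 = 0 := by
  obtain ⟨B, hB⟩ := h.bdd
  obtain ⟨B₀, hB₀⟩ := h₀.bdd
  have hg := h.field
  have hB0 : 0 ≤ B := (h.nonneg 0 0).trans (hB 0 0)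
  have m1 : Measurable fun p : ℝ × ℝ => ρ p.1 (q p.1 p.2) * flowJac g q p.1 p.2 :=
    (Measurable.comp (g := fun p : ℝ × ℝ => ρ p.1 p.2) (f := fun p : ℝ × ℝ => (p.1, q p.1 p.2))
      h.meas (hg.measurable_flow hq)).mul (hg.measurable_flowJac hq)
  have m2 : Measurable fun p : ℝ × ℝ => ρ₀ p.2 := h₀.meas.comp measurable_snd
  have l1 : LocallyIntegrable fun p : ℝ × ℝ => ρ p.1 (q p.1 p.2) * flowJac g q p.1 p.2 := by
    refine (locallyIntegrable_const (B * Real.exp (∫ s, D s))).mono m1.aestronglyMeasurable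
      (Filter.Eventually.of_forall fun p => ?_)
    rw [norm_mul, norm_mul, Real.norm_of_nonneg (h.nonneg _ _), Real.norm_of_nonneg hB0,
      Real.norm_of_nonneg (IsTransportField.flowJac_pos g q _ _).le,
      Real.norm_of_nonneg (Real.exp_pos _).le]
    exact mul_le_mul (hB _ _) (hg.flowJac_le _ _) (IsTransportField.flowJac_pos g q _ _).le hB0
  have l2 : LocallyIntegrable fun p : ℝ × ℝ => ρ₀ p.2 := by
    refine (locallyIntegrable_const B₀).mono m2.aestronglyMeasurable
      (Filter.Eventually.of_forall fun p => ?_)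
    rw [Real.norm_of_nonneg (h₀.nonneg _)]
    exact (hB₀ _).trans (le_abs_self _)
  -- It suffices to test with smooth ξ, and the admissible test for the continuity equation is the
  -- time primitive of ξ: its time derivative is ξ and its final value reproduces the term with ρ₀.
  refine (isOpen_Ioo.prod isOpen_Ioo).ae_eq_zero_of_integral_contDiff_smul_eq_zero
    ((l1.sub l2).locallyIntegrableOn _) fun ξ hξ hc hs => ?_
  obtain ⟨s, hsT, δ, k, K, M, hP⟩ := isPrimitiveTest_of_contDiff hT hξ hc hs
  have H := (h.continuity.lagrangian_primitive (h.hasLocalCoeffs_continuity h₀) hg hq hP hsT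
    fun t x ht => by simp [h.zero_time t x fun h' => ht.not_gt h'.1]).2
  have i1 : Integrable fun p : ℝ × ℝ => ξ p * (ρ p.1 (q p.1 p.2) * flowJac g q p.1 p.2) :=
    l1.integrable_smul_left_of_hasCompactSupport hξ.continuous hc
  have i2 : Integrable fun p : ℝ × ℝ => ξ p * ρ₀ p.2 :=
    l2.integrable_smul_left_of_hasCompactSupport hξ.continuous hc
  have e1 : ∫ p : ℝ × ℝ, ξ p * ρ₀ p.2 = ∫ x, ρ₀ x * ∫ τ in (0 : ℝ)..s, ξ (τ, x) := by
    rw [Measure.volume_eq_prod] at i2 ⊢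
    rw [integral_prod_symm _ i2]
    refine integral_congr_ae (Filter.Eventually.of_forall fun x => ?_)
    simp only
    rw [integral_mul_const, mul_comm, ← (hP.const_t T x hsT.le).1,
      intervalIntegral.integral_eq_integral_of_support_subset]
    intro τ hτ
    have : (τ, x) ∈ tsupport ξ := subset_tsupport _ hτ
    exact Ioo_subset_Ioc_self (hs this).1
  have e2 : ∫ p : ℝ × ℝ, ξ p * (ρ p.1 (q p.1 p.2) * flowJac g q p.1 p.2)
      = ∫ x, ρ₀ x * ∫ τ in (0 : ℝ)..s, ξ (τ, x) := by
    -- For the continuity equation the flux is exactly g times the density, so B - gA = 0 and only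
    -- the term with ξ survives.
    have e3 : ∀ p : ℝ × ℝ, -(ρ p.1 (q p.1 p.2) * flowJac g q p.1 p.2 * ξ (p.1, p.2))
        + (ρ p.1 (q p.1 p.2) * g p.1 (q p.1 p.2) - g p.1 (q p.1 p.2) * ρ p.1 (q p.1 p.2))
          * ((∫ τ in (0 : ℝ)..s, fderiv ℝ ξ (τ, p.2) (0, 1))
            - ∫ τ in (0 : ℝ)..p.1, fderiv ℝ ξ (τ, p.2) (0, 1))
        + 0 * flowJac g q p.1 p.2 * ((∫ τ in (0 : ℝ)..s, ξ (τ, p.2))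
            - ∫ τ in (0 : ℝ)..p.1, ξ (τ, p.2))
        = -(ξ p * (ρ p.1 (q p.1 p.2) * flowJac g q p.1 p.2)) := fun p => by
      rw [Prod.mk.eta]; ring
    simp only [e3] at H
    rw [integral_neg] at H
    linarith
  simp only [smul_eq_mul, mul_sub]
  rw [integral_sub i1 i2, e1, e2, sub_self]

/-- The momentum balance in Lagrangian coordinates. -/
theorem momentum_flow (h : IsVolumeSolution V T a γ ν c₁ θ D g ρ ρ₀ c₀)
    (h₀ : IsVolumeData V ρ₀ c₀) (hT : 0 < T) (ha : 0 < a) (hγ : 0 < γ) (hc₁ : 0 < c₁)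
    (hθ : 0 < θ) (hq : IsFlowOf g q) {s δ K M : ℝ} {Z f Zη : ℝ → ℝ → ℝ} {k : ℝ → ℝ}
    (hP : IsPrimitiveTest s δ V Z f Zη k K M) (hs : s < T) :
    (IntegrableOn (fun p : ℝ × ℝ =>
      -(ρ₀ p.2 * (c₁ * q p.1 p.2 ^ (-θ)) * g p.1 (q p.1 p.2) * f p.1 p.2)
        + (a * (ρ₀ p.2 ^ γ * flowJac g q p.1 p.2 ^ (-γ)) - ν * fieldDiv g p.1 (q p.1 p.2))
          * (Zη s p.2 - Zη p.1 p.2)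
        + ρ₀ p.2 * (-(c₁ * θ / 2) * q p.1 p.2 ^ (-θ - 1)) * g p.1 (q p.1 p.2) ^ 2
          * (Z s p.2 - Z p.1 p.2)) (Ioo 0 s ×ˢ Ioo 0 V)) ∧
    (∫ p : ℝ × ℝ in Ioo 0 s ×ˢ Ioo 0 V,
      (-(ρ₀ p.2 * (c₁ * q p.1 p.2 ^ (-θ)) * g p.1 (q p.1 p.2) * f p.1 p.2)
        + (a * (ρ₀ p.2 ^ γ * flowJac g q p.1 p.2 ^ (-γ)) - ν * fieldDiv g p.1 (q p.1 p.2))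
          * (Zη s p.2 - Zη p.1 p.2)
        + ρ₀ p.2 * (-(c₁ * θ / 2) * q p.1 p.2 ^ (-θ - 1)) * g p.1 (q p.1 p.2) ^ 2
          * (Z s p.2 - Z p.1 p.2)))
      + ∫ x, c₀ x * Z s x = 0 := by
  have hg := h.field
  have H := h.momentum.lagrangian_primitive (h.hasLocalCoeffs_momentum h₀ ha hγ hc₁ hθ) hg hq hP hs
    fun t x ht => by
      have ht' : t ∉ Ioo 0 T := fun h' => ht.not_gt h'.1
      simp [h.zero_time t x ht', hg.fieldDiv_zero_time ht', Real.zero_rpow hγ.ne']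
  have hS : MeasurableSet (Ioo 0 s ×ˢ Ioo 0 V : Set (ℝ × ℝ)) :=
    measurableSet_Ioo.prod measurableSet_Ioo
  rw [← integrable_indicator_iff hS, ← integral_indicator hS]
  -- Mass conservation eliminates the density: ρJ = ρ₀ in the kinetic terms and ρ^γ = ρ₀^γ J^(-γ) in
  -- the pressure. The convective flux has cancelled, leaving pressure minus viscous stress.
  have key := h.density_flow h₀ hT hq
  set E : ℝ × ℝ → ℝ := fun p =>
      -(ρ₀ p.2 * (c₁ * q p.1 p.2 ^ (-θ)) * g p.1 (q p.1 p.2) * f p.1 p.2)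
        + (a * (ρ₀ p.2 ^ γ * flowJac g q p.1 p.2 ^ (-γ)) - ν * fieldDiv g p.1 (q p.1 p.2))
          * (Zη s p.2 - Zη p.1 p.2)
        + ρ₀ p.2 * (-(c₁ * θ / 2) * q p.1 p.2 ^ (-θ - 1)) * g p.1 (q p.1 p.2) ^ 2
          * (Z s p.2 - Z p.1 p.2) with hE
  obtain ⟨H1, H2⟩ := H
  refine (fun hae => ⟨H1.congr hae, (congrArg (· + _) (integral_congr_ae hae)).symm.trans H2⟩) ?_
  filter_upwards [key] with p hp
  by_cases hpS : p ∈ (Ioo 0 s ×ˢ Ioo 0 V : Set (ℝ × ℝ))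
  · rw [indicator_of_mem hpS]
    have hJ := IsTransportField.flowJac_pos g q p.1 p.2
    have h1 := hp ⟨⟨hpS.1.1, hpS.1.2.trans hs⟩, hpS.2⟩
    have h2 : ρ₀ p.2 = ρ p.1 (q p.1 p.2) * flowJac g q p.1 p.2 := by linarith
    have h3 : ρ₀ p.2 ^ γ * flowJac g q p.1 p.2 ^ (-γ) = ρ p.1 (q p.1 p.2) ^ γ := by
      rw [h2, Real.mul_rpow (h.nonneg _ _) hJ.le, mul_assoc, ← Real.rpow_add hJ, add_neg_cancel,
        Real.rpow_zero, mul_one]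
    simp only [hE]
    rw [h3, h2]
    ring
  · rw [indicator_of_notMem hpS]
    by_cases hη : p.2 ∈ Icc δ (V - δ)
    · have hδ := hP.pos
      rcases le_or_gt p.1 0 with h1 | h1
      · have ht' : p.1 ∉ Ioo 0 T := fun h' => h1.not_gt h'.1
        simp [h.zero_time _ _ ht', hg.fieldDiv_zero_time ht', Real.zero_rpow hγ.ne']
      · have h2 : s ≤ p.1 := not_lt.1 fun h2 => hpS ⟨⟨h1, h2⟩, by linarith [hη.1], by
          linarith [hη.2]⟩
        obtain ⟨e1, e2, e3⟩ := hP.const_t p.1 p.2 h2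
        rw [e1, e2, e3]; ring
    · obtain ⟨e1, e2, e3⟩ := hP.zero_η p.1 p.2 hη
      obtain ⟨d1, d2, d3⟩ := hP.zero_η s p.2 hη
      rw [e1, e2, e3, d1, d2]; ring

end IsVolumeSolution

/-! ### Comparison of two flows -/

/-- Mean value inequality; for r ≤ 1 the derivative is largest in modulus at the lower end m. -/
theorem abs_rpow_sub_rpow_le {r m x y : ℝ} (hr : r ≤ 1) (hm : 0 < m) (hx : m ≤ x) (hy : m ≤ y) :
    |x ^ r - y ^ r| ≤ |r| * m ^ (r - 1) * |x - y| := by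
  have := (convex_Ici m).norm_image_sub_le_of_norm_hasDerivWithin_le (f := fun z : ℝ => z ^ r)
    (f' := fun z => r * z ^ (r - 1)) (C := |r| * m ^ (r - 1)) (fun z hz =>
      (Real.hasDerivAt_rpow_const (Or.inl (hm.trans_le hz).ne')).hasDerivWithinAt)
    (fun z hz => by
      rw [norm_mul, Real.norm_eq_abs, Real.norm_of_nonneg (Real.rpow_nonneg (hm.le.trans hz) _)]
      exact mul_le_mul_of_nonneg_left (Real.rpow_le_rpow_of_nonpos hm hz (by linarith))
        (abs_nonneg _)) hy hx
  simpa [Real.norm_eq_abs] using this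

/-- Absorption of the lower order terms of the difference of two kinetic terms. -/
theorem kinetic_absorb {κ₁ κ₂ K₁ K₂ g₁ g₂ p P w d k₀ b₁ b₂ b₃ : ℝ} (hw : 0 ≤ w) (hk : 0 < k₀)
    (hb₁ : 0 ≤ b₁) (hb₂ : 0 ≤ b₂) (hb₃ : 0 ≤ b₃) (hd : 0 ≤ d) (h1 : k₀ * w ≤ κ₁)
    (h2 : |(κ₁ - κ₂) * g₂| ≤ b₁ * w * d * |p|) (h3 : |K₁ * (g₁ + g₂)| ≤ b₂ * w * d)
    (h4 : |(K₁ - K₂) * g₂ ^ 2| ≤ b₃ * w * d ^ 2 * |p|) :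
    -((κ₁ * g₁ - κ₂ * g₂) * (g₁ - g₂)) + (K₁ * g₁ ^ 2 - K₂ * g₂ ^ 2) * (P - p)
      ≤ ((b₁ + b₂) ^ 2 / (2 * k₀) + 2 * b₃) * (w * d ^ 2) * (p ^ 2 + P ^ 2) := by
  set x := |g₁ - g₂| with hx
  have hx0 : 0 ≤ x := abs_nonneg _
  have hPp : |P - p| ≤ |P| + |p| := abs_sub _ _
  -- Splitting κ₁g₁ - κ₂g₂ = κ₁(g₁ - g₂) + (κ₁ - κ₂)g₂ isolates the negative square that pays for
  -- everything linear in x.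
  have e1 : -((κ₁ * g₁ - κ₂ * g₂) * (g₁ - g₂)) ≤ -(k₀ * w * x ^ 2) + b₁ * w * d * |p| * x := by
    have : (κ₁ * g₁ - κ₂ * g₂) * (g₁ - g₂) = κ₁ * x ^ 2 + (κ₁ - κ₂) * g₂ * (g₁ - g₂) := by
      rw [hx, sq_abs]; ring
    rw [this]
    have a1 : k₀ * w * x ^ 2 ≤ κ₁ * x ^ 2 := mul_le_mul_of_nonneg_right h1 (sq_nonneg _)
    have a2 : |(κ₁ - κ₂) * g₂ * (g₁ - g₂)| ≤ b₁ * w * d * |p| * x := by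
      rw [abs_mul]; exact mul_le_mul_of_nonneg_right h2 hx0
    linarith [neg_abs_le ((κ₁ - κ₂) * g₂ * (g₁ - g₂))]
  have e2 : (K₁ * g₁ ^ 2 - K₂ * g₂ ^ 2) * (P - p)
      ≤ (b₂ * w * d * x + b₃ * w * d ^ 2 * |p|) * (|P| + |p|) := by
    refine (le_abs_self _).trans ?_
    rw [abs_mul]
    refine mul_le_mul ?_ hPp (abs_nonneg _) (by positivity)
    have : K₁ * g₁ ^ 2 - K₂ * g₂ ^ 2 = K₁ * (g₁ + g₂) * (g₁ - g₂) + (K₁ - K₂) * g₂ ^ 2 := by ring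
    rw [this]
    refine (abs_add_le _ _).trans (add_le_add ?_ h4)
    rw [abs_mul]
    exact mul_le_mul_of_nonneg_right h3 hx0
  have hp0 : 0 ≤ |p| := abs_nonneg _
  have hP0 : 0 ≤ |P| := abs_nonneg _
  -- Young's inequality by completing the square.
  have e3 : -(k₀ * x ^ 2) + (b₁ + b₂) * d * x * (|P| + |p|)
      ≤ (b₁ + b₂) ^ 2 / (2 * k₀) * d ^ 2 * (p ^ 2 + P ^ 2) := by
    have a1 : ((b₁ + b₂) * d * (|P| + |p|)) ^ 2 ≤ 2 * ((b₁ + b₂) * d) ^ 2 * (p ^ 2 + P ^ 2) := by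
      rw [mul_pow]
      have : (|P| + |p|) ^ 2 ≤ 2 * (p ^ 2 + P ^ 2) := by
        nlinarith [sq_nonneg (|P| - |p|), sq_abs p, sq_abs P]
      linarith [mul_le_mul_of_nonneg_left this (sq_nonneg ((b₁ + b₂) * d))]
    have a2 : -(k₀ * x ^ 2) + (b₁ + b₂) * d * x * (|P| + |p|)
        ≤ ((b₁ + b₂) * d * (|P| + |p|)) ^ 2 / (4 * k₀) := by
      rw [le_div_iff₀ (by positivity)]
      nlinarith [sq_nonneg (2 * k₀ * x - (b₁ + b₂) * d * (|P| + |p|))]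
    refine a2.trans ((div_le_div_of_nonneg_right a1 (by positivity)).trans (le_of_eq ?_))
    field_simp
    ring
  have e4 : |p| * (|P| + |p|) ≤ 2 * (p ^ 2 + P ^ 2) := by
    nlinarith [sq_nonneg (|P| - |p|), sq_abs p, sq_abs P]
  have e5 : b₁ * |p| * x ≤ b₁ * (|P| + |p|) * x :=
    mul_le_mul_of_nonneg_right (mul_le_mul_of_nonneg_left (by linarith) hb₁) hx0
  have e6 := mul_le_mul_of_nonneg_left e3 hw
  have e7 := mul_le_mul_of_nonneg_left e5 (mul_nonneg hw hd)
  have e8 := mul_le_mul_of_nonneg_left e4 (mul_nonneg (mul_nonneg hb₃ hw) (sq_nonneg d))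
  generalize (b₁ + b₂) ^ 2 / (2 * k₀) = c at *
  refine (add_le_add e1 e2).trans ?_
  linarith

/-- The powers of η balance. Differentiating q^(-θ) costs a factor 1/η, and each factor g repays one
through |g| ≤ dΛη, so all hypotheses of `kinetic_absorb` hold with the common weight w = η^(-θ). -/
theorem exists_kinetic_bound {c₁ θ Λ : ℝ} (hc₁ : 0 < c₁) (hθ : 0 < θ) (hΛ : 0 < Λ) :
    ∃ C : ℝ, 0 ≤ C ∧ ∀ η q₁ q₂ g₁ g₂ P d : ℝ, 0 < η → 0 ≤ d → Λ⁻¹ * η ≤ q₁ → Λ⁻¹ * η ≤ q₂ →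
      q₁ ≤ Λ * η → |g₁| ≤ d * (Λ * η) → |g₂| ≤ d * (Λ * η) →
      -((c₁ * q₁ ^ (-θ) * g₁ - c₁ * q₂ ^ (-θ) * g₂) * (g₁ - g₂))
        + (-(c₁ * θ / 2) * q₁ ^ (-θ - 1) * g₁ ^ 2 - -(c₁ * θ / 2) * q₂ ^ (-θ - 1) * g₂ ^ 2)
          * (P - (q₁ - q₂))
      ≤ C * (η ^ (-θ) * d ^ 2) * ((q₁ - q₂) ^ 2 + P ^ 2) := by
  have hΛi : 0 < Λ⁻¹ := inv_pos.2 hΛ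
  set B₁ := c₁ * (θ * Λ⁻¹ ^ (-θ - 1)) * Λ with hB₁
  set B₂ := c₁ * θ / 2 * Λ⁻¹ ^ (-θ - 1) * (2 * Λ) with hB₂
  set B₃ := c₁ * θ / 2 * ((θ + 1) * Λ⁻¹ ^ (-θ - 1 - 1)) * Λ ^ 2 with hB₃
  set k₀ := c₁ * Λ ^ (-θ) with hk₀
  have h1 : 0 < B₁ := by positivity
  have h2 : 0 < B₂ := by positivity
  have h3 : 0 < B₃ := by positivity
  have h4 : 0 < k₀ := by positivity
  refine ⟨(B₁ + B₂) ^ 2 / (2 * k₀) + 2 * B₃, by positivity, ?_⟩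
  intro η q₁ q₂ g₁ g₂ P d hη hd hq₁ hq₂ hq₁' hg₁ hg₂
  have hm : 0 < Λ⁻¹ * η := mul_pos hΛi hη
  have hη' : 0 < η ^ (-θ) := Real.rpow_pos_of_pos hη _
  have s1 : (Λ⁻¹ * η) ^ (-θ - 1) = Λ⁻¹ ^ (-θ - 1) * (η ^ (-θ) * η⁻¹) := by
    rw [Real.mul_rpow hΛi.le hη.le, Real.rpow_sub hη (-θ), Real.rpow_one, div_eq_mul_inv]
  have s2 : (Λ⁻¹ * η) ^ (-θ - 1 - 1) = Λ⁻¹ ^ (-θ - 1 - 1) * (η ^ (-θ) * η⁻¹ * η⁻¹) := by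
    rw [Real.mul_rpow hΛi.le hη.le, Real.rpow_sub hη (-θ - 1), Real.rpow_sub hη (-θ),
      Real.rpow_one, div_eq_mul_inv, div_eq_mul_inv]
  refine kinetic_absorb hη'.le h4 h1.le h2.le h3.le hd ?_ ?_ ?_ ?_
  · rw [hk₀, mul_assoc, ← Real.mul_rpow hΛ.le hη.le]
    exact mul_le_mul_of_nonneg_left (Real.rpow_le_rpow_of_nonpos (hm.trans_le hq₁) hq₁'
      (by linarith)) hc₁.le
  · have := abs_rpow_sub_rpow_le (r := -θ) (by linarith) hm hq₁ hq₂
    rw [s1, abs_neg, abs_of_pos hθ] at this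
    rw [← mul_sub, abs_mul, abs_mul, abs_of_pos hc₁]
    refine (mul_le_mul (mul_le_mul_of_nonneg_left this hc₁.le) hg₂ (abs_nonneg _)
      (by positivity)).trans (le_of_eq ?_)
    rw [hB₁]
    field_simp
  · have : q₁ ^ (-θ - 1) ≤ (Λ⁻¹ * η) ^ (-θ - 1) :=
      Real.rpow_le_rpow_of_nonpos hm hq₁ (by linarith)
    rw [s1] at this
    rw [abs_mul, abs_mul, abs_neg, abs_of_pos (a := c₁ * θ / 2) (by positivity),
      abs_of_nonneg (Real.rpow_nonneg (hm.le.trans hq₁) _)]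
    have h5 : |g₁ + g₂| ≤ 2 * (d * (Λ * η)) := (abs_add_le _ _).trans (by linarith)
    refine (mul_le_mul (mul_le_mul_of_nonneg_left this (by positivity)) h5 (abs_nonneg _)
      (by positivity)).trans (le_of_eq ?_)
    rw [hB₂]
    field_simp
  · have := abs_rpow_sub_rpow_le (r := -θ - 1) (by linarith) hm hq₁ hq₂
    rw [s2, show (-θ - 1 : ℝ) = -(θ + 1) by ring, abs_neg, abs_of_pos (a := θ + 1)
      (by linarith)] at this
    rw [show (-θ - 1 : ℝ) = -(θ + 1) by ring]
    rw [← mul_sub, abs_mul, abs_mul, abs_neg, abs_of_pos (a := c₁ * θ / 2) (by positivity),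
      abs_pow]
    refine (mul_le_mul (mul_le_mul_of_nonneg_left this (by positivity))
      (pow_le_pow_left₀ (abs_nonneg _) hg₂ 2) (by positivity) (by positivity)).trans (le_of_eq ?_)
    rw [hB₃, show (-θ - 1 : ℝ) = -(θ + 1) by ring]
    field_simp

/-! ### Bounds for two flows with a common Lipschitz constant. -/

namespace IsTransportField

variable {V T : ℝ} {D : ℝ → ℝ} {g g₁ g₂ q q₁ q₂ : ℝ → ℝ → ℝ}

theorem mono {D' : ℝ → ℝ} (hg : IsTransportField V T D g) (hm : Measurable D')
    (hi : Integrable D') (hi2 : Integrable fun t => D' t ^ 2) (h0 : ∀ t, t ∉ Ioo 0 T → D' t = 0)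
    (h : ∀ t, D t ≤ D' t) : IsTransportField V T D' g :=
  ⟨hg.pos, hg.measurable, hm, fun t => (hg.nonneg t).trans (h t), hi, hi2, h0, fun t x y =>
    (hg.lip t x y).trans (mul_le_mul_of_nonneg_right (h t) (abs_nonneg _)), hg.zero_left,
    hg.zero_right⟩

theorem flow_le (hg : IsTransportField V T D g) (hq : IsFlowOf g q) {η : ℝ} (hη : 0 ≤ η) (t : ℝ) :
    q t η ≤ Real.exp (∫ s, D s) * η := by
  have := hg.abs_flow_sub_le hq t 0 η
  rw [hg.flow_of_nonpos hq le_rfl, sub_zero, sub_zero, abs_of_nonneg hη] at this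
  exact (le_abs_self _).trans this

theorem flow_nonneg (hg : IsTransportField V T D g) (hq : IsFlowOf g q) {η : ℝ} (hη : 0 ≤ η)
    (t : ℝ) : 0 ≤ q t η := by
  rw [← hg.flow_of_nonpos hq le_rfl t]
  exact (hg.flow_strictMono hq t).monotone hη

theorem le_flow (hg : IsTransportField V T D g) (hq : IsFlowOf g q) {η : ℝ} (hη : 0 ≤ η) (t : ℝ) :
    (Real.exp (∫ s, D s))⁻¹ * η ≤ q t η := by
  have := hg.le_abs_flow_sub hq t 0 η
  rwa [hg.flow_of_nonpos hq le_rfl, sub_zero, sub_zero, abs_of_nonneg hη,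
    abs_of_nonneg (hg.flow_nonneg hq hη t), Real.exp_neg] at this

theorem abs_field_flow_le (hg : IsTransportField V T D g) (hq : IsFlowOf g q) {η : ℝ}
    (hη : 0 ≤ η) (t : ℝ) : |g t (q t η)| ≤ D t * (Real.exp (∫ s, D s) * η) := by
  refine (hg.abs_le_mul t _).trans (mul_le_mul_of_nonneg_left ?_ (hg.nonneg t))
  rw [abs_of_nonneg (hg.flow_nonneg hq hη t)]
  exact hg.flow_le hq hη t

theorem abs_flow_diff_le (h₁ : IsTransportField V T D g₁) (h₂ : IsTransportField V T D g₂)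
    (hq₁ : IsFlowOf g₁ q₁) (hq₂ : IsFlowOf g₂ q₂) {η : ℝ} (hη : 0 ≤ η) (t : ℝ) :
    |q₁ t η - q₂ t η| ≤ Real.exp (∫ s, D s) * η := by
  have a := h₁.flow_nonneg hq₁ hη t
  have b := h₂.flow_nonneg hq₂ hη t
  have c := h₁.flow_le hq₁ hη t
  have d := h₂.flow_le hq₂ hη t
  rw [_root_.abs_le]
  constructor <;> linarith

/-- Both flows fix the wall V, so their difference vanishes linearly there, as it does at the
center. This compensates the steep slope of the cutoff at either end. -/
theorem abs_flow_diff_le' (h₁ : IsTransportField V T D g₁) (h₂ : IsTransportField V T D g₂)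
    (hq₁ : IsFlowOf g₁ q₁) (hq₂ : IsFlowOf g₂ q₂) {η : ℝ} (hη : η ≤ V) (t : ℝ) :
    |q₁ t η - q₂ t η| ≤ Real.exp (∫ s, D s) * (V - η) := by
  have key : ∀ {g q : ℝ → ℝ → ℝ}, IsTransportField V T D g → IsFlowOf g q →
      q t η ≤ V ∧ V - q t η ≤ Real.exp (∫ s, D s) * (V - η) := fun {g q} hg hq => by
    have := hg.abs_flow_sub_le hq t η V
    rw [hg.flow_of_ge hq le_rfl, abs_of_nonneg (sub_nonneg.2 hη)] at this
    refine ⟨?_, (le_abs_self _).trans this⟩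
    conv_rhs => rw [← hg.flow_of_ge hq le_rfl t]
    exact (hg.flow_strictMono hq t).monotone hη
  obtain ⟨a, b⟩ := key h₁ hq₁
  obtain ⟨c, d⟩ := key h₂ hq₂
  rw [_root_.abs_le]
  constructor <;> linarith

theorem abs_flowJac_diff_le (h₁ : IsTransportField V T D g₁) (h₂ : IsTransportField V T D g₂)
    (t η : ℝ) : |flowJac g₁ q₁ t η - flowJac g₂ q₂ t η| ≤ Real.exp (∫ s, D s) := by
  have a := flowJac_pos g₁ q₁ t η
  have b := flowJac_pos g₂ q₂ t η
  have c := h₁.flowJac_le (q := q₁) t η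
  have d := h₂.flowJac_le (q := q₂) t η
  rw [_root_.abs_le]
  constructor <;> linarith

/-- The logarithm of the quotient of the Jacobians of two flows. -/
noncomputable def logJacDiff (g₁ q₁ g₂ q₂ : ℝ → ℝ → ℝ) (t η : ℝ) : ℝ :=
  (∫ s in (0 : ℝ)..t, fieldDiv g₁ s (q₁ s η)) - ∫ s in (0 : ℝ)..t, fieldDiv g₂ s (q₂ s η)

theorem abs_logJacDiff_le (h₁ : IsTransportField V T D g₁) (h₂ : IsTransportField V T D g₂)
    (t η : ℝ) : |logJacDiff g₁ q₁ g₂ q₂ t η|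
      ≤ Real.exp (∫ s, D s) * |flowJac g₁ q₁ t η - flowJac g₂ q₂ t η| := by
  have a := h₁.le_flowJac (q := q₁) t η
  have b := h₂.le_flowJac (q := q₂) t η
  have key := (convex_Ici (Real.exp (-∫ s, D s))).norm_image_sub_le_of_norm_hasDerivWithin_le
    (f := Real.log) (f' := fun z => z⁻¹) (C := Real.exp (∫ s, D s)) (fun z hz =>
      (Real.hasDerivAt_log ((Real.exp_pos _).trans_le hz).ne').hasDerivWithinAt)
    (fun z hz => by
      have hz0 : 0 < z := (Real.exp_pos _).trans_le hz
      rw [Real.norm_of_nonneg (inv_nonneg.2 hz0.le), ← neg_neg (∫ s, D s), Real.exp_neg]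
      exact inv_anti₀ (Real.exp_pos _) hz) b a
  simpa [flowJac, logJacDiff, Real.norm_eq_abs] using key

theorem abs_flowJac_diff_le_log (h₁ : IsTransportField V T D g₁) (h₂ : IsTransportField V T D g₂)
    (t η : ℝ) : |flowJac g₁ q₁ t η - flowJac g₂ q₂ t η|
      ≤ Real.exp (∫ s, D s) * |logJacDiff g₁ q₁ g₂ q₂ t η| := by
  have a := (le_abs_self _).trans (h₁.abs_log_flowJac_le (q := q₁) t η)
  have b := (le_abs_self _).trans (h₂.abs_log_flowJac_le (q := q₂) t η)
  have key := (convex_Iic (∫ s, D s)).norm_image_sub_le_of_norm_hasDerivWithin_le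
    (f := Real.exp) (f' := Real.exp) (C := Real.exp (∫ s, D s)) (fun z _ =>
      (Real.hasDerivAt_exp z).hasDerivWithinAt)
    (fun z hz => by
      rw [Real.norm_of_nonneg (Real.exp_pos _).le]
      exact Real.exp_le_exp.2 hz) b a
  simpa [flowJac, logJacDiff, Real.norm_eq_abs] using key

/-- The viscous part of the energy identity for the difference of two flows. -/
theorem integral_viscous (h₁ : IsTransportField V T D g₁) (h₂ : IsTransportField V T D g₂)
    (hq₁ : IsFlowOf g₁ q₁) (hq₂ : IsFlowOf g₂ q₂) (s η : ℝ) :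
    ∫ t in (0 : ℝ)..s, ((fieldDiv g₁ t (q₁ t η) - fieldDiv g₂ t (q₂ t η))
        * ((flowJac g₁ q₁ s η - flowJac g₂ q₂ s η) - (flowJac g₁ q₁ t η - flowJac g₂ q₂ t η))
      - (logJacDiff g₁ q₁ g₂ q₂ t η * (flowJac g₁ q₁ t η - flowJac g₂ q₂ t η)
          * fieldDiv g₂ t (q₂ t η)
        - 1 / 2 * flowJac g₁ q₁ t η * fieldDiv g₁ t (q₁ t η)
          * logJacDiff g₁ q₁ g₂ q₂ t η ^ 2))
      = 1 / 2 * flowJac g₁ q₁ s η * logJacDiff g₁ q₁ g₂ q₂ s η ^ 2 := by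
  have aL : IsACWithDeriv (fun t => logJacDiff g₁ q₁ g₂ q₂ t η)
      (fun t => fieldDiv g₁ t (q₁ t η) - fieldDiv g₂ t (q₂ t η)) :=
    (h₁.log_flowJac_ac hq₁ η).sub (h₂.log_flowJac_ac hq₂ η)
  have aJ₁ := h₁.flowJac_ac hq₁ η
  have aJ₂ := h₂.flowJac_ac hq₂ η
  -- With δJ = J₁ - J₂, L = log(J₁/J₂) and G₂ the divergence of the second field along its flow, one
  -- has (δJ)' = J₁L' + δJ G₂. Adding ½J₁L² to L(δJ(s) - δJ) therefore cancels the products LL'J₁,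
  -- and only terms without L' remain besides the viscous integrand. The sum vanishes at time 0 and
  -- equals ½J₁L² at time s.
  have hΦ := (aL.mul ((IsACWithDeriv.const
    (flowJac g₁ q₁ s η - flowJac g₂ q₂ s η)).sub (aJ₁.sub aJ₂))).add
    (((IsACWithDeriv.const (1 / 2)).mul aJ₁).mul (aL.mul aL))
  have hI := hΦ.integral_eq 0 s
  have L0 : logJacDiff g₁ q₁ g₂ q₂ 0 η = 0 := by simp [logJacDiff]
  rw [L0] at hI
  refine Eq.trans (intervalIntegral.integral_congr fun t _ => ?_) (hI.trans ?_)
  · ring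
  · ring

end IsTransportField

/-! ### The difference of two flows as a test function -/

/-- A piecewise linear cutoff function, supported in `[δ, V - δ]` and equal to `1` on
`[2δ, V - 2δ]`. -/
noncomputable def boundaryCutoff (V δ η : ℝ) : ℝ :=
  max 0 (min 1 (min (δ⁻¹ * η - 1) (δ⁻¹ * (V - η) - 1)))

namespace boundaryCutoff

variable {V δ η : ℝ}

theorem lipschitz (hδ : 0 < δ) : LipschitzWith δ⁻¹.toNNReal (boundaryCutoff V δ) := by
  have h1 : LipschitzWith δ⁻¹.toNNReal fun η : ℝ => δ⁻¹ * η - 1 :=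
    LipschitzWith.of_dist_le_mul fun x y => by
      rw [Real.coe_toNNReal _ (inv_nonneg.2 hδ.le), Real.dist_eq, Real.dist_eq,
        show δ⁻¹ * x - 1 - (δ⁻¹ * y - 1) = δ⁻¹ * (x - y) by ring, abs_mul,
        abs_of_pos (inv_pos.2 hδ)]
  have h2 : LipschitzWith δ⁻¹.toNNReal fun η : ℝ => δ⁻¹ * (V - η) - 1 :=
    LipschitzWith.of_dist_le_mul fun x y => by
      rw [Real.coe_toNNReal _ (inv_nonneg.2 hδ.le), Real.dist_eq, Real.dist_eq,
        show δ⁻¹ * (V - x) - 1 - (δ⁻¹ * (V - y) - 1) = -(δ⁻¹ * (x - y)) by ring, abs_neg, abs_mul,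
        abs_of_pos (inv_pos.2 hδ)]
  have h3 := h1.min h2
  rw [max_self] at h3
  exact (h3.const_min 1).const_max 0

theorem nonneg (V δ η : ℝ) : 0 ≤ boundaryCutoff V δ η := le_max_left _ _

theorem le_one (V δ η : ℝ) : boundaryCutoff V δ η ≤ 1 := max_le zero_le_one (min_le_left _ _)

theorem eq_zero_left (hδ : 0 < δ) (h : η ≤ δ) : boundaryCutoff V δ η = 0 := by
  refine max_eq_left ((min_le_right _ _).trans ((min_le_left _ _).trans ?_))
  rw [sub_nonpos, inv_mul_le_iff₀ hδ]
  linarith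

theorem eq_zero_right (hδ : 0 < δ) (h : V - δ ≤ η) : boundaryCutoff V δ η = 0 := by
  refine max_eq_left ((min_le_right _ _).trans ((min_le_right _ _).trans ?_))
  rw [sub_nonpos, inv_mul_le_iff₀ hδ]
  linarith

theorem eq_one (hδ : 0 < δ) (h1 : 2 * δ ≤ η) (h2 : η ≤ V - 2 * δ) : boundaryCutoff V δ η = 1 := by
  have a : 1 ≤ δ⁻¹ * η - 1 := by
    rw [le_sub_iff_add_le, le_inv_mul_iff₀ hδ]; linarith
  have b : 1 ≤ δ⁻¹ * (V - η) - 1 := by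
    rw [le_sub_iff_add_le, le_inv_mul_iff₀ hδ]; linarith
  unfold boundaryCutoff
  rw [min_eq_left (le_min a b), max_eq_right zero_le_one]

theorem abs_deriv_le (hδ : 0 < δ) : |deriv (boundaryCutoff V δ) η| ≤ δ⁻¹ := by
  have := norm_deriv_le_of_lipschitz (lipschitz (V := V) hδ) (x₀ := η)
  rwa [Real.coe_toNNReal _ (inv_nonneg.2 hδ.le), Real.norm_eq_abs] at this

theorem deriv_eq_zero_outside (hδ : 0 < δ) (h : η ∉ Icc δ (V - δ)) :
    deriv (boundaryCutoff V δ) η = 0 := by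
  rcases lt_or_ge η δ with h1 | h1
  · have : boundaryCutoff V δ =ᶠ[nhds η] fun _ => 0 := by
      filter_upwards [Iio_mem_nhds h1] with x hx using eq_zero_left hδ hx.le
    rw [this.deriv_eq, deriv_const]
  · have h2 : V - δ < η := lt_of_not_ge fun h2 => h ⟨h1, h2⟩
    have : boundaryCutoff V δ =ᶠ[nhds η] fun _ => 0 := by
      filter_upwards [Ioi_mem_nhds h2] with x hx using eq_zero_right hδ (le_of_lt hx)
    rw [this.deriv_eq, deriv_const]

theorem deriv_eq_zero_inside (hδ : 0 < δ) (h1 : 2 * δ < η) (h2 : η < V - 2 * δ) :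
    deriv (boundaryCutoff V δ) η = 0 := by
  have : boundaryCutoff V δ =ᶠ[nhds η] fun _ => 1 := by
    filter_upwards [Ioo_mem_nhds h1 h2] with x hx using eq_one hδ hx.1.le hx.2.le
  rw [this.deriv_eq, deriv_const]

/-- The slope is at most 1/δ and lives within distance 2δ of the endpoints, where z is at most 2δΛ.
The bound does not depend on δ, so the cutoff can be removed by dominated convergence. -/
theorem abs_deriv_mul_le (hδ : 0 < δ) {Λ z : ℝ} (hΛ : 0 ≤ Λ) (hz : η ∈ Icc 0 V → |z| ≤ Λ * η)
    (hz' : η ∈ Icc 0 V → |z| ≤ Λ * (V - η)) : |deriv (boundaryCutoff V δ) η * z| ≤ 2 * Λ := by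
  have h0 : 0 ≤ 2 * Λ := by linarith
  by_cases hη : η ∈ Icc δ (V - δ)
  · have hηV : η ∈ Icc 0 V := ⟨by linarith [hη.1], by linarith [hη.2]⟩
    have key : |z| ≤ Λ * (2 * δ) → |deriv (boundaryCutoff V δ) η * z| ≤ 2 * Λ := fun h => by
      rw [abs_mul]
      refine (mul_le_mul (abs_deriv_le hδ) h (abs_nonneg _) (inv_nonneg.2 hδ.le)).trans
        (le_of_eq ?_)
      field_simp
    rcases le_or_gt η (2 * δ) with h1 | h1
    · exact key ((hz hηV).trans (mul_le_mul_of_nonneg_left h1 hΛ))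
    · rcases lt_or_ge η (V - 2 * δ) with h2 | h2
      · rw [deriv_eq_zero_inside hδ h1 h2, zero_mul, abs_zero]; exact h0
      · exact key ((hz' hηV).trans (mul_le_mul_of_nonneg_left (by linarith) hΛ))
  · rw [deriv_eq_zero_outside hδ hη, zero_mul, abs_zero]; exact h0

end boundaryCutoff

/-- Clamping the time freezes a function before 0 and after s and keeps it absolutely continuous,
which a truncation would not. -/
theorem IsACWithDeriv.comp_clamp {f f' : ℝ → ℝ} (hf : IsACWithDeriv f f') {s : ℝ} (hs : 0 ≤ s) :
    IsACWithDeriv (fun t => f (max 0 (min t s))) ((Ioo 0 s).indicator f') := by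
  refine IsACWithDeriv.of_integral (c := f 0) (a := 0)
    (hf.locallyIntegrable.indicator measurableSet_Ioo) fun x => ?_
  rcases le_or_gt x 0 with hx | hx
  · rw [max_eq_left ((min_le_left _ _).trans hx), intervalIntegral.integral_congr (g := fun _ => 0)]
    · simp
    · intro t ht
      rw [uIcc_of_ge hx] at ht
      exact indicator_of_notMem (fun h => by linarith [h.1, ht.2]) _
  · have h0 : 0 ≤ min x s := le_min hx.le hs
    rw [max_eq_right h0, intervalIntegral.integral_of_le hx.le,
      setIntegral_indicator measurableSet_Ioo]
    have : (Ioc 0 x ∩ Ioo 0 s : Set ℝ) =ᵐ[volume] Ioc 0 (min x s) := by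
      have h1 : (Ioc 0 x ∩ Ioc 0 s : Set ℝ) = Ioc 0 (min x s) := by
        rw [Ioc_inter_Ioc, max_self]
      rw [← h1]
      exact (ae_eq_refl _).inter Ioo_ae_eq_Ioc
    rw [setIntegral_congr_set this, ← intervalIntegral.integral_of_le h0, hf.integral_eq]
    ring

namespace IsTransportField

variable {V T : ℝ} {D : ℝ → ℝ} {g₁ g₂ q₁ q₂ : ℝ → ℝ → ℝ}

/-- The localized difference of two flows, stopped at the time `s`. -/
theorem isPrimitiveTest_flow_diff (h₁ : IsTransportField V T D g₁)
    (h₂ : IsTransportField V T D g₂) (hq₁ : IsFlowOf g₁ q₁) (hq₂ : IsFlowOf g₂ q₂) {s δ : ℝ}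
    (hs : 0 ≤ s) (hδ : 0 < δ) :
    IsPrimitiveTest s δ V
      (fun t η => boundaryCutoff V δ η * (q₁ (max 0 (min t s)) η - q₂ (max 0 (min t s)) η))
      (fun t η => boundaryCutoff V δ η
        * (Ioo 0 s).indicator (fun t => g₁ t (q₁ t η) - g₂ t (q₂ t η)) t)
      (fun t η => deriv (boundaryCutoff V δ) η
          * (q₁ (max 0 (min t s)) η - q₂ (max 0 (min t s)) η)
        + boundaryCutoff V δ η
          * (flowJac g₁ q₁ (max 0 (min t s)) η - flowJac g₂ q₂ (max 0 (min t s)) η))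
      (fun t => 2 * V * D t) (Real.exp (∫ s, D s) * V) (3 * Real.exp (∫ s, D s)) := by
  set Λ := Real.exp (∫ s, D s) with hΛ
  have hΛ0 : 0 < Λ := Real.exp_pos _
  have hV := h₁.pos
  have hcl : Measurable fun p : ℝ × ℝ => (max 0 (min p.1 s), p.2) :=
    (measurable_const.max (measurable_fst.min measurable_const)).prodMk measurable_snd
  have hχ : Measurable fun p : ℝ × ℝ => boundaryCutoff V δ p.2 :=
    (boundaryCutoff.lipschitz hδ).continuous.measurable.comp measurable_snd
  have hgm : ∀ {g q : ℝ → ℝ → ℝ}, IsTransportField V T D g → IsFlowOf g q →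
      Measurable fun p : ℝ × ℝ => g p.1 (q p.1 p.2) := fun {g q} hg hq =>
    Measurable.comp (g := fun p : ℝ × ℝ => g p.1 p.2) (f := fun p : ℝ × ℝ => (p.1, q p.1 p.2))
      hg.measurable (hg.measurable_flow hq)
  have hJm : ∀ {g q : ℝ → ℝ → ℝ}, IsTransportField V T D g → IsFlowOf g q →
      Measurable fun p : ℝ × ℝ => flowJac g q (max 0 (min p.1 s)) p.2 := fun {g q} hg hq =>
    Measurable.comp (g := fun p : ℝ × ℝ => flowJac g q p.1 p.2) (hg.measurable_flowJac hq) hcl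
  have hqm : ∀ {g q : ℝ → ℝ → ℝ}, IsTransportField V T D g → IsFlowOf g q →
      Measurable fun p : ℝ × ℝ => q (max 0 (min p.1 s)) p.2 := fun {g q} hg hq =>
    Measurable.comp (g := fun p : ℝ × ℝ => q p.1 p.2) (hg.flow_continuous hq).measurable hcl
  have hχ1 : ∀ η, |boundaryCutoff V δ η| ≤ 1 := fun η => by
    rw [abs_of_nonneg (boundaryCutoff.nonneg V δ η)]; exact boundaryCutoff.le_one V δ η
  have hχ0 : ∀ η, η ∉ Icc δ (V - δ) → boundaryCutoff V δ η = 0 := fun η hη => by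
    rcases le_or_gt η δ with h | h
    · exact boundaryCutoff.eq_zero_left hδ h
    · exact boundaryCutoff.eq_zero_right hδ (not_le.1 fun h' => hη ⟨h.le, h'⟩).le
  refine ⟨hδ, hs, ?_, ?_, fun η => ?_, fun t => ?_, measurable_const.mul h₁.measurable_lip, ?_,
    fun t η => ?_, fun η => ?_, fun t η => ?_, fun t η ht => ?_, fun t η ht => ?_,
    fun t η hη => ?_⟩
  · refine hχ.mul ?_
    have : (fun p : ℝ × ℝ => (Ioo 0 s).indicator (fun t => g₁ t (q₁ t p.2) - g₂ t (q₂ t p.2)) p.1)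
        = (Prod.fst ⁻¹' Ioo 0 s).indicator fun p : ℝ × ℝ =>
          g₁ p.1 (q₁ p.1 p.2) - g₂ p.1 (q₂ p.1 p.2) := by
      funext p
      by_cases hp : p.1 ∈ Ioo 0 s
      · rw [indicator_of_mem hp, indicator_of_mem (show p ∈ Prod.fst ⁻¹' Ioo 0 s from hp)]
      · rw [indicator_of_notMem hp, indicator_of_notMem (show p ∉ Prod.fst ⁻¹' Ioo 0 s from hp)]
    rw [this]
    exact ((hgm h₁ hq₁).sub (hgm h₂ hq₂)).indicator (measurable_fst measurableSet_Ioo)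
  · exact (((measurable_deriv _).comp measurable_snd).mul ((hqm h₁ hq₁).sub (hqm h₂ hq₂))).add
      (hχ.mul ((hJm h₁ hq₁).sub (hJm h₂ hq₂)))
  · refine ((IsACWithDeriv.const (boundaryCutoff V δ η)).mul
      (((h₁.flow_ac hq₁ η).sub (h₂.flow_ac hq₂ η)).comp_clamp hs)).congr_deriv
      (Filter.Eventually.of_forall fun t => ?_)
    ring
  · exact (IsACWithDeriv.of_lipschitz (boundaryCutoff.lipschitz hδ)).mul
      ((h₁.flow_ac_space hq₁ _).sub (h₂.flow_ac_space hq₂ _))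
  · refine (h₁.integrable_sq.const_mul ((2 * V) ^ 2)).congr
      (Filter.Eventually.of_forall fun t => ?_)
    ring
  · rw [abs_mul]
    have h0 : 0 ≤ 2 * V * D t := mul_nonneg (by linarith) (h₁.nonneg t)
    refine (mul_le_mul (hχ1 η) (?_ : _ ≤ 2 * V * D t) (abs_nonneg _) zero_le_one).trans
      (by rw [one_mul])
    by_cases ht : t ∈ Ioo 0 s
    · rw [indicator_of_mem ht]
      refine (abs_sub _ _).trans ((add_le_add (h₁.abs_le _ _) (h₂.abs_le _ _)).trans
        (le_of_eq (by ring)))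
    · rw [indicator_of_notMem ht, abs_zero]; exact h0
  · by_cases hη : η ∈ Icc δ (V - δ)
    · have hη0 : 0 ≤ η := by linarith [hη.1]
      rw [abs_mul]
      refine (mul_le_mul (hχ1 η) (h₁.abs_flow_diff_le h₂ hq₁ hq₂ hη0 _) (abs_nonneg _)
        zero_le_one).trans ?_
      rw [one_mul]
      exact mul_le_mul_of_nonneg_left (by linarith [hη.2]) hΛ0.le
    · rw [hχ0 η hη, zero_mul, abs_zero]; positivity
  · refine (abs_add_le _ _).trans ?_
    -- The part 2Λ is for the slope of the cutoff times the difference of the flows, the part Λ for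
    -- the difference of the Jacobians.
    rw [show 3 * Λ = 2 * Λ + 1 * Λ by ring]
    refine add_le_add (boundaryCutoff.abs_deriv_mul_le hδ hΛ0.le
      (fun h => h₁.abs_flow_diff_le h₂ hq₁ hq₂ h.1 _)
      (fun h => h₁.abs_flow_diff_le' h₂ hq₁ hq₂ h.2 _)) ?_
    rw [abs_mul]
    exact mul_le_mul (hχ1 η) (h₁.abs_flowJac_diff_le h₂ _ η) (abs_nonneg _) zero_le_one
  · have e : max 0 (min t s) = 0 := max_eq_left ((min_le_left _ _).trans ht)
    simp only [e, flow_zero hq₁, flow_zero hq₂, flowJac_zero]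
    rw [indicator_of_notMem fun h => by linarith [h.1]]
    simp
  · have e : max 0 (min t s) = s := by rw [min_eq_right ht, max_eq_right hs]
    have e' : max 0 (min s s) = s := by rw [min_self, max_eq_right hs]
    simp only [e, e']
    rw [indicator_of_notMem fun h => by linarith [h.2]]
    simp
  · rw [hχ0 η hη, boundaryCutoff.deriv_eq_zero_outside hδ hη]
    simp

end IsTransportField

/-! ### The energy identity for the difference of two solutions -/

/-- The contribution of the kinetic terms to the energy identity for the difference of two flows. -/
noncomputable def kineticDiff (c₁ θ : ℝ) (g₁ q₁ g₂ q₂ : ℝ → ℝ → ℝ) (s : ℝ) (p : ℝ × ℝ) : ℝ :=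
  -((c₁ * q₁ p.1 p.2 ^ (-θ) * g₁ p.1 (q₁ p.1 p.2) - c₁ * q₂ p.1 p.2 ^ (-θ) * g₂ p.1 (q₂ p.1 p.2))
      * (g₁ p.1 (q₁ p.1 p.2) - g₂ p.1 (q₂ p.1 p.2)))
    + (-(c₁ * θ / 2) * q₁ p.1 p.2 ^ (-θ - 1) * g₁ p.1 (q₁ p.1 p.2) ^ 2
        - -(c₁ * θ / 2) * q₂ p.1 p.2 ^ (-θ - 1) * g₂ p.1 (q₂ p.1 p.2) ^ 2)
      * ((q₁ s p.2 - q₂ s p.2) - (q₁ p.1 p.2 - q₂ p.1 p.2))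

/-- The contribution of the pressures to the energy identity for the difference of two flows. -/
noncomputable def pressureDiff (γ : ℝ) (g₁ q₁ g₂ q₂ : ℝ → ℝ → ℝ) (s : ℝ) (p : ℝ × ℝ) : ℝ :=
  (flowJac g₁ q₁ p.1 p.2 ^ (-γ) - flowJac g₂ q₂ p.1 p.2 ^ (-γ))
    * ((flowJac g₁ q₁ s p.2 - flowJac g₂ q₂ s p.2)
      - (flowJac g₁ q₁ p.1 p.2 - flowJac g₂ q₂ p.1 p.2))

/-- The contribution of the viscosity to the energy identity for the difference of two flows. -/
noncomputable def viscousDiff (g₁ q₁ g₂ q₂ : ℝ → ℝ → ℝ) (s : ℝ) (p : ℝ × ℝ) : ℝ :=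
  (fieldDiv g₁ p.1 (q₁ p.1 p.2) - fieldDiv g₂ p.1 (q₂ p.1 p.2))
    * ((flowJac g₁ q₁ s p.2 - flowJac g₂ q₂ s p.2)
      - (flowJac g₁ q₁ p.1 p.2 - flowJac g₂ q₂ p.1 p.2))

/-- The k factors of η in y outweigh the negative power of q, which is comparable to η. -/
theorem abs_rpow_mul_le {r V Λ η q y Y : ℝ} {k : ℕ} (hr : r ≤ 0) (hk : 0 ≤ r + k) (hΛ : 0 < Λ)
    (hη : 0 < η) (hηV : η ≤ V) (hq : Λ⁻¹ * η ≤ q) (hY : 0 ≤ Y) (hy : |y| ≤ Y * η ^ k) :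
    |q ^ r * y| ≤ Λ⁻¹ ^ r * V ^ (r + k) * Y := by
  have hm : 0 < Λ⁻¹ * η := mul_pos (inv_pos.2 hΛ) hη
  have h1 : q ^ r ≤ Λ⁻¹ ^ r * η ^ r := by
    rw [← Real.mul_rpow (inv_pos.2 hΛ).le hη.le]
    exact Real.rpow_le_rpow_of_nonpos hm hq hr
  have h2 : η ^ r * η ^ k = η ^ (r + k) := by
    rw [← Real.rpow_natCast, ← Real.rpow_add hη]
  have h3 : η ^ (r + k) ≤ V ^ (r + k) := Real.rpow_le_rpow hη.le hηV hk
  rw [abs_mul, abs_of_nonneg (Real.rpow_nonneg (hm.le.trans hq) r)]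
  calc q ^ r * |y| ≤ Λ⁻¹ ^ r * η ^ r * (Y * η ^ k) :=
        mul_le_mul h1 hy (abs_nonneg _) (by positivity)
    _ = Λ⁻¹ ^ r * (η ^ r * η ^ k) * Y := by ring
    _ ≤ _ := by
        rw [h2]
        exact mul_le_mul_of_nonneg_right (mul_le_mul_of_nonneg_left h3 (by positivity)) hY

/-! ### Measurability and integrability of the terms of the energy identity. -/

namespace IsTransportField

variable {V T : ℝ} {D : ℝ → ℝ} {g g₁ g₂ q q₁ q₂ : ℝ → ℝ → ℝ}

theorem measurable_field_flow (hg : IsTransportField V T D g) (hq : IsFlowOf g q) :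
    Measurable fun p : ℝ × ℝ => g p.1 (q p.1 p.2) :=
  Measurable.comp (g := fun p : ℝ × ℝ => g p.1 p.2) (f := fun p : ℝ × ℝ => (p.1, q p.1 p.2))
    hg.measurable (hg.measurable_flow hq)

theorem measurable_fieldDiv_flow (hg : IsTransportField V T D g) (hq : IsFlowOf g q) :
    Measurable fun p : ℝ × ℝ => fieldDiv g p.1 (q p.1 p.2) :=
  Measurable.comp (g := fun p : ℝ × ℝ => fieldDiv g p.1 p.2)
    (f := fun p : ℝ × ℝ => (p.1, q p.1 p.2)) hg.measurable_fieldDiv (hg.measurable_flow hq)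

theorem measurable_flowJac_at (hg : IsTransportField V T D g) (hq : IsFlowOf g q) (s : ℝ) :
    Measurable fun p : ℝ × ℝ => flowJac g q s p.2 :=
  Measurable.comp (g := fun p : ℝ × ℝ => flowJac g q p.1 p.2) (f := fun p : ℝ × ℝ => (s, p.2))
    (hg.measurable_flowJac hq) (measurable_const.prodMk measurable_snd)

theorem measurable_kineticDiff (h₁ : IsTransportField V T D g₁) (h₂ : IsTransportField V T D g₂)
    (hq₁ : IsFlowOf g₁ q₁) (hq₂ : IsFlowOf g₂ q₂) (c₁ θ s : ℝ) :
    Measurable (kineticDiff c₁ θ g₁ q₁ g₂ q₂ s) := by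
  have a₁ := (h₁.flow_continuous hq₁).measurable
  have a₂ := (h₂.flow_continuous hq₂).measurable
  have b₁ := h₁.measurable_field_flow hq₁
  have b₂ := h₂.measurable_field_flow hq₂
  have d₁ : Measurable fun p : ℝ × ℝ => q₁ s p.2 :=
    (h₁.flow_continuous_space hq₁ s).measurable.comp measurable_snd
  have d₂ : Measurable fun p : ℝ × ℝ => q₂ s p.2 :=
    (h₂.flow_continuous_space hq₂ s).measurable.comp measurable_snd
  exact ((((measurable_const.mul (a₁.pow_const _)).mul b₁).sub
    ((measurable_const.mul (a₂.pow_const _)).mul b₂)).mul (b₁.sub b₂)).neg.add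
    ((((measurable_const.mul (a₁.pow_const _)).mul (b₁.pow_const 2)).sub
      ((measurable_const.mul (a₂.pow_const _)).mul (b₂.pow_const 2))).mul
      ((d₁.sub d₂).sub (a₁.sub a₂)))

theorem measurable_pressureDiff (h₁ : IsTransportField V T D g₁) (h₂ : IsTransportField V T D g₂)
    (hq₁ : IsFlowOf g₁ q₁) (hq₂ : IsFlowOf g₂ q₂) (γ s : ℝ) :
    Measurable (pressureDiff γ g₁ q₁ g₂ q₂ s) :=
  (((h₁.measurable_flowJac hq₁).pow_const _).sub ((h₂.measurable_flowJac hq₂).pow_const _)).mul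
    (((h₁.measurable_flowJac_at hq₁ s).sub (h₂.measurable_flowJac_at hq₂ s)).sub
      ((h₁.measurable_flowJac hq₁).sub (h₂.measurable_flowJac hq₂)))

theorem measurable_viscousDiff (h₁ : IsTransportField V T D g₁) (h₂ : IsTransportField V T D g₂)
    (hq₁ : IsFlowOf g₁ q₁) (hq₂ : IsFlowOf g₂ q₂) (s : ℝ) :
    Measurable (viscousDiff g₁ q₁ g₂ q₂ s) :=
  ((h₁.measurable_fieldDiv_flow hq₁).sub (h₂.measurable_fieldDiv_flow hq₂)).mul
    (((h₁.measurable_flowJac_at hq₁ s).sub (h₂.measurable_flowJac_at hq₂ s)).sub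
      ((h₁.measurable_flowJac hq₁).sub (h₂.measurable_flowJac hq₂)))

/-- Up to the center, q^(-θ) meets two factors of size η and q^(-θ-1) meets three, so the power
η^(2-θ) remains; it is bounded because θ < 2. -/
theorem exists_abs_kineticDiff_le (h₁ : IsTransportField V T D g₁)
    (h₂ : IsTransportField V T D g₂) (hq₁ : IsFlowOf g₁ q₁) (hq₂ : IsFlowOf g₂ q₂) {c₁ θ : ℝ}
    (hc₁ : 0 < c₁) (hθ : 0 < θ) (hθ2 : θ < 2) :
    ∃ C, 0 ≤ C ∧ ∀ s t η, η ∈ Ioo 0 V →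
      |kineticDiff c₁ θ g₁ q₁ g₂ q₂ s (t, η)| ≤ C * D t ^ 2 := by
  set Λ := Real.exp (∫ s, D s) with hΛ
  have hΛ0 : 0 < Λ := Real.exp_pos _
  have hV := h₁.pos
  set A := Λ⁻¹ ^ (-θ) * V ^ (-θ + (2 : ℕ)) * (2 * Λ ^ 2) with hA
  set B := Λ⁻¹ ^ (-θ - 1) * V ^ (-θ - 1 + (3 : ℕ)) * (2 * Λ ^ 3) with hB
  have hA0 : 0 ≤ A := by positivity
  have hB0 : 0 ≤ B := by positivity
  refine ⟨2 * (c₁ * A) + 2 * (c₁ * θ / 2 * B), by positivity, fun s t η hη => ?_⟩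
  have hd := h₁.nonneg t
  have b1 := h₁.abs_field_flow_le hq₁ hη.1.le t
  have b2 := h₂.abs_field_flow_le hq₂ hη.1.le t
  rw [← hΛ] at b1 b2
  have bd : |g₁ t (q₁ t η) - g₂ t (q₂ t η)| ≤ 2 * (D t * (Λ * η)) :=
    (abs_sub _ _).trans (by linarith)
  have bq : |(q₁ s η - q₂ s η) - (q₁ t η - q₂ t η)| ≤ 2 * (Λ * η) :=
    (abs_sub _ _).trans (by
      have := h₁.abs_flow_diff_le h₂ hq₁ hq₂ hη.1.le s
      have := h₁.abs_flow_diff_le h₂ hq₁ hq₂ hη.1.le t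
      linarith)
  have kA : ∀ g q : ℝ, Λ⁻¹ * η ≤ q → |g| ≤ D t * (Λ * η) →
      |c₁ * q ^ (-θ) * g * (g₁ t (q₁ t η) - g₂ t (q₂ t η))| ≤ c₁ * A * D t ^ 2 := by
    intro g q hq hg
    have := abs_rpow_mul_le (r := -θ) (k := 2) (Y := 2 * Λ ^ 2 * D t ^ 2)
      (y := g * (g₁ t (q₁ t η) - g₂ t (q₂ t η))) (by linarith) (by push_cast; linarith) hΛ0 hη.1
      hη.2.le hq (by positivity) (by
        rw [abs_mul]
        refine (mul_le_mul hg bd (abs_nonneg _) ?_).trans (le_of_eq (by ring))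
        exact mul_nonneg hd (mul_nonneg hΛ0.le hη.1.le))
    rw [mul_assoc, mul_assoc, abs_mul, abs_of_pos hc₁, mul_assoc]
    refine mul_le_mul_of_nonneg_left (this.trans (le_of_eq ?_)) hc₁.le
    rw [hA]; ring
  have kB : ∀ g q : ℝ, Λ⁻¹ * η ≤ q → |g| ≤ D t * (Λ * η) →
      |-(c₁ * θ / 2) * q ^ (-θ - 1) * g ^ 2 * ((q₁ s η - q₂ s η) - (q₁ t η - q₂ t η))|
        ≤ c₁ * θ / 2 * B * D t ^ 2 := by
    intro g q hq hg
    have := abs_rpow_mul_le (r := -θ - 1) (k := 3) (Y := 2 * Λ ^ 3 * D t ^ 2)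
      (y := g ^ 2 * ((q₁ s η - q₂ s η) - (q₁ t η - q₂ t η))) (by linarith)
      (by push_cast; linarith) hΛ0 hη.1 hη.2.le hq (by positivity) (by
        rw [abs_mul, abs_pow]
        refine (mul_le_mul (pow_le_pow_left₀ (abs_nonneg _) hg 2) bq (abs_nonneg _)
          (by positivity)).trans (le_of_eq (by ring)))
    rw [mul_assoc, mul_assoc, abs_mul, abs_neg, abs_of_pos (a := c₁ * θ / 2) (by positivity),
      mul_assoc]
    refine mul_le_mul_of_nonneg_left (this.trans (le_of_eq ?_)) (by positivity)
    rw [hB]; ring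
  have l1 := h₁.le_flow hq₁ hη.1.le t
  have l2 := h₂.le_flow hq₂ hη.1.le t
  have a1 := kA _ _ l1 b1
  have a2 := kA _ _ l2 b2
  have a3 := kB _ _ l1 b1
  have a4 := kB _ _ l2 b2
  simp only [kineticDiff]
  rw [sub_mul, sub_mul]
  refine (abs_add_le _ _).trans ?_
  rw [abs_neg]
  refine (add_le_add (abs_sub _ _) (abs_sub _ _)).trans ?_
  linarith

theorem exists_abs_pressureDiff_le (h₁ : IsTransportField V T D g₁)
    (h₂ : IsTransportField V T D g₂) {γ : ℝ} (hγ : 0 < γ) :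
    ∃ C, 0 ≤ C ∧ ∀ t η,
      |flowJac g₁ q₁ t η ^ (-γ) - flowJac g₂ q₂ t η ^ (-γ)|
        ≤ C * |flowJac g₁ q₁ t η - flowJac g₂ q₂ t η| :=
  ⟨|-γ| * Real.exp (-∫ s, D s) ^ (-γ - 1), by positivity, fun t η =>
    abs_rpow_sub_rpow_le (by linarith) (Real.exp_pos _) (h₁.le_flowJac t η) (h₂.le_flowJac t η)⟩

theorem integrableOn_slab (hg : IsTransportField V T D g) {f : ℝ × ℝ → ℝ} (hf : Measurable f)
    {s C : ℝ} (hC : ∀ t η, t ∈ Ioo 0 s → η ∈ Ioo 0 V →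
      |f (t, η)| ≤ C * (1 + D t + D t ^ 2)) : IntegrableOn f (Ioo 0 s ×ˢ Ioo 0 V) := by
  have hS : MeasurableSet (Ioo 0 s ×ˢ Ioo 0 V : Set (ℝ × ℝ)) :=
    measurableSet_Ioo.prod measurableSet_Ioo
  have i0 : Integrable ((Ioo 0 s).indicator fun t => |C| * (1 + D t + D t ^ 2)) := by
    refine (integrable_indicator_iff measurableSet_Ioo).2 (Integrable.const_mul ?_ _)
    exact ((integrableOn_const measure_Ioo_lt_top.ne).add hg.integrable.integrableOn).add
      hg.integrable_sq.integrableOn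
  rw [← integrable_indicator_iff hS]
  have pos : ∀ t, 0 ≤ 1 + D t + D t ^ 2 := fun t => by
    have := hg.nonneg t
    positivity
  refine integrable_of_strip (V := V) (hf.indicator hS).aestronglyMeasurable i0 (fun t x => ?_)
    fun t x hx => indicator_of_notMem (fun hp => hx (Ioo_subset_Icc_self hp.2)) _
  by_cases hp : (t, x) ∈ (Ioo 0 s ×ˢ Ioo 0 V : Set (ℝ × ℝ))
  · rw [indicator_of_mem hp, indicator_of_mem hp.1]
    exact (hC t x hp.1 hp.2).trans (mul_le_mul_of_nonneg_right (le_abs_self C) (pos t))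
  · rw [indicator_of_notMem hp, abs_zero]
    exact indicator_nonneg (fun t _ => mul_nonneg (abs_nonneg C) (pos t)) t

theorem integrableOn_kineticDiff (h₁ : IsTransportField V T D g₁)
    (h₂ : IsTransportField V T D g₂) (hq₁ : IsFlowOf g₁ q₁) (hq₂ : IsFlowOf g₂ q₂) {c₁ θ : ℝ}
    (hc₁ : 0 < c₁) (hθ : 0 < θ) (hθ2 : θ < 2) {r : ℝ → ℝ} (hr : Measurable r) {B : ℝ}
    (hB : ∀ x, |r x| ≤ B) (s : ℝ) :
    IntegrableOn (fun p : ℝ × ℝ => r p.2 * kineticDiff c₁ θ g₁ q₁ g₂ q₂ s p)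
      (Ioo 0 s ×ˢ Ioo 0 V) := by
  obtain ⟨C, hC0, hC⟩ := h₁.exists_abs_kineticDiff_le h₂ hq₁ hq₂ hc₁ hθ hθ2
  have hB0 : 0 ≤ B := (abs_nonneg _).trans (hB 0)
  refine h₁.integrableOn_slab (C := B * C) ((hr.comp measurable_snd).mul
    (h₁.measurable_kineticDiff h₂ hq₁ hq₂ c₁ θ s)) fun t η _ hη => ?_
  change |r η * kineticDiff c₁ θ g₁ q₁ g₂ q₂ s (t, η)| ≤ _
  rw [abs_mul, mul_assoc]
  have hd := h₁.nonneg t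
  refine mul_le_mul (hB _) ((hC s t η hη).trans ?_) (abs_nonneg _) hB0
  exact mul_le_mul_of_nonneg_left (by linarith) hC0

theorem abs_jac_increment_le (h₁ : IsTransportField V T D g₁) (h₂ : IsTransportField V T D g₂)
    (s t η : ℝ) : |(flowJac g₁ q₁ s η - flowJac g₂ q₂ s η)
      - (flowJac g₁ q₁ t η - flowJac g₂ q₂ t η)| ≤ 2 * Real.exp (∫ s, D s) :=
  (abs_sub _ _).trans (by
    have := h₁.abs_flowJac_diff_le h₂ (q₁ := q₁) (q₂ := q₂) s η
    have := h₁.abs_flowJac_diff_le h₂ (q₁ := q₁) (q₂ := q₂) t η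
    linarith)

theorem integrableOn_pressureDiff (h₁ : IsTransportField V T D g₁)
    (h₂ : IsTransportField V T D g₂) (hq₁ : IsFlowOf g₁ q₁) (hq₂ : IsFlowOf g₂ q₂) {γ : ℝ}
    (hγ : 0 < γ) {r : ℝ → ℝ} (hr : Measurable r) {B : ℝ}
    (hB : ∀ x, |r x| ≤ B) (s : ℝ) :
    IntegrableOn (fun p : ℝ × ℝ => r p.2 * pressureDiff γ g₁ q₁ g₂ q₂ s p)
      (Ioo 0 s ×ˢ Ioo 0 V) := by
  obtain ⟨C, hC0, hC⟩ := h₁.exists_abs_pressureDiff_le h₂ (q₁ := q₁) (q₂ := q₂) hγ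
  set Λ := Real.exp (∫ s, D s) with hΛ
  have hΛ0 : 0 < Λ := Real.exp_pos _
  have hB0 : 0 ≤ B := (abs_nonneg _).trans (hB 0)
  refine h₁.integrableOn_slab (C := B * (C * Λ * (2 * Λ))) ((hr.comp measurable_snd).mul
    (h₁.measurable_pressureDiff h₂ hq₁ hq₂ γ s)) fun t η _ hη => ?_
  have hd := h₁.nonneg t
  have e1 : |r η * pressureDiff γ g₁ q₁ g₂ q₂ s (t, η)| ≤ B * (C * Λ * (2 * Λ)) := by
    rw [abs_mul, pressureDiff, abs_mul]
    refine mul_le_mul (hB _) (mul_le_mul ((hC t η).trans ?_) (h₁.abs_jac_increment_le h₂ s t η)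
      (abs_nonneg _) (by positivity)) (by positivity) hB0
    exact mul_le_mul_of_nonneg_left (h₁.abs_flowJac_diff_le h₂ t η) hC0
  refine e1.trans (le_mul_of_one_le_right (by positivity) ?_)
  nlinarith [sq_nonneg (D t)]

theorem integrableOn_viscousDiff (h₁ : IsTransportField V T D g₁)
    (h₂ : IsTransportField V T D g₂) (hq₁ : IsFlowOf g₁ q₁) (hq₂ : IsFlowOf g₂ q₂) (s : ℝ) :
    IntegrableOn (viscousDiff g₁ q₁ g₂ q₂ s) (Ioo 0 s ×ˢ Ioo 0 V) := by
  set Λ := Real.exp (∫ s, D s) with hΛ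
  have hΛ0 : 0 < Λ := Real.exp_pos _
  refine h₁.integrableOn_slab (C := 2 * (2 * Λ)) (h₁.measurable_viscousDiff h₂ hq₁ hq₂ s)
    fun t η _ hη => ?_
  have hd := h₁.nonneg t
  have e0 : |fieldDiv g₁ t (q₁ t η) - fieldDiv g₂ t (q₂ t η)| ≤ 2 * D t :=
    (abs_sub _ _).trans (by
      have := h₁.abs_fieldDiv_le t (q₁ t η)
      have := h₂.abs_fieldDiv_le t (q₂ t η)
      linarith)
  rw [viscousDiff, abs_mul]
  refine (mul_le_mul e0 (h₁.abs_jac_increment_le h₂ s t η) (abs_nonneg _)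
    (by positivity)).trans ?_
  nlinarith [sq_nonneg (D t)]

end IsTransportField

namespace IsVolumeSolution

variable {V T a γ ν c₁ θ : ℝ} {D : ℝ → ℝ} {g₁ g₂ ρ₁ ρ₂ q₁ q₂ : ℝ → ℝ → ℝ} {ρ₀ c₀ : ℝ → ℝ}

/-- The energy identity for the difference of two solutions with the same initial data. -/
theorem energy_identity (h₁ : IsVolumeSolution V T a γ ν c₁ θ D g₁ ρ₁ ρ₀ c₀)
    (h₂ : IsVolumeSolution V T a γ ν c₁ θ D g₂ ρ₂ ρ₀ c₀) (h₀ : IsVolumeData V ρ₀ c₀) (hT : 0 < T)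
    (ha : 0 < a) (hγ : 0 < γ) (hc₁ : 0 < c₁) (hθ : 0 < θ) (hθ2 : θ < 2)
    (hq₁ : IsFlowOf g₁ q₁) (hq₂ : IsFlowOf g₂ q₂) {s : ℝ} (hs0 : 0 ≤ s) (hs : s < T) :
    ∫ p in Ioo 0 s ×ˢ Ioo 0 V, (ρ₀ p.2 * kineticDiff c₁ θ g₁ q₁ g₂ q₂ s p
      + a * ρ₀ p.2 ^ γ * pressureDiff γ g₁ q₁ g₂ q₂ s p
      - ν * viscousDiff g₁ q₁ g₂ q₂ s p) = 0 := by
  have hg₁ := h₁.field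
  have hg₂ := h₂.field
  obtain ⟨B₀, hB₀⟩ := h₀.bdd
  have hr : ∀ x, |ρ₀ x| ≤ B₀ := fun x => by rw [abs_of_nonneg (h₀.nonneg x)]; exact hB₀ x
  have hr' : ∀ x, |a * ρ₀ x ^ γ| ≤ a * B₀ ^ γ := fun x => by
    rw [abs_of_nonneg (mul_nonneg ha.le (Real.rpow_nonneg (h₀.nonneg x) _))]
    exact mul_le_mul_of_nonneg_left (Real.rpow_le_rpow (h₀.nonneg x) (hB₀ x) hγ.le) ha.le
  have mr' : Measurable fun x => a * ρ₀ x ^ γ := measurable_const.mul (h₀.meas.pow_const γ)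
  have iK := hg₁.integrableOn_kineticDiff hg₂ hq₁ hq₂ hc₁ hθ hθ2 h₀.meas hr s
  have iP := hg₁.integrableOn_pressureDiff hg₂ hq₁ hq₂ hγ mr' hr' s
  have iV := (hg₁.integrableOn_viscousDiff hg₂ hq₁ hq₂ s).const_mul ν
  have iF := (iK.add iP).sub iV
  set Λ := Real.exp (∫ s, D s) with hΛ
  have hΛ0 : 0 < Λ := Real.exp_pos _
  set F : ℝ × ℝ → ℝ := fun p => ρ₀ p.2 * kineticDiff c₁ θ g₁ q₁ g₂ q₂ s p
      + a * ρ₀ p.2 ^ γ * pressureDiff γ g₁ q₁ g₂ q₂ s p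
      - ν * viscousDiff g₁ q₁ g₂ q₂ s p with hF
  -- The difference of the total stresses, which the derivative of the cutoff multiplies.
  set P : ℝ × ℝ → ℝ := fun p => a * ρ₀ p.2 ^ γ * (flowJac g₁ q₁ p.1 p.2 ^ (-γ)
      - flowJac g₂ q₂ p.1 p.2 ^ (-γ))
      - ν * (fieldDiv g₁ p.1 (q₁ p.1 p.2) - fieldDiv g₂ p.1 (q₂ p.1 p.2)) with hP
  have mP : Measurable P :=
    ((mr'.comp measurable_snd).mul (((hg₁.measurable_flowJac hq₁).pow_const _).sub
      ((hg₂.measurable_flowJac hq₂).pow_const _))).sub (measurable_const.mul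
      ((hg₁.measurable_fieldDiv_flow hq₁).sub (hg₂.measurable_fieldDiv_flow hq₂)))
  have iPP : IntegrableOn P (Ioo 0 s ×ˢ Ioo 0 V) := by
    obtain ⟨C, hC0, hC⟩ := hg₁.exists_abs_pressureDiff_le hg₂ (q₁ := q₁) (q₂ := q₂) hγ
    have hB0 : 0 ≤ a * B₀ ^ γ := (abs_nonneg _).trans (hr' 0)
    refine hg₁.integrableOn_slab (C := a * B₀ ^ γ * (C * Λ) + |ν| * 2) mP fun t η _ _ => ?_
    have hd := hg₁.nonneg t
    have e0 : |fieldDiv g₁ t (q₁ t η) - fieldDiv g₂ t (q₂ t η)| ≤ 2 * D t :=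
      (abs_sub _ _).trans (by
        have := hg₁.abs_fieldDiv_le t (q₁ t η)
        have := hg₂.abs_fieldDiv_le t (q₂ t η)
        linarith)
    have e1 : |P (t, η)| ≤ a * B₀ ^ γ * (C * Λ) + |ν| * (2 * D t) := by
      refine (abs_sub _ _).trans (add_le_add ?_ ?_)
      · rw [abs_mul]
        refine mul_le_mul (hr' η) ((hC t η).trans ?_) (abs_nonneg _) hB0
        exact mul_le_mul_of_nonneg_left (hg₁.abs_flowJac_diff_le hg₂ t η) hC0
      · rw [abs_mul]
        exact mul_le_mul_of_nonneg_left e0 (abs_nonneg _)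
    have f1 : 0 ≤ a * B₀ ^ γ * (C * Λ) := by positivity
    have f2 : 0 ≤ |ν| := abs_nonneg _
    refine e1.trans ?_
    nlinarith [mul_nonneg f1 hd, mul_nonneg f1 (sq_nonneg (D t)), mul_nonneg f2 (sq_nonneg (D t))]
  set dq : ℝ × ℝ → ℝ := fun p => (q₁ s p.2 - q₂ s p.2) - (q₁ p.1 p.2 - q₂ p.1 p.2) with hdq
  have hδ : ∀ n : ℕ, 0 < 1 / ((n : ℝ) + 1) := fun n => by positivity
  set Fn : ℕ → ℝ × ℝ → ℝ := fun n p => boundaryCutoff V (1 / ((n : ℝ) + 1)) p.2 * F p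
    + deriv (boundaryCutoff V (1 / ((n : ℝ) + 1))) p.2 * dq p * P p with hFn
  have hS : MeasurableSet (Ioo 0 s ×ˢ Ioo 0 V : Set (ℝ × ℝ)) :=
    measurableSet_Ioo.prod measurableSet_Ioo
  -- Both momentum balances are tested with the same localized difference of the flows; since the
  -- initial data agree, their contributions cancel on subtraction.
  have hzero : ∀ n, ∫ p in Ioo 0 s ×ˢ Ioo 0 V, Fn n p = 0 := fun n => by
    have hpt := hg₁.isPrimitiveTest_flow_diff hg₂ hq₁ hq₂ hs0 (hδ n)
    obtain ⟨j1, k1⟩ := h₁.momentum_flow h₀ hT ha hγ hc₁ hθ hq₁ hpt hs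
    obtain ⟨j2, k2⟩ := h₂.momentum_flow h₀ hT ha hγ hc₁ hθ hq₂ hpt hs
    have hsub := integral_sub j1 j2
    have hz := hsub.trans (by linarith : _ = (0 : ℝ))
    refine Eq.trans (setIntegral_congr_fun hS fun p hp => ?_) hz
    have e : max 0 (min p.1 s) = p.1 := by
      rw [min_eq_left hp.1.2.le, max_eq_right hp.1.1.le]
    have e' : max 0 (min s s) = s := by rw [min_self, max_eq_right hs0]
    simp only [e, e', indicator_of_mem hp.1, hFn, hF, hP, hdq, kineticDiff, pressureDiff,
      viscousDiff]
    ring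
  have hlim : Filter.Tendsto (fun n => ∫ p in Ioo 0 s ×ˢ Ioo 0 V, Fn n p) Filter.atTop
      (nhds (∫ p in Ioo 0 s ×ˢ Ioo 0 V, F p)) := by
    have mdq : Measurable dq :=
      (((hg₁.flow_continuous_space hq₁ s).measurable.comp measurable_snd).sub
        ((hg₂.flow_continuous_space hq₂ s).measurable.comp measurable_snd)).sub
        ((hg₁.flow_continuous hq₁).measurable.sub (hg₂.flow_continuous hq₂).measurable)
    refine tendsto_integral_of_dominated_convergence (fun p => |F p| + 4 * Λ * |P p|)
      (fun n => ?_) (iF.abs.add (iPP.abs.const_mul _)) (fun n => ?_) ?_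
    · refine AEStronglyMeasurable.add (AEStronglyMeasurable.mul ?_ iF.aestronglyMeasurable)
        ((((measurable_deriv _).comp measurable_snd).mul mdq).mul mP).aestronglyMeasurable
      exact ((boundaryCutoff.lipschitz (hδ n)).continuous.measurable.comp
        measurable_snd).aestronglyMeasurable
    · refine Filter.Eventually.of_forall fun p => ?_
      refine (norm_add_le _ _).trans (add_le_add ?_ ?_)
      · rw [norm_mul, Real.norm_of_nonneg (boundaryCutoff.nonneg _ _ _)]
        exact mul_le_of_le_one_left (abs_nonneg _) (boundaryCutoff.le_one _ _ _)
      · rw [norm_mul]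
        refine mul_le_mul_of_nonneg_right ?_ (abs_nonneg _)
        -- The increment `dq` is a difference of two differences of flows, so it obeys the linear
        -- bounds with 2Λ in place of Λ at both ends.
        rw [show 4 * Λ = 2 * (2 * Λ) by ring]
        refine boundaryCutoff.abs_deriv_mul_le (hδ n) (by positivity) (fun h => ?_) fun h => ?_
        · refine (abs_sub _ _).trans ?_
          have := hg₁.abs_flow_diff_le hg₂ hq₁ hq₂ h.1 s
          have := hg₁.abs_flow_diff_le hg₂ hq₁ hq₂ h.1 p.1
          linarith
        · refine (abs_sub _ _).trans ?_
          have := hg₁.abs_flow_diff_le' hg₂ hq₁ hq₂ h.2 s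
          have := hg₁.abs_flow_diff_le' hg₂ hq₁ hq₂ h.2 p.1
          linarith
    -- At a fixed interior label the cutoff is eventually 1 with zero derivative, so the sequence is
    -- eventually constant.
    · refine (ae_restrict_iff' hS).2 (Filter.Eventually.of_forall fun p hp => ?_)
      refine tendsto_const_nhds.congr' ?_
      have t1 : Filter.Tendsto (fun n : ℕ => 2 * (1 / ((n : ℝ) + 1))) Filter.atTop (nhds 0) := by
        simpa using tendsto_one_div_add_atTop_nhds_zero_nat.const_mul (2 : ℝ)
      filter_upwards [t1.eventually_lt_const hp.2.1,
        t1.eventually_lt_const (sub_pos.2 hp.2.2)] with n hn1 hn2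
      have hn3 : p.2 < V - 2 * (1 / ((n : ℝ) + 1)) := by linarith
      simp only [hFn]
      rw [boundaryCutoff.eq_one (hδ n) hn1.le hn3.le,
        boundaryCutoff.deriv_eq_zero_inside (hδ n) hn1 hn3]
      ring
  simp only [hzero] at hlim
  exact tendsto_nhds_unique hlim tendsto_const_nhds

end IsVolumeSolution

/-! ### Uniqueness in one space dimension -/

theorem ae_prod_of_ae_snd {P : ℝ → Prop} (h : ∀ᵐ η, P η) : ∀ᵐ p : ℝ × ℝ, P p.2 := by
  rw [Measure.volume_eq_prod]
  exact Measure.quasiMeasurePreserving_snd.ae h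

/-- Cauchy–Schwarz, by expanding the nonnegative square of f minus its mean. -/
theorem sq_integral_le_mul_integral_sq {f : ℝ → ℝ} {x : ℝ} (hx : 0 < x)
    (hf : IntervalIntegrable f volume 0 x) (hf2 : IntervalIntegrable (fun y => f y ^ 2) volume 0 x) :
    (∫ y in (0 : ℝ)..x, f y) ^ 2 ≤ x * ∫ y in (0 : ℝ)..x, f y ^ 2 := by
  set I := ∫ y in (0 : ℝ)..x, f y with hI
  set c := I / x with hc
  have h1 : 0 ≤ ∫ y in (0 : ℝ)..x, (f y ^ 2 - 2 * c * f y + c ^ 2) := by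
    refine intervalIntegral.integral_nonneg hx.le fun y _ => ?_
    nlinarith [sq_nonneg (f y - c)]
  rw [intervalIntegral.integral_add (hf2.sub (hf.const_mul _)) intervalIntegrable_const,
    intervalIntegral.integral_sub hf2 (hf.const_mul _), intervalIntegral.integral_const_mul,
    intervalIntegral.integral_const, ← hI, sub_zero, smul_eq_mul] at h1
  have h2 : c * x = I := div_mul_cancel₀ I hx.ne'
  have h3 := mul_nonneg hx.le h1
  nlinarith

/-! ### The distance between the Jacobians and what it controls. -/

namespace IsTransportField

variable {V T : ℝ} {D : ℝ → ℝ} {g g₁ g₂ q q₁ q₂ : ℝ → ℝ → ℝ}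

/-- The squared distance in `L²` of the Jacobians of two flows. -/
noncomputable def jacDist (V : ℝ) (g₁ q₁ g₂ q₂ : ℝ → ℝ → ℝ) (t : ℝ) : ℝ :=
  ∫ η in Ioo 0 V, (flowJac g₁ q₁ t η - flowJac g₂ q₂ t η) ^ 2

theorem measurable_flowJac_slice (hg : IsTransportField V T D g) (hq : IsFlowOf g q) (t : ℝ) :
    Measurable (flowJac g q t) :=
  Measurable.comp (g := fun p : ℝ × ℝ => flowJac g q p.1 p.2) (f := fun η : ℝ => (t, η))
    (hg.measurable_flowJac hq) (measurable_const.prodMk measurable_id)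

theorem sq_jac_diff_le (h₁ : IsTransportField V T D g₁) (h₂ : IsTransportField V T D g₂)
    (t η : ℝ) : (flowJac g₁ q₁ t η - flowJac g₂ q₂ t η) ^ 2 ≤ Real.exp (∫ s, D s) ^ 2 := by
  rw [← sq_abs]
  exact pow_le_pow_left₀ (abs_nonneg _) (h₁.abs_flowJac_diff_le h₂ t η) 2

theorem integrableOn_sq_jac_diff (h₁ : IsTransportField V T D g₁)
    (h₂ : IsTransportField V T D g₂) (hq₁ : IsFlowOf g₁ q₁) (hq₂ : IsFlowOf g₂ q₂) (t : ℝ) :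
    IntegrableOn (fun η => (flowJac g₁ q₁ t η - flowJac g₂ q₂ t η) ^ 2) (Ioo 0 V) :=
  IntegrableOn.of_bound measure_Ioo_lt_top (((h₁.measurable_flowJac_slice hq₁ t).sub
    (h₂.measurable_flowJac_slice hq₂ t)).pow_const 2).aestronglyMeasurable
    (Real.exp (∫ s, D s) ^ 2) (Filter.Eventually.of_forall fun η => by
      rw [Real.norm_of_nonneg (sq_nonneg _)]
      exact h₁.sq_jac_diff_le h₂ t η)

theorem jacDist_le (h₁ : IsTransportField V T D g₁) (h₂ : IsTransportField V T D g₂)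
    (hq₁ : IsFlowOf g₁ q₁) (hq₂ : IsFlowOf g₂ q₂) (t : ℝ) :
    jacDist V g₁ q₁ g₂ q₂ t ≤ Real.exp (∫ s, D s) ^ 2 * V := by
  have := setIntegral_mono (h₁.integrableOn_sq_jac_diff h₂ hq₁ hq₂ t)
    (integrableOn_const (measure_Ioo_lt_top.ne) (C := Real.exp (∫ s, D s) ^ 2))
    fun η => h₁.sq_jac_diff_le h₂ t η
  refine this.trans (le_of_eq ?_)
  rw [setIntegral_const, Real.volume_real_Ioo_of_le h₁.pos.le, smul_eq_mul]
  ring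

theorem jacDist_nonneg (V : ℝ) (g₁ q₁ g₂ q₂ : ℝ → ℝ → ℝ) (t : ℝ) : 0 ≤ jacDist V g₁ q₁ g₂ q₂ t :=
  MeasureTheory.integral_nonneg fun _ => sq_nonneg _

/-- The difference of the flows vanishes at the center and has label derivative J₁ - J₂, so
Cauchy–Schwarz applies on (0,η). The gained factor η reduces the weight η^(-θ) of the kinetic terms
to η^(1-θ). -/
theorem sq_flow_diff_le (h₁ : IsTransportField V T D g₁) (h₂ : IsTransportField V T D g₂)
    (hq₁ : IsFlowOf g₁ q₁) (hq₂ : IsFlowOf g₂ q₂) (t : ℝ) {η : ℝ} (hη : η ∈ Ioo 0 V) :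
    (q₁ t η - q₂ t η) ^ 2 ≤ η * jacDist V g₁ q₁ g₂ q₂ t := by
  have hac := (h₁.flow_ac_space hq₁ t).sub (h₂.flow_ac_space hq₂ t)
  have hI := hac.integral_eq 0 η
  rw [h₁.flow_of_nonpos hq₁ le_rfl, h₂.flow_of_nonpos hq₂ le_rfl, sub_self, sub_zero] at hI
  have h2 : IntegrableOn (fun η => (flowJac g₁ q₁ t η - flowJac g₂ q₂ t η) ^ 2) (Ioc 0 η) :=
    (h₁.integrableOn_sq_jac_diff h₂ hq₁ hq₂ t).mono_set fun x hx =>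
      ⟨hx.1, hx.2.trans_lt hη.2⟩
  rw [← hI]
  refine (sq_integral_le_mul_integral_sq hη.1 (hac.intervalIntegrable 0 η)
    ((intervalIntegrable_iff_integrableOn_Ioc_of_le hη.1.le).2 h2)).trans ?_
  refine mul_le_mul_of_nonneg_left ?_ hη.1.le
  rw [intervalIntegral.integral_of_le hη.1.le]
  exact setIntegral_mono_set (h₁.integrableOn_sq_jac_diff h₂ hq₁ hq₂ t)
    (Filter.Eventually.of_forall fun _ => sq_nonneg _)
    (Filter.Eventually.of_forall fun x hx => ⟨hx.1, hx.2.trans_lt hη.2⟩)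

theorem flow_eq_of_jacDist_eq_zero (h₁ : IsTransportField V T D g₁)
    (h₂ : IsTransportField V T D g₂) (hq₁ : IsFlowOf g₁ q₁) (hq₂ : IsFlowOf g₂ q₂) {t : ℝ}
    (h : jacDist V g₁ q₁ g₂ q₂ t = 0) (η : ℝ) : q₁ t η = q₂ t η := by
  rcases le_or_gt η 0 with h0 | h0
  · rw [h₁.flow_of_nonpos hq₁ h0, h₂.flow_of_nonpos hq₂ h0]
  rcases le_or_gt V η with hV | hV
  · rw [h₁.flow_of_ge hq₁ hV, h₂.flow_of_ge hq₂ hV]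
  have := h₁.sq_flow_diff_le h₂ hq₁ hq₂ t (η := η) ⟨h0, hV⟩
  rw [h, mul_zero] at this
  exact sub_eq_zero.1 (pow_eq_zero_iff (two_ne_zero) |>.1 (le_antisymm this (sq_nonneg _)))

/-- A field along its flow is the time derivative of the trajectories, and trajectories that agree
on an interval have the same derivative in its interior. The endpoint s is negligible. -/
theorem ae_field_eq (h₁ : IsTransportField V T D g₁) (h₂ : IsTransportField V T D g₂)
    (hq₁ : IsFlowOf g₁ q₁) (hq₂ : IsFlowOf g₂ q₂) {s : ℝ}
    (h : ∀ t ∈ Ico 0 s, ∀ η, q₁ t η = q₂ t η) :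
    ∀ᵐ p : ℝ × ℝ, p.1 ∈ Ioc 0 s → g₁ p.1 (q₁ p.1 p.2) = g₂ p.1 (q₂ p.1 p.2) := by
  have hm : MeasurableSet {p : ℝ × ℝ |
      p.1 ∈ Ioc 0 s → g₁ p.1 (q₁ p.1 p.2) = g₂ p.1 (q₂ p.1 p.2)} := by
    simp only [imp_iff_not_or]
    exact (measurable_fst measurableSet_Ioc).compl.union
      (measurableSet_eq_fun (h₁.measurable_field_flow hq₁) (h₂.measurable_field_flow hq₂))
  rw [Measure.volume_eq_prod, Measure.ae_prod_iff_ae_ae hm,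
    Measure.ae_ae_comm (p := fun t η => t ∈ Ioc 0 s → g₁ t (q₁ t η) = g₂ t (q₂ t η)) hm]
  refine Filter.Eventually.of_forall fun η => ?_
  filter_upwards [(h₁.flow_ac hq₁ η).ae_deriv, (h₂.flow_ac hq₂ η).ae_deriv,
    Measure.ae_ne volume s] with t ht₁ ht₂ hts ht
  have hto : t ∈ Ioo 0 s := ⟨ht.1, lt_of_le_of_ne ht.2 hts⟩
  refine ht₁.unique (ht₂.congr_of_eventuallyEq ?_)
  filter_upwards [Ioo_mem_nhds hto.1 hto.2] with x hx using h x ⟨hx.1.le, hx.2⟩ η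

/-- The Jacobians are derivatives of one and the same map of the label, off a null set that serves
all times. -/
theorem ae_flowJac_eq (h₁ : IsTransportField V T D g₁) (h₂ : IsTransportField V T D g₂)
    (hq₁ : IsFlowOf g₁ q₁) (hq₂ : IsFlowOf g₂ q₂) {I : Set ℝ}
    (h : ∀ t ∈ I, ∀ η, q₁ t η = q₂ t η) :
    ∀ᵐ η, ∀ t ∈ I, flowJac g₁ q₁ t η = flowJac g₂ q₂ t η := by
  filter_upwards [h₁.ae_hasDerivAt_flow hq₁, h₂.ae_hasDerivAt_flow hq₂] with η e₁ e₂ t ht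
  have : q₁ t = q₂ t := funext (h t ht)
  exact (e₁ t).unique (this ▸ e₂ t)

/-- The remainder in the viscous part of the energy identity. -/
noncomputable def viscousRem (g₁ q₁ g₂ q₂ : ℝ → ℝ → ℝ) (p : ℝ × ℝ) : ℝ :=
  logJacDiff g₁ q₁ g₂ q₂ p.1 p.2 * (flowJac g₁ q₁ p.1 p.2 - flowJac g₂ q₂ p.1 p.2)
      * fieldDiv g₂ p.1 (q₂ p.1 p.2)
    - 1 / 2 * flowJac g₁ q₁ p.1 p.2 * fieldDiv g₁ p.1 (q₁ p.1 p.2)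
      * logJacDiff g₁ q₁ g₂ q₂ p.1 p.2 ^ 2

theorem measurable_viscousRem (h₁ : IsTransportField V T D g₁) (h₂ : IsTransportField V T D g₂)
    (hq₁ : IsFlowOf g₁ q₁) (hq₂ : IsFlowOf g₂ q₂) : Measurable (viscousRem g₁ q₁ g₂ q₂) := by
  have hL : Measurable fun p : ℝ × ℝ => logJacDiff g₁ q₁ g₂ q₂ p.1 p.2 := by
    have : (fun p : ℝ × ℝ => logJacDiff g₁ q₁ g₂ q₂ p.1 p.2)
        = fun p => Real.log (flowJac g₁ q₁ p.1 p.2) - Real.log (flowJac g₂ q₂ p.1 p.2) := by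
      funext p
      simp only [flowJac, Real.log_exp, logJacDiff]
    rw [this]
    exact (Real.measurable_log.comp (h₁.measurable_flowJac hq₁)).sub
      (Real.measurable_log.comp (h₂.measurable_flowJac hq₂))
  exact ((hL.mul ((h₁.measurable_flowJac hq₁).sub (h₂.measurable_flowJac hq₂))).mul
    (h₂.measurable_fieldDiv_flow hq₂)).sub
    (((measurable_const.mul (h₁.measurable_flowJac hq₁)).mul
      (h₁.measurable_fieldDiv_flow hq₁)).mul (hL.pow_const 2))

theorem abs_viscousRem_le (h₁ : IsTransportField V T D g₁) (h₂ : IsTransportField V T D g₂)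
    (p : ℝ × ℝ) : |viscousRem g₁ q₁ g₂ q₂ p|
      ≤ (Real.exp (∫ s, D s) + Real.exp (∫ s, D s) ^ 3) * D p.1
        * (flowJac g₁ q₁ p.1 p.2 - flowJac g₂ q₂ p.1 p.2) ^ 2 := by
  set Λ := Real.exp (∫ s, D s) with hΛ
  have hΛ0 : 0 < Λ := Real.exp_pos _
  have hd := h₁.nonneg p.1
  set x := |flowJac g₁ q₁ p.1 p.2 - flowJac g₂ q₂ p.1 p.2| with hx
  have hx0 : 0 ≤ x := abs_nonneg _
  have hL : |logJacDiff g₁ q₁ g₂ q₂ p.1 p.2| ≤ Λ * x := h₁.abs_logJacDiff_le h₂ p.1 p.2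
  have hJ0 := flowJac_pos g₁ q₁ p.1 p.2
  have hJ : flowJac g₁ q₁ p.1 p.2 ≤ Λ := h₁.flowJac_le p.1 p.2
  have e1 : |logJacDiff g₁ q₁ g₂ q₂ p.1 p.2 * (flowJac g₁ q₁ p.1 p.2 - flowJac g₂ q₂ p.1 p.2)
      * fieldDiv g₂ p.1 (q₂ p.1 p.2)| ≤ Λ * x * x * D p.1 := by
    rw [abs_mul, abs_mul]
    exact mul_le_mul (mul_le_mul_of_nonneg_right hL hx0) (h₂.abs_fieldDiv_le _ _) (abs_nonneg _)
      (by positivity)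
  have e2 : |1 / 2 * flowJac g₁ q₁ p.1 p.2 * fieldDiv g₁ p.1 (q₁ p.1 p.2)
      * logJacDiff g₁ q₁ g₂ q₂ p.1 p.2 ^ 2| ≤ 1 / 2 * Λ * D p.1 * (Λ * x) ^ 2 := by
    rw [abs_mul, abs_mul, abs_mul, abs_of_pos hJ0, abs_of_pos (a := (1 / 2 : ℝ)) (by norm_num),
      abs_pow]
    exact mul_le_mul (mul_le_mul (mul_le_mul_of_nonneg_left hJ (by norm_num))
      (h₁.abs_fieldDiv_le _ _) (abs_nonneg _) (by positivity))
      (pow_le_pow_left₀ (abs_nonneg _) hL 2) (by positivity) (by positivity)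
  rw [← sq_abs (flowJac g₁ q₁ p.1 p.2 - flowJac g₂ q₂ p.1 p.2), ← hx]
  refine (abs_sub _ _).trans ((add_le_add e1 e2).trans ?_)
  nlinarith [mul_nonneg (mul_nonneg (pow_pos hΛ0 3).le hd) (sq_nonneg x)]

theorem integrableOn_viscousRem (h₁ : IsTransportField V T D g₁)
    (h₂ : IsTransportField V T D g₂) (hq₁ : IsFlowOf g₁ q₁) (hq₂ : IsFlowOf g₂ q₂) (s : ℝ) :
    IntegrableOn (viscousRem g₁ q₁ g₂ q₂) (Ioo 0 s ×ˢ Ioo 0 V) := by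
  set Λ := Real.exp (∫ s, D s) with hΛ
  have hΛ0 : 0 < Λ := Real.exp_pos _
  refine h₁.integrableOn_slab (C := (Λ + Λ ^ 3) * Λ ^ 2) (h₁.measurable_viscousRem h₂ hq₁ hq₂)
    fun t η _ _ => ?_
  have hd := h₁.nonneg t
  refine (h₁.abs_viscousRem_le h₂ (t, η)).trans ?_
  rw [← hΛ, mul_assoc, mul_assoc]
  refine mul_le_mul_of_nonneg_left ?_ (by positivity)
  rw [mul_comm]
  exact mul_le_mul (h₁.sq_jac_diff_le h₂ t η) (by nlinarith [sq_nonneg (D t)]) hd (by positivity)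

/-- Coercivity of the viscous part. On each label `integral_viscous` gives ½J₁L² at time s, and J₁ ≥
m and |L| ≥ m|J₁ - J₂| with m = exp(-∫D) produce the constant m³/2; Fubini collects the labels. -/
theorem le_integral_viscous (h₁ : IsTransportField V T D g₁) (h₂ : IsTransportField V T D g₂)
    (hq₁ : IsFlowOf g₁ q₁) (hq₂ : IsFlowOf g₂ q₂) {s : ℝ} (hs : 0 ≤ s) :
    1 / 2 * Real.exp (-∫ s, D s) ^ 3 * jacDist V g₁ q₁ g₂ q₂ s
      ≤ ∫ p in Ioo 0 s ×ˢ Ioo 0 V, (viscousDiff g₁ q₁ g₂ q₂ s p - viscousRem g₁ q₁ g₂ q₂ p) := by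
  have hi := (h₁.integrableOn_viscousDiff h₂ hq₁ hq₂ s).sub
    (h₁.integrableOn_viscousRem h₂ hq₁ hq₂ s)
  set m := Real.exp (-∫ s, D s) with hm
  have hm0 : 0 < m := Real.exp_pos _
  have hmΛ : m * Real.exp (∫ s, D s) = 1 := by rw [hm, ← Real.exp_add]; simp
  have key : ∀ η, ∫ t in Ioo 0 s, (viscousDiff g₁ q₁ g₂ q₂ s (t, η) - viscousRem g₁ q₁ g₂ q₂ (t, η))
      = 1 / 2 * flowJac g₁ q₁ s η * logJacDiff g₁ q₁ g₂ q₂ s η ^ 2 := fun η => by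
    rw [← integral_Ioc_eq_integral_Ioo, ← intervalIntegral.integral_of_le hs]
    exact h₁.integral_viscous h₂ hq₁ hq₂ s η
  rw [IntegrableOn, Measure.volume_eq_prod, ← Measure.prod_restrict] at hi
  have hri := hi.integral_prod_right
  rw [Measure.volume_eq_prod, ← Measure.prod_restrict]
  refine le_trans ?_ (integral_prod_symm _ hi).symm.le
  simp only [Pi.sub_apply, key] at hri ⊢
  rw [jacDist, ← integral_const_mul]
  refine setIntegral_mono ((h₁.integrableOn_sq_jac_diff h₂ hq₁ hq₂ s).const_mul _) hri fun η => ?_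
  have a1 := h₁.abs_flowJac_diff_le_log h₂ (q₁ := q₁) (q₂ := q₂) s η
  have a2 : m * |flowJac g₁ q₁ s η - flowJac g₂ q₂ s η| ≤ |logJacDiff g₁ q₁ g₂ q₂ s η| := by
    have := mul_le_mul_of_nonneg_left a1 hm0.le
    rwa [← mul_assoc, hmΛ, one_mul] at this
  have a3 := pow_le_pow_left₀ (by positivity) a2 2
  rw [mul_pow, sq_abs, sq_abs] at a3
  have a4 : m ≤ flowJac g₁ q₁ s η := h₁.le_flowJac s η
  have a5 := mul_le_mul a4 a3 (by positivity) (hm0.le.trans a4)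
  simp only
  linarith

end IsTransportField

/-! ### The Grönwall argument. -/

namespace IsVolumeSolution

variable {V T a γ ν c₁ θ : ℝ} {D : ℝ → ℝ} {g₁ g₂ ρ₁ ρ₂ q₁ q₂ : ℝ → ℝ → ℝ} {ρ₀ c₀ : ℝ → ℝ}

open IsTransportField in
/-- The pointwise bound of the lower order terms of the energy identity. -/
theorem exists_integrand_le (h₁ : IsVolumeSolution V T a γ ν c₁ θ D g₁ ρ₁ ρ₀ c₀)
    (h₂ : IsVolumeSolution V T a γ ν c₁ θ D g₂ ρ₂ ρ₀ c₀) (h₀ : IsVolumeData V ρ₀ c₀)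
    (ha : 0 < a) (hγ : 0 < γ) (hν : 0 < ν) (hc₁ : 0 < c₁) (hθ : 0 < θ)
    (hq₁ : IsFlowOf g₁ q₁) (hq₂ : IsFlowOf g₂ q₂) :
    ∃ C, 0 ≤ C ∧ ∀ s t η Y : ℝ, η ∈ Ioo 0 V → jacDist V g₁ q₁ g₂ q₂ t ≤ Y →
      jacDist V g₁ q₁ g₂ q₂ s ≤ Y →
      ρ₀ η * kineticDiff c₁ θ g₁ q₁ g₂ q₂ s (t, η)
        + a * ρ₀ η ^ γ * pressureDiff γ g₁ q₁ g₂ q₂ s (t, η)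
        - ν * viscousRem g₁ q₁ g₂ q₂ (t, η)
      ≤ C * ((1 + D t + D t ^ 2) * (η ^ (1 - θ) * Y
        + (flowJac g₁ q₁ s η - flowJac g₂ q₂ s η) ^ 2)
        + (1 + D t + D t ^ 2) * (flowJac g₁ q₁ t η - flowJac g₂ q₂ t η) ^ 2) := by
  have hg₁ := h₁.field
  have hg₂ := h₂.field
  obtain ⟨B₀, hB₀⟩ := h₀.bdd
  have hB : 0 ≤ B₀ := (h₀.nonneg 0).trans (hB₀ 0)
  have hr' : ∀ x, |a * ρ₀ x ^ γ| ≤ a * B₀ ^ γ := fun x => by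
    rw [abs_of_nonneg (mul_nonneg ha.le (Real.rpow_nonneg (h₀.nonneg x) _))]
    exact mul_le_mul_of_nonneg_left (Real.rpow_le_rpow (h₀.nonneg x) (hB₀ x) hγ.le) ha.le
  set Λ := Real.exp (∫ s, D s) with hΛ
  have hΛ0 : 0 < Λ := Real.exp_pos _
  obtain ⟨CK, hCK0, hCK⟩ := exists_kinetic_bound hc₁ hθ hΛ0
  obtain ⟨CP, hCP0, hCP⟩ := hg₁.exists_abs_pressureDiff_le hg₂ (q₁ := q₁) (q₂ := q₂) hγ
  refine ⟨2 * (B₀ * CK) + 2 * (a * B₀ ^ γ * CP) + ν * (Λ + Λ ^ 3), by positivity,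
    fun s t η Y hη hYt hYs => ?_⟩
  have hd := hg₁.nonneg t
  have hY0 : 0 ≤ Y := (jacDist_nonneg V g₁ q₁ g₂ q₂ s).trans hYs
  have hη' : 0 < η := hη.1
  have hw1 : 0 ≤ η ^ (1 - θ) := Real.rpow_nonneg hη'.le _
  set x := (flowJac g₁ q₁ t η - flowJac g₂ q₂ t η) with hx
  set X := (flowJac g₁ q₁ s η - flowJac g₂ q₂ s η) with hX
  -- One weight dominates the constant from the pressure, D from the viscous remainder and D² from
  -- the kinetic terms.
  obtain ⟨m, hm⟩ : ∃ m, m = 1 + D t + D t ^ 2 := ⟨_, rfl⟩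
  have u1 : 1 ≤ m := by rw [hm]; linarith [sq_nonneg (D t)]
  have u2 : D t ≤ m := by rw [hm]; linarith [sq_nonneg (D t)]
  have u0 : D t ^ 2 ≤ m := by rw [hm]; linarith
  have hmt : 0 ≤ m := zero_le_one.trans u1
  rw [← hm]
  have k1 : kineticDiff c₁ θ g₁ q₁ g₂ q₂ s (t, η) ≤ CK * m * (2 * (η ^ (1 - θ) * Y)) := by
    refine (hCK η (q₁ t η) (q₂ t η) (g₁ t (q₁ t η)) (g₂ t (q₂ t η)) (q₁ s η - q₂ s η) (D t) hη'
      hd (hg₁.le_flow hq₁ hη'.le t) (hg₂.le_flow hq₂ hη'.le t) (hg₁.flow_le hq₁ hη'.le t)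
      (hg₁.abs_field_flow_le hq₁ hη'.le t) (hg₂.abs_field_flow_le hq₂ hη'.le t)).trans ?_
    have a1 := (hg₁.sq_flow_diff_le hg₂ hq₁ hq₂ t hη).trans
      (mul_le_mul_of_nonneg_left hYt hη'.le)
    have a2 := (hg₁.sq_flow_diff_le hg₂ hq₁ hq₂ s hη).trans
      (mul_le_mul_of_nonneg_left hYs hη'.le)
    have a3 : η ^ (1 - θ) = η ^ (-θ) * η := by
      rw [show 1 - θ = -θ + 1 by ring, Real.rpow_add hη', Real.rpow_one]
    rw [a3]
    have a5 : 0 ≤ η ^ (-θ) := Real.rpow_nonneg hη'.le _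
    calc _ ≤ CK * (η ^ (-θ) * D t ^ 2) * (2 * (η * Y)) :=
          mul_le_mul_of_nonneg_left (by linarith) (by positivity)
      _ = (CK * η ^ (-θ) * (2 * (η * Y))) * D t ^ 2 := by ring
      _ ≤ (CK * η ^ (-θ) * (2 * (η * Y))) * m :=
          mul_le_mul_of_nonneg_left u0 (by positivity)
      _ = _ := by ring
  have k2 : ρ₀ η * kineticDiff c₁ θ g₁ q₁ g₂ q₂ s (t, η)
      ≤ 2 * (B₀ * CK) * (m * (η ^ (1 - θ) * Y)) := by
    refine (mul_le_mul_of_nonneg_left k1 (h₀.nonneg η)).trans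
      ((mul_le_mul_of_nonneg_right (hB₀ η) (by positivity)).trans (le_of_eq (by ring)))
  have k3 : a * ρ₀ η ^ γ * pressureDiff γ g₁ q₁ g₂ q₂ s (t, η)
      ≤ 2 * (a * B₀ ^ γ * CP) * (x ^ 2 + X ^ 2) := by
    refine (le_abs_self _).trans ?_
    have a0 : |pressureDiff γ g₁ q₁ g₂ q₂ s (t, η)|
        = |flowJac g₁ q₁ t η ^ (-γ) - flowJac g₂ q₂ t η ^ (-γ)| * |X - x| := abs_mul _ _
    have a1 : |X - x| ≤ |X| + |x| := abs_sub _ _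
    have a2 : |x| * (|X| + |x|) ≤ 2 * (x ^ 2 + X ^ 2) := by
      nlinarith [sq_nonneg (|X| - |x|), sq_abs x, sq_abs X]
    rw [abs_mul (a * ρ₀ η ^ γ), a0]
    calc _ ≤ a * B₀ ^ γ * (CP * |x| * (|X| + |x|)) :=
          mul_le_mul (hr' η) (mul_le_mul (hCP t η) a1 (abs_nonneg _) (by positivity))
            (by positivity) (by positivity)
      _ = a * B₀ ^ γ * CP * (|x| * (|X| + |x|)) := by ring
      _ ≤ a * B₀ ^ γ * CP * (2 * (x ^ 2 + X ^ 2)) :=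
          mul_le_mul_of_nonneg_left a2 (by positivity)
      _ = _ := by ring
  have k4 : -(ν * viscousRem g₁ q₁ g₂ q₂ (t, η)) ≤ ν * (Λ + Λ ^ 3) * (D t * x ^ 2) := by
    have a1 := hg₁.abs_viscousRem_le hg₂ (q₁ := q₁) (q₂ := q₂) (t, η)
    have a2 := mul_le_mul_of_nonneg_left ((neg_le_abs _).trans a1) hν.le
    rw [mul_neg] at a2
    refine a2.trans (le_of_eq ?_)
    simp only [hΛ, hx]
    ring
  have n1 : 0 ≤ 2 * (B₀ * CK) := by positivity
  have n2 : 0 ≤ 2 * (a * B₀ ^ γ * CP) := by positivity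
  have n3 : 0 ≤ ν * (Λ + Λ ^ 3) := by positivity
  have p0 : 0 ≤ m * (η ^ (1 - θ) * Y) := by positivity
  have p1 : 0 ≤ m * x ^ 2 := by positivity
  have p2 : 0 ≤ m * X ^ 2 := by positivity
  have u3 : x ^ 2 + X ^ 2 ≤ m * (x ^ 2 + X ^ 2) := le_mul_of_one_le_left (by positivity) u1
  have u4 : D t * x ^ 2 ≤ m * x ^ 2 := mul_le_mul_of_nonneg_right u2 (sq_nonneg _)
  have w1 := mul_le_mul_of_nonneg_left
    (show m * (η ^ (1 - θ) * Y) ≤ m * (η ^ (1 - θ) * Y + X ^ 2) + m * x ^ 2 by linarith) n1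
  have w2 := mul_le_mul_of_nonneg_left
    (show x ^ 2 + X ^ 2 ≤ m * (η ^ (1 - θ) * Y + X ^ 2) + m * x ^ 2 by linarith) n2
  have w3 := mul_le_mul_of_nonneg_left
    (show D t * x ^ 2 ≤ m * (η ^ (1 - θ) * Y + X ^ 2) + m * x ^ 2 by linarith) n3
  rw [add_mul, add_mul]
  linarith

open IsTransportField in
/-- If two flows coincide up to the time `s₀`, their distance at a later time `s` is controlled by
their distances on `[s₀, s]`. -/
theorem exists_jacDist_le (h₁ : IsVolumeSolution V T a γ ν c₁ θ D g₁ ρ₁ ρ₀ c₀)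
    (h₂ : IsVolumeSolution V T a γ ν c₁ θ D g₂ ρ₂ ρ₀ c₀) (h₀ : IsVolumeData V ρ₀ c₀) (hT : 0 < T)
    (ha : 0 < a) (hγ : 0 < γ) (hν : 0 < ν) (hc₁ : 0 < c₁) (hθ : 0 < θ) (hθ2 : θ < 2)
    (hq₁ : IsFlowOf g₁ q₁) (hq₂ : IsFlowOf g₂ q₂) :
    ∃ C, 0 ≤ C ∧ ∀ s₀ s Y : ℝ, 0 ≤ s₀ → s₀ ≤ s → s < T →
      (∀ t ∈ Icc 0 s₀, ∀ η, q₁ t η = q₂ t η) →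
      (∀ t ∈ Icc s₀ s, jacDist V g₁ q₁ g₂ q₂ t ≤ Y) →
      jacDist V g₁ q₁ g₂ q₂ s ≤ C * (∫ t in s₀..s, (1 + D t + D t ^ 2)) * Y := by
  have hg₁ := h₁.field
  have hg₂ := h₂.field
  obtain ⟨B₀, hB₀⟩ := h₀.bdd
  have hB : 0 ≤ B₀ := (h₀.nonneg 0).trans (hB₀ 0)
  set Λ := Real.exp (∫ s, D s) with hΛ
  have hΛ0 : 0 < Λ := Real.exp_pos _
  obtain ⟨C', hC'0, hC'⟩ := h₁.exists_integrand_le h₂ h₀ ha hγ hν hc₁ hθ hq₁ hq₂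
  set W := ∫ η in Ioo 0 V, η ^ (1 - θ) with hW
  have hW0 : 0 ≤ W := setIntegral_nonneg measurableSet_Ioo fun η hη => Real.rpow_nonneg hη.1.le _
  -- The exponent 1 - θ exceeds -1 exactly because θ < 2.
  have hWi : IntegrableOn (fun η : ℝ => η ^ (1 - θ)) (Ioo 0 V) :=
    ((intervalIntegrable_iff_integrableOn_Ioc_of_le hg₁.pos.le).1
      (intervalIntegral.intervalIntegrable_rpow' (by linarith))).mono_set Ioo_subset_Ioc_self
  set m := Real.exp (-∫ s, D s) with hm
  have hm0 : 0 < m := Real.exp_pos _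
  set κ := ν * (1 / 2 * m ^ 3) with hκ
  have hκ0 : 0 < κ := by positivity
  refine ⟨C' * (W + 2) / κ, by positivity, fun s₀ s Y hs₀ hss hsT heq hY => ?_⟩
  have hs : 0 ≤ s := hs₀.trans hss
  have hY0 : 0 ≤ Y := (jacDist_nonneg V g₁ q₁ g₂ q₂ s).trans (hY s ⟨hss, le_rfl⟩)
  have hr : ∀ x, |ρ₀ x| ≤ B₀ := fun x => by rw [abs_of_nonneg (h₀.nonneg x)]; exact hB₀ x
  have hr' : ∀ x, |a * ρ₀ x ^ γ| ≤ a * B₀ ^ γ := fun x => by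
    rw [abs_of_nonneg (mul_nonneg ha.le (Real.rpow_nonneg (h₀.nonneg x) _))]
    exact mul_le_mul_of_nonneg_left (Real.rpow_le_rpow (h₀.nonneg x) (hB₀ x) hγ.le) ha.le
  have mr' : Measurable fun x => a * ρ₀ x ^ γ := measurable_const.mul (h₀.meas.pow_const γ)
  have iK := hg₁.integrableOn_kineticDiff hg₂ hq₁ hq₂ hc₁ hθ hθ2 h₀.meas hr s
  have iP := hg₁.integrableOn_pressureDiff hg₂ hq₁ hq₂ hγ mr' hr' s
  have iV := (hg₁.integrableOn_viscousDiff hg₂ hq₁ hq₂ s).const_mul ν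
  have iR := (hg₁.integrableOn_viscousRem hg₂ hq₁ hq₂ s).const_mul ν
  set S : Set (ℝ × ℝ) := Ioo 0 s ×ˢ Ioo 0 V with hS
  set S' : Set (ℝ × ℝ) := Ioo s₀ s ×ˢ Ioo 0 V with hS'
  have hSS' : S' ⊆ S := prod_mono (Ioo_subset_Ioo_left hs₀) subset_rfl
  have hSm : MeasurableSet S := measurableSet_Ioo.prod measurableSet_Ioo
  have hSm' : MeasurableSet S' := measurableSet_Ioo.prod measurableSet_Ioo
  set F : ℝ × ℝ → ℝ := fun p => ρ₀ p.2 * kineticDiff c₁ θ g₁ q₁ g₂ q₂ s p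
    + a * ρ₀ p.2 ^ γ * pressureDiff γ g₁ q₁ g₂ q₂ s p - ν * viscousRem g₁ q₁ g₂ q₂ p with hF
  have iF : IntegrableOn F S := (iK.add iP).sub iR
  have hE := h₁.energy_identity h₂ h₀ hT ha hγ hc₁ hθ hθ2 hq₁ hq₂ hs hsT
  have hvis := hg₁.le_integral_viscous hg₂ hq₁ hq₂ hs
  -- F is the integrand of the energy identity with the viscous term replaced by its remainder; its
  -- integral is thus ν times the coercive quantity.
  have hlow : κ * jacDist V g₁ q₁ g₂ q₂ s ≤ ∫ p in S, F p := by
    have e1 : ∫ p in S, F p = ν * ∫ p in S, (viscousDiff g₁ q₁ g₂ q₂ s p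
        - viscousRem g₁ q₁ g₂ q₂ p) := by
      have e2 := integral_sub iF ((iK.add iP).sub iV)
      have e3 : ∫ p in S, (((fun p : ℝ × ℝ => ρ₀ p.2 * kineticDiff c₁ θ g₁ q₁ g₂ q₂ s p)
          + fun p : ℝ × ℝ => a * ρ₀ p.2 ^ γ * pressureDiff γ g₁ q₁ g₂ q₂ s p)
          - fun p => ν * viscousDiff g₁ q₁ g₂ q₂ s p) p = 0 := hE
      rw [e3, sub_zero] at e2
      rw [← e2, ← integral_const_mul]
      refine integral_congr_ae (Filter.Eventually.of_forall fun p => ?_)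
      simp only [hF, Pi.sub_apply, Pi.add_apply]
      ring
    rw [e1, hκ, mul_assoc]
    exact mul_le_mul_of_nonneg_left hvis hν.le
  have hJeq := ae_prod_of_ae_snd (hg₁.ae_flowJac_eq hg₂ hq₁ hq₂ heq)
  have hgeq := hg₁.ae_field_eq hg₂ hq₁ hq₂ (s := s₀) fun t ht => heq t ⟨ht.1, ht.2.le⟩
  -- While the flows agree, so do almost everywhere their Jacobians and the fields along them, and
  -- every term of F contains such a difference. Only the times after s₀ contribute.
  have hzero : ∀ᵐ p : ℝ × ℝ, p ∈ S \ S' → F p = 0 := by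
    filter_upwards [hJeq, hgeq] with p hJ hg hp
    have ht0 : p.1 ≤ s₀ := by
      by_contra hc
      exact hp.2 ⟨⟨not_le.1 hc, hp.1.1.2⟩, hp.1.2⟩
    have e1 := hg ⟨hp.1.1.1, ht0⟩
    have e2 := hJ p.1 ⟨hp.1.1.1.le, ht0⟩
    have e3 := heq p.1 ⟨hp.1.1.1.le, ht0⟩ p.2
    rw [e3] at e1
    have e4 : logJacDiff g₁ q₁ g₂ q₂ p.1 p.2 = 0 := by
      have := hg₁.abs_logJacDiff_le hg₂ (q₁ := q₁) (q₂ := q₂) p.1 p.2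
      rw [e2, sub_self, abs_zero, mul_zero] at this
      exact abs_nonpos_iff.1 this
    simp only [hF, kineticDiff, pressureDiff, viscousRem, e1, e2, e3, e4]
    ring
  have hres : ∫ p in S, F p = ∫ p in S', F p :=
    (setIntegral_eq_of_subset_of_ae_sdiff_eq_zero hSm.nullMeasurableSet hSS' hzero)
  set μ : ℝ → ℝ := fun t => 1 + D t + D t ^ 2 with hμ
  have hμ0 : ∀ t, 0 ≤ μ t := fun t => by
    have := hg₁.nonneg t
    simp only [hμ]
    positivity
  have hμi : IntegrableOn μ (Ioo s₀ s) :=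
    ((integrableOn_const measure_Ioo_lt_top.ne).add hg₁.integrable.integrableOn).add
      hg₁.integrable_sq.integrableOn
  set w : ℝ → ℝ := fun η => η ^ (1 - θ) * Y + (flowJac g₁ q₁ s η - flowJac g₂ q₂ s η) ^ 2 with hw
  have hwi : IntegrableOn w (Ioo 0 V) :=
    (hWi.mul_const Y).add (hg₁.integrableOn_sq_jac_diff hg₂ hq₁ hq₂ s)
  set δJ : ℝ × ℝ → ℝ := fun p => flowJac g₁ q₁ p.1 p.2 - flowJac g₂ q₂ p.1 p.2 with hδJ
  have iH1 : IntegrableOn (fun p : ℝ × ℝ => μ p.1 * w p.2) S' := by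
    have := hμi.mul_prod hwi
    rwa [Measure.prod_restrict, ← Measure.volume_eq_prod] at this
  have iH2 : IntegrableOn (fun p : ℝ × ℝ => μ p.1 * δJ p ^ 2) S' := by
    refine (hg₁.integrableOn_slab (C := Λ ^ 2) ?_ fun t η _ _ => ?_).mono_set hSS'
    · exact (((measurable_const.add hg₁.measurable_lip).add
        (hg₁.measurable_lip.pow_const 2)).comp measurable_fst).mul
        (((hg₁.measurable_flowJac hq₁).sub (hg₂.measurable_flowJac hq₂)).pow_const 2)
    · rw [abs_of_nonneg (mul_nonneg (hμ0 _) (sq_nonneg _)), mul_comm]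
      exact mul_le_mul_of_nonneg_right (hg₁.sq_jac_diff_le hg₂ t η) (hμ0 t)
  have hpt : ∀ p ∈ S', F p ≤ C' * (μ p.1 * w p.2 + μ p.1 * δJ p ^ 2) := fun p hp =>
    hC' s p.1 p.2 Y hp.2 (hY p.1 ⟨hp.1.1.le, hp.1.2.le⟩) (hY s ⟨hss, le_rfl⟩)
  have hup : ∫ p in S', F p ≤ C' * ((∫ t in Ioo s₀ s, μ t) * (W * Y
      -- The part with the weight w separates into a time and a label integral; the part with the
      -- Jacobians at time t is integrated over labels first and bounded by Y for each t.
      + jacDist V g₁ q₁ g₂ q₂ s) + (∫ t in Ioo s₀ s, μ t) * Y) := by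
    refine (setIntegral_mono_on (iF.mono_set hSS') ((iH1.add iH2).const_mul C') hSm' hpt).trans ?_
    simp only [Pi.add_apply]
    rw [integral_const_mul]
    have e1 := integral_add iH1 iH2
    rw [e1]
    refine mul_le_mul_of_nonneg_left (add_le_add (le_of_eq ?_) ?_) hC'0
    · rw [hS', Measure.volume_eq_prod, setIntegral_prod_mul]
      congr 1
      have e2 := integral_add (hWi.mul_const Y) (hg₁.integrableOn_sq_jac_diff hg₂ hq₁ hq₂ s)
      rw [integral_mul_const] at e2
      exact e2
    · rw [IntegrableOn, hS', Measure.volume_eq_prod] at iH2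
      rw [hS', Measure.volume_eq_prod, setIntegral_prod _ iH2, ← integral_mul_const]
      rw [← Measure.prod_restrict] at iH2
      refine setIntegral_mono_on iH2.integral_prod_left (hμi.mul_const Y) measurableSet_Ioo
        fun t ht => ?_
      refine (integral_const_mul (μ t) _).trans_le ?_
      exact mul_le_mul_of_nonneg_left (hY t ⟨ht.1.le, ht.2.le⟩) (hμ0 t)
  rw [intervalIntegral.integral_of_le hss, integral_Ioc_eq_integral_Ioo]
  set I := ∫ t in Ioo s₀ s, μ t with hI
  have hI0 : 0 ≤ I := setIntegral_nonneg measurableSet_Ioo fun t _ => hμ0 t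
  have hfin : κ * jacDist V g₁ q₁ g₂ q₂ s ≤ C' * (W + 2) * I * Y := by
    refine hlow.trans (hres.le.trans (hup.trans ?_))
    have : I * (W * Y + jacDist V g₁ q₁ g₂ q₂ s) ≤ I * (W * Y + Y) :=
      mul_le_mul_of_nonneg_left (by linarith [hY s ⟨hss, le_rfl⟩]) hI0
    have := mul_le_mul_of_nonneg_left this hC'0
    linarith
  rw [show C' * (W + 2) / κ * I * Y = C' * (W + 2) * I * Y / κ by ring, le_div_iff₀ hκ0]
  linarith

open IsTransportField in
-- A Grönwall argument that uses only boundedness of the distance in time. The function E = C∫(1 + D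
-- + D²) is continuous and nondecreasing; on an interval where it grows by at most 1/2 the supremum
-- of the distance is at most half of itself, hence zero. Induction on such intervals reaches every
-- time before T.
theorem flow_unique (h₁ : IsVolumeSolution V T a γ ν c₁ θ D g₁ ρ₁ ρ₀ c₀)
    (h₂ : IsVolumeSolution V T a γ ν c₁ θ D g₂ ρ₂ ρ₀ c₀) (h₀ : IsVolumeData V ρ₀ c₀) (hT : 0 < T)
    (ha : 0 < a) (hγ : 0 < γ) (hν : 0 < ν) (hc₁ : 0 < c₁) (hθ : 0 < θ) (hθ2 : θ < 2)
    (hq₁ : IsFlowOf g₁ q₁) (hq₂ : IsFlowOf g₂ q₂) :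
    ∀ t ∈ Ico 0 T, ∀ η, q₁ t η = q₂ t η := by
  obtain ⟨C, hC0, hC⟩ := h₁.exists_jacDist_le h₂ h₀ hT ha hγ hν hc₁ hθ hθ2 hq₁ hq₂
  have hg₁ := h₁.field
  have hg₂ := h₂.field
  set μ : ℝ → ℝ := fun t => 1 + D t + D t ^ 2 with hμ
  have hμi : LocallyIntegrable μ :=
    ((locallyIntegrable_const 1).add hg₁.integrable.locallyIntegrable).add
      hg₁.integrable_sq.locallyIntegrable
  have hμI : ∀ a b, IntervalIntegrable μ volume a b := fun a b =>
    (hμi.integrableOn_isCompact isCompact_uIcc).intervalIntegrable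
  have hμ0 : ∀ t, 0 ≤ μ t := fun t => by
    have := hg₁.nonneg t
    simp only [hμ]
    positivity
  set E : ℝ → ℝ := fun t => C * ∫ τ in (0 : ℝ)..t, μ τ with hE
  have hEc : Continuous E := continuous_const.mul (intervalIntegral.continuous_primitive hμI 0)
  have hEadd : ∀ s t, C * ∫ τ in s..t, μ τ = E t - E s := fun s t => by
    simp only [hE]
    rw [← mul_sub, intervalIntegral.integral_interval_sub_left (hμI 0 t) (hμI 0 s)]
  have hEmono : ∀ s t, s ≤ t → E s ≤ E t := fun s t hst => by
    have : 0 ≤ C * ∫ τ in s..t, μ τ :=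
      mul_nonneg hC0 (intervalIntegral.integral_nonneg hst fun u _ => hμ0 u)
    linarith [hEadd s t]
  have hE0 : E 0 = 0 := by simp [hE]
  have key : ∀ n : ℕ, ∀ s ∈ Ico 0 T, E s ≤ n / 2 → ∀ t ∈ Icc 0 s, ∀ η, q₁ t η = q₂ t η := by
    have step : ∀ s₀ s : ℝ, 0 ≤ s₀ → s₀ ≤ s → s < T → E s - E s₀ ≤ 1 / 2 →
        (∀ t ∈ Icc 0 s₀, ∀ η, q₁ t η = q₂ t η) → ∀ t ∈ Icc 0 s, ∀ η, q₁ t η = q₂ t η := by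
      intro s₀ s hs₀ hss hsT hEs heq t ht η
      rcases le_or_gt t s₀ with h | h
      · exact heq t ⟨ht.1, h⟩ η
      set A := jacDist V g₁ q₁ g₂ q₂ '' Icc s₀ s with hA
      have hAb : BddAbove A := ⟨_, by
        rintro _ ⟨τ, -, rfl⟩
        exact hg₁.jacDist_le hg₂ hq₁ hq₂ τ⟩
      have hle : ∀ τ ∈ Icc s₀ s, jacDist V g₁ q₁ g₂ q₂ τ ≤ sSup A := fun τ hτ =>
        le_csSup hAb ⟨τ, hτ, rfl⟩
      have hY0 : 0 ≤ sSup A := (jacDist_nonneg V g₁ q₁ g₂ q₂ s).trans (hle s ⟨hss, le_rfl⟩)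
      have hhalf : sSup A ≤ 1 / 2 * sSup A := by
        refine csSup_le ⟨_, s, ⟨hss, le_rfl⟩, rfl⟩ ?_
        rintro _ ⟨τ, hτ, rfl⟩
        refine (hC s₀ τ (sSup A) hs₀ hτ.1 (hτ.2.trans_lt hsT) heq fun r hr =>
          hle r ⟨hr.1, hr.2.trans hτ.2⟩).trans (mul_le_mul_of_nonneg_right ?_ hY0)
        have := hEadd s₀ τ
        linarith [hEmono τ s hτ.2]
      have h0 : jacDist V g₁ q₁ g₂ q₂ t = 0 :=
        le_antisymm ((hle t ⟨h.le, ht.2⟩).trans (by linarith)) (jacDist_nonneg V g₁ q₁ g₂ q₂ t)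
      exact hg₁.flow_eq_of_jacDist_eq_zero hg₂ hq₁ hq₂ h0 η
    have h00 : ∀ t ∈ Icc (0 : ℝ) 0, ∀ η, q₁ t η = q₂ t η := fun t ht η => by
      rw [Icc_self, mem_singleton_iff] at ht
      rw [ht, flow_zero hq₁, flow_zero hq₂]
    intro n
    induction n with
    | zero =>
      intro s hs hEs
      refine step 0 s le_rfl hs.1 hs.2 ?_ h00
      rw [hE0]
      push_cast at hEs
      linarith
    | succ n ih =>
      intro s hs hEs
      rcases le_or_gt (E s) (n / 2) with h | h
      · exact ih s hs h
      -- The time at which E passes n/2 separates the interval already treated from the next step,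
      -- on which E grows by at most 1/2.
      obtain ⟨s₀, hs₀, hEs₀⟩ := intermediate_value_Icc hs.1 hEc.continuousOn
        (show (n : ℝ) / 2 ∈ Icc (E 0) (E s) from ⟨by rw [hE0]; positivity, h.le⟩)
      refine step s₀ s hs₀.1 hs₀.2 hs.2 ?_ (ih s₀ ⟨hs₀.1, hs₀.2.trans_lt hs.2⟩ hEs₀.le)
      rw [hEs₀]
      push_cast at hEs
      linarith
  intro t ht η
  obtain ⟨n, hn⟩ := exists_nat_ge (2 * E t)
  exact key n t ht (by linarith) t ⟨ht.1, le_rfl⟩ η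

theorem mono {g ρ : ℝ → ℝ → ℝ} {D' : ℝ → ℝ} (h : IsVolumeSolution V T a γ ν c₁ θ D g ρ ρ₀ c₀)
    (hD' : IsTransportField V T D' g) : IsVolumeSolution V T a γ ν c₁ θ D' g ρ ρ₀ c₀ :=
  ⟨hD', h.meas, h.nonneg, h.bdd, h.zero_time, h.continuity, h.momentum⟩

open IsTransportField in
/-- Uniqueness of solutions in the volume coordinate. -/
theorem unique {D₁ D₂ : ℝ → ℝ} (h₁ : IsVolumeSolution V T a γ ν c₁ θ D₁ g₁ ρ₁ ρ₀ c₀)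
    (h₂ : IsVolumeSolution V T a γ ν c₁ θ D₂ g₂ ρ₂ ρ₀ c₀) (h₀ : IsVolumeData V ρ₀ c₀) (hT : 0 < T)
    (ha : 0 < a) (hγ : 0 < γ) (hν : 0 < ν) (hc₁ : 0 < c₁) (hθ : 0 < θ) (hθ2 : θ < 2) :
    ∀ᵐ p : ℝ × ℝ, p ∈ Ioo 0 T ×ˢ Ioo 0 V → g₁ p.1 p.2 = g₂ p.1 p.2 ∧ ρ₁ p.1 p.2 = ρ₂ p.1 p.2 := by
  have f₁ := h₁.field
  have f₂ := h₂.field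
  -- The comparison requires one Lipschitz bound for both fields; the sum serves.
  have hm : Measurable fun t => D₁ t + D₂ t := f₁.measurable_lip.add f₂.measurable_lip
  have hi : Integrable fun t => D₁ t + D₂ t := f₁.integrable.add f₂.integrable
  have hi2 : Integrable fun t => (D₁ t + D₂ t) ^ 2 := by
    refine ((f₁.integrable_sq.const_mul 2).add (f₂.integrable_sq.const_mul 2)).mono'
      (hm.pow_const 2).aestronglyMeasurable (Filter.Eventually.of_forall fun t => ?_)
    rw [Real.norm_of_nonneg (sq_nonneg _)]
    simp only [Pi.add_apply]
    nlinarith [sq_nonneg (D₁ t - D₂ t)]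
  have hz : ∀ t, t ∉ Ioo 0 T → D₁ t + D₂ t = 0 := fun t ht => by
    rw [f₁.lip_zero t ht, f₂.lip_zero t ht, add_zero]
  have g₁' := f₁.mono hm hi hi2 hz fun t => le_add_of_nonneg_right (f₂.nonneg t)
  have g₂' := f₂.mono hm hi hi2 hz fun t => le_add_of_nonneg_left (f₁.nonneg t)
  obtain ⟨q₁, hq₁⟩ := f₁.exists_flow
  obtain ⟨q₂, hq₂⟩ := f₂.exists_flow
  have hq := (h₁.mono g₁').flow_unique (h₂.mono g₂') h₀ hT ha hγ hν hc₁ hθ hθ2 hq₁ hq₂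
  have hJ := ae_prod_of_ae_snd (g₁'.ae_flowJac_eq g₂' hq₁ hq₂ hq)
  have hg := g₁'.ae_field_eq g₂' hq₁ hq₂ (s := T) hq
  -- The conclusion may be checked along the trajectories of the first flow, since the flow map
  -- preserves null sets in both directions.
  rw [g₁'.ae_flow_iff hq₁]
  filter_upwards [hJ, hg, h₁.density_flow h₀ hT hq₁, h₂.density_flow h₀ hT hq₂]
    with p e₁ e₂ e₃ e₄ hp
  have ht : p.1 ∈ Ioo 0 T := hp.1
  have hη : p.2 ∈ Ioo 0 V := by
    refine ⟨not_le.1 fun h => ?_, not_le.1 fun h => ?_⟩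
    · have := hp.2.1
      rw [g₁'.flow_of_nonpos hq₁ h] at this
      exact h.not_gt this
    · have := hp.2.2
      rw [g₁'.flow_of_ge hq₁ h] at this
      exact h.not_gt this
  have a1 := hq p.1 ⟨ht.1.le, ht.2⟩ p.2
  have a2 := e₁ p.1 ⟨ht.1.le, ht.2⟩
  have a3 := e₃ ⟨ht, hη⟩
  have a4 := e₄ ⟨ht, hη⟩
  have a5 := e₂ ⟨ht.1, ht.2.le⟩
  refine ⟨?_, ?_⟩
  · rw [a5, a1]
  -- Both densities times the common Jacobian equal ρ₀, and the Jacobian is positive.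
  · rw [← a2] at a4
    rw [← a1] at a4
    have hJ0 := (flowJac_pos g₁ q₁ p.1 p.2).ne'
    exact mul_right_cancel₀ hJ0 (by linarith)

end IsVolumeSolution

/-! ### Vector calculus in the ball -/

section VectorCalculus

variable {N : ℕ}

/-- The matrix entry `A_{ij}` as a continuous linear functional. -/
noncomputable def entryCLM (i j : Fin N) :
    (EuclideanSpace ℝ (Fin N) →L[ℝ] EuclideanSpace ℝ (Fin N)) →L[ℝ] ℝ :=
  (EuclideanSpace.proj (𝕜 := ℝ) i).comp
    (ContinuousLinearMap.apply ℝ (EuclideanSpace ℝ (Fin N)) (EuclideanSpace.single j 1))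

theorem entryCLM_apply (i j : Fin N)
    (A : EuclideanSpace ℝ (Fin N) →L[ℝ] EuclideanSpace ℝ (Fin N)) :
    entryCLM i j A = (A (EuclideanSpace.single j 1)) i := rfl

/-- The trace as a continuous linear functional. -/
noncomputable def divCLM (N : ℕ) :
    (EuclideanSpace ℝ (Fin N) →L[ℝ] EuclideanSpace ℝ (Fin N)) →L[ℝ] ℝ := ∑ i, entryCLM i i

theorem divCLM_apply (A : EuclideanSpace ℝ (Fin N) →L[ℝ] EuclideanSpace ℝ (Fin N)) :
    divCLM N A = divOf A := by
  simp [divCLM, divOf, entryCLM_apply]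

theorem clm_apply_eq_sum (L : EuclideanSpace ℝ (Fin N) →L[ℝ] ℝ) (v : EuclideanSpace ℝ (Fin N)) :
    L v = ∑ i, v i * L (EuclideanSpace.single i 1) := by
  conv_lhs => rw [← (EuclideanSpace.basisFun (Fin N) ℝ).sum_repr v]
  simp

theorem fderiv_coord {φ : EuclideanSpace ℝ (Fin N) → EuclideanSpace ℝ (Fin N)}
    {x : EuclideanSpace ℝ (Fin N)} (h : DifferentiableAt ℝ φ x) (i : Fin N)
    (v : EuclideanSpace ℝ (Fin N)) :
    fderiv ℝ (fun y => φ y i) x v = (fderiv ℝ φ x v) i := by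
  have := ((EuclideanSpace.proj (𝕜 := ℝ) i).hasFDerivAt.comp x h.hasFDerivAt).fderiv
  exact congrArg (fun L => L v) this

theorem contDiff_coord {φ : EuclideanSpace ℝ (Fin N) → EuclideanSpace ℝ (Fin N)}
    {n : WithTop ℕ∞} (h : ContDiff ℝ n φ) (i : Fin N) : ContDiff ℝ n fun y => φ y i :=
  (EuclideanSpace.proj (𝕜 := ℝ) i).contDiff.comp h

theorem hasCompactSupport_coord {φ : EuclideanSpace ℝ (Fin N) → EuclideanSpace ℝ (Fin N)}
    (h : HasCompactSupport φ) (i : Fin N) : HasCompactSupport fun y => φ y i :=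
  h.comp_left (g := fun v : EuclideanSpace ℝ (Fin N) => v i) rfl

theorem integral_by_parts_smooth {E : Type*} [NormedAddCommGroup E] [NormedSpace ℝ E]
    [MeasurableSpace E] [BorelSpace E] [FiniteDimensional ℝ E] (m : Measure E) [m.IsAddHaarMeasure]
    {f w : E → ℝ} (hf : ContDiff ℝ 1 f) (hc : HasCompactSupport f) (hw : ContDiff ℝ 1 w) (v : E) :
    Integrable (fun x => f x * fderiv ℝ w x v) m ∧ Integrable (fun x => fderiv ℝ f x v * w x) m ∧
    ∫ x, f x * fderiv ℝ w x v ∂m = -∫ x, fderiv ℝ f x v * w x ∂m := by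
  have c1 : Continuous fun x => fderiv ℝ w x v :=
    (hw.continuous_fderiv one_ne_zero).clm_apply continuous_const
  have c2 : Continuous fun x => fderiv ℝ f x v :=
    (hf.continuous_fderiv one_ne_zero).clm_apply continuous_const
  have i1 : Integrable (fun x => f x * fderiv ℝ w x v) m :=
    (hf.continuous.mul c1).integrable_of_hasCompactSupport hc.mul_right
  have i2 : Integrable (fun x => fderiv ℝ f x v * w x) m :=
    (c2.mul hw.continuous).integrable_of_hasCompactSupport (hc.fderiv_apply ℝ v).mul_right
  exact ⟨i1, i2, integral_mul_fderiv_eq_neg_fderiv_mul_of_integrable i2 i1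
    ((hf.continuous.mul hw.continuous).integrable_of_hasCompactSupport hc.mul_right)
    (fun x _ => hf.differentiable one_ne_zero x) fun x _ => hw.differentiable one_ne_zero x⟩

/-- The divergence theorem for a compactly supported vector field. -/
theorem integral_fderiv_add_div {H : EuclideanSpace ℝ (Fin N) → ℝ} (hH : ContDiff ℝ 1 H)
    {φ : EuclideanSpace ℝ (Fin N) → EuclideanSpace ℝ (Fin N)} (hφ : ContDiff ℝ 1 φ)
    (hc : HasCompactSupport φ) :
    ∫ x, (fderiv ℝ H x (φ x) + H x * divOf (fderiv ℝ φ x)) = 0 := by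
  have hd : ∀ x, DifferentiableAt ℝ φ x := hφ.differentiable one_ne_zero
  have e : ∀ x, fderiv ℝ H x (φ x) + H x * divOf (fderiv ℝ φ x)
      = ∑ i, (φ x i * fderiv ℝ H x (EuclideanSpace.single i 1)
        + fderiv ℝ (fun y => φ y i) x (EuclideanSpace.single i 1) * H x) := fun x => by
    rw [clm_apply_eq_sum, divOf, Finset.mul_sum, ← Finset.sum_add_distrib]
    refine Finset.sum_congr rfl fun i _ => ?_
    rw [fderiv_coord (hd x), mul_comm (H x)]
  have key := fun i : Fin N => integral_by_parts_smooth volume (contDiff_coord hφ i)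
    (hasCompactSupport_coord hc i) hH (EuclideanSpace.single i 1)
  have i1 : ∀ i, Integrable fun x => φ x i * fderiv ℝ H x (EuclideanSpace.single i 1)
      + fderiv ℝ (fun y => φ y i) x (EuclideanSpace.single i 1) * H x :=
    fun i => (key i).1.add (key i).2.1
  simp only [e]
  rw [integral_finsetSum _ fun i _ => i1 i]
  refine Finset.sum_eq_zero fun i _ => ?_
  rw [integral_add (key i).1 (key i).2.1, (key i).2.2]
  ring

/-- For a gradient field `ψ`, the Frobenius product with `∇ψ` has the same integral as the product
of the divergences. -/
theorem integral_frobProd_sub_div {ψ φ : EuclideanSpace ℝ (Fin N) → EuclideanSpace ℝ (Fin N)}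
    (hψ : ContDiff ℝ 2 ψ) (hsymm : ∀ x i j, (fderiv ℝ ψ x (EuclideanSpace.single i 1)) j
      = (fderiv ℝ ψ x (EuclideanSpace.single j 1)) i)
    (hφ : ContDiff ℝ 1 φ) (hc : HasCompactSupport φ) :
    ∫ x, (frobProd (fderiv ℝ φ x) (fderiv ℝ ψ x)
      - divOf (fderiv ℝ φ x) * divOf (fderiv ℝ ψ x)) = 0 := by
  set e : Fin N → EuclideanSpace ℝ (Fin N) := fun i => EuclideanSpace.single i 1 with he
  have hd : ∀ x, DifferentiableAt ℝ φ x := hφ.differentiable one_ne_zero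
  have hdψ : ∀ x, DifferentiableAt ℝ ψ x := hψ.differentiable two_ne_zero
  set w : Fin N → Fin N → EuclideanSpace ℝ (Fin N) → ℝ := fun i j x => (fderiv ℝ ψ x (e j)) i
    with hw
  have hfd : ContDiff ℝ 1 (fderiv ℝ ψ) := hψ.fderiv_right (by norm_num)
  have hwc : ∀ i j, ContDiff ℝ 1 (w i j) := fun i j =>
    contDiff_coord (φ := fun x => fderiv ℝ ψ x (e j)) (hfd.clm_apply contDiff_const) i
  have hwd : ∀ i j k x, fderiv ℝ (w i j) x (e k) = (fderiv ℝ (fderiv ℝ ψ) x (e k) (e j)) i :=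
    fun i j k x => by
    have h1 : DifferentiableAt ℝ (fderiv ℝ ψ) x := hfd.differentiable one_ne_zero x
    have h2 : HasFDerivAt (fun x => fderiv ℝ ψ x (e j)) _ x :=
      h1.hasFDerivAt.clm_apply (hasFDerivAt_const (e j) x)
    rw [show fderiv ℝ (w i j) x (e k) = fderiv ℝ (fun y => (fderiv ℝ ψ y (e j)) i) x (e k) from rfl,
      fderiv_coord (φ := fun y => fderiv ℝ ψ y (e j)) h2.differentiableAt, h2.fderiv]
    simp
  have hsnd : ∀ i j k x, fderiv ℝ (w i j) x (e k) = fderiv ℝ (w i k) x (e j) := fun i j k x => by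
    have h1 : IsSymmSndFDerivAt ℝ ψ x := (hψ.contDiffAt).isSymmSndFDerivAt (by simp)
    rw [hwd, hwd, h1.eq]
  have hwsymm : ∀ i j, w i j = w j i := fun i j => funext fun x => hsymm x j i
  set H : EuclideanSpace ℝ (Fin N) → ℝ := fun x => ∑ j, w j j x with hH
  have hHc : ContDiff ℝ 1 H := ContDiff.sum fun j _ => hwc j j
  -- The gradient of div ψ equals Δψ: this uses the symmetry of the second derivative and that of
  -- ∇ψ.
  have hHd : ∀ x i, fderiv ℝ H x (e i) = ∑ j, fderiv ℝ (w i j) x (e j) := fun x i => by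
    have : HasFDerivAt H (∑ j, fderiv ℝ (w j j) x) x := by
      have := HasFDerivAt.fun_sum (u := Finset.univ) (A := fun j => w j j)
        (A' := fun j => fderiv ℝ (w j j) x) (x := x)
        fun j _ => ((hwc j j).differentiable one_ne_zero x).hasFDerivAt
      exact this
    rw [this.fderiv, sum_apply]
    refine Finset.sum_congr rfl fun j _ => ?_
    rw [hsnd j j i, hwsymm j i]
  have k1 := integral_fderiv_add_div hHc hφ hc
  have key := fun i j : Fin N => integral_by_parts_smooth volume (contDiff_coord hφ i)
    (hasCompactSupport_coord hc i) (hwc i j) (e j)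
  -- Consequently the difference of the two products is a difference of divergences of compactly
  -- supported fields.
  have e1 : ∀ x, frobProd (fderiv ℝ φ x) (fderiv ℝ ψ x)
      - divOf (fderiv ℝ φ x) * divOf (fderiv ℝ ψ x)
      = (∑ i, ∑ j, (φ x i * fderiv ℝ (w i j) x (e j)
        + fderiv ℝ (fun y => φ y i) x (e j) * w i j x))
        - (fderiv ℝ H x (φ x) + H x * divOf (fderiv ℝ φ x)) := fun x => by
    have a1 : fderiv ℝ H x (φ x) = ∑ i, ∑ j, φ x i * fderiv ℝ (w i j) x (e j) := by
      rw [clm_apply_eq_sum]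
      refine Finset.sum_congr rfl fun i _ => ?_
      rw [← Finset.mul_sum, ← hHd]
    have a2 : frobProd (fderiv ℝ φ x) (fderiv ℝ ψ x)
        = ∑ i, ∑ j, fderiv ℝ (fun y => φ y i) x (e j) * w i j x := by
      refine Finset.sum_congr rfl fun i _ => Finset.sum_congr rfl fun j _ => ?_
      rw [fderiv_coord (hd x)]
    have a3 : divOf (fderiv ℝ ψ x) = H x := rfl
    simp only [Finset.sum_add_distrib]
    rw [a1, a2, a3]
    ring
  have i1 : ∀ i j, Integrable fun x => φ x i * fderiv ℝ (w i j) x (e j)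
      + fderiv ℝ (fun y => φ y i) x (e j) * w i j x := fun i j => (key i j).1.add (key i j).2.1
  have hz : ∫ x, (∑ i, ∑ j, (φ x i * fderiv ℝ (w i j) x (e j)
        + fderiv ℝ (fun y => φ y i) x (e j) * w i j x)) = 0 := by
    rw [integral_finsetSum _ fun i _ => integrable_finsetSum _ fun j _ => i1 i j]
    refine Finset.sum_eq_zero fun i _ => ?_
    rw [integral_finsetSum _ fun j _ => i1 i j]
    refine Finset.sum_eq_zero fun j _ => ?_
    rw [integral_add (key i j).1 (key i j).2.1, (key i j).2.2]
    ring
  have i2 : Integrable fun x => fderiv ℝ H x (φ x) + H x * divOf (fderiv ℝ φ x) := by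
    have c1 : Continuous fun x => fderiv ℝ H x (φ x) :=
      (hHc.continuous_fderiv one_ne_zero).clm_apply hφ.continuous
    have c2 : Continuous fun x => H x * divOf (fderiv ℝ φ x) := by
      simp only [← divCLM_apply]
      exact hHc.continuous.mul ((divCLM N).continuous.comp (hφ.continuous_fderiv one_ne_zero))
    refine (c1.add c2).integrable_of_hasCompactSupport
      (HasCompactSupport.intro (K := tsupport φ) hc fun x hx => ?_)
    change fderiv ℝ H x (φ x) + H x * divOf (fderiv ℝ φ x) = 0
    rw [image_eq_zero_of_notMem_tsupport hx, fderiv_of_notMem_tsupport ℝ hx]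
    simp [divOf]
  simp only [e1]
  rw [integral_sub (integrable_finsetSum _ fun i _ => integrable_finsetSum _ fun j _ => i1 i j) i2,
    hz, k1, sub_zero]

theorem continuous_norm_functional {X F : Type*} [TopologicalSpace X] [NormedAddCommGroup F]
    [NormedSpace ℝ F] {β : X → F →L[ℝ] ℝ} (hβ : Continuous β) : Continuous fun x => ‖β x‖ :=
  hβ.norm

theorem aestronglyMeasurable_functional_apply {X F : Type*} [TopologicalSpace X]
    [SecondCountableTopology X] [TopologicalSpace.PseudoMetrizableSpace X] [MeasurableSpace X]
    [OpensMeasurableSpace X] [NormedAddCommGroup F] [NormedSpace ℝ F] {m : Measure X}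
    {β : X → F →L[ℝ] ℝ} (hβ : Continuous β) {v : X → F} (hv : AEStronglyMeasurable v m) :
    AEStronglyMeasurable (fun x => β x (v x)) m :=
  isBoundedBilinearMap_apply.continuous.comp_aestronglyMeasurable
    ((Continuous.aestronglyMeasurable hβ).prodMk hv)

/-- A continuous linear relation between a field and its gradient which holds, in the mean, for all
test fields also holds for the fields in `H¹₀`. -/
theorem IsH10WithGradient.integral_eq_zero {R : ℝ}
    {W : EuclideanSpace ℝ (Fin N) → EuclideanSpace ℝ (Fin N)}
    {DW : EuclideanSpace ℝ (Fin N) → EuclideanSpace ℝ (Fin N) →L[ℝ] EuclideanSpace ℝ (Fin N)}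
    (h : IsH10WithGradient R W DW) {α : EuclideanSpace ℝ (Fin N) → EuclideanSpace ℝ (Fin N) →L[ℝ] ℝ}
    {β : EuclideanSpace ℝ (Fin N) →
      (EuclideanSpace ℝ (Fin N) →L[ℝ] EuclideanSpace ℝ (Fin N)) →L[ℝ] ℝ}
    (hα : Continuous α) (hβ : Continuous β)
    (hz : ∀ φ : EuclideanSpace ℝ (Fin N) → EuclideanSpace ℝ (Fin N), ContDiff ℝ ∞ φ →
      HasCompactSupport φ → ∫ x, (α x (φ x) + β x (fderiv ℝ φ x)) = 0) :
    IntegrableOn (fun x => α x (W x)) (ballDomain N R) ∧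
    IntegrableOn (fun x => β x (DW x)) (ballDomain N R) ∧
    ∫ x in ballDomain N R, (α x (W x) + β x (DW x)) = 0 := by
  obtain ⟨hW, hDW, happ⟩ := h
  set m := (volume : Measure (EuclideanSpace ℝ (Fin N))).restrict (ballDomain N R) with hm
  have : IsFiniteMeasure m := ⟨by
    rw [hm, Measure.restrict_apply_univ]; exact measure_ball_lt_top⟩
  have hS : MeasurableSet (ballDomain N R) := measurableSet_ball
  have hcpt := isCompact_closedBall (0 : EuclideanSpace ℝ (Fin N)) R
  obtain ⟨K₁, hK₁⟩ := hcpt.exists_bound_of_continuousOn hα.norm.continuousOn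
  obtain ⟨K₂, hK₂⟩ := hcpt.exists_bound_of_continuousOn (continuous_norm_functional hβ).continuousOn
  simp only [norm_norm] at hK₁ hK₂
  set K := max (max K₁ K₂) 0 with hK
  have hK0 : 0 ≤ K := le_max_right _ _
  have b1 : ∀ᵐ x ∂m, ‖α x‖ ≤ K := (ae_restrict_iff' hS).2 (Filter.Eventually.of_forall fun x hx =>
    (hK₁ x (Metric.ball_subset_closedBall hx)).trans ((le_max_left _ _).trans (le_max_left _ _)))
  have b2 : ∀ᵐ x ∂m, ‖β x‖ ≤ K := (ae_restrict_iff' hS).2 (Filter.Eventually.of_forall fun x hx =>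
    (hK₂ x (Metric.ball_subset_closedBall hx)).trans ((le_max_right _ _).trans (le_max_left _ _)))
  have iα : ∀ {v : EuclideanSpace ℝ (Fin N) → EuclideanSpace ℝ (Fin N)}, Integrable v m →
      Integrable (fun x => α x (v x)) m := fun {v} hv => by
    refine (hv.norm.const_mul K).mono' (aestronglyMeasurable_functional_apply hα hv.aestronglyMeasurable) ?_
    filter_upwards [b1] with x hx
    exact ((α x).le_opNorm _).trans (mul_le_mul_of_nonneg_right hx (norm_nonneg _))
  have iβ : ∀ {v : EuclideanSpace ℝ (Fin N) →
      EuclideanSpace ℝ (Fin N) →L[ℝ] EuclideanSpace ℝ (Fin N)}, Integrable v m →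
      Integrable (fun x => β x (v x)) m := fun {v} hv => by
    refine (hv.norm.const_mul K).mono' (aestronglyMeasurable_functional_apply hβ hv.aestronglyMeasurable) ?_
    filter_upwards [b2] with x hx
    exact ((β x).le_opNorm _).trans (mul_le_mul_of_nonneg_right hx (norm_nonneg _))
  have iW := hW.integrable one_le_two
  have iDW := hDW.integrable one_le_two
  refine ⟨iα iW, iβ iDW, ?_⟩
  set I := ∫ x in ballDomain N R, (α x (W x) + β x (DW x)) with hI
  -- The Hölder factor |Ω|^(1/2), which turns the L² approximation into an L¹ approximation.
  set M : ℝ≥0∞ := m univ ^ (1 / (1 : ℝ≥0∞).toReal - 1 / (2 : ℝ≥0∞).toReal) with hM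
  have hMtop : M ≠ ⊤ := ENNReal.rpow_ne_top_of_nonneg (by norm_num) (measure_ne_top _ _)
  have key : ∀ n : ℕ, ‖I‖ₑ ≤ ENNReal.ofReal K * (2 * M) * ((n : ℝ≥0∞))⁻¹ := fun n => by
    obtain ⟨φ, hφ, hc, hsup, hφ1, hφ2⟩ := happ ((n : ℝ≥0∞))⁻¹
      (ENNReal.inv_pos.2 (ENNReal.natCast_ne_top n))
    have hφc := hφ.continuous
    have hdφc : Continuous (fderiv ℝ φ) := hφ.continuous_fderiv (by simp)
    have iφ : Integrable φ m := (hφc.integrable_of_hasCompactSupport hc).restrict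
    have idφ : Integrable (fderiv ℝ φ) m :=
      (hdφc.integrable_of_hasCompactSupport (hc.fderiv ℝ)).restrict
    have h0 : ∫ x in ballDomain N R, (α x (φ x) + β x (fderiv ℝ φ x)) = 0 := by
      rw [setIntegral_eq_integral_of_forall_compl_eq_zero fun x hx => ?_]
      · exact hz φ hφ hc
      · have hx' : x ∉ tsupport φ := fun h' => hx (hsup h')
        rw [image_eq_zero_of_notMem_tsupport hx', fderiv_of_notMem_tsupport ℝ hx']
        simp
    have e1 : I = ∫ x in ballDomain N R, (α x (W x - φ x) + β x (DW x - fderiv ℝ φ x)) := by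
      have h1 := integral_sub ((iα iW).add (iβ iDW)) ((iα iφ).add (iβ idφ))
      simp only [Pi.add_apply] at h1
      rw [h0, sub_zero, ← hI] at h1
      rw [← h1]
      refine integral_congr_ae (Filter.Eventually.of_forall fun x => ?_)
      simp only [map_sub]
      ring
    rw [e1]
    refine (enorm_integral_le_lintegral_enorm _).trans ?_
    have hK' : ∀ (r s : ℝ), 0 ≤ s → r ≤ K * s → ENNReal.ofReal r ≤ ENNReal.ofReal K *
        ENNReal.ofReal s := fun r s _ hr => by
      rw [← ENNReal.ofReal_mul hK0]; exact ENNReal.ofReal_le_ofReal hr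
    calc ∫⁻ x, ‖α x (W x - φ x) + β x (DW x - fderiv ℝ φ x)‖ₑ ∂m
        ≤ ∫⁻ x, (ENNReal.ofReal K * ‖W x - φ x‖ₑ + ENNReal.ofReal K * ‖DW x - fderiv ℝ φ x‖ₑ) ∂m := by
          refine lintegral_mono_ae ?_
          filter_upwards [b1, b2] with x hx1 hx2
          refine (enorm_add_le _ _).trans (add_le_add ?_ ?_)
          · rw [← ofReal_norm, ← ofReal_norm]
            exact hK' _ _ (norm_nonneg _) (((α x).le_opNorm _).trans
              (mul_le_mul_of_nonneg_right hx1 (norm_nonneg _)))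
          · rw [← ofReal_norm, ← ofReal_norm]
            exact hK' _ _ (norm_nonneg _) (((β x).le_opNorm _).trans
              (mul_le_mul_of_nonneg_right hx2 (norm_nonneg _)))
      _ = ENNReal.ofReal K * eLpNorm (fun x => W x - φ x) 1 m
          + ENNReal.ofReal K * eLpNorm (fun x => DW x - fderiv ℝ φ x) 1 m := by
          have h2 : AEMeasurable (fun x => ENNReal.ofReal K * ‖W x - φ x‖ₑ) m :=
            (iW.sub iφ).aestronglyMeasurable.enorm.const_mul _
          rw [lintegral_add_left' h2,
            lintegral_const_mul' _ _ ENNReal.ofReal_ne_top,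
            lintegral_const_mul' _ _ ENNReal.ofReal_ne_top, eLpNorm_one_eq_lintegral_enorm,
            eLpNorm_one_eq_lintegral_enorm]
      _ ≤ ENNReal.ofReal K * ((n : ℝ≥0∞)⁻¹ * M) + ENNReal.ofReal K * ((n : ℝ≥0∞)⁻¹ * M) := by
          gcongr
          · exact (eLpNorm_le_eLpNorm_mul_rpow_measure_univ one_le_two
              (iW.sub iφ).aestronglyMeasurable).trans (mul_le_mul_left hφ1.le _)
          · exact (eLpNorm_le_eLpNorm_mul_rpow_measure_univ one_le_two
              (iDW.sub idφ).aestronglyMeasurable).trans (mul_le_mul_left hφ2.le _)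
      _ = ENNReal.ofReal K * (2 * M) * ((n : ℝ≥0∞))⁻¹ := by ring
  have hlim : Filter.Tendsto (fun n : ℕ => ENNReal.ofReal K * (2 * M) * ((n : ℝ≥0∞))⁻¹)
      Filter.atTop (nhds (ENNReal.ofReal K * (2 * M) * 0)) :=
    ENNReal.Tendsto.const_mul ENNReal.tendsto_inv_nat_nhds_zero
      (Or.inr (ENNReal.mul_ne_top ENNReal.ofReal_ne_top (ENNReal.mul_ne_top (by simp) hMtop)))
  rw [mul_zero] at hlim
  have := ge_of_tendsto' hlim key
  exact enorm_eq_zero.1 (le_antisymm this zero_le)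

end VectorCalculus

/-! ### Lipschitz representatives -/

/-- The derivative of the mollification at x is the distributional derivative tested with a
reflected bump of mass one, hence bounded by d at every scale. -/
theorem abs_mollify_sub_le {f : ℝ → ℝ} (hf : LocallyIntegrable f) {d : ℝ}
    (hb : ∀ h : ℝ → ℝ, ContDiff ℝ ∞ h → HasCompactSupport h →
      |∫ y, f y * deriv h y| ≤ d * ∫ y, |h y|) (n : ℕ) (x y : ℝ) :
    |mollify n f x - mollify n f y| ≤ d * |x - y| := by
  have hd : ∀ x, HasDerivAt (mollify n f)
      (∫ y, deriv ((bumpSeq ℝ n).normed volume) (x - y) * f y) x := fun x => by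
    have := (bumpSeq ℝ n).hasCompactSupport_normed (μ := volume) |>.hasDerivAt_convolution_left
      (ContinuousLinearMap.lsmul ℝ ℝ) ((bumpSeq ℝ n).contDiff_normed (n := 1)) hf x
    rwa [convolution_lsmul_swap] at this
  have hbd : ∀ x, ‖∫ y, deriv ((bumpSeq ℝ n).normed volume) (x - y) * f y‖ ≤ d := fun x => by
    have h1 : ContDiff ℝ ∞ fun y => (bumpSeq ℝ n).normed volume (x - y) :=
      (bumpSeq ℝ n).contDiff_normed.comp (by fun_prop)
    have h2 : HasCompactSupport fun y => (bumpSeq ℝ n).normed volume (x - y) :=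
      ((bumpSeq ℝ n).hasCompactSupport_normed (μ := volume)).comp_homeomorph (Homeomorph.subLeft x)
    have h3 := hb _ h1 h2
    have h4 : ∀ y, deriv (fun y => (bumpSeq ℝ n).normed volume (x - y)) y
        = -deriv ((bumpSeq ℝ n).normed volume) (x - y) := fun y => by
      exact deriv_comp_const_sub _ _ _
    have h5 : ∀ y, |(bumpSeq ℝ n).normed volume (x - y)| = (bumpSeq ℝ n).normed volume (x - y) :=
      fun y => abs_of_nonneg ((bumpSeq ℝ n).nonneg_normed _)
    simp only [h4, h5, integral_bump_sub, mul_one, mul_neg, integral_neg, abs_neg] at h3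
    rw [Real.norm_eq_abs]
    refine le_trans (le_of_eq ?_) h3
    congr 1
    exact integral_congr_ae (Filter.Eventually.of_forall fun y => mul_comm _ _)
  have := Convex.norm_image_sub_le_of_norm_hasDerivWithin_le (s := univ) (x := y) (y := x)
    (fun z _ => (hd z).hasDerivWithinAt) (fun z _ => hbd z) convex_univ (mem_univ _) (mem_univ _)
  exact this

/-- A locally integrable function with bounded distributional derivative agrees with a Lipschitz
function, to which its mollifications converge. -/
theorem exists_lipschitz_rep {f : ℝ → ℝ} (hf : LocallyIntegrable f) {d : ℝ} (hd : 0 ≤ d)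
    (hb : ∀ h : ℝ → ℝ, ContDiff ℝ ∞ h → HasCompactSupport h →
      |∫ y, f y * deriv h y| ≤ d * ∫ y, |h y|) :
    ∃ F : ℝ → ℝ, (∀ x y, |F x - F y| ≤ d * |x - y|) ∧ F =ᵐ[volume] f ∧
      ∀ x, Filter.Tendsto (fun n => mollify n f x) Filter.atTop (nhds (F x)) := by
  -- On this set of full measure f inherits the uniform Lipschitz bound of its mollifications, and a
  -- Lipschitz extension of f from S is the representative.
  set S := {x | Filter.Tendsto (fun n => mollify n f x) Filter.atTop (nhds (f x))} with hS
  have hlip : LipschitzOnWith d.toNNReal f S := LipschitzOnWith.of_dist_le_mul fun x hx y hy => by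
    rw [Real.coe_toNNReal _ hd, Real.dist_eq, Real.dist_eq]
    exact le_of_tendsto' ((Filter.Tendsto.sub hx hy).abs) fun n => abs_mollify_sub_le hf hb n x y
  obtain ⟨F, hF, hFS⟩ := hlip.extend_real
  have hFf : F =ᵐ[volume] f := by
    filter_upwards [ae_tendsto_mollify hf] with x hx
    exact (hFS hx).symm
  refine ⟨F, fun x y => ?_, hFf, fun x => ?_⟩
  · have := hF.dist_le_mul x y
    rwa [Real.coe_toNNReal _ hd, Real.dist_eq, Real.dist_eq] at this
  · refine (tendsto_mollify_of_continuous hF.continuous x).congr fun n => ?_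
    rw [mollify_apply, mollify_apply]
    refine integral_congr_ae ?_
    filter_upwards [hFf] with y hy
    rw [hy]

theorem eq_zero_of_ae_eq_zero_on_open {F f : ℝ → ℝ} (hF : Continuous F) (hFf : F =ᵐ[volume] f)
    {O : Set ℝ} (hO : IsOpen O) (h0 : ∀ x ∈ O, f x = 0) : ∀ x ∈ closure O, F x = 0 := by
  have h1 : F =ᵐ[volume.restrict O] fun _ => 0 := by
    rw [Filter.EventuallyEq, ae_restrict_iff' hO.measurableSet]
    filter_upwards [hFf] with x hx hxO
    rw [hx, h0 x hxO]
  have h2 := Measure.eqOn_open_of_ae_eq h1 hO hF.continuousOn continuousOn_const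
  exact fun x hx => h2.closure hF continuous_const hx

/-- A measurable family of Lipschitz representatives. -/
theorem exists_lipschitz_family {V : ℝ} {f : ℝ → ℝ → ℝ}
    (hf : Measurable (Function.uncurry f)) {D : ℝ → ℝ} (hD : ∀ t, 0 ≤ D t)
    (hfi : ∀ t, LocallyIntegrable (f t)) (h0 : ∀ t, ∀ x ∉ Ioo 0 V, f t x = 0)
    (hb : ∀ t, ∀ h : ℝ → ℝ, ContDiff ℝ ∞ h → HasCompactSupport h →
      |∫ y, f t y * deriv h y| ≤ D t * ∫ y, |h y|) :
    ∃ g : ℝ → ℝ → ℝ, Measurable (Function.uncurry g) ∧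
      (∀ t x y, |g t x - g t y| ≤ D t * |x - y|) ∧ (∀ t x, x ≤ 0 → g t x = 0) ∧
      (∀ t x, V ≤ x → g t x = 0) ∧ ∀ t, g t =ᵐ[volume] f t := by
  choose g hlip hae hlim using fun t => exists_lipschitz_rep (hfi t) (hD t) (hb t)
  have hcont : ∀ t, Continuous (g t) := fun t => by
    have : LipschitzWith (D t).toNNReal (g t) := LipschitzWith.of_dist_le_mul fun x y => by
      rw [Real.coe_toNNReal _ (hD t)]
      exact hlip t x y
    exact this.continuous
  refine ⟨g, ?_, hlip, fun t x hx => ?_, fun t x hx => ?_, hae⟩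
  -- Joint measurability does not follow from choosing representatives slice by slice; it holds
  -- because they are everywhere limits of the mollifications, which are measurable in time and
  -- space.
  · refine measurable_of_tendsto_metrizable (f := fun n (p : ℝ × ℝ) => mollify n (f p.1) p.2)
      (fun n => ?_) (tendsto_pi_nhds.2 fun p => hlim p.1 p.2)
    simp only [mollify_apply]
    have hm : Measurable fun z : (ℝ × ℝ) × ℝ =>
        (bumpSeq ℝ n).normed volume (z.1.2 - z.2) * f z.1.1 z.2 :=
      ((bumpSeq ℝ n).continuous_normed.measurable.comp (by fun_prop)).mul
        (hf.comp (g := Function.uncurry f) (f := fun z : (ℝ × ℝ) × ℝ => (z.1.1, z.2))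
          (by fun_prop))
    exact hm.stronglyMeasurable.integral_prod_right'.measurable
  · refine eq_zero_of_ae_eq_zero_on_open (hcont t) (hae t) isOpen_Iio
      (fun y hy => h0 t y fun h => lt_asymm h.1 hy) x ?_
    rw [closure_Iio]; exact hx
  · refine eq_zero_of_ae_eq_zero_on_open (hcont t) (hae t) isOpen_Ioi
      (fun y hy => h0 t y fun h => lt_asymm h.2 hy) x ?_
    rw [closure_Ioi]; exact hx

/-! ### The volume coordinate -/

section Transfer

variable {X Y : Type*} [MeasurableSpace X] [MeasurableSpace Y] {m : Measure X} {m' : Measure Y}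
  {Φ : X → Y} {c : ℝ}

theorem ae_comp_of_map_eq_smul (hΦ : Measurable Φ) (h : Measure.map Φ m = ENNReal.ofReal c • m')
    {P : Y → Prop} (hP : ∀ᵐ y ∂m', P y) : ∀ᵐ x ∂m, P (Φ x) := by
  refine ae_of_ae_map hΦ.aemeasurable ?_
  rw [h]
  exact Measure.ae_smul_measure hP _

theorem integral_comp_of_map_eq_smul (hΦ : Measurable Φ)
    (h : Measure.map Φ m = ENNReal.ofReal c • m') (hc : 0 < c) {f : Y → ℝ}
    (hf : AEStronglyMeasurable f m') : ∫ x, f (Φ x) ∂m = c * ∫ y, f y ∂m' := by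
  have h1 : AEStronglyMeasurable f (Measure.map Φ m) := by rw [h]; exact hf.smul_measure _
  rw [← integral_map hΦ.aemeasurable h1, h, integral_smul_measure, ENNReal.toReal_ofReal hc.le,
    smul_eq_mul]

theorem integrable_of_comp_of_map_eq_smul (hΦ : Measurable Φ)
    (h : Measure.map Φ m = ENNReal.ofReal c • m') (hc : 0 < c) {f : Y → ℝ}
    (hf : AEStronglyMeasurable f m') (hi : Integrable (fun x => f (Φ x)) m) : Integrable f m' := by
  have h1 : AEStronglyMeasurable f (Measure.map Φ m) := by rw [h]; exact hf.smul_measure _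
  have h2 := (integrable_map_measure h1 hΦ.aemeasurable).2 hi
  rw [h] at h2
  exact (integrable_smul_measure (ENNReal.ofReal_pos.2 hc).ne' ENNReal.ofReal_ne_top).1 h2

end Transfer


section VolumeCoordinate

variable {N : ℕ}

/-- The volume coordinate `|x| ^ N / N`. -/
noncomputable def volCoord (x : EuclideanSpace ℝ (Fin N)) : ℝ := ‖x‖ ^ N / N

/-- The radius of the sphere with given volume coordinate. -/
noncomputable def volRadius (N : ℕ) (q : ℝ) : ℝ := (N * q) ^ (N : ℝ)⁻¹

/-- The ratio between the volume of an annulus and the length of its interval of volume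
coordinates. -/
noncomputable def sphereConst (N : ℕ) : ℝ :=
  N * (volume (Metric.ball (0 : EuclideanSpace ℝ (Fin N)) 1)).toReal

theorem sphereConst_pos (hN : 0 < N) : 0 < sphereConst N :=
  mul_pos (by exact_mod_cast hN) (ENNReal.toReal_pos
    (Metric.measure_ball_pos volume _ one_pos).ne' measure_ball_lt_top.ne)

theorem measurable_volRadius : Measurable (volRadius N) :=
  (measurable_id.const_mul _).pow_const _

theorem volCoord_nonneg (x : EuclideanSpace ℝ (Fin N)) : 0 ≤ volCoord x := by
  unfold volCoord; positivity

theorem natCast_mul_volCoord (hN : 0 < N) (x : EuclideanSpace ℝ (Fin N)) :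
    N * volCoord x = ‖x‖ ^ N := by
  have : (0 : ℝ) < N := by exact_mod_cast hN
  unfold volCoord
  field_simp

theorem volRadius_volCoord (hN : 0 < N) (x : EuclideanSpace ℝ (Fin N)) :
    volRadius N (volCoord x) = ‖x‖ := by
  rw [volRadius, natCast_mul_volCoord hN, Real.pow_rpow_inv_natCast (norm_nonneg _) hN.ne']

theorem volCoord_pos (hN : 0 < N) {x : EuclideanSpace ℝ (Fin N)} (hx : x ≠ 0) :
    0 < volCoord x :=
  div_pos (pow_pos (norm_pos_iff.2 hx) _) (by exact_mod_cast hN)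

theorem volCoord_lt_iff (hN : 0 < N) {R : ℝ} (hR : 0 < R) (x : EuclideanSpace ℝ (Fin N)) :
    volCoord x < R ^ N / N ↔ x ∈ ballDomain N R := by
  have h : (0 : ℝ) < N := by exact_mod_cast hN
  rw [volCoord, div_lt_div_iff_of_pos_right h, pow_lt_pow_iff_left₀ (norm_nonneg _) hR.le hN.ne',
    ballDomain, mem_ball_zero_iff]

theorem hasFDerivAt_volCoord (hN : 2 ≤ N) (x : EuclideanSpace ℝ (Fin N)) :
    HasFDerivAt volCoord ((‖x‖ ^ (N - 2)) • innerSL ℝ x) x := by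
  have h0 : (N : ℝ) ≠ 0 := by
    have : 0 < N := by omega
    exact_mod_cast this.ne'
  have h := (hasFDerivAt_norm_rpow x (p := (N : ℝ)) (by exact_mod_cast hN)).mul_const (N : ℝ)⁻¹
  have e : (volCoord : EuclideanSpace ℝ (Fin N) → ℝ) = fun y => ‖y‖ ^ (N : ℝ) * (N : ℝ)⁻¹ := by
    funext y
    rw [volCoord, Real.rpow_natCast, div_eq_mul_inv]
  have e2 : (N : ℝ)⁻¹ • ((N : ℝ) * ‖x‖ ^ ((N : ℝ) - 2)) • innerSL ℝ x
      = (‖x‖ ^ (N - 2)) • innerSL ℝ x := by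
    rw [smul_smul, show (N : ℝ) - 2 = ((N - 2 : ℕ) : ℝ) by push_cast [hN]; ring,
      Real.rpow_natCast, inv_mul_cancel_left₀ h0]
  rw [e, ← e2]
  exact h

theorem contDiff_volCoord (hN : 2 ≤ N) : ContDiff ℝ 1 (volCoord (N := N)) := by
  have h := (contDiff_norm_rpow (E := EuclideanSpace ℝ (Fin N)) (p := (N : ℝ))
    (by exact_mod_cast hN)).mul (contDiff_const (c := (N : ℝ)⁻¹))
  have e : (volCoord : EuclideanSpace ℝ (Fin N) → ℝ) = fun y => ‖y‖ ^ (N : ℝ) * (N : ℝ)⁻¹ := by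
    funext y
    rw [volCoord, Real.rpow_natCast, div_eq_mul_inv]
  rw [e]
  exact h

theorem contDiffAt_volCoord {x : EuclideanSpace ℝ (Fin N)} (hx : x ≠ 0) {n : WithTop ℕ∞} :
    ContDiffAt ℝ n volCoord x :=
  ((contDiffAt_norm ℝ hx).pow N).div_const _

theorem continuous_volCoord : Continuous (volCoord (N := N)) :=
  (continuous_norm.pow N).div_const _

/-- Sublevel sets of the volume coordinate are balls whose volume is proportional to the level, so
the two finite measures agree on half-lines. -/
theorem map_volCoord (hN : 2 ≤ N) {R : ℝ} (hR : 0 < R) :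
    Measure.map volCoord ((volume : Measure (EuclideanSpace ℝ (Fin N))).restrict (ballDomain N R))
      = ENNReal.ofReal (sphereConst N) • (volume : Measure ℝ).restrict (Ioo 0 (R ^ N / N)) := by
  have hN0 : 0 < N := by omega
  have h : (0 : ℝ) < N := by exact_mod_cast hN0
  set w₁ := volume (Metric.ball (0 : EuclideanSpace ℝ (Fin N)) 1) with hw
  have hw' : w₁ ≠ ⊤ := measure_ball_lt_top.ne
  have hfin : IsFiniteMeasure
      ((volume : Measure (EuclideanSpace ℝ (Fin N))).restrict (ballDomain N R)) := ⟨by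
    rw [Measure.restrict_apply_univ]; exact measure_ball_lt_top⟩
  have hc : ∀ a : ℝ, 0 ≤ a → ENNReal.ofReal (sphereConst N) * ENNReal.ofReal a
      = ENNReal.ofReal (N * a) * w₁ := fun a ha => by
    rw [sphereConst, ← hw, ENNReal.ofReal_mul h.le, ENNReal.ofReal_toReal hw',
      ENNReal.ofReal_mul h.le]
    ring
  refine Measure.ext_of_Iic _ _ fun a => ?_
  rw [Measure.map_apply continuous_volCoord.measurable measurableSet_Iic,
    Measure.restrict_apply (continuous_volCoord.measurable measurableSet_Iic),
    Measure.smul_apply, Measure.restrict_apply measurableSet_Iic, smul_eq_mul]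
  rcases lt_or_ge a 0 with h1 | h1
  · have e1 : volCoord (N := N) ⁻¹' Iic a = ∅ := by
      ext x
      simpa using h1.trans_le (volCoord_nonneg x)
    have e2 : Iic a ∩ Ioo 0 (R ^ N / N) = ∅ := by
      ext x
      simp only [mem_inter_iff, mem_Iic, mem_Ioo, mem_empty_iff_false, iff_false]
      intro h2
      linarith [h2.1, h2.2.1]
    simp [e1, e2]
  rcases lt_or_ge a (R ^ N / N) with h2 | h2
  · have hNa : 0 ≤ N * a := by positivity
    set s := volRadius N a with hs
    have hs0 : 0 ≤ s := Real.rpow_nonneg hNa _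
    have hsN : s ^ N = N * a := by
      rw [hs, volRadius, Real.rpow_inv_natCast_pow hNa hN0.ne']
    have e1 : volCoord (N := N) ⁻¹' Iic a ∩ ballDomain N R = Metric.closedBall 0 s := by
      ext x
      have e3 : volCoord x ≤ a ↔ ‖x‖ ≤ s := by
        rw [volCoord, div_le_iff₀ h, mul_comm a, ← hsN, pow_le_pow_iff_left₀ (norm_nonneg _) hs0
          hN0.ne']
      rw [mem_inter_iff, mem_preimage, mem_Iic, ← volCoord_lt_iff hN0 hR, mem_closedBall_zero_iff,
        e3]
      exact ⟨fun h => h.1, fun h => ⟨h, (e3.2 h).trans_lt h2⟩⟩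
    have e2 : Iic a ∩ Ioo 0 (R ^ N / N) = Ioc 0 a := by
      ext x
      simp only [mem_inter_iff, mem_Iic, mem_Ioo, mem_Ioc]
      exact ⟨fun h => ⟨h.2.1, h.1⟩, fun h => ⟨h.2, h.1, h.2.trans_lt h2⟩⟩
    rw [e1, e2, Real.volume_Ioc, sub_zero, hc a h1, Measure.addHaar_closedBall _ _ hs0,
      finrank_euclideanSpace_fin, hsN]
  · have e1 : volCoord (N := N) ⁻¹' Iic a ∩ ballDomain N R = Metric.ball 0 R :=
      inter_eq_right.2 fun x hx => (((volCoord_lt_iff hN0 hR x).2 hx).le.trans h2)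
    have e2 : Iic a ∩ Ioo 0 (R ^ N / N) = Ioo 0 (R ^ N / N) :=
      inter_eq_right.2 fun x hx => hx.2.le.trans h2
    rw [e1, e2, Real.volume_Ioo, sub_zero, hc _ (by positivity), Measure.addHaar_ball_of_pos _ _ hR,
      finrank_euclideanSpace_fin, mul_div_cancel₀ _ h.ne']

theorem restrict_spaceTimeCyl (R T : ℝ) :
    (volume : Measure (ℝ × EuclideanSpace ℝ (Fin N))).restrict (spaceTimeCyl N R T)
      = ((volume : Measure ℝ).restrict (Ioo 0 T)).prod
        ((volume : Measure (EuclideanSpace ℝ (Fin N))).restrict (ballDomain N R)) := by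
  rw [Measure.prod_restrict]; rfl

theorem map_volCoord_spaceTime (hN : 2 ≤ N) {R : ℝ} (hR : 0 < R) (T : ℝ) :
    Measure.map (fun z : ℝ × EuclideanSpace ℝ (Fin N) => (z.1, volCoord z.2))
      (volume.restrict (spaceTimeCyl N R T))
      = ENNReal.ofReal (sphereConst N) •
        (volume : Measure (ℝ × ℝ)).restrict (Ioo 0 T ×ˢ Ioo 0 (R ^ N / N)) := by
  have hfin : IsFiniteMeasure
      ((volume : Measure (EuclideanSpace ℝ (Fin N))).restrict (ballDomain N R)) := ⟨by
    rw [Measure.restrict_apply_univ]; exact measure_ball_lt_top⟩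
  have h := Measure.map_prod_map ((volume : Measure ℝ).restrict (Ioo 0 T))
    ((volume : Measure (EuclideanSpace ℝ (Fin N))).restrict (ballDomain N R)) measurable_id
    (continuous_volCoord (N := N)).measurable
  rw [restrict_spaceTimeCyl]
  change Measure.map (Prod.map id volCoord) _ = _
  rw [← h, map_volCoord hN hR, Measure.map_id, Measure.prod_smul_right, Measure.prod_restrict]
  rfl

theorem measurable_prod_volCoord :
    Measurable fun z : ℝ × EuclideanSpace ℝ (Fin N) => (z.1, volCoord z.2) :=
  measurable_fst.prodMk (continuous_volCoord.measurable.comp measurable_snd)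

end VolumeCoordinate

/-! ### Radial fields on time slices -/

section Slices

variable {N : ℕ}

theorem hasFDerivAt_comp_volCoord (hN : 2 ≤ N) {h : ℝ → ℝ} (hh : ContDiff ℝ 1 h)
    (x : EuclideanSpace ℝ (Fin N)) :
    HasFDerivAt (fun y => h (volCoord y))
      (deriv h (volCoord x) • (‖x‖ ^ (N - 2)) • innerSL ℝ x) x :=
  ((hh.differentiable one_ne_zero _).hasDerivAt).comp_hasFDerivAt x (hasFDerivAt_volCoord hN x)

theorem inner_smul_radial (hN : 2 ≤ N) {x : EuclideanSpace ℝ (Fin N)} (hx : x ≠ 0) (s : ℝ) :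
    ‖x‖ ^ (N - 2) * inner ℝ x ((s * (‖x‖ ^ N)⁻¹) • x) = s := by
  have h0 : ‖x‖ ≠ 0 := norm_ne_zero_iff.2 hx
  have e : ‖x‖ ^ N = ‖x‖ ^ (N - 2) * ‖x‖ ^ 2 := by rw [← pow_add]; congr 1; omega
  rw [inner_smul_right, real_inner_self_eq_norm_sq, e]
  field_simp

/-- Integrate by parts with the function x ↦ h(volCoord x), whose gradient h' |x|^(N-2) x pairs with
W to give f h'. As W vanishes on the sphere, h may be any C¹ function; the weak derivative of f,
extended by zero, is thus the divergence of W, with no mass at the endpoints. -/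
theorem integral_divOf_slice (hN : 2 ≤ N) {R : ℝ} (hR : 0 < R)
    {W : EuclideanSpace ℝ (Fin N) → EuclideanSpace ℝ (Fin N)}
    {DW : EuclideanSpace ℝ (Fin N) → EuclideanSpace ℝ (Fin N) →L[ℝ] EuclideanSpace ℝ (Fin N)}
    (hH : IsH10WithGradient R W DW) {f : ℝ → ℝ} (hf : Measurable f)
    (hW : ∀ᵐ x ∂(volume.restrict (ballDomain N R)), W x = (f (volCoord x) * (‖x‖ ^ N)⁻¹) • x)
    {h : ℝ → ℝ} (hh : ContDiff ℝ 1 h) :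
    IntegrableOn (fun q => f q * deriv h q) (Ioo 0 (R ^ N / N)) ∧
    IntegrableOn (fun x => h (volCoord x) * divOf (DW x)) (ballDomain N R) ∧
    ∫ x in ballDomain N R, h (volCoord x) * divOf (DW x)
      = -(sphereConst N * ∫ q in Ioo 0 (R ^ N / N), f q * deriv h q) := by
  have hN0 : 0 < N := by omega
  have hc := sphereConst_pos hN0
  have : Nonempty (Fin N) := ⟨⟨0, hN0⟩⟩
  set H : EuclideanSpace ℝ (Fin N) → ℝ := fun x => h (volCoord x) with hHdef
  have hHc : ContDiff ℝ 1 H := hh.comp (contDiff_volCoord hN)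
  have hα : Continuous (fderiv ℝ H) := hHc.continuous_fderiv one_ne_zero
  obtain ⟨i1, i2, i3⟩ := hH.integral_eq_zero (α := fderiv ℝ H) (β := fun x => H x • divCLM N) hα
    (hHc.continuous.smul continuous_const) fun φ hφ hφc => by
      have := integral_fderiv_add_div hHc (hφ.of_le (by simp)) hφc
      simpa [divCLM_apply] using this
  simp only [smul_apply, divCLM_apply, smul_eq_mul] at i2 i3
  have e : ∀ᵐ x ∂(volume.restrict (ballDomain N R)), fderiv ℝ H x (W x)
      = f (volCoord x) * deriv h (volCoord x) := by
    have hne : ∀ᵐ x ∂((volume : Measure (EuclideanSpace ℝ (Fin N))).restrict (ballDomain N R)),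
        x ≠ 0 := by
      refine ae_restrict_of_ae ?_
      have : Nontrivial (EuclideanSpace ℝ (Fin N)) := Module.nontrivial_of_finrank_pos (R := ℝ) (by
        rw [finrank_euclideanSpace_fin]; exact hN0)
      exact Measure.ae_ne volume 0
    filter_upwards [hW, hne] with x hx hx0
    rw [(hasFDerivAt_comp_volCoord hN hh x).fderiv, hx]
    simp only [smul_apply, innerSL_apply_apply, smul_eq_mul]
    rw [inner_smul_radial hN hx0, mul_comm]
  have hm : Measurable fun q => f q * deriv h q :=
    hf.mul (hh.continuous_deriv_one.measurable)
  have hmap := map_volCoord hN hR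
  have i4 : IntegrableOn (fun x : EuclideanSpace ℝ (Fin N) =>
      f (volCoord x) * deriv h (volCoord x)) (ballDomain N R) := i1.congr e
  refine ⟨integrable_of_comp_of_map_eq_smul continuous_volCoord.measurable hmap hc
    hm.aestronglyMeasurable i4, i2, ?_⟩
  rw [← integral_comp_of_map_eq_smul continuous_volCoord.measurable hmap hc
    hm.aestronglyMeasurable]
  have h5 := integral_add i1 i2
  rw [i3, integral_congr_ae e] at h5
  linarith

/-- A bound on the divergence becomes a distributional Lipschitz bound on the flux. Since h need not
vanish at 0 or V, the bound holds for the zero extension to the line, which is what forces the flux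
to vanish at both ends. -/
theorem abs_integral_deriv_slice_le (hN : 2 ≤ N) {R : ℝ} (hR : 0 < R)
    {W : EuclideanSpace ℝ (Fin N) → EuclideanSpace ℝ (Fin N)}
    {DW : EuclideanSpace ℝ (Fin N) → EuclideanSpace ℝ (Fin N) →L[ℝ] EuclideanSpace ℝ (Fin N)}
    (hH : IsH10WithGradient R W DW) {f : ℝ → ℝ} (hf : Measurable f)
    (hW : ∀ᵐ x ∂(volume.restrict (ballDomain N R)), W x = (f (volCoord x) * (‖x‖ ^ N)⁻¹) • x)
    {d : ℝ} (hd : ∀ᵐ x ∂(volume.restrict (ballDomain N R)), |divOf (DW x)| ≤ d)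
    {h : ℝ → ℝ} (hh : ContDiff ℝ 1 h) (hhc : HasCompactSupport h) :
    |∫ q in Ioo 0 (R ^ N / N), f q * deriv h q| ≤ d * ∫ q, |h q| := by
  have hN0 : 0 < N := by omega
  have hc := sphereConst_pos hN0
  obtain ⟨-, i2, i3⟩ := integral_divOf_slice hN hR hH hf hW hh
  have hd0 : 0 ≤ d := by
    have : (ae (volume.restrict (ballDomain N R))).NeBot := by
      rw [ae_restrict_neBot]
      exact (Metric.measure_ball_pos volume _ hR).ne'
    obtain ⟨x, hx⟩ := hd.exists
    exact (abs_nonneg _).trans hx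
  have hmap := map_volCoord hN hR
  have hcpt := isCompact_closedBall (0 : EuclideanSpace ℝ (Fin N)) R
  have hint : IntegrableOn (fun x : EuclideanSpace ℝ (Fin N) => |h (volCoord x)|)
      (ballDomain N R) :=
    (((hh.continuous.comp continuous_volCoord).abs.continuousOn).integrableOn_compact hcpt).mono_set
      Metric.ball_subset_closedBall
  have h1 : |∫ x in ballDomain N R, h (volCoord x) * divOf (DW x)|
      ≤ ∫ x in ballDomain N R, d * |h (volCoord x)| := by
    refine abs_integral_le_integral_abs.trans (integral_mono_ae i2.abs (hint.const_mul d) ?_)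
    filter_upwards [hd] with x hx
    rw [abs_mul, mul_comm]
    exact mul_le_mul_of_nonneg_right hx (abs_nonneg _)
  have h2 : ∫ x in ballDomain N R, |h (volCoord x)|
      = sphereConst N * ∫ q in Ioo 0 (R ^ N / N), |h q| :=
    integral_comp_of_map_eq_smul continuous_volCoord.measurable hmap hc (f := fun q => |h q|)
      hh.continuous.abs.aestronglyMeasurable
  have h3 : ∫ q in Ioo 0 (R ^ N / N), |h q| ≤ ∫ q, |h q| :=
    setIntegral_le_integral (hh.continuous.integrable_of_hasCompactSupport hhc).abs
      (Filter.Eventually.of_forall fun q => abs_nonneg _)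
  rw [integral_const_mul, h2, i3, abs_neg, abs_mul, abs_of_pos hc] at h1
  have h4 : sphereConst N * |∫ q in Ioo 0 (R ^ N / N), f q * deriv h q|
      ≤ sphereConst N * (d * ∫ q in Ioo 0 (R ^ N / N), |h q|) := by linarith
  exact (le_of_mul_le_mul_left h4 hc).trans (mul_le_mul_of_nonneg_left h3 hd0)

end Slices

/-- Integration by parts for a transport field against a smooth function. -/
theorem IsTransportField.integral_fieldDiv_mul {V T : ℝ} {D : ℝ → ℝ} {g : ℝ → ℝ → ℝ}
    (hg : IsTransportField V T D g) (t : ℝ) {h : ℝ → ℝ} (hh : ContDiff ℝ 1 h) :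
    ∫ q in Ioo 0 V, fieldDiv g t q * h q = -∫ q in Ioo 0 V, g t q * deriv h q := by
  have h1 := (hg.field_ac t).mul (IsACWithDeriv.id.comp_contDiff hh)
  have h2 := h1.integral_eq 0 V
  rw [hg.zero_right t V le_rfl, hg.zero_left t 0 le_rfl, zero_mul, zero_mul, sub_self,
    intervalIntegral.integral_of_le hg.pos.le, integral_Ioc_eq_integral_Ioo] at h2
  have i1 : IntegrableOn (fun q => fieldDiv g t q * h q) (Ioo 0 V) := by
    refine (IntegrableOn.continuousOn_mul hh.continuous.continuousOn
      ((hg.field_ac t).locallyIntegrable.integrableOn_isCompact isCompact_Icc)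
      isCompact_Icc).mono_set Ioo_subset_Icc_self |>.congr ?_
    exact Filter.Eventually.of_forall fun q => mul_comm _ _
  have hcont : Continuous fun q => g t q * deriv h q :=
    (hg.continuous_field t).mul hh.continuous_deriv_one
  have i2 : IntegrableOn (fun q => g t q * deriv h q) (Ioo 0 V) :=
    (hcont.continuousOn.integrableOn_compact isCompact_Icc).mono_set Ioo_subset_Icc_self
  have h3 := integral_add i1 i2
  have h4 : ∫ q in Ioo 0 V, (fieldDiv g t q * h q + g t q * deriv h q) = 0 := by
    refine Eq.trans ?_ h2
    refine integral_congr_ae (Filter.Eventually.of_forall fun q => ?_)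
    simp
  linarith

section TransportField

variable {N : ℕ}

theorem ae_slice_of_ae_cyl {R T : ℝ} {P : ℝ × EuclideanSpace ℝ (Fin N) → Prop}
    (h : ∀ᵐ z ∂(volume.restrict (spaceTimeCyl N R T)), P z) :
    ∀ᵐ t ∂(volume.restrict (Ioo (0 : ℝ) T)),
      ∀ᵐ x ∂((volume : Measure (EuclideanSpace ℝ (Fin N))).restrict (ballDomain N R)), P (t, x) := by
  rw [restrict_spaceTimeCyl] at h
  exact Measure.ae_ae_of_ae_prod h

/-- The essential supremum of a time slice, for a function in `L²(0,T;L^∞)`, coincides almost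
everywhere with a square integrable function. -/
theorem MemMixedLp.exists_slice_bound {R T : ℝ} {w : ℝ × EuclideanSpace ℝ (Fin N) → ℝ}
    (h : MemMixedLp 2 ⊤ R T w) :
    ∃ d : ℝ → ℝ, Measurable d ∧ (∀ t, 0 ≤ d t) ∧ IntegrableOn (fun t => d t ^ 2) (Ioo 0 T) ∧
      ∀ᵐ t ∂(volume.restrict (Ioo (0 : ℝ) T)),
        ∀ᵐ x ∂((volume : Measure (EuclideanSpace ℝ (Fin N))).restrict (ballDomain N R)),
          |w (t, x)| ≤ d t := by
  obtain ⟨hm, hfin⟩ := h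
  set m := (volume : Measure (EuclideanSpace ℝ (Fin N))).restrict (ballDomain N R) with hmdef
  set w' := hm.mk w with hw'
  have hw'm : StronglyMeasurable w' := hm.stronglyMeasurable_mk
  set δ : ℝ → ℝ≥0∞ := fun t => eLpNorm (fun x => w' (t, x)) ⊤ m with hδ
  have hδm : Measurable δ := by
    -- An essential supremum is at most c exactly when the superlevel set is null, and the measure
    -- of a slice depends measurably on the time.
    refine measurable_of_Iic fun c => ?_
    have e : δ ⁻¹' Iic c = {t | m {x | c < ‖w' (t, x)‖ₑ} = 0} := by
      ext t
      rw [mem_preimage, mem_Iic, hδ, mem_ofPred_eq]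
      simp only [eLpNorm_exponent_top]
      constructor
      · intro h
        have := ae_le_eLpNormEssSup (f := fun x => w' (t, x)) (μ := m)
        have h2 : ∀ᵐ x ∂m, ‖w' (t, x)‖ₑ ≤ c := this.mono fun x hx => hx.trans h
        rw [ae_iff] at h2
        simpa using h2
      · intro h
        refine essSup_le_of_ae_le c ?_
        change ∀ᵐ x ∂m, ‖w' (t, x)‖ₑ ≤ c
        rw [ae_iff]
        simpa using h
    rw [e]
    have hS : MeasurableSet {z : ℝ × EuclideanSpace ℝ (Fin N) | c < ‖w' z‖ₑ} :=
      measurableSet_lt measurable_const hw'm.measurable.enorm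
    exact (measurable_measure_prodMk_left hS) (measurableSet_singleton 0)
  have hae : ∀ᵐ t ∂(volume.restrict (Ioo (0 : ℝ) T)), ∀ᵐ x ∂m, w (t, x) = w' (t, x) :=
    ae_slice_of_ae_cyl hm.ae_eq_mk
  have hδw : ∀ᵐ t ∂(volume.restrict (Ioo (0 : ℝ) T)), δ t = eLpNorm (fun x => w (t, x)) ⊤ m := by
    filter_upwards [hae] with t ht
    exact eLpNorm_congr_ae (ht.mono fun x hx => hx.symm)
  have hδ2 : ∫⁻ t in Ioo 0 T, δ t ^ 2 < ⊤ := by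
    have h1 : eLpNorm δ 2 (volume.restrict (Ioo 0 T)) < ⊤ := by
      rwa [eLpNorm_congr_ae hδw]
    have h2 := lintegral_rpow_enorm_lt_top_of_eLpNorm_lt_top two_ne_zero ENNReal.ofNat_ne_top h1
    simpa using h2
  have hδfin : ∀ᵐ t ∂(volume.restrict (Ioo (0 : ℝ) T)), δ t < ⊤ := by
    filter_upwards [ae_lt_top (hδm.pow_const 2) hδ2.ne] with t ht
    exact ENNReal.pow_lt_top_iff.1 ht |>.resolve_right two_ne_zero
  refine ⟨fun t => (δ t).toReal, hδm.ennreal_toReal, fun t => ENNReal.toReal_nonneg, ?_, ?_⟩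
  · have : (fun t => (δ t).toReal ^ 2) = fun t => (δ t ^ 2).toReal := by
      funext t; rw [ENNReal.toReal_pow]
    rw [this]
    exact integrable_toReal_of_lintegral_ne_top (hδm.pow_const 2).aemeasurable hδ2.ne
  · filter_upwards [hae, hδfin] with t h1 h2
    filter_upwards [h1, ae_le_eLpNormEssSup (f := fun x => w' (t, x)) (μ := m)] with x h3 h4
    rw [h3, ← Real.norm_eq_abs, ← toReal_enorm]
    exact ENNReal.toReal_mono h2.ne (h4.trans (le_of_eq (eLpNorm_exponent_top).symm))

end TransportField

/-! ### The transport field of a radial flow -/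

section TransportField

variable {N : ℕ}

/-- The volume flux of a radial velocity field with bounded divergence is a transport field. -/
theorem exists_isTransportField (hN : 2 ≤ N) {R T : ℝ} (hR : 0 < R)
    {U : ℝ × EuclideanSpace ℝ (Fin N) → EuclideanSpace ℝ (Fin N)}
    {DU : ℝ × EuclideanSpace ℝ (Fin N) →
      EuclideanSpace ℝ (Fin N) →L[ℝ] EuclideanSpace ℝ (Fin N)}
    (hbd : ∀ᵐ t ∂(volume.restrict (Ioo (0 : ℝ) T)),
      IsH10WithGradient R (fun x => U (t, x)) (fun x => DU (t, x)))
    (hdiv : MemMixedLp 2 ⊤ R T (fun z => divOf (DU z))) {u : ℝ × ℝ → ℝ} (hu : Measurable u)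
    (hU : ∀ᵐ z ∂(volume.restrict (spaceTimeCyl N R T)),
      U z = u (z.1, ‖z.2‖) • (‖z.2‖⁻¹ • z.2)) :
    ∃ (D : ℝ → ℝ) (g : ℝ → ℝ → ℝ), IsTransportField (R ^ N / N) T D g ∧
      (∀ᵐ z ∂(volume.restrict (spaceTimeCyl N R T)),
        U z = (g z.1 (volCoord z.2) * (‖z.2‖ ^ N)⁻¹) • z.2) ∧
      ∀ᵐ t ∂(volume.restrict (Ioo (0 : ℝ) T)), ∀ h : ℝ → ℝ, ContDiff ℝ 1 h →
        ∫ x in ballDomain N R, h (volCoord x) * divOf (DU (t, x))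
          = sphereConst N * ∫ q in Ioo 0 (R ^ N / N), fieldDiv g t q * h q := by
  have hN0 : 0 < N := by omega
  have hNr : (0 : ℝ) < N := by exact_mod_cast hN0
  set V := R ^ N / N with hV
  have hV0 : 0 < V := by positivity
  obtain ⟨d, hdm, hd0, hd2, hdb⟩ := hdiv.exists_slice_bound
  set F : ℝ → ℝ → ℝ := fun t q => volRadius N q ^ (N - 1) * u (t, volRadius N q) with hF
  have hFm : Measurable (Function.uncurry F) := by
    have h1 : Measurable fun p : ℝ × ℝ => volRadius N p.2 := measurable_volRadius.comp measurable_snd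
    exact (h1.pow_const _).mul (hu.comp (measurable_fst.prodMk h1))
  have hFt : ∀ t, Measurable (F t) := fun t => hFm.comp (measurable_const.prodMk measurable_id)
  have hUF : ∀ᵐ z ∂(volume.restrict (spaceTimeCyl N R T)),
      U z = (F z.1 (volCoord z.2) * (‖z.2‖ ^ N)⁻¹) • z.2 := by
    filter_upwards [hU] with z hz
    rw [hz, hF]
    simp only
    rw [volRadius_volCoord hN0, smul_smul]
    rcases eq_or_ne z.2 0 with h | h
    · rw [h, smul_zero, smul_zero]
    · congr 1
      have h0 : ‖z.2‖ ≠ 0 := norm_ne_zero_iff.2 h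
      have e : ‖z.2‖ ^ N = ‖z.2‖ ^ (N - 1) * ‖z.2‖ := by rw [← pow_succ]; congr 1; omega
      rw [e]
      field_simp
  have hgood : ∀ᵐ t ∂(volume.restrict (Ioo (0 : ℝ) T)),
      IsH10WithGradient R (fun x => U (t, x)) (fun x => DU (t, x)) ∧
      (∀ᵐ x ∂(volume.restrict (ballDomain N R)),
        U (t, x) = (F t (volCoord x) * (‖x‖ ^ N)⁻¹) • x) ∧
      (∀ᵐ x ∂(volume.restrict (ballDomain N R)), |divOf (DU (t, x))| ≤ d t) := by
    filter_upwards [hbd, ae_slice_of_ae_cyl hUF, hdb] with t h1 h2 h3 using ⟨h1, h2, h3⟩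
  -- Flux and Lipschitz constant are set to zero on a measurable null set of bad times, so that the
  -- family of slices has the required bounds at every time.
  obtain ⟨M, hMs, hMm, hM0⟩ := exists_measurable_superset_of_null (ae_iff.1 hgood)
  set 𝒢 : Set ℝ := Ioo 0 T \ M with h𝒢
  have h𝒢m : MeasurableSet 𝒢 := measurableSet_Ioo.diff hMm
  have h𝒢ae : ∀ᵐ t ∂(volume.restrict (Ioo (0 : ℝ) T)), t ∈ 𝒢 := by
    have h1 : ∀ᵐ t ∂(volume.restrict (Ioo (0 : ℝ) T)), t ∉ M := measure_eq_zero_iff_ae_notMem.1 hM0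
    filter_upwards [h1, ae_restrict_mem measurableSet_Ioo] with t h1 h2 using ⟨h2, h1⟩
  have hg𝒢 : ∀ t ∈ 𝒢, _ := fun t ht => not_not.1 fun hn => ht.2 (hMs hn)
  set f : ℝ → ℝ → ℝ := fun t q => (𝒢 ×ˢ Ioo 0 V).indicator (Function.uncurry F) (t, q) with hf
  have hf1 : ∀ t ∈ 𝒢, f t = (Ioo 0 V).indicator (F t) := fun t ht => by
    funext q
    by_cases hq : q ∈ Ioo 0 V
    · rw [indicator_of_mem hq, hf]
      exact indicator_of_mem (show (t, q) ∈ 𝒢 ×ˢ Ioo 0 V from ⟨ht, hq⟩) _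
    · rw [indicator_of_notMem hq, hf]
      exact indicator_of_notMem (fun h => hq h.2) _
  have hf2 : ∀ t ∉ 𝒢, f t = fun _ => 0 := fun t ht => by
    funext q
    exact indicator_of_notMem (fun h => ht h.1) _
  have hfm : Measurable (Function.uncurry f) := hFm.indicator (h𝒢m.prod measurableSet_Ioo)
  set D : ℝ → ℝ := 𝒢.indicator d with hD
  have hDm : Measurable D := hdm.indicator h𝒢m
  have hD0 : ∀ t, 0 ≤ D t := fun t => indicator_nonneg (fun s _ => hd0 s) t
  have hfint : ∀ t, ∀ h : ℝ → ℝ, ∫ q, f t q * deriv h q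
      = 𝒢.indicator (fun t => ∫ q in Ioo 0 V, F t q * deriv h q) t := fun t h => by
    by_cases ht : t ∈ 𝒢
    · rw [indicator_of_mem ht, hf1 t ht, ← integral_indicator measurableSet_Ioo]
      refine integral_congr_ae (Filter.Eventually.of_forall fun q => ?_)
      exact (indicator_mul_left (Ioo 0 V) (F t) (deriv h)).symm
    · rw [indicator_of_notMem ht, hf2 t ht]; simp
  obtain ⟨g, hgm, hlip, hz1, hz2, hae⟩ := exists_lipschitz_family (V := V) hfm hD0
    (fun t => by
      by_cases ht : t ∈ 𝒢
      · obtain ⟨h1, h2, h3⟩ := hg𝒢 t ht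
        -- With h(q) = q the derivative is 1, so the lemma yields integrability of the flux itself.
        have h4 := (integral_divOf_slice hN hR h1 (hFt t) h2 contDiff_id).1
        rw [hf1 t ht]
        refine Integrable.locallyIntegrable ((integrable_indicator_iff measurableSet_Ioo).2 ?_)
        simpa using h4
      · rw [hf2 t ht]; exact (integrable_zero _ _ _).locallyIntegrable)
    (fun t q hq => indicator_of_notMem (fun h => hq h.2) _)
    (fun t h hh hhc => by
      rw [hfint]
      by_cases ht : t ∈ 𝒢
      · obtain ⟨h1, h2, h3⟩ := hg𝒢 t ht
        rw [indicator_of_mem ht, hD, indicator_of_mem ht]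
        exact abs_integral_deriv_slice_le hN hR h1 (hFt t) h2 h3 (hh.of_le (by simp)) hhc
      · rw [indicator_of_notMem ht, abs_zero]
        exact mul_nonneg (hD0 t) (integral_nonneg fun q => abs_nonneg _))
  have hsq : Integrable fun t => D t ^ 2 := by
    have e : (fun t => D t ^ 2) = 𝒢.indicator fun t => d t ^ 2 := by
      funext t
      by_cases ht : t ∈ 𝒢
      · rw [hD, indicator_of_mem ht, indicator_of_mem ht]
      · rw [hD, indicator_of_notMem ht, indicator_of_notMem ht]; norm_num
    rw [e, integrable_indicator_iff h𝒢m]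
    exact hd2.mono_set sdiff_subset
  have hDT : ∀ t, t ∉ Ioo 0 T → D t = 0 := fun t ht => indicator_of_notMem (fun h => ht h.1) _
  have hDi : Integrable D := by
    have h1 : IntegrableOn (fun t => 1 + D t ^ 2) (Ioo 0 T) :=
      (integrableOn_const (by simp)).add hsq.integrableOn
    have h2 : IntegrableOn D (Ioo 0 T) := by
      refine Integrable.mono' h1 hDm.aestronglyMeasurable (Filter.Eventually.of_forall fun t => ?_)
      rw [Real.norm_of_nonneg (hD0 t)]
      nlinarith [sq_nonneg (D t - 1), hD0 t]
    exact h2.integrable_of_forall_notMem_eq_zero hDT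
  have hfield : IsTransportField V T D g :=
    ⟨hV0, hgm, hDm, hD0, hDi, hsq, hDT, hlip, hz1, hz2⟩
  have hgF : ∀ t ∈ 𝒢, ∀ᵐ q ∂(volume.restrict (Ioo 0 V)), g t q = F t q := fun t ht => by
    rw [ae_restrict_iff' measurableSet_Ioo]
    filter_upwards [hae t] with q hq hqV
    rw [hq, hf1 t ht, indicator_of_mem hqV]
  refine ⟨D, g, hfield, ?_, ?_⟩
  · have hS : MeasurableSet {p : ℝ × ℝ | g p.1 p.2 = F p.1 p.2} := measurableSet_eq_fun hgm hFm
    have h1 : ∀ᵐ p ∂((volume : Measure (ℝ × ℝ)).restrict (Ioo 0 T ×ˢ Ioo 0 V)),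
        g p.1 p.2 = F p.1 p.2 := by
      have : (volume : Measure (ℝ × ℝ)).restrict (Ioo 0 T ×ˢ Ioo 0 V)
          = (volume.restrict (Ioo 0 T)).prod (volume.restrict (Ioo 0 V)) := by
        rw [Measure.prod_restrict]; rfl
      rw [this, Measure.ae_prod_iff_ae_ae hS]
      filter_upwards [h𝒢ae] with t ht using hgF t ht
    have h2 := ae_comp_of_map_eq_smul measurable_prod_volCoord
      (map_volCoord_spaceTime (N := N) hN hR T) h1
    filter_upwards [hUF, h2] with z h3 h4
    rw [h3, h4]
  · filter_upwards [h𝒢ae] with t ht h hh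
    obtain ⟨h1, h2, h3⟩ := hg𝒢 t ht
    rw [(integral_divOf_slice hN hR h1 (hFt t) h2 hh).2.2, hfield.integral_fieldDiv_mul t hh,
      mul_neg]
    congr 2
    refine integral_congr_ae ?_
    filter_upwards [hgF t ht] with q hq
    rw [hq]

end TransportField

/-! ### Radial test functions -/

theorem contDiff_of_forall_tsupport {E F : Type*} [NormedAddCommGroup E] [NormedSpace ℝ E]
    [NormedAddCommGroup F] [NormedSpace ℝ F] {n : WithTop ℕ∞} {f : E → F}
    (h : ∀ x ∈ tsupport f, ContDiffAt ℝ n f x) : ContDiff ℝ n f := by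
  refine contDiff_iff_contDiffAt.2 fun x => ?_
  by_cases hx : x ∈ tsupport f
  · exact h x hx
  · exact contDiffAt_const.congr_of_eventuallyEq (notMem_tsupport_iff_eventuallyEq.1 hx)

section RadialTests

variable {N : ℕ}

theorem fderiv_apply_prod {z : ℝ × ℝ → ℝ} {p : ℝ × ℝ} (τ w : ℝ) :
    fderiv ℝ z p (τ, w) = τ * fderiv ℝ z p (1, 0) + w * fderiv ℝ z p (0, 1) := by
  have : ((τ, w) : ℝ × ℝ) = τ • (1, 0) + w • (0, 1) := by simp
  rw [this, map_add, map_smul, map_smul, smul_eq_mul, smul_eq_mul]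

/-- Functions of the volume coordinate supported in `(-∞, T) × (0, V)` are supported in
`(-∞, T) × (B_R ∖ {0})`. -/
theorem radial_support (hN : 0 < N) {R T : ℝ} (hR : 0 < R) {z : ℝ × ℝ → ℝ}
    (hc : HasCompactSupport z) (hs : tsupport z ⊆ Iio T ×ˢ Ioo 0 (R ^ N / N)) {G : Type*}
    [NormedAddCommGroup G] {F : ℝ × EuclideanSpace ℝ (Fin N) → G}
    (hF : ∀ p, z (p.1, volCoord p.2) = 0 → F p = 0) :
    HasCompactSupport F ∧ tsupport F ⊆ Iio T ×ˢ ballDomain N R ∧ ∀ p ∈ tsupport F, p.2 ≠ 0 := by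
  have hΦ : Continuous fun p : ℝ × EuclideanSpace ℝ (Fin N) => (p.1, volCoord p.2) :=
    continuous_fst.prodMk (continuous_volCoord.comp continuous_snd)
  have h1 : tsupport F ⊆ (fun p : ℝ × EuclideanSpace ℝ (Fin N) => (p.1, volCoord p.2)) ⁻¹'
      tsupport z := by
    refine closure_minimal (fun p hp => ?_) ((isClosed_tsupport z).preimage hΦ)
    exact subset_tsupport z (fun h0 => hp (hF p h0))
  have h2 : tsupport F ⊆ Iio T ×ˢ ballDomain N R := fun p hp =>
    ⟨(hs (h1 hp)).1, (volCoord_lt_iff hN hR p.2).1 (hs (h1 hp)).2.2⟩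
  refine ⟨?_, h2, fun p hp h0 => ?_⟩
  · refine HasCompactSupport.intro (K := (Prod.fst '' tsupport z) ×ˢ Metric.closedBall 0 R)
      ((hc.isCompact.image continuous_fst).prod (isCompact_closedBall _ _)) fun p hp => ?_
    by_contra hFp
    have hpt := subset_tsupport F hFp
    exact hp ⟨⟨_, h1 hpt, rfl⟩, Metric.ball_subset_closedBall (h2 hpt).2⟩
  · have := (hs (h1 hp)).2.1
    simp only [h0, volCoord, norm_zero, zero_pow hN.ne', zero_div, lt_irrefl] at this

theorem hasFDerivAt_prod_volCoord (hN : 2 ≤ N) (p : ℝ × EuclideanSpace ℝ (Fin N)) :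
    HasFDerivAt (fun p : ℝ × EuclideanSpace ℝ (Fin N) => (p.1, volCoord p.2))
      ((ContinuousLinearMap.fst ℝ ℝ _).prod
        (((‖p.2‖ ^ (N - 2)) • innerSL ℝ p.2).comp (ContinuousLinearMap.snd ℝ ℝ _))) p :=
  hasFDerivAt_fst.prodMk ((hasFDerivAt_volCoord hN p.2).comp p hasFDerivAt_snd)

theorem fderiv_radial (hN : 2 ≤ N) {z : ℝ × ℝ → ℝ} (hz : ContDiff ℝ ∞ z)
    (p : ℝ × EuclideanSpace ℝ (Fin N)) (τ : ℝ) (v : EuclideanSpace ℝ (Fin N)) :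
    fderiv ℝ (fun p : ℝ × EuclideanSpace ℝ (Fin N) => z (p.1, volCoord p.2)) p (τ, v)
      = τ * fderiv ℝ z (p.1, volCoord p.2) (1, 0)
        + ‖p.2‖ ^ (N - 2) * inner ℝ p.2 v * fderiv ℝ z (p.1, volCoord p.2) (0, 1) := by
  have h := ((hz.differentiable (by simp) (p.1, volCoord p.2)).hasFDerivAt.comp p
    (hasFDerivAt_prod_volCoord hN p)).fderiv
  have h' : fderiv ℝ (fun p : ℝ × EuclideanSpace ℝ (Fin N) => z (p.1, volCoord p.2)) p = _ := h
  rw [h']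
  exact fderiv_apply_prod τ _

/-- The volume coordinate need not be smooth at the origin, but the support of the composition
avoids the origin. -/
theorem contDiff_radial {R T : ℝ} (hN : 0 < N) (hR : 0 < R) {z : ℝ × ℝ → ℝ}
    (hz : ContDiff ℝ ∞ z) (hc : HasCompactSupport z)
    (hs : tsupport z ⊆ Iio T ×ˢ Ioo 0 (R ^ N / N)) :
    ContDiff ℝ ∞ fun p : ℝ × EuclideanSpace ℝ (Fin N) => z (p.1, volCoord p.2) := by
  refine contDiff_of_forall_tsupport fun p hp => ?_
  have h0 := (radial_support hN hR hc hs
    (F := fun p : ℝ × EuclideanSpace ℝ (Fin N) => z (p.1, volCoord p.2)) fun p h => h).2.2 p hp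
  exact hz.contDiffAt.comp p (contDiffAt_fst.prodMk
    ((contDiffAt_volCoord h0).comp p contDiffAt_snd))

/-- The radial vector field with volume flux proportional to `z`. -/
noncomputable def radialField (N : ℕ) (z : ℝ × ℝ → ℝ) (p : ℝ × EuclideanSpace ℝ (Fin N)) :
    EuclideanSpace ℝ (Fin N) :=
  (z (p.1, volCoord p.2) * (‖p.2‖ ^ N)⁻¹) • p.2

theorem radialField_support (hN : 0 < N) {R T : ℝ} (hR : 0 < R) {z : ℝ × ℝ → ℝ}
    (hc : HasCompactSupport z) (hs : tsupport z ⊆ Iio T ×ˢ Ioo 0 (R ^ N / N)) :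
    HasCompactSupport (radialField N z) ∧ tsupport (radialField N z) ⊆ Iio T ×ˢ ballDomain N R ∧
      ∀ p ∈ tsupport (radialField N z), p.2 ≠ 0 :=
  radial_support hN hR hc hs fun p hp => by rw [radialField, hp, zero_mul, zero_smul]

theorem contDiff_radialField {R T : ℝ} (hN : 0 < N) (hR : 0 < R) {z : ℝ × ℝ → ℝ}
    (hz : ContDiff ℝ ∞ z) (hc : HasCompactSupport z)
    (hs : tsupport z ⊆ Iio T ×ˢ Ioo 0 (R ^ N / N)) : ContDiff ℝ ∞ (radialField N z) := by
  refine contDiff_of_forall_tsupport fun p hp => ?_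
  have h0 := (radialField_support hN hR hc hs).2.2 p hp
  have h1 : ContDiffAt ℝ ∞ (fun p : ℝ × EuclideanSpace ℝ (Fin N) => (‖p.2‖ ^ N)⁻¹) p :=
    ((contDiffAt_norm ℝ h0).comp p contDiffAt_snd |>.pow N).inv
      (pow_ne_zero _ (norm_ne_zero_iff.2 h0))
  exact ((contDiff_radial hN hR hz hc hs).contDiffAt.mul h1).smul contDiffAt_snd

/-- The radial part of the gradient of a radial field. -/
noncomputable def radialCoeff (N : ℕ) (z : ℝ × ℝ → ℝ) (p : ℝ × EuclideanSpace ℝ (Fin N)) : ℝ :=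
  ‖p.2‖ ^ (N - 2) * (fderiv ℝ z (p.1, volCoord p.2) (0, 1) * (‖p.2‖ ^ N)⁻¹
    - N * z (p.1, volCoord p.2) * ((‖p.2‖ ^ N)⁻¹) ^ 2)

theorem fderiv_radialField (hN : 2 ≤ N) {z : ℝ × ℝ → ℝ} (hz : ContDiff ℝ ∞ z)
    {p : ℝ × EuclideanSpace ℝ (Fin N)} (hp : p.2 ≠ 0) (τ : ℝ) (v : EuclideanSpace ℝ (Fin N)) :
    fderiv ℝ (radialField N z) p (τ, v)
      = (τ * fderiv ℝ z (p.1, volCoord p.2) (1, 0) * (‖p.2‖ ^ N)⁻¹) • p.2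
        + (radialCoeff N z p * inner ℝ p.2 v) • p.2
        + (z (p.1, volCoord p.2) * (‖p.2‖ ^ N)⁻¹) • v := by
  have hN0 : 0 < N := by omega
  have hm : ‖p.2‖ ^ N ≠ 0 := pow_ne_zero _ (norm_ne_zero_iff.2 hp)
  have h1 : HasFDerivAt (fun p : ℝ × EuclideanSpace ℝ (Fin N) => z (p.1, volCoord p.2)) _ p :=
    (hz.differentiable (by simp) (p.1, volCoord p.2)).hasFDerivAt.comp p
      (hasFDerivAt_prod_volCoord hN p)
  have h2 : HasFDerivAt (fun p : ℝ × EuclideanSpace ℝ (Fin N) => (N * volCoord p.2)) _ p :=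
    ((hasFDerivAt_volCoord hN p.2).comp p hasFDerivAt_snd).const_mul (N : ℝ)
  have h3 : HasFDerivAt (fun p : ℝ × EuclideanSpace ℝ (Fin N) => (N * volCoord p.2)⁻¹) _ p :=
    (hasDerivAt_inv (by rw [natCast_mul_volCoord hN0]; exact hm)).comp_hasFDerivAt p h2
  have hsnd : HasFDerivAt (fun p : ℝ × EuclideanSpace ℝ (Fin N) => p.2)
    (ContinuousLinearMap.snd ℝ ℝ (EuclideanSpace ℝ (Fin N))) p := hasFDerivAt_snd
  -- Writing |x|^N as N times the volume coordinate reduces all derivatives to the single formula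
  -- for its gradient.
  have e : radialField N z = fun p : ℝ × EuclideanSpace ℝ (Fin N) =>
      (z (p.1, volCoord p.2) * (N * volCoord p.2)⁻¹) • p.2 := by
    funext y
    rw [radialField, natCast_mul_volCoord hN0]
  have h4 := ((h1.mul h3).smul hsnd).fderiv
  rw [e]
  refine (congrArg (fun L => L (τ, v)) h4).trans ?_
  simp only [natCast_mul_volCoord hN0, add_apply, smul_apply, ContinuousLinearMap.comp_apply,
    ContinuousLinearMap.smulRight_apply, ContinuousLinearMap.coe_snd',
    ContinuousLinearMap.prod_apply, ContinuousLinearMap.coe_fst', innerSL_apply_apply, smul_eq_mul]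
  rw [fderiv_apply_prod, add_comm, ← add_smul]
  congr 1
  congr 1
  rw [radialCoeff]
  field_simp
  ring

end RadialTests

/-! ### Algebraic identities for radial test fields. -/

section RadialIdentities

variable {N : ℕ}

theorem pow_eq_pow_sub_two_mul (hN : 2 ≤ N) (r : ℝ) : r ^ N = r ^ (N - 2) * r ^ 2 := by
  rw [← pow_add]; congr 1; omega

theorem fderiv_radialField_inr (hN : 2 ≤ N) {z : ℝ × ℝ → ℝ} (hz : ContDiff ℝ ∞ z)
    {p : ℝ × EuclideanSpace ℝ (Fin N)} (hp : p.2 ≠ 0) (v : EuclideanSpace ℝ (Fin N)) :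
    (fderiv ℝ (radialField N z) p).comp (ContinuousLinearMap.inr ℝ ℝ _) v
      = (radialCoeff N z p * inner ℝ p.2 v) • p.2
        + (z (p.1, volCoord p.2) * (‖p.2‖ ^ N)⁻¹) • v := by
  change fderiv ℝ (radialField N z) p (0, v) = _
  rw [fderiv_radialField hN hz hp]
  simp

/-- The trace of the isotropic part is N z |x|^(-N), which cancels the zero-order term in
`radialCoeff`; the normalization of the field is chosen for this. -/
theorem divOf_radialField (hN : 2 ≤ N) {z : ℝ × ℝ → ℝ} (hz : ContDiff ℝ ∞ z)
    {p : ℝ × EuclideanSpace ℝ (Fin N)} (hp : p.2 ≠ 0) :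
    divOf ((fderiv ℝ (radialField N z) p).comp (ContinuousLinearMap.inr ℝ ℝ _))
      = fderiv ℝ z (p.1, volCoord p.2) (0, 1) := by
  have h0 : ‖p.2‖ ≠ 0 := norm_ne_zero_iff.2 hp
  have e : ∀ i : Fin N, ((fderiv ℝ (radialField N z) p).comp (ContinuousLinearMap.inr ℝ ℝ _)
      (EuclideanSpace.single i 1)) i
      = radialCoeff N z p * (p.2 i ^ 2) + z (p.1, volCoord p.2) * (‖p.2‖ ^ N)⁻¹ := fun i => by
    rw [fderiv_radialField_inr hN hz hp]
    simp [EuclideanSpace.inner_single_right]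
    ring
  simp only [divOf, e]
  rw [Finset.sum_add_distrib, ← Finset.mul_sum, ← EuclideanSpace.real_norm_sq_eq]
  simp only [Finset.sum_const, Finset.card_univ, Fintype.card_fin, nsmul_eq_mul]
  rw [radialCoeff, pow_eq_pow_sub_two_mul hN]
  field_simp
  ring

/-- The gradient is a multiple of x ⊗ x plus a multiple of the identity. Its symmetry is what allows
the viscous terms to be merged. -/
theorem radialField_symm (hN : 2 ≤ N) {z : ℝ × ℝ → ℝ} (hz : ContDiff ℝ ∞ z)
    {p : ℝ × EuclideanSpace ℝ (Fin N)} (hp : p.2 ≠ 0) (i j : Fin N) :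
    ((fderiv ℝ (radialField N z) p).comp (ContinuousLinearMap.inr ℝ ℝ _)
      (EuclideanSpace.single i 1)) j
    = ((fderiv ℝ (radialField N z) p).comp (ContinuousLinearMap.inr ℝ ℝ _)
      (EuclideanSpace.single j 1)) i := by
  rw [fderiv_radialField_inr hN hz hp, fderiv_radialField_inr hN hz hp]
  simp only [PiLp.add_apply, PiLp.smul_apply, EuclideanSpace.inner_single_right, smul_eq_mul,
    PiLp.single_apply, one_mul, conj_trivial]
  have : (if j = i then (1 : ℝ) else 0) = if i = j then 1 else 0 := by simp only [eq_comm]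
  rw [this]
  ring

theorem fderiv_radialField_slice {R T : ℝ} (hN : 0 < N) (hR : 0 < R) {z : ℝ × ℝ → ℝ}
    (hz : ContDiff ℝ ∞ z) (hc : HasCompactSupport z)
    (hs : tsupport z ⊆ Iio T ×ˢ Ioo 0 (R ^ N / N)) (t : ℝ) (x : EuclideanSpace ℝ (Fin N)) :
    fderiv ℝ (fun y => radialField N z (t, y)) x
      = (fderiv ℝ (radialField N z) (t, x)).comp (ContinuousLinearMap.inr ℝ ℝ _) := by
  have h := ((contDiff_radialField hN hR hz hc hs).differentiable (by simp) (t, x)).hasFDerivAt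
  exact (h.comp x (hasFDerivAt_prodMk_right t x)).fderiv

theorem fderiv_radialField_zero (hN : 0 < N) {R T : ℝ} (hR : 0 < R) {z : ℝ × ℝ → ℝ}
    (hc : HasCompactSupport z) (hs : tsupport z ⊆ Iio T ×ˢ Ioo 0 (R ^ N / N)) {p : ℝ ×
    EuclideanSpace ℝ (Fin N)} (hp : p.2 = 0) : fderiv ℝ (radialField N z) p = 0 :=
  fderiv_of_notMem_tsupport ℝ fun h => (radialField_support hN hR hc hs).2.2 p h hp

/-- The coefficient of the kinetic energy in the volume coordinate. -/
theorem volCoord_rpow (hN : 2 ≤ N) {x : EuclideanSpace ℝ (Fin N)} (hx : x ≠ 0) :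
    (N : ℝ) ^ (-(2 - 2 / (N : ℝ))) * volCoord x ^ (-(2 - 2 / (N : ℝ)))
      = ‖x‖ ^ 2 * ((‖x‖ ^ N)⁻¹) ^ 2 := by
  have hN0 : 0 < N := by omega
  have hNr : (N : ℝ) ≠ 0 := by exact_mod_cast hN0.ne'
  have h0 : 0 < ‖x‖ := norm_pos_iff.2 hx
  rw [← Real.mul_rpow (Nat.cast_nonneg _) (volCoord_nonneg x), natCast_mul_volCoord hN0,
    ← Real.rpow_natCast, ← Real.rpow_mul h0.le,
    show (N : ℝ) * -(2 - 2 / (N : ℝ)) = 2 - 2 * N by field_simp; ring, Real.rpow_sub h0]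
  have e : ‖x‖ ^ (2 * (N : ℝ)) = (‖x‖ ^ N) ^ 2 := by
    rw [mul_comm, Real.rpow_mul h0.le, Real.rpow_natCast, Real.rpow_two]
  rw [e, Real.rpow_two, inv_pow, Real.rpow_natCast, div_eq_mul_inv]

theorem inner_radialField_time (hN : 2 ≤ N) {z : ℝ × ℝ → ℝ} (hz : ContDiff ℝ ∞ z)
    {p : ℝ × EuclideanSpace ℝ (Fin N)} (hp : p.2 ≠ 0) (s : ℝ) :
    inner ℝ ((s * (‖p.2‖ ^ N)⁻¹) • p.2) (fderiv ℝ (radialField N z) p (1, 0))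
      = (N : ℝ) ^ (-(2 - 2 / (N : ℝ))) * volCoord p.2 ^ (-(2 - 2 / (N : ℝ))) * s
        * fderiv ℝ z (p.1, volCoord p.2) (1, 0) := by
  rw [fderiv_radialField hN hz hp, volCoord_rpow hN hp]
  simp only [inner_zero_right, mul_zero, zero_smul, add_zero, smul_zero, one_mul, inner_smul_left,
    inner_smul_right, real_inner_self_eq_norm_sq, conj_trivial]
  ring

/-- Both sides equal s² |x|^(2-2N) (z_q - (N-1) |x|^(-N) z). The zero-order coefficient is half the
derivative of c₁ q^(-θ), since θ/(2q) = (N-1) |x|^(-N). -/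
theorem inner_radialField_transport (hN : 2 ≤ N) {z : ℝ × ℝ → ℝ} (hz : ContDiff ℝ ∞ z)
    {p : ℝ × EuclideanSpace ℝ (Fin N)} (hp : p.2 ≠ 0) (s : ℝ) :
    inner ℝ ((s * (‖p.2‖ ^ N)⁻¹) • p.2)
        (fderiv ℝ (radialField N z) p (0, (s * (‖p.2‖ ^ N)⁻¹) • p.2))
      = (N : ℝ) ^ (-(2 - 2 / (N : ℝ))) * volCoord p.2 ^ (-(2 - 2 / (N : ℝ))) * s ^ 2
          * fderiv ℝ z (p.1, volCoord p.2) (0, 1)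
        + -((N : ℝ) ^ (-(2 - 2 / (N : ℝ))) * (2 - 2 / (N : ℝ)) / 2)
          * volCoord p.2 ^ (-(2 - 2 / (N : ℝ)) - 1) * s ^ 2 * z (p.1, volCoord p.2) := by
  have hN0 : 0 < N := by omega
  have hNr : (N : ℝ) ≠ 0 := by exact_mod_cast hN0.ne'
  have h0 : ‖p.2‖ ≠ 0 := norm_ne_zero_iff.2 hp
  have hQ := volCoord_pos hN0 hp
  have e1 : volCoord p.2 ^ (-(2 - 2 / (N : ℝ)) - 1)
      = volCoord p.2 ^ (-(2 - 2 / (N : ℝ))) * (N * (‖p.2‖ ^ N)⁻¹) := by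
    rw [Real.rpow_sub_one hQ.ne', ← natCast_mul_volCoord hN0]
    field_simp
  have e2 : -((N : ℝ) ^ (-(2 - 2 / (N : ℝ))) * (2 - 2 / (N : ℝ)) / 2)
      * volCoord p.2 ^ (-(2 - 2 / (N : ℝ)) - 1) = -(‖p.2‖ ^ 2 * ((‖p.2‖ ^ N)⁻¹) ^ 2)
        * ((2 - 2 / (N : ℝ)) / 2 * (N * (‖p.2‖ ^ N)⁻¹)) := by
    rw [e1, ← volCoord_rpow hN hp]
    ring
  rw [e2, fderiv_radialField hN hz hp, volCoord_rpow hN hp]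
  simp only [zero_mul, zero_smul, zero_add, inner_add_right, inner_smul_left,
    inner_smul_right, real_inner_self_eq_norm_sq, conj_trivial]
  rw [radialCoeff, pow_eq_pow_sub_two_mul hN]
  field_simp
  ring

end RadialIdentities

/-! ### The equations in the volume coordinate -/

section Equations

variable {N : ℕ}

/-- The Frobenius product with a fixed matrix, as a continuous linear functional. -/
noncomputable def frobCLM (B : EuclideanSpace ℝ (Fin N) →L[ℝ] EuclideanSpace ℝ (Fin N)) :
    (EuclideanSpace ℝ (Fin N) →L[ℝ] EuclideanSpace ℝ (Fin N)) →L[ℝ] ℝ :=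
  ∑ i, ∑ j, entryCLM i j B • entryCLM i j

theorem frobCLM_apply (A B : EuclideanSpace ℝ (Fin N) →L[ℝ] EuclideanSpace ℝ (Fin N)) :
    frobCLM B A = frobProd A B := by
  simp [frobCLM, frobProd, entryCLM_apply, mul_comm]

theorem continuous_functional_sub {X F : Type*} [TopologicalSpace X] [NormedAddCommGroup F]
    [NormedSpace ℝ F] {β β' : X → F →L[ℝ] ℝ} (hβ : Continuous β) (hβ' : Continuous β') :
    Continuous fun x => β x - β' x :=
  hβ.sub hβ'

theorem continuous_functional_sum {X F ι : Type*} [TopologicalSpace X] [NormedAddCommGroup F]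
    [NormedSpace ℝ F] {β : ι → X → F →L[ℝ] ℝ} (s : Finset ι) (hβ : ∀ i, Continuous (β i)) :
    Continuous fun x => ∑ i ∈ s, β i x :=
  continuous_finsetSum _ fun i _ => hβ i

theorem continuous_frobCLM {X : Type*} [TopologicalSpace X]
    {B : X → EuclideanSpace ℝ (Fin N) →L[ℝ] EuclideanSpace ℝ (Fin N)} (hB : Continuous B) :
    Continuous fun x => frobCLM (B x) :=
  continuous_functional_sum _ fun i => continuous_functional_sum _ fun j =>
    ((entryCLM i j).continuous.comp hB).smul continuous_const

/-- The radial test field has a symmetric gradient, so against an H¹₀ field the integral of ∇W : ∇ψ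
equals that of div W div ψ. The coefficients μ and μ + λ therefore add up to 2μ + λ, and div ψ is
z_q. -/
theorem integral_dissipation_slice (hN : 2 ≤ N) {R T : ℝ} (hR : 0 < R)
    {W : EuclideanSpace ℝ (Fin N) → EuclideanSpace ℝ (Fin N)}
    {DW : EuclideanSpace ℝ (Fin N) → EuclideanSpace ℝ (Fin N) →L[ℝ] EuclideanSpace ℝ (Fin N)}
    (h : IsH10WithGradient R W DW) {z : ℝ × ℝ → ℝ} (hz : ContDiff ℝ ∞ z)
    (hc : HasCompactSupport z) (hs : tsupport z ⊆ Iio T ×ˢ Ioo 0 (R ^ N / N)) (t μ lam : ℝ) :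
    ∫ x in ballDomain N R, (μ * frobProd (DW x)
        ((fderiv ℝ (radialField N z) (t, x)).comp (ContinuousLinearMap.inr ℝ ℝ _))
      + (μ + lam) * (divOf (DW x)
        * divOf ((fderiv ℝ (radialField N z) (t, x)).comp (ContinuousLinearMap.inr ℝ ℝ _))))
      = (2 * μ + lam) *
        ∫ x in ballDomain N R, fderiv ℝ z (t, volCoord x) (0, 1) * divOf (DW x) := by
  have hN0 : 0 < N := by omega
  set ψ : EuclideanSpace ℝ (Fin N) → EuclideanSpace ℝ (Fin N) := fun y => radialField N z (t, y)
    with hψdef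
  have hψ : ContDiff ℝ ∞ ψ :=
    (contDiff_radialField hN0 hR hz hc hs).comp (contDiff_const.prodMk contDiff_id)
  have hfd : ∀ x, (fderiv ℝ (radialField N z) (t, x)).comp (ContinuousLinearMap.inr ℝ ℝ _)
      = fderiv ℝ ψ x := fun x => (fderiv_radialField_slice hN0 hR hz hc hs t x).symm
  have hfc : Continuous (fderiv ℝ ψ) := hψ.continuous_fderiv (by simp)
  have hdc : Continuous fun x => divOf (fderiv ℝ ψ x) := by
    simp only [← divCLM_apply]
    exact (divCLM N).continuous.comp hfc
  have hsymm : ∀ x i j, (fderiv ℝ ψ x (EuclideanSpace.single i 1)) j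
      = (fderiv ℝ ψ x (EuclideanSpace.single j 1)) i := fun x i j => by
    rw [← hfd]
    rcases eq_or_ne x 0 with hx | hx
    · rw [fderiv_radialField_zero (p := (t, x)) hN0 hR hc hs hx]
      rfl
    · exact radialField_symm (p := (t, x)) hN hz hx i j
  have hdiv : ∀ x, divOf (fderiv ℝ ψ x) = fderiv ℝ z (t, volCoord x) (0, 1) := fun x => by
    rw [← hfd]
    rcases eq_or_ne x 0 with hx | hx
    · rw [fderiv_radialField_zero (p := (t, x)) hN0 hR hc hs hx, fderiv_of_notMem_tsupport ℝ]
      · simp [divOf]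
      · intro h'
        have := (hs h').2.1
        simp only [hx, volCoord, norm_zero, zero_pow hN0.ne', zero_div, lt_irrefl] at this
    · exact divOf_radialField (p := (t, x)) hN hz hx
  simp only [hfd]
  have hψ2 : ContDiff ℝ 2 ψ := by exact_mod_cast contDiff_infty.1 hψ 2
  obtain ⟨-, i2, i3⟩ := h.integral_eq_zero (α := fun _ => 0)
    (β := fun x => frobCLM (fderiv ℝ ψ x) - divOf (fderiv ℝ ψ x) • divCLM N) continuous_const
    (continuous_functional_sub (continuous_frobCLM hfc) (hdc.smul continuous_const))
    fun φ hφ hφc => by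
      have := integral_frobProd_sub_div hψ2 hsymm (hφ.of_le (by simp)) hφc
      simpa [divCLM_apply, frobCLM_apply, mul_comm] using this
  have hfin : IsFiniteMeasure
      ((volume : Measure (EuclideanSpace ℝ (Fin N))).restrict (ballDomain N R)) := ⟨by
    rw [Measure.restrict_apply_univ]; exact measure_ball_lt_top⟩
  have i4 : IntegrableOn (fun x => divOf (fderiv ℝ ψ x) * divOf (DW x)) (ballDomain N R) := by
    have i5 := (divCLM N).integrable_comp (h.2.1.integrable one_le_two)
    simp only [divCLM_apply] at i5
    obtain ⟨C, hC⟩ := (isCompact_closedBall (0 : EuclideanSpace ℝ (Fin N)) R).exists_bound_of_continuousOn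
      hdc.continuousOn
    refine i5.bdd_mul hdc.aestronglyMeasurable (c := C) ?_
    exact (ae_restrict_iff' measurableSet_ball).2 (Filter.Eventually.of_forall fun x hx =>
      hC x (Metric.ball_subset_closedBall hx))
  simp only [sub_apply, smul_apply, frobCLM_apply, divCLM_apply, smul_eq_mul, zero_apply,
    zero_add] at i2 i3
  have h6 := integral_add (i2.const_mul μ) (i4.const_mul (2 * μ + lam))
  rw [integral_const_mul, integral_const_mul, i3, mul_zero, zero_add] at h6
  simp only [hdiv] at h6 ⊢
  rw [← h6]
  refine integral_congr_ae (Filter.Eventually.of_forall fun x => ?_)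
  simp only
  ring

end Equations

section Equations

variable {N : ℕ}

theorem isFiniteMeasure_ballDomain (N : ℕ) (R : ℝ) : IsFiniteMeasure
    ((volume : Measure (EuclideanSpace ℝ (Fin N))).restrict (ballDomain N R)) := ⟨by
  rw [Measure.restrict_apply_univ]; exact measure_ball_lt_top⟩

theorem isFiniteMeasure_spaceTimeCyl (N : ℕ) (R T : ℝ) : IsFiniteMeasure
    ((volume : Measure (ℝ × EuclideanSpace ℝ (Fin N))).restrict (spaceTimeCyl N R T)) := by
  have := isFiniteMeasure_ballDomain N R
  rw [restrict_spaceTimeCyl]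
  infer_instance

theorem ae_spaceTimeCyl_ne_zero (hN : 0 < N) (R T : ℝ) :
    ∀ᵐ z ∂((volume : Measure (ℝ × EuclideanSpace ℝ (Fin N))).restrict (spaceTimeCyl N R T)),
      z.2 ≠ 0 := by
  have := isFiniteMeasure_ballDomain N R
  have hnt : Nontrivial (EuclideanSpace ℝ (Fin N)) := Module.nontrivial_of_finrank_pos (R := ℝ) (by
    rw [finrank_euclideanSpace_fin]; exact hN)
  have hS : MeasurableSet {z : ℝ × EuclideanSpace ℝ (Fin N) | z.2 ≠ 0} :=
    measurable_snd (measurableSet_singleton 0).compl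
  rw [restrict_spaceTimeCyl, Measure.ae_prod_iff_ae_ae hS]
  exact Filter.Eventually.of_forall fun t => ae_restrict_of_ae (Measure.ae_ne volume 0)

theorem integral_dissipation (hN : 2 ≤ N) {R T : ℝ} (hR : 0 < R)
    {U : ℝ × EuclideanSpace ℝ (Fin N) → EuclideanSpace ℝ (Fin N)}
    {DU : ℝ × EuclideanSpace ℝ (Fin N) →
      EuclideanSpace ℝ (Fin N) →L[ℝ] EuclideanSpace ℝ (Fin N)}
    (hbd : ∀ᵐ t ∂(volume.restrict (Ioo (0 : ℝ) T)),
      IsH10WithGradient R (fun x => U (t, x)) (fun x => DU (t, x)))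
    (hDU : MemLp DU 2 (volume.restrict (spaceTimeCyl N R T))) {D : ℝ → ℝ} {g : ℝ → ℝ → ℝ}
    (hg : IsTransportField (R ^ N / N) T D g)
    (hdiv : ∀ᵐ t ∂(volume.restrict (Ioo (0 : ℝ) T)), ∀ h : ℝ → ℝ, ContDiff ℝ 1 h →
        ∫ x in ballDomain N R, h (volCoord x) * divOf (DU (t, x))
          = sphereConst N * ∫ q in Ioo 0 (R ^ N / N), fieldDiv g t q * h q)
    {z : ℝ × ℝ → ℝ} (hz : ContDiff ℝ ∞ z)
    (hc : HasCompactSupport z) (hs : tsupport z ⊆ Iio T ×ˢ Ioo 0 (R ^ N / N)) (μ lam : ℝ) :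
    IntegrableOn (fun p => fieldDiv g p.1 p.2 * fderiv ℝ z p (0, 1))
      (Ioo 0 T ×ˢ Ioo 0 (R ^ N / N)) ∧
    ∫ p in spaceTimeCyl N R T, (μ * frobProd (DU p)
        ((fderiv ℝ (radialField N z) p).comp (ContinuousLinearMap.inr ℝ ℝ _))
      + (μ + lam) * (divOf (DU p)
        * divOf ((fderiv ℝ (radialField N z) p).comp (ContinuousLinearMap.inr ℝ ℝ _))))
      = sphereConst N * ((2 * μ + lam) * ∫ p in Ioo 0 T ×ˢ Ioo 0 (R ^ N / N),
        fieldDiv g p.1 p.2 * fderiv ℝ z p (0, 1)) := by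
  have hN0 : 0 < N := by omega
  have hfin1 := isFiniteMeasure_ballDomain N R
  have hfin2 := isFiniteMeasure_spaceTimeCyl N R T
  have hψ := contDiff_radialField hN0 hR hz hc hs
  set P : ℝ × EuclideanSpace ℝ (Fin N) →
      EuclideanSpace ℝ (Fin N) →L[ℝ] EuclideanSpace ℝ (Fin N) := fun p =>
    (fderiv ℝ (radialField N z) p).comp (ContinuousLinearMap.inr ℝ ℝ _) with hP
  have hPc : Continuous P := (hψ.continuous_fderiv (by simp)).clm_comp continuous_const
  have hPs : HasCompactSupport P :=
    ((radialField_support hN0 hR hc hs).1.fderiv ℝ).comp_left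
      (g := fun A : ℝ × EuclideanSpace ℝ (Fin N) →L[ℝ] EuclideanSpace ℝ (Fin N) =>
        A.comp (ContinuousLinearMap.inr ℝ ℝ (EuclideanSpace ℝ (Fin N))))
      (ContinuousLinearMap.zero_comp _)
  obtain ⟨M, hM⟩ := hPc.bounded_above_of_compact_support hPs
  have iDU := hDU.integrable one_le_two
  have iprod : ∀ L L' : (EuclideanSpace ℝ (Fin N) →L[ℝ] EuclideanSpace ℝ (Fin N)) →L[ℝ] ℝ,
      Integrable (fun p => L (DU p) * L' (P p)) (volume.restrict (spaceTimeCyl N R T)) :=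
    fun L L' => by
    refine ((L.integrable_comp iDU).bdd_mul (L'.continuous.comp hPc).aestronglyMeasurable
      (c := ‖L'‖ * M) (Filter.Eventually.of_forall fun p => ?_)).congr
        (Filter.Eventually.of_forall fun p => mul_comm _ _)
    exact (L'.le_opNorm _).trans (mul_le_mul_of_nonneg_left (hM p) (norm_nonneg _))
  have iH : Integrable (fun p => μ * frobProd (DU p) (P p)
      + (μ + lam) * (divOf (DU p) * divOf (P p))) (volume.restrict (spaceTimeCyl N R T)) := by
    refine Integrable.add (Integrable.const_mul ?_ _) (Integrable.const_mul ?_ _)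
    · exact integrable_finsetSum _ fun i _ => integrable_finsetSum _ fun j _ =>
        iprod (entryCLM i j) (entryCLM i j)
    · have := iprod (divCLM N) (divCLM N)
      simpa only [divCLM_apply] using this
  have hbox : (volume : Measure (ℝ × ℝ)).restrict (Ioo 0 T ×ˢ Ioo 0 (R ^ N / N))
      = (volume.restrict (Ioo 0 T)).prod (volume.restrict (Ioo 0 (R ^ N / N))) := by
    rw [Measure.prod_restrict]; rfl
  have hzc : Continuous fun p => fderiv ℝ z p (0, 1) :=
    (hz.continuous_fderiv (by simp)).clm_apply continuous_const
  obtain ⟨M', hM'⟩ := hzc.bounded_above_of_compact_support (hc.fderiv_apply ℝ (0, 1))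
  have iG : IntegrableOn (fun p => fieldDiv g p.1 p.2 * fderiv ℝ z p (0, 1))
      (Ioo 0 T ×ˢ Ioo 0 (R ^ N / N)) := by
    have h1 : Integrable (fun p : ℝ × ℝ => D p.1) (volume.restrict (Ioo 0 T ×ˢ Ioo 0 (R ^ N / N))) := by
      rw [hbox]
      exact hg.integrable.integrableOn.comp_fst _
    refine (h1.mul_const M').mono' (hg.measurable_fieldDiv.mul hzc.measurable).aestronglyMeasurable
      (Filter.Eventually.of_forall fun p => ?_)
    rw [norm_mul]
    exact mul_le_mul (hg.abs_fieldDiv_le _ _) (hM' p) (norm_nonneg _) (hg.nonneg _)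
  refine ⟨iG, ?_⟩
  rw [restrict_spaceTimeCyl] at iH ⊢
  rw [IntegrableOn, hbox] at iG
  rw [integral_prod _ iH, hbox, integral_prod _ iG, ← integral_const_mul, ← integral_const_mul]
  refine integral_congr_ae ?_
  filter_upwards [hbd, hdiv] with t h1 h2
  have h3 := integral_dissipation_slice hN hR h1 hz hc hs t μ lam
  have hz2 : ContDiff ℝ 2 z := by exact_mod_cast contDiff_infty.1 hz 2
  have hcd : ContDiff ℝ 1 fun q => fderiv ℝ z (t, q) (0, 1) :=
    (((hz2.fderiv_right (m := 1) (by norm_num)).comp (contDiff_const.prodMk contDiff_id)).clm_apply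
      contDiff_const)
  rw [h2 _ hcd] at h3
  refine h3.trans ?_
  ring

/-- Integrals over the full plane of functions supported in `(0, T) × (0, V)`. -/
theorem integral_eq_setIntegral_box {T V : ℝ} {F : ℝ × ℝ → ℝ}
    (h1 : ∀ t x, t ∉ Ioo 0 T → F (t, x) = 0) (h2 : ∀ t x, x ∉ Ioo 0 V → F (t, x) = 0) :
    ∫ p, F p = ∫ p in Ioo 0 T ×ˢ Ioo 0 V, F p := by
  refine (setIntegral_eq_integral_of_forall_compl_eq_zero fun p hp => ?_).symm
  by_cases h : p.1 ∈ Ioo 0 T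
  · exact h2 p.1 p.2 fun h' => hp ⟨h, h'⟩
  · exact h1 p.1 p.2 h

theorem integral_test_initial {R T : ℝ} (hN : 2 ≤ N) (hR : 0 < R) {z : ℝ × ℝ → ℝ}
    (hz : Continuous z) (hs : tsupport z ⊆ Iio T ×ˢ Ioo 0 (R ^ N / N)) {c₀ : ℝ → ℝ}
    (hc₀ : Measurable c₀) :
    ∫ x in ballDomain N R, c₀ (volCoord x) * z (0, volCoord x)
      = sphereConst N * ∫ q, c₀ q * z (0, q) := by
  have hm : Measurable fun q => c₀ q * z (0, q) :=
    hc₀.mul (hz.measurable.comp (measurable_const.prodMk measurable_id))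
  rw [integral_comp_of_map_eq_smul (f := fun q => c₀ q * z (0, q)) continuous_volCoord.measurable
    (map_volCoord hN hR)
    (sphereConst_pos (by omega)) hm.aestronglyMeasurable,
    setIntegral_eq_integral_of_forall_compl_eq_zero fun q hq => ?_]
  rw [image_eq_zero_of_notMem_tsupport fun h => hq (hs h).2, mul_zero]

/-- The continuity equation in the volume coordinate. -/
theorem isWeakIdentity_continuity (hN : 2 ≤ N) {R T : ℝ} (hR : 0 < R)
    {ρ : ℝ × EuclideanSpace ℝ (Fin N) → ℝ}
    {U : ℝ × EuclideanSpace ℝ (Fin N) → EuclideanSpace ℝ (Fin N)}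
    {ρ₀ : EuclideanSpace ℝ (Fin N) → ℝ} {g r : ℝ → ℝ → ℝ} {r₀ : ℝ → ℝ}
    (hg : Measurable fun p : ℝ × ℝ => g p.1 p.2) (hr : Measurable fun p : ℝ × ℝ => r p.1 p.2)
    (hr₀ : Measurable r₀) (hr0 : ∀ t x, t ∉ Ioo 0 T → r t x = 0)
    (hρ : ∀ᵐ z ∂(volume.restrict (spaceTimeCyl N R T)), ρ z = r z.1 (volCoord z.2))
    (hU : ∀ᵐ z ∂(volume.restrict (spaceTimeCyl N R T)),
      U z = (g z.1 (volCoord z.2) * (‖z.2‖ ^ N)⁻¹) • z.2)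
    (hρ₀ : ∀ᵐ x ∂(volume.restrict (ballDomain N R)), ρ₀ x = r₀ (volCoord x))
    (heq : ∀ φ : ℝ × EuclideanSpace ℝ (Fin N) → ℝ,
      ContDiff ℝ ∞ φ → HasCompactSupport φ → tsupport φ ⊆ Iio T ×ˢ ballDomain N R →
      (∫ z in spaceTimeCyl N R T, ρ z * (fderiv ℝ φ z (1, 0) + fderiv ℝ φ z (0, U z)))
        + ∫ x in ballDomain N R, ρ₀ x * φ (0, x) = 0) :
    IsWeakIdentity T (R ^ N / N) (fun p => r p.1 p.2) (fun p => r p.1 p.2 * g p.1 p.2)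
      (fun _ => 0) r₀ := by
  intro z hz hc hs
  have hN0 : 0 < N := by omega
  have hcst := sphereConst_pos hN0
  obtain ⟨s1, s2, -⟩ := radial_support hN0 hR hc hs
    (F := fun p : ℝ × EuclideanSpace ℝ (Fin N) => z (p.1, volCoord p.2)) fun p h => h
  have h := heq _ (contDiff_radial hN0 hR hz hc hs) s1 s2
  have hzd : ∀ v, Measurable fun p => fderiv ℝ z p v := fun v =>
    ((hz.continuous_fderiv (by simp)).clm_apply continuous_const).measurable
  set F : ℝ × ℝ → ℝ := fun p => r p.1 p.2 * fderiv ℝ z p (1, 0)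
    + r p.1 p.2 * g p.1 p.2 * fderiv ℝ z p (0, 1) + 0 * z p with hF
  have hFm : Measurable F := ((hr.mul (hzd _)).add ((hr.mul hg).mul (hzd _))).add
    (hz.continuous.measurable.const_mul 0)
  have e1 : ∫ p in spaceTimeCyl N R T, ρ p *
      (fderiv ℝ (fun p : ℝ × EuclideanSpace ℝ (Fin N) => z (p.1, volCoord p.2)) p (1, 0)
      + fderiv ℝ (fun p : ℝ × EuclideanSpace ℝ (Fin N) => z (p.1, volCoord p.2)) p (0, U p))
      = ∫ p in spaceTimeCyl N R T, F (p.1, volCoord p.2) := by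
    refine integral_congr_ae ?_
    filter_upwards [hρ, hU, ae_spaceTimeCyl_ne_zero hN0 R T] with p h1 h2 h3
    rw [fderiv_radial hN hz, fderiv_radial hN hz, h1, h2, inner_smul_radial hN h3, hF]
    simp only [inner_zero_right]
    ring
  have e2 : ∫ x in ballDomain N R, ρ₀ x * z (0, volCoord x)
      = sphereConst N * ∫ q, r₀ q * z (0, q) := by
    rw [← integral_test_initial hN hR hz.continuous hs hr₀]
    refine integral_congr_ae ?_
    filter_upwards [hρ₀] with x h1
    rw [h1]
  rw [e1, e2, integral_comp_of_map_eq_smul measurable_prod_volCoord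
    (map_volCoord_spaceTime hN hR T) hcst hFm.aestronglyMeasurable, ← mul_add,
    ← integral_eq_setIntegral_box] at h
  · exact (mul_eq_zero.1 h).resolve_left hcst.ne'
  · intro t x ht
    simp [hF, hr0 t x ht]
  · intro t x hx
    have : (t, x) ∉ tsupport z := fun h => hx (hs h).2
    simp [hF, fderiv_of_notMem_tsupport ℝ this]

end Equations

section Momentum

variable {N : ℕ}

/-- The momentum equation in the volume coordinate. -/
theorem isWeakIdentity_momentum (hN : 2 ≤ N) {R T a γ μ lam : ℝ} (hR : 0 < R) (hγ : 0 < γ)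
    {ρ : ℝ × EuclideanSpace ℝ (Fin N) → ℝ}
    {U : ℝ × EuclideanSpace ℝ (Fin N) → EuclideanSpace ℝ (Fin N)}
    {DU : ℝ × EuclideanSpace ℝ (Fin N) →
      EuclideanSpace ℝ (Fin N) →L[ℝ] EuclideanSpace ℝ (Fin N)}
    {ρ₀ : EuclideanSpace ℝ (Fin N) → ℝ}
    {U₀ : EuclideanSpace ℝ (Fin N) → EuclideanSpace ℝ (Fin N)}
    {D : ℝ → ℝ} {g r : ℝ → ℝ → ℝ} {c₀ : ℝ → ℝ} {B : ℝ}
    (hg : IsTransportField (R ^ N / N) T D g) (hr : Measurable fun p : ℝ × ℝ => r p.1 p.2)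
    (hr0 : ∀ t x, t ∉ Ioo 0 T → r t x = 0) (hrnn : ∀ t x, 0 ≤ r t x) (hrB : ∀ t x, r t x ≤ B)
    (hU2 : MemLp U 2 (volume.restrict (spaceTimeCyl N R T)))
    (hDU : MemLp DU 2 (volume.restrict (spaceTimeCyl N R T)))
    (hbd : ∀ᵐ t ∂(volume.restrict (Ioo (0 : ℝ) T)),
      IsH10WithGradient R (fun x => U (t, x)) (fun x => DU (t, x)))
    (hdiv : ∀ᵐ t ∂(volume.restrict (Ioo (0 : ℝ) T)), ∀ h : ℝ → ℝ, ContDiff ℝ 1 h →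
        ∫ x in ballDomain N R, h (volCoord x) * divOf (DU (t, x))
          = sphereConst N * ∫ q in Ioo 0 (R ^ N / N), fieldDiv g t q * h q)
    (hρ : ∀ᵐ z ∂(volume.restrict (spaceTimeCyl N R T)), ρ z = r z.1 (volCoord z.2))
    (hU : ∀ᵐ z ∂(volume.restrict (spaceTimeCyl N R T)),
      U z = (g z.1 (volCoord z.2) * (‖z.2‖ ^ N)⁻¹) • z.2)
    (hc₀ : Measurable c₀)
    (hinit : ∀ᵐ x ∂(volume.restrict (ballDomain N R)),
      ρ₀ x * inner ℝ (U₀ x) x * (‖x‖ ^ N)⁻¹ = c₀ (volCoord x))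
    (heq : ∀ φ : ℝ × EuclideanSpace ℝ (Fin N) → EuclideanSpace ℝ (Fin N),
      ContDiff ℝ ∞ φ → HasCompactSupport φ → tsupport φ ⊆ Iio T ×ˢ ballDomain N R →
      (∫ z in spaceTimeCyl N R T,
          (ρ z * inner ℝ (U z) (fderiv ℝ φ z (1, 0))
            + ρ z * inner ℝ (U z) (fderiv ℝ φ z (0, U z))
            + a * ρ z ^ γ * divOf ((fderiv ℝ φ z).comp (ContinuousLinearMap.inr ℝ ℝ _))))
        + ∫ x in ballDomain N R, ρ₀ x * inner ℝ (U₀ x) (φ (0, x))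
      = ∫ z in spaceTimeCyl N R T,
          (μ * frobProd (DU z) ((fderiv ℝ φ z).comp (ContinuousLinearMap.inr ℝ ℝ _))
            + (μ + lam) * (divOf (DU z)
                * divOf ((fderiv ℝ φ z).comp (ContinuousLinearMap.inr ℝ ℝ _))))) :
    IsWeakIdentity T (R ^ N / N)
      (fun p => r p.1 p.2 * ((N : ℝ) ^ (-(2 - 2 / (N : ℝ))) * p.2 ^ (-(2 - 2 / (N : ℝ))))
        * g p.1 p.2)
      (fun p => r p.1 p.2 * ((N : ℝ) ^ (-(2 - 2 / (N : ℝ))) * p.2 ^ (-(2 - 2 / (N : ℝ))))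
        * g p.1 p.2 ^ 2 + (a * r p.1 p.2 ^ γ - (2 * μ + lam) * fieldDiv g p.1 p.2))
      (fun p => r p.1 p.2 * (-((N : ℝ) ^ (-(2 - 2 / (N : ℝ))) * (2 - 2 / (N : ℝ)) / 2)
        * p.2 ^ (-(2 - 2 / (N : ℝ)) - 1)) * g p.1 p.2 ^ 2) c₀ := by
  intro z hz hc hs
  have hN0 : 0 < N := by omega
  have hcst := sphereConst_pos hN0
  have hfin2 := isFiniteMeasure_spaceTimeCyl N R T
  obtain ⟨s1, s2, -⟩ := radialField_support hN0 hR hc hs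
  have hψ := contDiff_radialField hN0 hR hz hc hs
  have h := heq _ hψ s1 s2
  obtain ⟨iG, hG⟩ := integral_dissipation hN hR hbd hDU hg hdiv hz hc hs μ lam
  have hzc : ∀ v, Continuous fun p => fderiv ℝ z p v := fun v =>
    (hz.continuous_fderiv (by simp)).clm_apply continuous_const
  have hzd : ∀ v, Measurable fun p => fderiv ℝ z p v := fun v => (hzc v).measurable
  set θ : ℝ := 2 - 2 / (N : ℝ) with hθ
  have hgm : Measurable fun p : ℝ × ℝ => g p.1 p.2 := hg.measurable
  have hpow : ∀ s : ℝ, Measurable fun p : ℝ × ℝ => p.2 ^ s := fun s => measurable_snd.pow_const s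
  set F : ℝ × ℝ → ℝ := fun p =>
    r p.1 p.2 * ((N : ℝ) ^ (-θ) * p.2 ^ (-θ)) * g p.1 p.2 * fderiv ℝ z p (1, 0)
    + (r p.1 p.2 * ((N : ℝ) ^ (-θ) * p.2 ^ (-θ)) * g p.1 p.2 ^ 2 + a * r p.1 p.2 ^ γ)
      * fderiv ℝ z p (0, 1)
    + r p.1 p.2 * (-((N : ℝ) ^ (-θ) * θ / 2) * p.2 ^ (-θ - 1)) * g p.1 p.2 ^ 2 * z p with hF
  have hFm : Measurable F :=
    ((((hr.mul ((hpow _).const_mul _)).mul hgm).mul (hzd _)).add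
      ((((hr.mul ((hpow _).const_mul _)).mul (hgm.pow_const 2)).add
        ((hr.pow_const γ).const_mul a)).mul (hzd _))).add
      (((hr.mul ((hpow _).const_mul _)).mul (hgm.pow_const 2)).mul hz.continuous.measurable)
  set K : ℝ × EuclideanSpace ℝ (Fin N) → ℝ := fun p =>
    ρ p * inner ℝ (U p) (fderiv ℝ (radialField N z) p (1, 0))
      + ρ p * inner ℝ (U p) (fderiv ℝ (radialField N z) p (0, U p))
      + a * ρ p ^ γ * divOf ((fderiv ℝ (radialField N z) p).comp
        (ContinuousLinearMap.inr ℝ ℝ _)) with hK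
  have hne := ae_spaceTimeCyl_ne_zero hN0 R T
  have hKF : ∀ᵐ p ∂(volume.restrict (spaceTimeCyl N R T)), K p = F (p.1, volCoord p.2) := by
    filter_upwards [hρ, hU, hne] with p h1 h2 h3
    rw [hK, hF]
    simp only
    rw [h1, h2, inner_radialField_time hN hz h3, inner_radialField_transport hN hz h3,
      divOf_radialField hN hz h3]
    ring
  have hΦ := measurable_prod_volCoord (N := N)
  have hmap := map_volCoord_spaceTime hN hR T
  -- In physical variables the integrand is bounded by multiples of |U|, |U|² and a constant, and U
  -- is square integrable on a set of finite measure.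
  have iK : Integrable (fun p => F (p.1, volCoord p.2)) (volume.restrict (spaceTimeCyl N R T)) := by
    obtain ⟨M, hM⟩ := (hψ.continuous_fderiv (by simp)).bounded_above_of_compact_support
      (s1.fderiv ℝ)
    obtain ⟨M', hM'⟩ := (hzc (0, 1)).bounded_above_of_compact_support (hc.fderiv_apply ℝ (0, 1))
    have hM0 : 0 ≤ M := (norm_nonneg _).trans (hM 0)
    have hB0 : 0 ≤ B := (hrnn 0 0).trans (hrB 0 0)
    have i1 := (hU2.integrable one_le_two).norm
    have i2 := hU2.integrable_norm_pow two_ne_zero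
    have i3 := ((i1.const_mul (B * M)).add (i2.const_mul (B * M))).add
      (integrable_const (μ := volume.restrict (spaceTimeCyl N R T)) (|a| * B ^ γ * M'))
    refine i3.mono' (hFm.comp hΦ).aestronglyMeasurable ?_
    filter_upwards [hρ, hKF, hne] with p h1 h2 h3
    rw [← h2, hK]
    simp only [Pi.add_apply]
    have hρ0 : 0 ≤ ρ p := by rw [h1]; exact hrnn _ _
    have hρB : ρ p ≤ B := by rw [h1]; exact hrB _ _
    have b1 : ‖ρ p * inner ℝ (U p) (fderiv ℝ (radialField N z) p (1, 0))‖ ≤ B * M * ‖U p‖ := by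
      have e1 : ‖fderiv ℝ (radialField N z) p (1, 0)‖ ≤ M := by
        refine ((fderiv ℝ (radialField N z) p).le_opNorm _).trans ?_
        simpa using hM p
      rw [norm_mul, Real.norm_of_nonneg hρ0, mul_assoc]
      refine mul_le_mul hρB ((norm_inner_le_norm _ _).trans ?_) (norm_nonneg _) hB0
      rw [mul_comm]
      exact mul_le_mul_of_nonneg_right e1 (norm_nonneg _)
    have b2 : ‖ρ p * inner ℝ (U p) (fderiv ℝ (radialField N z) p (0, U p))‖
        ≤ B * M * ‖U p‖ ^ 2 := by
      have e1 : ‖fderiv ℝ (radialField N z) p (0, U p)‖ ≤ M * ‖U p‖ := by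
        refine ((fderiv ℝ (radialField N z) p).le_opNorm _).trans ?_
        have : ‖((0, U p) : ℝ × EuclideanSpace ℝ (Fin N))‖ = ‖U p‖ := by simp [Prod.norm_def]
        rw [this]
        exact mul_le_mul_of_nonneg_right (hM p) (norm_nonneg _)
      rw [norm_mul, Real.norm_of_nonneg hρ0, mul_assoc]
      refine mul_le_mul hρB ((norm_inner_le_norm _ _).trans ?_) (norm_nonneg _) hB0
      refine (mul_le_mul_of_nonneg_left e1 (norm_nonneg _)).trans (le_of_eq ?_)
      ring
    have b3 : ‖a * ρ p ^ γ * divOf ((fderiv ℝ (radialField N z) p).comp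
        (ContinuousLinearMap.inr ℝ ℝ _))‖ ≤ |a| * B ^ γ * M' := by
      rw [divOf_radialField hN hz h3, norm_mul, norm_mul, Real.norm_eq_abs a,
        Real.norm_of_nonneg (Real.rpow_nonneg hρ0 _)]
      exact mul_le_mul (mul_le_mul_of_nonneg_left (Real.rpow_le_rpow hρ0 hρB hγ.le) (abs_nonneg _))
        (hM' _) (norm_nonneg _) (by positivity)
    exact (norm_add₃_le).trans (add_le_add (add_le_add b1 b2) b3)
  have iF : IntegrableOn F (Ioo 0 T ×ˢ Ioo 0 (R ^ N / N)) :=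
    integrable_of_comp_of_map_eq_smul hΦ hmap hcst hFm.aestronglyMeasurable iK
  have e1 : ∫ p in spaceTimeCyl N R T, K p
      = sphereConst N * ∫ p in Ioo 0 T ×ˢ Ioo 0 (R ^ N / N), F p := by
    rw [integral_congr_ae hKF, integral_comp_of_map_eq_smul hΦ hmap hcst hFm.aestronglyMeasurable]
  have e2 : ∫ x in ballDomain N R, ρ₀ x * inner ℝ (U₀ x) (radialField N z (0, x))
      = sphereConst N * ∫ q, c₀ q * z (0, q) := by
    rw [← integral_test_initial hN hR hz.continuous hs hc₀]
    refine integral_congr_ae ?_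
    filter_upwards [hinit] with x h1
    rw [← h1, radialField, inner_smul_right]
    ring
  rw [e1, e2, hG] at h
  have h' : (∫ p in Ioo 0 T ×ˢ Ioo 0 (R ^ N / N), F p) + ∫ q, c₀ q * z (0, q)
      = (2 * μ + lam) * ∫ p in Ioo 0 T ×ˢ Ioo 0 (R ^ N / N),
        fieldDiv g p.1 p.2 * fderiv ℝ z p (0, 1) := by
    refine mul_left_cancel₀ hcst.ne' ?_
    rw [mul_add]
    exact h
  have e3 := integral_sub iF (iG.const_mul (2 * μ + lam))
  rw [integral_const_mul] at e3
  have e4 := integral_eq_setIntegral_box (T := T) (V := R ^ N / N)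
    (F := fun p => F p - (2 * μ + lam) * (fieldDiv g p.1 p.2 * fderiv ℝ z p (0, 1)))
    (fun t x ht => by
      simp [hF, hr0 t x ht, hg.fieldDiv_zero_time ht, Real.zero_rpow hγ.ne'])
    (fun t x hx => by
      have : (t, x) ∉ tsupport z := fun h => hx (hs h).2
      simp [hF, fderiv_of_notMem_tsupport ℝ this, image_eq_zero_of_notMem_tsupport this])
  have e5 : ∀ p : ℝ × ℝ, r p.1 p.2 * ((N : ℝ) ^ (-θ) * p.2 ^ (-θ)) * g p.1 p.2
        * fderiv ℝ z p (1, 0)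
      + (r p.1 p.2 * ((N : ℝ) ^ (-θ) * p.2 ^ (-θ)) * g p.1 p.2 ^ 2
        + (a * r p.1 p.2 ^ γ - (2 * μ + lam) * fieldDiv g p.1 p.2)) * fderiv ℝ z p (0, 1)
      + r p.1 p.2 * (-((N : ℝ) ^ (-θ) * θ / 2) * p.2 ^ (-θ - 1)) * g p.1 p.2 ^ 2 * z p
      = F p - (2 * μ + lam) * (fieldDiv g p.1 p.2 * fderiv ℝ z p (0, 1)) := fun p => by
    rw [hF]
    ring
  simp only [e5]
  linarith

end Momentum

/-! ### Uniqueness of radial weak solutions -/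

section Uniqueness

variable {N : ℕ}

theorem exists_ae_abs_le {X : Type*} [MeasurableSpace X] {m : Measure X} {f : X → ℝ}
    (hf : MemLp f ⊤ m) : ∃ B : ℝ, 0 ≤ B ∧ ∀ᵐ x ∂m, |f x| ≤ B := by
  refine ⟨(eLpNorm f ⊤ m).toReal, ENNReal.toReal_nonneg, ?_⟩
  filter_upwards [ae_le_eLpNormEssSup (f := f) (μ := m)] with x hx
  rw [← Real.norm_eq_abs, ← toReal_enorm]
  exact ENNReal.toReal_mono hf.2.ne (hx.trans (le_of_eq (eLpNorm_exponent_top).symm))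

theorem clip_eq_self {B x : ℝ} (h0 : 0 ≤ x) (hB : x ≤ B) : max 0 (min B x) = x := by
  rw [min_eq_right hB, max_eq_right h0]

theorem clip_le {B : ℝ} (hB : 0 ≤ B) (x : ℝ) : max 0 (min B x) ≤ B :=
  max_le hB (min_le_left _ _)

/-- Admissible initial data, written in the volume coordinate. -/
theorem IsAdmissibleData.exists_isVolumeData (hN : 2 ≤ N) {R : ℝ} (hR : 0 < R)
    {ρ₀ : EuclideanSpace ℝ (Fin N) → ℝ}
    {U₀ : EuclideanSpace ℝ (Fin N) → EuclideanSpace ℝ (Fin N)} (h : IsAdmissibleData R ρ₀ U₀) :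
    ∃ r₀ c₀ : ℝ → ℝ, IsVolumeData (R ^ N / N) r₀ c₀ ∧ Measurable c₀ ∧
      (∀ᵐ x ∂(volume.restrict (ballDomain N R)), ρ₀ x = r₀ (volCoord x)) ∧
      ∀ᵐ x ∂(volume.restrict (ballDomain N R)),
        ρ₀ x * inner ℝ (U₀ x) x * (‖x‖ ^ N)⁻¹ = c₀ (volCoord x) := by
  have hN0 : 0 < N := by omega
  have hNr : (0 : ℝ) < N := by exact_mod_cast hN0
  have hfin := isFiniteMeasure_ballDomain N R
  obtain ⟨r, u, hr, hu, hru⟩ := h.radial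
  obtain ⟨c, hc, hcρ⟩ := h.lower_bound
  obtain ⟨B, hB0, hB⟩ := exists_ae_abs_le h.density_bounded
  -- Clipping makes the bounds hold everywhere and changes the density only on a null set.
  set r₀ : ℝ → ℝ := fun q => max 0 (min B (r (volRadius N q))) with hr₀
  have hsm := measurable_volRadius (N := N)
  have hr₀m : Measurable r₀ := measurable_const.max (measurable_const.min (hr.comp hsm))
  set w : ℝ → ℝ := fun q => r₀ q * u (volRadius N q) * volRadius N q with hw
  have hwm : Measurable w := (hr₀m.mul (hu.comp hsm)).mul hsm
  have e1 : ∀ᵐ x ∂(volume.restrict (ballDomain N R)), ρ₀ x = r₀ (volCoord x) := by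
    filter_upwards [hru, hcρ, hB] with x h1 h2 h3
    rw [hr₀]
    simp only
    rw [volRadius_volCoord hN0, ← h1.1, clip_eq_self (hc.le.trans h2) ((le_abs_self _).trans h3)]
  have e2 : ∀ᵐ x ∂(volume.restrict (ballDomain N R)),
      ρ₀ x * inner ℝ (U₀ x) x = w (volCoord x) := by
    filter_upwards [hru, e1] with x h1 h2
    rw [hw]
    simp only
    rw [← h2, volRadius_volCoord hN0, h1.2, inner_smul_left, inner_smul_left,
      real_inner_self_eq_norm_sq, conj_trivial, conj_trivial, mul_assoc]
    congr 2
    rcases eq_or_ne ‖x‖ 0 with h0 | h0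
    · rw [h0]; ring
    · field_simp
  refine ⟨r₀, fun q => w q * (N * q)⁻¹, ⟨hr₀m, fun x => le_max_left _ _, ⟨B, fun x => clip_le hB0 _⟩,
    fun K hK hKV => ?_⟩, hwm.mul (measurable_id.const_mul _).inv, e1, ?_⟩
  · have i1 : IntegrableOn (fun x : EuclideanSpace ℝ (Fin N) => w (volCoord x))
        (ballDomain N R) := by
      refine ((h.velocity_H1.1.integrable one_le_two).norm.const_mul (B * R)).mono'
        (hwm.comp continuous_volCoord.measurable).aestronglyMeasurable ?_
      filter_upwards [e2, hB, ae_restrict_mem measurableSet_ball] with x h1 h2 h3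
      rw [← h1, norm_mul, Real.norm_eq_abs (ρ₀ x), mul_assoc]
      refine mul_le_mul h2 ((norm_inner_le_norm _ _).trans ?_) (norm_nonneg _) hB0
      rw [mul_comm]
      exact mul_le_mul_of_nonneg_right (mem_ball_zero_iff.1 h3).le (norm_nonneg _)
    have i2 : IntegrableOn w (Ioo 0 (R ^ N / N)) :=
      integrable_of_comp_of_map_eq_smul continuous_volCoord.measurable (map_volCoord hN hR)
        (sphereConst_pos hN0) hwm.aestronglyMeasurable i1
    -- The factor 1/(Nq) is singular at the center only, which compact subsets of (0,V) avoid.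
    refine (i2.mono_set hKV).mul_continuousOn (ContinuousOn.inv₀ (by fun_prop) fun q hq => ?_) hK
    exact (mul_pos hNr (hKV hq).1).ne'
  · filter_upwards [e2] with x h1
    rw [h1, natCast_mul_volCoord hN0]

/-- A regular radial weak solution, written in the volume coordinate. -/
theorem IsRegularRadialWeakSolution.exists_isVolumeSolution (hN : 2 ≤ N) {R T a γ μ lam : ℝ}
    (hR : 0 < R) (hγ : 0 < γ) {ρ₀ : EuclideanSpace ℝ (Fin N) → ℝ}
    {U₀ : EuclideanSpace ℝ (Fin N) → EuclideanSpace ℝ (Fin N)}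
    {ρ : ℝ × EuclideanSpace ℝ (Fin N) → ℝ}
    {U : ℝ × EuclideanSpace ℝ (Fin N) → EuclideanSpace ℝ (Fin N)}
    (h : IsRegularRadialWeakSolution R T a γ μ lam ρ₀ U₀ ρ U) {r₀ c₀ : ℝ → ℝ}
    (hr₀ : Measurable r₀) (hc₀ : Measurable c₀)
    (hρ₀ : ∀ᵐ x ∂(volume.restrict (ballDomain N R)), ρ₀ x = r₀ (volCoord x))
    (hinit : ∀ᵐ x ∂(volume.restrict (ballDomain N R)),
      ρ₀ x * inner ℝ (U₀ x) x * (‖x‖ ^ N)⁻¹ = c₀ (volCoord x)) :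
    ∃ (D : ℝ → ℝ) (g r : ℝ → ℝ → ℝ),
      IsVolumeSolution (R ^ N / N) T a γ (2 * μ + lam) ((N : ℝ) ^ (-(2 - 2 / (N : ℝ))))
        (2 - 2 / (N : ℝ)) D g r r₀ c₀ ∧
      (∀ᵐ z ∂(volume.restrict (spaceTimeCyl N R T)), ρ z = r z.1 (volCoord z.2)) ∧
      ∀ᵐ z ∂(volume.restrict (spaceTimeCyl N R T)),
        U z = (g z.1 (volCoord z.2) * (‖z.2‖ ^ N)⁻¹) • z.2 := by
  have hN0 : 0 < N := by omega
  obtain ⟨⟨r', u, hr', hu, hru⟩, DU, hsol, hreg⟩ := h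
  obtain ⟨D, g, hg, hU, hdiv⟩ := exists_isTransportField hN hR hsol.boundary hreg.div_L2Linfty hu
    (hru.mono fun z hz => hz.2)
  obtain ⟨B, hB0, hB⟩ := exists_ae_abs_le hreg.density_bounded
  set r : ℝ → ℝ → ℝ := fun t q =>
    (Ioo 0 T).indicator (fun t => max 0 (min B (r' (t, volRadius N q)))) t with hr
  have hrm : Measurable fun p : ℝ × ℝ => r p.1 p.2 := by
    have h1 : Measurable fun p : ℝ × ℝ => max 0 (min B (r' (p.1, volRadius N p.2))) :=
      measurable_const.max (measurable_const.min
        (hr'.comp (measurable_fst.prodMk (measurable_volRadius.comp measurable_snd))))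
    exact h1.indicator (measurable_fst measurableSet_Ioo)
  have hr0 : ∀ t x, t ∉ Ioo 0 T → r t x = 0 := fun t x ht => indicator_of_notMem ht _
  have hrnn : ∀ t x, 0 ≤ r t x := fun t x => indicator_nonneg (fun _ _ => le_max_left _ _) t
  have hrB : ∀ t x, r t x ≤ B := fun t x => by
    by_cases ht : t ∈ Ioo 0 T
    · exact (indicator_of_mem ht _).trans_le (clip_le hB0 _)
    · exact (hr0 t x ht).trans_le hB0
  have hρ : ∀ᵐ z ∂(volume.restrict (spaceTimeCyl N R T)), ρ z = r z.1 (volCoord z.2) := by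
    have hS : MeasurableSet (spaceTimeCyl N R T) := measurableSet_Ioo.prod measurableSet_ball
    filter_upwards [hru, hB, hsol.density_nonneg, ae_restrict_mem hS] with z h1 h2 h3 h4
    rw [hr]
    simp only
    rw [indicator_of_mem h4.1, volRadius_volCoord hN0, ← h1.1,
      clip_eq_self h3 ((le_abs_self _).trans h2)]
  exact ⟨D, g, r, ⟨hg, hrm, hrnn, ⟨B, hrB⟩, hr0,
    isWeakIdentity_continuity hN hR hg.measurable hrm hr₀ hr0 hρ hU hρ₀ hsol.continuity_eq,
    isWeakIdentity_momentum hN hR hγ hg hrm hr0 hrnn hrB hsol.velocity_L2 hsol.gradient_L2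
      hsol.boundary hdiv hρ hU hc₀ hinit hsol.momentum_eq⟩, hρ, hU⟩

end Uniqueness

theorem theorem1p2 {N : ℕ} (hN : N = 2 ∨ N = 3) {R T a γ μ lam : ℝ}
    (hR : 0 < R) (hT : 0 < T) (ha : 0 < a) (hγ : 1 < γ)
    (hμ : 0 < μ) (hlam : 0 ≤ μ + (N : ℝ) / 2 * lam)
    (ρ₀ : EuclideanSpace ℝ (Fin N) → ℝ)
    (U₀ : EuclideanSpace ℝ (Fin N) → EuclideanSpace ℝ (Fin N))
    (hdata : IsAdmissibleData R ρ₀ U₀)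
    (ρ₁ ρ₂ : ℝ × EuclideanSpace ℝ (Fin N) → ℝ)
    (U₁ U₂ : ℝ × EuclideanSpace ℝ (Fin N) → EuclideanSpace ℝ (Fin N))
    (h₁ : IsRegularRadialWeakSolution R T a γ μ lam ρ₀ U₀ ρ₁ U₁)
    (h₂ : IsRegularRadialWeakSolution R T a γ μ lam ρ₀ U₀ ρ₂ U₂) :
    (∀ᵐ z ∂(volume.restrict (spaceTimeCyl N R T)), ρ₁ z = ρ₂ z) ∧
      (∀ᵐ z ∂(volume.restrict (spaceTimeCyl N R T)), U₁ z = U₂ z) := by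
  have hN2 : 2 ≤ N := by omega
  have hNr : (2 : ℝ) ≤ N := by exact_mod_cast hN2
  have hγ0 : 0 < γ := one_pos.trans hγ
  -- The condition gives λ ≥ -2μ/N, hence 2μ + λ ≥ 2μ(1 - 1/N) > 0.
  have hν : 0 < 2 * μ + lam := by
    rcases hN with rfl | rfl <;> push_cast at hlam <;> linarith
  have hdivN : 2 / (N : ℝ) ≤ 1 := (div_le_one (by linarith)).2 hNr
  have hdivN0 : 0 < 2 / (N : ℝ) := by positivity
  obtain ⟨r₀, c₀, hd, hc₀, hρ₀, hinit⟩ := hdata.exists_isVolumeData hN2 hR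
  obtain ⟨D₁, g₁, r₁, s₁, hρ₁, hU₁⟩ :=
    h₁.exists_isVolumeSolution hN2 hR hγ0 hd.meas hc₀ hρ₀ hinit
  obtain ⟨D₂, g₂, r₂, s₂, hρ₂, hU₂⟩ :=
    h₂.exists_isVolumeSolution hN2 hR hγ0 hd.meas hc₀ hρ₀ hinit
  -- The exponent θ = 2 - 2/N lies in (0,2), as 0 < 2/N ≤ 1.
  have huniq := s₁.unique s₂ hd hT ha hγ0 hν (by positivity) (by linarith) (by linarith)
  have hbox := (ae_restrict_iff' (measurableSet_Ioo.prod measurableSet_Ioo)).2 huniq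
  have hpull := ae_comp_of_map_eq_smul measurable_prod_volCoord
    (map_volCoord_spaceTime (N := N) hN2 hR T) hbox
  constructor
  · filter_upwards [hpull, hρ₁, hρ₂] with z h h1 h2
    rw [h1, h2, h.2]
  · filter_upwards [hpull, hU₁, hU₂] with z h h1 h2
    rw [h1, h2, h.1]
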